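/- **Setting.** Let $f\in C^2(\mathbb R)$ have exactly three zeros $a_-<a<a_+$, with $f'(a_\pm)<0<f'(a)$ and $\int_{a_-}^{a_+}f=0$. For small $|\delta|$ let $a_-(\delta),a(\delta),a_+(\delta)$ be the zeros of $f+\delta$ nearest to $a_-,a,a_+$, and let $(c(\delta),m(\cdot;\delta))$ be the speed and profile of the traveling wave $$m_{zz}+c(\delta)m_z+f(m)+\delta=0\ \text{ on }\mathbb R,\qquad m(\pm\infty;\delta)=a_\pm(\delta),\quad m(0;\delta)=a(\delta).$$ Let $\Omega\subset\mathbb R^n$, $n\ge2$, be a bounded domain with smooth boundary. For $\varepsilon>0$ consider a random noise $\xi^\varepsilon(t)$ and closed hypersurfaces $\gamma^\varepsilon_t\subset\Omega$ enclosing regions $\Omega^\varepsilon_t$ and moving with inward normal velocity $$V=(n-1)\kappa-\frac{c(\varepsilon\xi^\varepsilon(t))}{\varepsilon}\quad\text{on }\gamma_t^\varepsilon,$$ $\kappa$ being the mean curvature (mean of the principal curvatures), from arbitrary initial hypersurfaces, in one of the following two situations. * **(MN1)** $n=2$ and $\xi^\varepsilon(t)=\varepsilon^{-\gamma_1}\xi(\varepsilon^{-2\gamma_1}t)$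 with $0<\gamma_1<\frac13$, where $(\xi(t))_{t\ge0}$ is a stationary centered process with almost surely $C^1$ paths satisfying $|\xi|,|\dot\xi|\le M$ for a deterministic $M$, and strongly mixing: with $\mathcal F_{s,t}=\sigma(\xi(r):s\le r\le t)$ and $$\rho(t)=\sup_{s\ge0}\ \sup_{A\in\mathcal F_{s+t,\infty},\,B\in\mathcal F_{0,s}}\frac{|\mathbb P(A\cap B)-\mathbb P(A)\mathbb P(B)|}{\mathbb P(B)},$$ one has $\int_0^\infty\rho(t)^{1/p}dt<\infty$ for some $p>\frac32$. The $\gamma_t^\varepsilon$ are strictly convex closed curves parametrized by the angle $\theta$ of the outward normal (Gauss map), with curvature $\kappa(\theta,t)>0$. Given $N>0$ and $T>0$ put $\mathcal T=\min(\sigma^\varepsilon_N,T)$, where $\sigma_N^\varepsilon$ is the first time at which $\max_\theta\max\{\kappa,\kappa^{-1},|\partial_\theta\kappa|\}>N$ or $\mathrm{dist}(\gamma_t^\varepsilon,\partial\Omega)<1/N$ (the lifetime of the family, if this does not occur before). * **(MN2)** $\xi^\varepsilon=\frac{d}{dt}(W*\rho^\varepsilon)$, where $W$ is a two-sided Brownian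 motion, $\rho^\varepsilon(\tau)=\varepsilon^{-\gamma_2}\rho(\varepsilon^{-\gamma_2}\tau)$, $0<\gamma_2<\frac23$, and $\rho\ge0$ is smooth, even, supported in $[-1,1]$, with integral $1$. Put $\mathcal T=T$, where $T>0$ is such that, for the given realization, the $\gamma^\varepsilon_t$ exist for $0\le t\le T$ and all small $\varepsilon$, and there are closed hypersurfaces $\Gamma_t\subset\Omega$, of class $C^{2,\alpha}$ uniformly in $t\in[0,T]$ for some $\alpha\in(0,1)$, with $$\sup_{0\le t\le T}\|d(\cdot,t)-\tilde d^\varepsilon(\cdot,t)\|_{C^{2,\alpha}}\to0\quad(\varepsilon\to0),$$ $d$ and $\tilde d^\varepsilon$ being the signed distances to $\Gamma_t$ and $\gamma_t^\varepsilon$ (the functions compared in $\Omega$, their derivatives in a tube $|d(\cdot,t)|<r$ around $\Gamma_t$, with $r>0$ independent of $t$). The families $\gamma^\varepsilon_t$ depend continuously on $t$ and their signed distances are $C^2$ in space and $C^1$ in time near $\gamma^\varepsilon_t$. Let $\tilde d^\varepsilon(\cdot,t)$ be the signed distance to $\gamma_t^\varepsilon$, negative in $\Omega_t^\varepsilon$.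 For $d_0>0$ let $\varphi\in C^\infty(\mathbb R)$ be nondecreasing with $\varphi(s)=s$ for $|s|\le d_0$ and $\varphi(s)=\pm2d_0$ for $\pm s\ge2d_0$, and put $d^\varepsilon=\varphi(\tilde d^\varepsilon)$. For $\beta,\sigma,K,L>0$ put $$p(t)=-e^{-\beta t/\varepsilon^2}+e^{Lt}+K,\qquad q(t)=\sigma\left(\beta e^{-\beta t/\varepsilon^2}+\varepsilon^2Le^{Lt}\right),$$ $$u_\varepsilon^\pm(x,t)=m\left(\frac{d^\varepsilon(x,t)\pm\varepsilon p(t)}{\varepsilon};\varepsilon\xi^\varepsilon(t)\right)\pm q(t).$$ **Proposition.** There are $\beta>0$ and $\sigma_0>0$, depending only on $f$, such that for every $\sigma\in(0,\sigma_0]$ the following holds in both situations, almost surely. If $d_0>0$ is sufficiently small (and $\varphi$ is as above), then for every $K>1$ there are $\varepsilon_0>0$ and $L>0$ such that for all $\varepsilon\in(0,\varepsilon_0)$ the functions $u_\varepsilon^\pm$ are differentiable in $t$ and $C^2$ in $x$ in $\Omega\times(0,\mathcal T)$, and there $$\mathcal L u_\varepsilon^+\ge0,\qquad \mathcal L u_\varepsilon^-\le0,\qquad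 \mathcal Lu:=\partial_tu-\Delta u-\frac1{\varepsilon^2}f(u)-\frac1\varepsilon\xi^\varepsilon(t).$$ In (MN1), the bound on $d_0$ and the constants $\varepsilon_0,L$ are deterministic and the same for all families $\gamma^\varepsilon_t$; in (MN2) they may depend on the realization and on the families. -/

import Mathlib

open MeasureTheory ProbabilityTheory Filter Topology Set Laplacian
open scoped ENNReal NNReal

namespace AllenCahn

noncomputable section

/-! ### The nonlinearity and its traveling waves -/

/-- `f` is a balanced bistable nonlinearity of class `C²` with zeros `am < a < ap`. -/
structure IsBalancedBistable (f : ℝ → ℝ) (am a ap : ℝ) : Prop where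
  contDiff : ContDiff ℝ 2 f
  lt_left : am < a
  lt_right : a < ap
  zeros : ∀ u, f u = 0 ↔ u = am ∨ u = a ∨ u = ap
  deriv_left : deriv f am < 0
  deriv_mid : 0 < deriv f a
  deriv_right : deriv f ap < 0
  balanced : ∫ u in am..ap, f u = 0

/-- `z` is a zero of `f + δ`, and no zero of `f + δ` is closer to `z₀` than `z`. If `z₀` is a
nondegenerate zero of `f` and `|δ|` is small, there is exactly one such `z`, and
`z = z₀ + O(δ)`. (Far away from the zeros of `f`, the function `f + δ` may have further zeros.) -/
def IsNearestZero (f : ℝ → ℝ) (δ z₀ z : ℝ) : Prop :=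
  f z + δ = 0 ∧ ∀ w, f w + δ = 0 → |z - z₀| ≤ |w - z₀|

/-- `(c, m)` are the speed and the profile of a traveling wave of `v_t = v_zz + f(v) + δ` that
connects `a₋(δ)` to `a₊(δ)`, normalized by `m(0) = a(δ)`. -/
structure IsTravelingWave (f : ℝ → ℝ) (am a ap δ c : ℝ) (m : ℝ → ℝ) : Prop where
  contDiff : ContDiff ℝ 2 m
  ode : ∀ z, deriv (deriv m) z + c * deriv m z + f (m z) + δ = 0
  left : ∃ l, IsNearestZero f δ am l ∧ Tendsto m atBot (𝓝 l)
  mid : IsNearestZero f δ a (m 0)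
  right : ∃ l, IsNearestZero f δ ap l ∧ Tendsto m atTop (𝓝 l)

/-- The traveling wave (speed, profile) for the parameter `δ`; an arbitrary pair if there is
none. -/
def travelingWave (f : ℝ → ℝ) (am a ap δ : ℝ) : ℝ × (ℝ → ℝ) :=
  Classical.epsilon fun q : ℝ × (ℝ → ℝ) => IsTravelingWave f am a ap δ q.1 q.2

/-- The wave speed `c(δ)`. -/
def waveSpeed (f : ℝ → ℝ) (am a ap δ : ℝ) : ℝ := (travelingWave f am a ap δ).1

/-- The wave profile `m(z; δ)`. -/
def waveProfile (f : ℝ → ℝ) (am a ap z δ : ℝ) : ℝ := (travelingWave f am a ap δ).2 z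

/-! ### The two types of mild noise -/

section Noise

variable {Ωp : Type*} [MeasurableSpace Ωp]

/-- The σ-algebra generated by the variables `ξ r`, `r ∈ I`. -/
abbrev sigmaGen (ξ : ℝ → Ωp → ℝ) (I : Set ℝ) : MeasurableSpace Ωp :=
  ⨆ r ∈ I, MeasurableSpace.comap (ξ r) inferInstance

/-- The mixing rate of the process `ξ`. -/
def mixingRate (P : Measure Ωp) (ξ : ℝ → Ωp → ℝ) (t : ℝ) : ℝ≥0∞ :=
  ⨆ (s : ℝ) (_ : 0 ≤ s) (A : Set Ωp) (_ : MeasurableSet[sigmaGen ξ (Ici (s + t))] A)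
    (B : Set Ωp) (_ : MeasurableSet[sigmaGen ξ (Icc 0 s)] B),
    ENNReal.ofReal (|P.real (A ∩ B) - P.real A * P.real B| / P.real B)

/-- The process `(ξ t)`, `t ≥ 0`, from which the first type of noise is built: stationary,
strongly mixing, centered, with `C¹` paths bounded by `M` together with their derivative. -/
structure IsMixingProcess (P : Measure Ωp) (ξ : ℝ → Ωp → ℝ) (M : ℝ) : Prop where
  measurable : ∀ t, 0 ≤ t → Measurable (ξ t)
  stationary : ∀ (k : ℕ) (τ : ℝ) (t : Fin k → ℝ), 0 ≤ τ → (∀ i, 0 ≤ t i) →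
    P.map (fun ω i => ξ (t i + τ) ω) = P.map (fun ω i => ξ (t i) ω)
  mixing : ∃ p : ℝ, 3 / 2 < p ∧ ∫⁻ t in Ioi (0 : ℝ), mixingRate P ξ t ^ (1 / p) < ⊤
  contDiff : ∀ᵐ ω ∂P, ContDiffOn ℝ 1 (fun t => ξ t ω) (Ici 0)
  bound : ∀ᵐ ω ∂P, ∀ t, 0 ≤ t → |ξ t ω| ≤ M
  bound_deriv : ∀ᵐ ω ∂P, ∀ t, 0 < t → |deriv (fun s => ξ s ω) t| ≤ M
  centered : ∀ t, 0 ≤ t → ∫ ω, ξ t ω ∂P = 0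

/-- First type of noise: `ξ^ε(t) = ε^{-γ₁} ξ(ε^{-2γ₁} t)`. -/
def noiseOne (ξ : ℝ → Ωp → ℝ) (γ₁ ε : ℝ) (ω : Ωp) (t : ℝ) : ℝ :=
  ε ^ (-γ₁) * ξ (ε ^ (-(2 * γ₁)) * t) ω

/-- Brownian motion on the whole line: `B` for nonnegative times, `B'` run backwards for
negative times. -/
def twoSided (B B' : ℝ≥0 → Ωp → ℝ) (ω : Ωp) (t : ℝ) : ℝ :=
  if 0 ≤ t then B t.toNNReal ω else B' (-t).toNNReal ω

/-- A smooth symmetric nonnegative kernel with support in `[-1, 1]` and integral `1`. -/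
structure IsMollifier (ρ : ℝ → ℝ) : Prop where
  contDiff : ContDiff ℝ (⊤ : ℕ∞) ρ
  nonneg : ∀ s, 0 ≤ ρ s
  symm : ∀ s, ρ (-s) = ρ s
  supp : ∀ s, 1 < |s| → ρ s = 0
  integral : ∫ s, ρ s = 1

/-- The mollified path `(W * ρ^ε)(t)`, with `ρ^ε(τ) = ε^{-γ₂} ρ(ε^{-γ₂} τ)`. -/
def mollified (ρ : ℝ → ℝ) (W : ℝ → ℝ) (γ₂ ε t : ℝ) : ℝ :=
  ∫ s, ε ^ (-γ₂) * ρ (ε ^ (-γ₂) * (t - s)) * W s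

/-- Second type of noise: the time derivative of the mollified Brownian motion. -/
def noiseTwo (ρ : ℝ → ℝ) (B B' : ℝ≥0 → Ωp → ℝ) (γ₂ ε : ℝ) (ω : Ωp) (t : ℝ) : ℝ :=
  deriv (fun s => mollified ρ (twoSided B B' ω) γ₂ ε s) t

end Noise

/-! ### Domains, signed distances and evolving hypersurfaces -/

section Geometry

variable {n : ℕ}

/-- A nonempty bounded connected open set with smooth boundary, lying locally on one side of its
boundary. -/
structure IsSmoothBoundedDomain (Ω : Set (EuclideanSpace ℝ (Fin n))) : Prop where
  isOpen : IsOpen Ω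
  isConnected : IsConnected Ω
  isBounded : Bornology.IsBounded Ω
  smooth : ∀ p ∈ frontier Ω, ∃ g : EuclideanSpace ℝ (Fin n) → ℝ, ContDiff ℝ (⊤ : ℕ∞) g ∧
    fderiv ℝ g p ≠ 0 ∧ ∃ V ∈ 𝓝 p, ∀ x ∈ V, x ∈ Ω ↔ g x < 0

open Classical in
/-- The signed distance to the hypersurface `γ` that encloses the region `U`: negative in `U`,
positive outside. -/
def signedDist (γ U : Set (EuclideanSpace ℝ (Fin n))) (x : EuclideanSpace ℝ (Fin n)) : ℝ :=
  if x ∈ U then -Metric.infDist x γ else Metric.infDist x γ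

/-- The smooth increasing cut-off function applied to the signed distance. -/
structure IsCutoff (φ : ℝ → ℝ) (d₀ : ℝ) : Prop where
  contDiff : ContDiff ℝ (⊤ : ℕ∞) φ
  mono : Monotone φ
  left : ∀ s, s ≤ -(2 * d₀) → φ s = -(2 * d₀)
  mid : ∀ s, |s| ≤ d₀ → φ s = s
  right : ∀ s, 2 * d₀ ≤ s → φ s = 2 * d₀

/-- The outward unit normal to a strictly convex curve at the point with Gauss angle `θ`. -/
def gaussNormal (θ : ℝ) : EuclideanSpace ℝ (Fin 2) := !₂[Real.cos θ, Real.sin θ]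

/-- The unit tangent to a strictly convex curve at the point with Gauss angle `θ`. -/
def gaussTangent (θ : ℝ) : EuclideanSpace ℝ (Fin 2) := !₂[-Real.sin θ, Real.cos θ]

/-- A family of strictly convex closed curves in the planar domain `Ω`, defined for
`0 ≤ t < S`, and parametrized by the Gauss angle: `x θ t` is the point of the curve at time `t`
where the outward normal is `gaussNormal θ`, and `κ θ t > 0` is the curvature there. The curves
move with inward normal velocity `V = κ - F(t)` for `0 < t < S`. -/
structure IsConvexFlow (Ω : Set (EuclideanSpace ℝ (Fin 2))) (F : ℝ → ℝ) (S : ℝ≥0∞)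
    (x : ℝ → ℝ → EuclideanSpace ℝ (Fin 2)) (κ : ℝ → ℝ → ℝ) : Prop where
  lifetime_pos : 0 < S
  periodic : ∀ θ t, 0 ≤ t → ENNReal.ofReal t < S → x (θ + 2 * Real.pi) t = x θ t
  mem : ∀ θ t, 0 ≤ t → ENNReal.ofReal t < S → x θ t ∈ Ω
  curvature_pos : ∀ θ t, 0 ≤ t → ENNReal.ofReal t < S → 0 < κ θ t
  gauss : ∀ θ t, 0 ≤ t → ENNReal.ofReal t < S →
    HasDerivAt (fun η => x η t) ((κ θ t)⁻¹ • gaussTangent θ) θ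
  continuous_pos : ContinuousOn (fun q : ℝ × ℝ => x q.1 q.2)
    {q | 0 ≤ q.2 ∧ ENNReal.ofReal q.2 < S}
  continuous_curvature : ContinuousOn (fun q : ℝ × ℝ => κ q.1 q.2)
    {q | 0 ≤ q.2 ∧ ENNReal.ofReal q.2 < S}
  contDiff_curvature : ∀ t, 0 < t → ENNReal.ofReal t < S → ContDiff ℝ 1 (fun θ => κ θ t)
  differentiable_time : ∀ θ t, 0 < t → ENNReal.ofReal t < S →
    DifferentiableAt ℝ (fun s => x θ s) t
  law : ∀ θ t, 0 < t → ENNReal.ofReal t < S →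
    -inner ℝ (deriv (fun s => x θ s) t) (gaussNormal θ) = κ θ t - F t

/-- The time `σ_N`: the first time at which `max {κ, 1/κ, |∂_θ κ|}` exceeds `N` somewhere on the
curve or the distance from the curve to `∂Ω` is less than `1/N` (the lifetime `S` if this does
not happen before). -/
def stoppingTime (Ω : Set (EuclideanSpace ℝ (Fin 2))) (N : ℝ) (S : ℝ≥0∞)
    (x : ℝ → ℝ → EuclideanSpace ℝ (Fin 2)) (κ : ℝ → ℝ → ℝ) : ℝ≥0∞ :=
  sInf ({S} ∪ {s | ∃ t : ℝ, 0 < t ∧ s = ENNReal.ofReal t ∧ s < S ∧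
    ((∃ θ, N < max (κ θ t) (max (κ θ t)⁻¹ |deriv (fun η => κ η t) θ|)) ∨
      ∃ θ, Metric.infDist (x θ t) (frontier Ω) < 1 / N)})

/-- The signed distance to a strictly convex curve `γ_t`, whose enclosed region is the interior of
its convex hull. -/
def convexDist (x : ℝ → ℝ → EuclideanSpace ℝ (Fin 2)) (y : EuclideanSpace ℝ (Fin 2)) (t : ℝ) : ℝ :=
  signedDist (range fun θ => x θ t) (interior (convexHull ℝ (range fun θ => x θ t))) y

/-- The signed distance to the boundary of the region `U t`. -/
def regionDist (U : ℝ → Set (EuclideanSpace ℝ (Fin n))) (x : EuclideanSpace ℝ (Fin n)) (t : ℝ) :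
    ℝ :=
  signedDist (frontier (U t)) (U t) x

/-- The mean curvature (the mean of the principal curvatures, positive for spheres) of
`∂(U t)` at `y`: the Laplacian of the signed distance, divided by `n - 1`. -/
def meanCurvature (U : ℝ → Set (EuclideanSpace ℝ (Fin n))) (y : EuclideanSpace ℝ (Fin n))
    (t : ℝ) : ℝ :=
  (Δ (fun x => regionDist U x t)) y / ((n : ℝ) - 1)

/-- The inward normal velocity of `∂(U t)` at `y`: the time derivative of the signed distance. -/
def inwardVelocity (U : ℝ → Set (EuclideanSpace ℝ (Fin n))) (y : EuclideanSpace ℝ (Fin n))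
    (t : ℝ) : ℝ :=
  deriv (fun s => regionDist U y s) t

/-- A family of closed hypersurfaces `∂(U t)` in `Ω`, `0 ≤ t ≤ T`, enclosing the regions `U t`,
which depends continuously on time, whose signed distance is of class `C²` in space and `C¹`
in time near the hypersurfaces, and which moves by `V = (n-1)κ - F(t)` for `0 < t < T`. -/
structure IsForcedFlow (Ω : Set (EuclideanSpace ℝ (Fin n))) (F : ℝ → ℝ) (T : ℝ)
    (U : ℝ → Set (EuclideanSpace ℝ (Fin n))) : Prop where
  isOpen : ∀ t ∈ Icc 0 T, IsOpen (U t)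
  nonempty : ∀ t ∈ Icc 0 T, (U t).Nonempty
  isBounded : ∀ t ∈ Icc 0 T, Bornology.IsBounded (U t)
  frontier_subset : ∀ t ∈ Icc 0 T, frontier (U t) ⊆ Ω
  continuous_time : ∀ x, ContinuousOn (fun t => regionDist U x t) (Icc 0 T)
  regular : ∀ t ∈ Ioo 0 T, ∀ y ∈ frontier (U t), ∃ V ∈ 𝓝 (y, t),
    (∀ q ∈ V, ContDiffAt ℝ 2 (fun x => regionDist U x q.2) q.1 ∧
      DifferentiableAt ℝ (fun s => regionDist U q.1 s) q.2) ∧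
    ContinuousOn (fun q : EuclideanSpace ℝ (Fin n) × ℝ =>
      deriv (fun s => regionDist U q.1 s) q.2) V
  law : ∀ t ∈ Ioo 0 T, ∀ y ∈ frontier (U t),
    inwardVelocity U y t = ((n : ℝ) - 1) * meanCurvature U y t - F t

/-- The function `g` is `C²` on the open set `D`, its derivatives of order at most `2` are bounded
by `C` there, and its second derivative is `α`-Hölder continuous on `D` with constant `C`. -/
def HolderBoundOn (α C : ℝ) (g : EuclideanSpace ℝ (Fin n) → ℝ)
    (D : Set (EuclideanSpace ℝ (Fin n))) : Prop :=
  ContDiffOn ℝ 2 g D ∧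
  (∀ k : ℕ, k ≤ 2 → ∀ x ∈ D, ‖iteratedFDeriv ℝ k g x‖ ≤ C) ∧
  ∀ x ∈ D, ∀ y ∈ D, ‖iteratedFDeriv ℝ 2 g x - iteratedFDeriv ℝ 2 g y‖ ≤ C * ‖x - y‖ ^ α

/-- `sup_{0 ≤ t ≤ T} ‖d(·, t) - d^ε(·, t)‖_{C^{2,α}} → 0` as `ε → 0`, where `d(·, t)` and
`d^ε(·, t)` are the signed distances to the closed hypersurfaces `∂(G t)` and `∂(U ε t)`. The
hypersurfaces `∂(G t)` are of class `C^{2,α}`, uniformly in `t`. As signed distances are regular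
only near the hypersurface, derivatives are compared in a tube `|d(·, t)| < r`, and the functions
themselves in all of `Ω`. -/
structure SignedDistConverge (Ω : Set (EuclideanSpace ℝ (Fin n))) (T : ℝ)
    (G : ℝ → Set (EuclideanSpace ℝ (Fin n))) (U : ℝ → ℝ → Set (EuclideanSpace ℝ (Fin n))) :
    Prop where
  isOpen : ∀ t ∈ Icc 0 T, IsOpen (G t)
  nonempty : ∀ t ∈ Icc 0 T, (G t).Nonempty
  isBounded : ∀ t ∈ Icc 0 T, Bornology.IsBounded (G t)
  frontier_subset : ∀ t ∈ Icc 0 T, frontier (G t) ⊆ Ω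
  converge : ∃ α r C : ℝ, 0 < α ∧ α < 1 ∧ 0 < r ∧
    (∀ t ∈ Icc 0 T, HolderBoundOn α C (fun x => regionDist G x t) {x | |regionDist G x t| < r}) ∧
    ∀ η > 0, ∃ ε₁ > 0, ∀ ε, 0 < ε → ε < ε₁ → ∀ t ∈ Icc 0 T,
      (∀ x ∈ Ω, |regionDist (U ε) x t - regionDist G x t| ≤ η) ∧
      HolderBoundOn α η (fun x => regionDist (U ε) x t - regionDist G x t)
        {x | |regionDist G x t| < r}

/-! ### Sub- and supersolutions -/

/-- `∂_t u - Δu - ε⁻² f(u) - ε⁻¹ ξ(t)` at the point `(x, t)`. -/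
def acOperator (f : ℝ → ℝ) (ε : ℝ) (ξ : ℝ → ℝ) (u : EuclideanSpace ℝ (Fin n) → ℝ → ℝ)
    (x : EuclideanSpace ℝ (Fin n)) (t : ℝ) : ℝ :=
  deriv (fun s => u x s) t - (Δ (fun y => u y t)) x - 1 / ε ^ 2 * f (u x t) - 1 / ε * ξ t

/-- `u` is differentiable in time and twice continuously differentiable in space at each point of
`Ω × (0, S)`. -/
def IsClassicalOn (Ω : Set (EuclideanSpace ℝ (Fin n))) (S : ℝ≥0∞)
    (u : EuclideanSpace ℝ (Fin n) → ℝ → ℝ) : Prop :=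
  ∀ x ∈ Ω, ∀ t : ℝ, 0 < t → ENNReal.ofReal t < S →
    DifferentiableAt ℝ (fun s => u x s) t ∧ ContDiffAt ℝ 2 (fun y => u y t) x

/-- `u` is a (classical) supersolution of the Allen–Cahn equation in `Ω × (0, S)`. -/
def IsSupersolution (f : ℝ → ℝ) (ε : ℝ) (ξ : ℝ → ℝ) (Ω : Set (EuclideanSpace ℝ (Fin n)))
    (S : ℝ≥0∞) (u : EuclideanSpace ℝ (Fin n) → ℝ → ℝ) : Prop :=
  IsClassicalOn Ω S u ∧
    ∀ x ∈ Ω, ∀ t : ℝ, 0 < t → ENNReal.ofReal t < S → 0 ≤ acOperator f ε ξ u x t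

/-- `u` is a (classical) subsolution of the Allen–Cahn equation in `Ω × (0, S)`. -/
def IsSubsolution (f : ℝ → ℝ) (ε : ℝ) (ξ : ℝ → ℝ) (Ω : Set (EuclideanSpace ℝ (Fin n)))
    (S : ℝ≥0∞) (u : EuclideanSpace ℝ (Fin n) → ℝ → ℝ) : Prop :=
  IsClassicalOn Ω S u ∧
    ∀ x ∈ Ω, ∀ t : ℝ, 0 < t → ENNReal.ofReal t < S → acOperator f ε ξ u x t ≤ 0

/-- `p(t) = -e^{-βt/ε²} + e^{Lt} + K`. -/
def pFun (β K L ε t : ℝ) : ℝ := -Real.exp (-(β * t / ε ^ 2)) + Real.exp (L * t) + K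

/-- `q(t) = σ (β e^{-βt/ε²} + ε² L e^{Lt})`. -/
def qFun (σ β L ε t : ℝ) : ℝ :=
  σ * (β * Real.exp (-(β * t / ε ^ 2)) + ε ^ 2 * L * Real.exp (L * t))

/-- `u_ε^+(x,t) = m((d(x,t) + ε p(t))/ε; ε ξ(t)) + q(t)`, with `m` the wave profile. -/
def uPlus (f : ℝ → ℝ) (am a ap σ β K L ε : ℝ) (ξ : ℝ → ℝ)
    (d : EuclideanSpace ℝ (Fin n) → ℝ → ℝ) (x : EuclideanSpace ℝ (Fin n)) (t : ℝ) : ℝ :=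
  waveProfile f am a ap ((d x t + ε * pFun β K L ε t) / ε) (ε * ξ t) + qFun σ β L ε t

/-- `u_ε^-(x,t) = m((d(x,t) - ε p(t))/ε; ε ξ(t)) - q(t)`, with `m` the wave profile. -/
def uMinus (f : ℝ → ℝ) (am a ap σ β K L ε : ℝ) (ξ : ℝ → ℝ)
    (d : EuclideanSpace ℝ (Fin n) → ℝ → ℝ) (x : EuclideanSpace ℝ (Fin n)) (t : ℝ) : ℝ :=
  waveProfile f am a ap ((d x t - ε * pFun β K L ε t) / ε) (ε * ξ t) - qFun σ β L ε t

end Geometry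

end

end AllenCahn

open AllenCahn

universe u

namespace AllenCahn

/-! ### One-dimensional differential inequalities -/

/-! Insert a barrier into the operator and use the wave equation for `m`. With `z = (d ± εp)/ε` and
`s = ±1`, `WaveBounds.acOperator_uSign` shows that `s` times the result is `s` times the three
errors `m_z/ε (d_t - Δd + c/ε)`, `(1 - |∇d|²) m_zz/ε²` and `m_δ ε ξ'`, plus a good part `m_z p' + q'
- s (f(m + s q) - f(m))/ε²`. The functions `p`, `q` are matched: `p' = q/(σε²)` and `q' ≥ -βq/ε²`.
Where `m` is close to a stable zero, `f' < 0` makes the reaction term helpful; in the transition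
layer `m_z` is bounded below and `1/σ` is large. Hence (`exists_reaction_bound`) the good part is at
least `βq/ε²`, which is at least `βσL e^{Lt}`. The errors are at most `A e^{Lt}` with `A`
independent of `L` and `ε`. So `L` is chosen first and `ε₀` afterwards (`exists_barriers`).

The error bound rests on three independent inputs. Waves (`exists_waveBounds`): for small `δ` the
waves exist, `m` is differentiable in `(z, δ)`, `m_δ` is bounded, and `m_z`, `m_zz` decay in `z`,
all uniformly in `δ`. A standing wave comes from the energy identity; the implicit function theorem
continues it, because the linearization, augmented by the speed and the normalization, is bijective.
The definitions pick a wave by choice, so uniqueness of fronts (`IsFront.unique`, after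
`IsFront.strict`) is needed to identify the chosen wave with the branch. Geometry (the two theorems
`isFrontDistanceAt`): near the front the signed distance has unit gradient, its time derivative is
that at the nearest point of the front, and its Laplacian differs from the Laplacian there by
`O(|d|)`. Thus `d_t - Δd + c/ε = O(|d|)`, and `|d| ≤ ε(|z| + p)` is absorbed by the decay of `m_z`.
Far from the front `|z|` is of order `1/ε`, and the decay makes everything small. Noise
(`noiseOne_bounds`, `noiseTwo_bounds`): `εξ^ε` is small and `ε` times the derivative of `ξ^ε` is
bounded. This is where `γ₁ < 1/3` enters, and `γ₂ < 2/3` through the Hölder continuity of Brownian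
paths with every exponent below `1/2`. -/

theorem monotoneOn_Ici_of_hasDerivAt {f f' : ℝ → ℝ} {R : ℝ}
    (h : ∀ z, R ≤ z → HasDerivAt f (f' z) z) (h0 : ∀ z, R ≤ z → 0 ≤ f' z) :
    MonotoneOn f (Ici R) := by
  apply monotoneOn_of_deriv_nonneg (convex_Ici R)
  · exact fun z hz => (h z hz).continuousAt.continuousWithinAt
  · exact fun z hz => (h z (interior_subset hz)).differentiableAt.differentiableWithinAt
  · intro z hz
    rw [(h z (interior_subset hz)).deriv]
    exact h0 z (interior_subset hz)

theorem monotone_of_hasDerivAt_nonneg {f f' : ℝ → ℝ} (h : ∀ z, HasDerivAt f (f' z) z)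
    (h0 : ∀ z, 0 ≤ f' z) : Monotone f :=
  monotone_of_deriv_nonneg (fun z => (h z).differentiableAt) fun z => by
    rw [(h z).deriv]; exact h0 z

/-- A bounded solution of `s'' ≥ ν² s` on a half-line satisfies `s' + ν s ≤ 0`. -/
theorem deriv_add_mul_nonpos_of_bounded {s s' s'' : ℝ → ℝ} {ν R C : ℝ} (hν : 0 < ν)
    (h1 : ∀ z, R ≤ z → HasDerivAt s (s' z) z) (h2 : ∀ z, R ≤ z → HasDerivAt s' (s'' z) z)
    (h3 : ∀ z, R ≤ z → ν ^ 2 * s z ≤ s'' z) (hb : ∀ z, R ≤ z → s z ≤ C) :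
    ∀ z, R ≤ z → s' z + ν * s z ≤ 0 := by
  intro z₀ hz₀
  by_contra! hpos
  set r := s' z₀ + ν * s z₀ with hr
  have hexp : ∀ a z : ℝ, HasDerivAt (fun z => Real.exp (a * z)) (a * Real.exp (a * z)) z := by
    intro a z
    have := ((hasDerivAt_id z).const_mul a).exp
    simpa [mul_comm] using this
  -- The operator factors: `s'' - ν² s = (∂ - ν)(∂ + ν) s`. So a positive value `r` of `s' + ν s` at
  -- `z₀` grows at least like `e^{νz}`, and a second integration makes `s` itself unbounded.
  have hA : MonotoneOn (fun z => (s' z + ν * s z) * Real.exp (-ν * z)) (Ici R) := by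
    refine monotoneOn_Ici_of_hasDerivAt
      (fun z hz => ((h2 z hz).add ((h1 z hz).const_mul ν)).mul (hexp (-ν) z)) ?_
    intro z hz
    have : (s'' z + ν * s' z) * Real.exp (-ν * z) +
        (s' z + ν * s z) * (-ν * Real.exp (-ν * z)) =
        (s'' z - ν ^ 2 * s z) * Real.exp (-ν * z) := by ring
    simp only [Pi.add_apply] at *
    rw [this]
    exact mul_nonneg (by linarith [h3 z hz]) (Real.exp_pos _).le
  have hA' : ∀ z, z₀ ≤ z → r * Real.exp (ν * (z - z₀)) ≤ s' z + ν * s z := by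
    intro z hz
    have := hA hz₀ (hz₀.trans hz) hz
    simp only at this
    have h5 : r * Real.exp (-ν * z₀) * Real.exp (ν * z) ≤ s' z + ν * s z := by
      calc _ ≤ ((s' z + ν * s z) * Real.exp (-ν * z)) * Real.exp (ν * z) :=
            mul_le_mul_of_nonneg_right this (Real.exp_pos _).le
        _ = (s' z + ν * s z) := by rw [mul_assoc, ← Real.exp_add]; simp
    rwa [mul_assoc, ← Real.exp_add, show -ν * z₀ + ν * z = ν * (z - z₀) by ring] at h5
  -- `s e^{νz} - r e^{2 ν z - ν z₀} / (2ν)` is nondecreasing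
  have hB : MonotoneOn (fun z => s z * Real.exp (ν * z) -
      r * Real.exp (-ν * z₀) / (2 * ν) * Real.exp (2 * ν * z)) (Ici z₀) := by
    refine monotoneOn_Ici_of_hasDerivAt
      (fun z hz => ((h1 z (hz₀.trans hz)).mul (hexp ν z)).sub
        ((hexp (2 * ν) z).const_mul (r * Real.exp (-ν * z₀) / (2 * ν)))) ?_
    intro z hz
    have h6 := hA' z hz
    have h7 : Real.exp (2 * ν * z) = Real.exp (ν * z) * Real.exp (ν * z) := by
      rw [← Real.exp_add]; ring_nf
    have h8 : Real.exp (ν * (z - z₀)) = Real.exp (-ν * z₀) * Real.exp (ν * z) := by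
      rw [← Real.exp_add]; ring_nf
    have : s' z * Real.exp (ν * z) + s z * (ν * Real.exp (ν * z)) -
        r * Real.exp (-ν * z₀) / (2 * ν) * (2 * ν * Real.exp (2 * ν * z)) =
        (s' z + ν * s z - r * Real.exp (ν * (z - z₀))) * Real.exp (ν * z) := by
      rw [h7, h8]; field_simp
    rw [this]
    exact mul_nonneg (by linarith) (Real.exp_pos _).le
  have hC : ∀ z, z₀ ≤ z → s z₀ * Real.exp (ν * (z₀ - z)) - r / (2 * ν) * Real.exp (ν * (z₀ - z)) +
      r / (2 * ν) * Real.exp (ν * (z - z₀)) ≤ s z := by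
    intro z hz
    have := hB (le_refl z₀) hz hz
    simp only at this
    have h9 := mul_le_mul_of_nonneg_right this (Real.exp_pos (-ν * z)).le
    have e1 : s z * Real.exp (ν * z) * Real.exp (-ν * z) = s z := by
      rw [mul_assoc, ← Real.exp_add]; simp
    have e2 : Real.exp (-ν * z₀) * Real.exp (2 * ν * z) * Real.exp (-ν * z) =
        Real.exp (ν * (z - z₀)) := by
      rw [← Real.exp_add, ← Real.exp_add]; ring_nf
    have e3 : Real.exp (-ν * z₀) * Real.exp (2 * ν * z₀) * Real.exp (-ν * z) =
        Real.exp (ν * (z₀ - z)) := by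
      rw [← Real.exp_add, ← Real.exp_add]; ring_nf
    have e4 : Real.exp (ν * z₀) * Real.exp (-ν * z) = Real.exp (ν * (z₀ - z)) := by
      rw [← Real.exp_add]; ring_nf
    have e5 : (s z₀ * Real.exp (ν * z₀) - r * Real.exp (-ν * z₀) / (2 * ν) *
        Real.exp (2 * ν * z₀)) * Real.exp (-ν * z) =
        s z₀ * Real.exp (ν * (z₀ - z)) - r / (2 * ν) * Real.exp (ν * (z₀ - z)) := by
      nth_rewrite 2 [← e3]
      rw [← e4]; ring
    have e6 : (s z * Real.exp (ν * z) - r * Real.exp (-ν * z₀) / (2 * ν) *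
        Real.exp (2 * ν * z)) * Real.exp (-ν * z) =
        s z - r / (2 * ν) * Real.exp (ν * (z - z₀)) := by
      rw [← e2]; nth_rewrite 2 [← e1]; ring
    rw [e5, e6] at h9
    linarith
  have hr0 : 0 < r / (2 * ν) := by positivity
  have hlim : Tendsto (fun z => r / (2 * ν) * Real.exp (ν * (z - z₀))) atTop atTop := by
    refine Tendsto.const_mul_atTop hr0 (Real.tendsto_exp_atTop.comp ?_)
    exact Tendsto.const_mul_atTop hν (tendsto_atTop_add_const_right _ _ tendsto_id)
  obtain ⟨z, hz1, hz2⟩ := ((hlim.eventually_gt_atTop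
    (C + |s z₀ - r / (2 * ν)|)).and (eventually_ge_atTop z₀)).exists
  have h10 := hC z hz2
  have h11 : Real.exp (ν * (z₀ - z)) ≤ 1 := by
    rw [Real.exp_le_one_iff]; nlinarith
  have h12 : -|s z₀ - r / (2 * ν)| ≤ (s z₀ - r / (2 * ν)) * Real.exp (ν * (z₀ - z)) := by
    have := abs_le.1 (le_refl |(s z₀ - r / (2 * ν)) * Real.exp (ν * (z₀ - z))|)
    rw [abs_mul, abs_of_pos (Real.exp_pos _)] at this
    nlinarith [abs_nonneg (s z₀ - r / (2 * ν))]
  have := hb z (hz₀.trans hz2)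
  linarith

theorem le_mul_exp_of_deriv_add_mul_nonpos {s s' : ℝ → ℝ} {ν R : ℝ}
    (h1 : ∀ z, R ≤ z → HasDerivAt s (s' z) z) (h2 : ∀ z, R ≤ z → s' z + ν * s z ≤ 0) :
    ∀ z, R ≤ z → s z ≤ s R * Real.exp (-(ν * (z - R))) := by
  intro z hz
  have hexp : ∀ z : ℝ, HasDerivAt (fun z => Real.exp (ν * z)) (ν * Real.exp (ν * z)) z := by
    intro z
    have := ((hasDerivAt_id z).const_mul ν).exp
    simpa [mul_comm] using this
  have hA : MonotoneOn (fun z => -(s z * Real.exp (ν * z))) (Ici R) := by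
    refine monotoneOn_Ici_of_hasDerivAt (fun z hz => ((h1 z hz).mul (hexp z)).neg) ?_
    intro z hz
    nlinarith [mul_nonneg (neg_nonneg.2 (h2 z hz)) (Real.exp_pos (ν * z)).le]
  have h3 : s z * Real.exp (ν * z) ≤ s R * Real.exp (ν * R) := by
    simpa using hA (le_refl R) hz hz
  have h4 := mul_le_mul_of_nonneg_right h3 (Real.exp_pos (-(ν * z))).le
  rw [mul_assoc, ← Real.exp_add, mul_assoc, ← Real.exp_add] at h4
  simpa [show ν * R + -(ν * z) = -(ν * (z - R)) by ring] using h4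

/-- A bounded solution of `s'' ≥ ν² s` on a half-line decays exponentially. -/
theorem le_mul_exp_of_bounded {s s' s'' : ℝ → ℝ} {ν R C : ℝ} (hν : 0 < ν)
    (h1 : ∀ z, R ≤ z → HasDerivAt s (s' z) z) (h2 : ∀ z, R ≤ z → HasDerivAt s' (s'' z) z)
    (h3 : ∀ z, R ≤ z → ν ^ 2 * s z ≤ s'' z) (hb : ∀ z, R ≤ z → s z ≤ C) :
    ∀ z, R ≤ z → s z ≤ s R * Real.exp (-(ν * (z - R))) :=
  le_mul_exp_of_deriv_add_mul_nonpos h1 (deriv_add_mul_nonpos_of_bounded hν h1 h2 h3 hb)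

theorem exists_lipschitz_of_contDiff {g : ℝ → ℝ} (hg : ContDiff ℝ 1 g) (R : ℝ) :
    ∃ K, 0 ≤ K ∧ ∀ u v, |u| ≤ R → |v| ≤ R → |g u - g v| ≤ K * |u - v| := by
  have hc : Continuous (deriv g) := hg.continuous_deriv le_rfl
  obtain ⟨K, hK⟩ := (isCompact_Icc (a := -R) (b := R)).exists_bound_of_continuousOn hc.continuousOn
  refine ⟨|K|, abs_nonneg _, fun u v hu hv => ?_⟩
  have := (convex_Icc (-R) R).norm_image_sub_le_of_norm_deriv_le (f := g) (C := |K|)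
    (fun x _ => (hg.differentiable one_ne_zero).differentiableAt)
    (fun x hx => (hK x hx).trans (le_abs_self _)) (abs_le.1 hv) (abs_le.1 hu)
  simpa using this

/-! ### Heteroclinic orbits of `m'' + c m' + g(m) = 0` -/

/-- `m` solves `m'' + c m' + g(m) = 0` and connects `l` to `r`; `m'` is its derivative. -/
structure IsFront (g : ℝ → ℝ) (l r c : ℝ) (m m' : ℝ → ℝ) : Prop where
  deriv : ∀ z, HasDerivAt m (m' z) z
  deriv_deriv : ∀ z, HasDerivAt m' (-(c * m' z) - g (m z)) z
  left : Tendsto m atBot (𝓝 l)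
  right : Tendsto m atTop (𝓝 r)

namespace IsFront

variable {g m m' : ℝ → ℝ} {l b r c : ℝ}

theorem reflect (h : IsFront g l r c m m') :
    IsFront (fun u => -g (-u)) (-r) (-l) (-c) (fun z => -m (-z)) (fun z => m' (-z)) where
  deriv z := by
    have h1 : HasDerivAt (fun z : ℝ => -z) (-1) z := hasDerivAt_neg z
    simpa using! ((h.deriv (-z)).comp z h1).neg
  deriv_deriv z := by
    have h1 : HasDerivAt (fun z : ℝ => -z) (-1) z := hasDerivAt_neg z
    have := (h.deriv_deriv (-z)).comp z h1
    convert! this using 1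
    simp
    ring
  left := (h.right.comp tendsto_neg_atBot_atTop).neg
  right := (h.left.comp tendsto_neg_atTop_atBot).neg

theorem continuous (h : IsFront g l r c m m') : Continuous m :=
  continuous_iff_continuousAt.2 fun z => (h.deriv z).continuousAt

theorem continuous_deriv (h : IsFront g l r c m m') : Continuous m' :=
  continuous_iff_continuousAt.2 fun z => (h.deriv_deriv z).continuousAt

/-- At some point of `(z, z + 1)` the derivative equals the increment `m(z + 1) - m(z)`. From there
back to `z` the quantity `m' + c m` changes only by the size of `g(m)`. All these differences tend
to zero. -/
theorem deriv_tendsto_atTop (h : IsFront g l r c m m') (hg : Continuous g) (hr : g r = 0) :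
    Tendsto m' atTop (𝓝 0) := by
  have hgm : Tendsto (fun z => g (m z)) atTop (𝓝 0) := by
    rw [← hr]; exact (hg.tendsto r).comp h.right
  rw [Metric.tendsto_atTop]
  intro ε hε
  obtain ⟨e, he, hee⟩ : ∃ e > 0, (3 + 2 * |c|) * e < ε := by
    refine ⟨ε / (2 * (3 + 2 * |c|)), by positivity, ?_⟩
    have : 0 < 3 + 2 * |c| := by positivity
    field_simp; linarith
  obtain ⟨N1, hN1⟩ := (Metric.tendsto_atTop.1 h.right) e he
  obtain ⟨N2, hN2⟩ := (Metric.tendsto_atTop.1 hgm) e he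
  refine ⟨max N1 N2, fun z hz => ?_⟩
  have hz1 : N1 ≤ z := le_of_max_le_left hz
  have hz2 : N2 ≤ z := le_of_max_le_right hz
  obtain ⟨ξ, hξ, hξ'⟩ := exists_hasDerivAt_eq_slope m m' (show z < z + 1 by linarith)
    h.continuous.continuousOn (fun x _ => h.deriv x)
  obtain ⟨η, hη, hη'⟩ := exists_hasDerivAt_eq_slope (fun z => m' z + c * m z) (fun z => -g (m z))
    hξ.1 (h.continuous_deriv.add (h.continuous.const_mul c)).continuousOn
    (fun x _ => by
      have := (h.deriv_deriv x).add ((h.deriv x).const_mul c)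
      convert! this using 1; ring)
  have e1 : m' ξ = m (z + 1) - m z := by rw [hξ']; simp
  have e2 : (m' ξ + c * m ξ) - (m' z + c * m z) = -g (m η) * (ξ - z) := by
    rw [hη']; field_simp [sub_ne_zero.2 hξ.1.ne']
  have b1 := hN1 z hz1
  have b2 := hN1 (z + 1) (by linarith)
  have b3 := hN1 ξ (by linarith [hξ.1])
  have b4 := hN2 η (by linarith [hη.1])
  rw [Real.dist_eq, abs_lt] at b1 b2 b3
  rw [Real.dist_eq, sub_zero] at b4 ⊢
  have b5 : |m ξ - m z| ≤ 2 * e := by rw [abs_le]; constructor <;> linarith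
  have b6 : |m (z + 1) - m z| ≤ 2 * e := by rw [abs_le]; constructor <;> linarith
  have b7 : |g (m η) * (ξ - z)| ≤ e := by
    rw [abs_mul]
    have : |ξ - z| ≤ 1 := by rw [abs_le]; constructor <;> linarith [hξ.1, hξ.2]
    nlinarith [abs_nonneg (g (m η)), abs_nonneg (ξ - z)]
  have e3 : m' z = (m (z + 1) - m z) + c * (m ξ - m z) + g (m η) * (ξ - z) := by linarith
  calc |m' z| ≤ |m (z + 1) - m z| + |c * (m ξ - m z)| + |g (m η) * (ξ - z)| := by
        rw [e3]; exact abs_add_three _ _ _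
    _ ≤ 2 * e + |c| * (2 * e) + e := by
        rw [abs_mul]; gcongr
    _ < ε := by linarith

theorem deriv_tendsto_atBot (h : IsFront g l r c m m') (hg : Continuous g) (hl : g l = 0) :
    Tendsto m' atBot (𝓝 0) := by
  have := h.reflect.deriv_tendsto_atTop (by fun_prop) (by simp [hl])
  simpa [Function.comp_def] using this.comp tendsto_neg_atBot_atTop

theorem bounded (h : IsFront g l r c m m') : ∃ R, ∀ z, |m z| ≤ R := by
  have h1 := h.left.abs.eventually_lt_const (show |l| < |l| + 1 by linarith)
  have h2 := h.right.abs.eventually_lt_const (show |r| < |r| + 1 by linarith)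
  obtain ⟨A, hA⟩ := eventually_atBot.1 h1
  obtain ⟨B, hB⟩ := eventually_atTop.1 h2
  obtain ⟨C, hC⟩ := (isCompact_Icc (a := A) (b := B)).exists_bound_of_continuousOn
    h.continuous.continuousOn
  refine ⟨max C (max (|l| + 1) (|r| + 1)), fun z => ?_⟩
  rcases le_total z A with hz | hz
  · exact (hA z hz).le.trans (by simp)
  rcases le_total B z with hz' | hz'
  · exact (hB z hz').le.trans (by simp)
  · exact (hC z ⟨hz, hz'⟩).trans (le_max_left _ _)

/-- An orbit that passes through an equilibrium is constant. -/
theorem eq_const (h : IsFront g l r c m m') (hg : ContDiff ℝ 1 g) {u₀ z₀ : ℝ} (hu : g u₀ = 0)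
    (h0 : m z₀ = u₀) (h0' : m' z₀ = 0) : ∀ z, m z = u₀ := by
  obtain ⟨R, hR⟩ := h.bounded
  obtain ⟨K, hK0, hK⟩ := exists_lipschitz_of_contDiff hg R
  -- Gronwall for the squared phase-plane distance to the equilibrium: `|e'| ≤ L e`, so `e e^{Lz}`
  -- is nondecreasing and `e e^{-Lz}` nonincreasing, which forces `e = 0` on both sides of `z₀`.
  set e : ℝ → ℝ := fun z => (m z - u₀) ^ 2 + m' z ^ 2 with he
  set e' : ℝ → ℝ := fun z => 2 * (m z - u₀) * m' z + 2 * m' z * (-(c * m' z) - g (m z)) with he'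
  have hde : ∀ z, HasDerivAt e (e' z) z := by
    intro z
    have h1 := (((h.deriv z).sub_const u₀).pow 2).add ((h.deriv_deriv z).pow 2)
    convert! h1 using 1
    simp [he']
  set L := 1 + K + 2 * |c| with hL
  have hbd : ∀ z, |e' z| ≤ L * e z := by
    intro z
    have h1 : |g (m z)| ≤ K * |m z - u₀| := by
      have := hK (m z) u₀ (hR z) (h0 ▸ hR z₀)
      rwa [hu, sub_zero] at this
    have h2 : |e' z| ≤ 2 * |m z - u₀| * |m' z| + 2 * |m' z| * (|c| * |m' z| + K * |m z - u₀|) := by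
      have a1 : |2 * (m z - u₀) * m' z| = 2 * |m z - u₀| * |m' z| := by simp [abs_mul]
      have a2 : |2 * m' z * (-(c * m' z) - g (m z))| ≤
          2 * |m' z| * (|c| * |m' z| + K * |m z - u₀|) := by
        rw [abs_mul, abs_mul, abs_two]
        gcongr
        calc |-(c * m' z) - g (m z)| ≤ |-(c * m' z)| + |g (m z)| := abs_sub _ _
          _ ≤ _ := by rw [abs_neg, abs_mul]; gcongr
      exact (abs_add_le _ _).trans (add_le_add a1.le a2)
    have h3 : e z = |m z - u₀| ^ 2 + |m' z| ^ 2 := by simp [he]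
    rw [h3]
    have h4 : 2 * |m z - u₀| * |m' z| ≤ |m z - u₀| ^ 2 + |m' z| ^ 2 := two_mul_le_add_sq _ _
    have : 0 ≤ |c| := abs_nonneg c
    nlinarith [abs_nonneg (m z - u₀), abs_nonneg (m' z), sq_nonneg |m z - u₀|]
  have hexp : ∀ a z : ℝ, HasDerivAt (fun z => Real.exp (a * z)) (a * Real.exp (a * z)) z := by
    intro a z
    have := ((hasDerivAt_id z).const_mul a).exp
    simpa [mul_comm] using this
  have hmono1 : Monotone fun z => e z * Real.exp (L * z) := by
    refine monotone_of_hasDerivAt_nonneg (fun z => (hde z).mul (hexp L z)) fun z => ?_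
    have := (abs_le.1 (hbd z)).1
    nlinarith [Real.exp_pos (L * z)]
  have hmono2 : Monotone fun z => -(e z * Real.exp (-L * z)) := by
    refine monotone_of_hasDerivAt_nonneg (fun z => ((hde z).mul (hexp (-L) z)).neg) fun z => ?_
    have := (abs_le.1 (hbd z)).2
    nlinarith [Real.exp_pos (-L * z)]
  have he0 : e z₀ = 0 := by simp [he, h0, h0']
  intro z
  have hez : e z ≤ 0 := by
    rcases le_total z z₀ with hz | hz
    · have := hmono1 hz
      simp only [he0, zero_mul] at this
      exact nonpos_of_mul_nonpos_left this (Real.exp_pos _)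
    · have := hmono2 hz
      simp only [he0, zero_mul, neg_zero] at this
      exact nonpos_of_mul_nonpos_left (neg_nonneg.1 (by linarith)) (Real.exp_pos _)
  have : (m z - u₀) ^ 2 ≤ 0 := by nlinarith [sq_nonneg (m' z)]
  nlinarith [pow_eq_zero_iff (two_ne_zero) |>.1 (le_antisymm this (sq_nonneg _))]

/-- Multiply the equation by `m'`. Only the drift term changes the mechanical energy, so the energy
is monotone with a direction given by the sign of `c`. -/
theorem energy_hasDerivAt (h : IsFront g l r c m m') (hg : Continuous g) (z : ℝ) :
    HasDerivAt (fun z => m' z ^ 2 / 2 + ∫ u in l..m z, g u) (-(c * m' z ^ 2)) z := by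
  have h1 : HasDerivAt (fun u => ∫ v in l..u, g v) (g (m z)) (m z) :=
    intervalIntegral.integral_hasDerivAt_right (hg.intervalIntegrable _ _)
      (hg.stronglyMeasurableAtFilter _ _) hg.continuousAt
  have h2 := (((h.deriv_deriv z).pow 2).div_const 2).add (h1.comp z (h.deriv z))
  convert! h2 using 1
  simp; ring

/-- The energy `E = m'²/2 + F(m)` runs from `0` to `F(r) ≥ 0`. If `c > 0` it would be nonincreasing,
hence constant with `m' = 0`; so `c ≤ 0` and `0 ≤ E ≤ F(r)`. Since `F < 0` below `l`, there is no
minimum below `l`; at the level `r` the bound `E ≤ F(r)` forces `m' = 0`, so the orbit would be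
constant. Since `F < 0` also on `(l, b]`, a critical point has `m` in `(b, r)`, where `m'' < 0`;
after it `m` could never increase again and would not reach `r`. Therefore `m'` has no zero. -/
theorem strict_of_nonneg_integral (h : IsFront g l r c m m') (hg : ContDiff ℝ 1 g) (hlb : l < b)
    (hbr : b < r) (gl : g l = 0) (gr : g r = 0) (h0 : ∀ u, u < l → 0 < g u)
    (h1 : ∀ u, l < u → u < b → g u < 0) (h2 : ∀ u, b < u → u < r → 0 < g u)
    (hI : 0 ≤ ∫ u in l..r, g u) : ∀ z, l < m z ∧ m z < r ∧ 0 < m' z := by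
  have hgc := hg.continuous
  have hlr : l < r := hlb.trans hbr
  set F : ℝ → ℝ := fun u => ∫ v in l..u, g v with hF
  have hFc : Continuous F := intervalIntegral.continuous_primitive
    (fun a b => hgc.intervalIntegrable a b) l
  set E : ℝ → ℝ := fun z => m' z ^ 2 / 2 + F (m z) with hE
  have hEd : ∀ z, HasDerivAt E (-(c * m' z ^ 2)) z := h.energy_hasDerivAt hgc
  have hEbot : Tendsto E atBot (𝓝 0) := by
    have := (((h.deriv_tendsto_atBot hgc gl).pow 2).div_const 2).add ((hFc.tendsto l).comp h.left)
    simpa [hF] using this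
  have hEtop : Tendsto E atTop (𝓝 (F r)) := by
    have := (((h.deriv_tendsto_atTop hgc gr).pow 2).div_const 2).add ((hFc.tendsto r).comp h.right)
    simpa using this
  have hne : ∀ u, ¬ ∀ z, m z = u := by
    intro u hu
    have hm : m = fun _ => u := funext hu
    have e1 : l = u := tendsto_nhds_unique h.left (hm ▸ tendsto_const_nhds)
    have e2 : r = u := tendsto_nhds_unique h.right (hm ▸ tendsto_const_nhds)
    exact hlr.ne (e1.trans e2.symm)
  have hc : c ≤ 0 := by
    by_contra! hc
    have hanti : Antitone E := by
      have : Monotone fun z => -E z :=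
        monotone_of_hasDerivAt_nonneg (fun z => (hEd z).neg) fun z => by simp; positivity
      exact fun x y hxy => neg_le_neg_iff.1 (this hxy)
    have hz : ∀ z, E z = 0 := fun z =>
      le_antisymm (hanti.ge_of_tendsto hEbot z) (hI.trans (hanti.le_of_tendsto hEtop z))
    have hE0 : E = fun _ => 0 := funext hz
    have hm'0 : ∀ z, m' z = 0 := by
      intro z
      have e1 := (hEd z).unique (hE0 ▸ hasDerivAt_const z (0 : ℝ))
      have : c * m' z ^ 2 = 0 := by linarith
      simpa [hc.ne'] using this
    refine hne (m 0) fun z => ?_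
    exact is_const_of_deriv_eq_zero (fun z => (h.deriv z).differentiableAt)
      (fun z => (h.deriv z).deriv.trans (hm'0 z)) z 0
  have hmono : Monotone E := monotone_of_hasDerivAt_nonneg hEd fun z => by
    nlinarith [sq_nonneg (m' z)]
  have hE0 : ∀ z, 0 ≤ E z := fun z => hmono.le_of_tendsto hEbot z
  have hE1 : ∀ z, E z ≤ F r := fun z => hmono.ge_of_tendsto hEtop z
  have hFneg : ∀ u, u < l → F u < 0 := by
    intro u hu
    have := intervalIntegral.intervalIntegral_pos_of_pos_on (hgc.intervalIntegrable u l)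
      (fun v hv => h0 v hv.2) hu
    simp only [hF]
    rw [intervalIntegral.integral_symm]; linarith
  have hFneg' : ∀ u, l < u → u ≤ b → F u < 0 := by
    intro u hu hub
    have := intervalIntegral.intervalIntegral_pos_of_pos_on (f := fun v => -g v)
      (hgc.neg.intervalIntegrable l u)
      (fun v hv => by have := h1 v hv.1 (hv.2.trans_le hub); linarith) hu
    rw [intervalIntegral.integral_neg] at this
    simp only [hF]; linarith
  have hge : ∀ z, l ≤ m z := by
    by_contra! hcon
    obtain ⟨z₀, hz₀⟩ := hcon
    have hco : ∀ᶠ x in cocompact ℝ, m z₀ ≤ m x := by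
      rw [cocompact_eq_atBot_atTop, eventually_sup]
      exact ⟨(h.left.eventually_const_lt hz₀).mono fun _ => le_of_lt,
        (h.right.eventually_const_lt (hz₀.trans hlr)).mono fun _ => le_of_lt⟩
    obtain ⟨z₁, hz₁⟩ := h.continuous.exists_forall_le' z₀ hco
    have hd0 : m' z₁ = 0 := IsLocalMin.hasDerivAt_eq_zero (Eventually.of_forall hz₁) (h.deriv z₁)
    have := hE0 z₁
    have h3 := hFneg (m z₁) ((hz₁ z₀).trans_lt hz₀)
    simp only [hE, hd0] at this
    linarith
  have hgt : ∀ z, l < m z := by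
    intro z
    refine lt_of_le_of_ne (hge z) fun heq => hne l ?_
    refine h.eq_const hg gl heq.symm (IsLocalMin.hasDerivAt_eq_zero (a := z) ?_ (h.deriv z))
    exact Eventually.of_forall fun y => heq ▸ hge y
  have hner : ∀ z, m z ≠ r := by
    intro z hz
    refine hne r (h.eq_const hg gr hz ?_)
    have := hE1 z
    simp only [hE, hz] at this
    have h3 : m' z ^ 2 ≤ 0 := by linarith
    exact pow_eq_zero_iff two_ne_zero |>.1 (le_antisymm h3 (sq_nonneg _))
  have hlt : ∀ z, m z < r := by
    intro z
    by_contra! hz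
    obtain ⟨z₁, hz₁⟩ := (h.left.eventually_lt_const hlr).exists
    obtain ⟨y, hy⟩ := mem_range_of_exists_le_of_exists_ge h.continuous ⟨z₁, hz₁.le⟩ ⟨z, hz⟩
    exact hner y hy
  have hm'ne : ∀ z, m' z ≠ 0 := by
    intro z₀ hz₀
    have hcrit : ∀ z, m' z = 0 → -(c * m' z) - g (m z) < 0 := by
      intro z hz
      have h3 := hE0 z
      simp only [hE, hz] at h3
      have h4 : b < m z := by
        by_contra! hcon
        have := hFneg' (m z) (hgt z) hcon
        linarith
      have := h2 (m z) h4 (hlt z)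
      rw [hz]; linarith
    have hle : ∀ z, z₀ ≤ z → m' z ≤ 0 := by
      intro z hz
      refine image_le_of_deriv_right_lt_deriv_boundary (f := m')
        (f' := fun z => -(c * m' z) - g (m z)) (a := z₀) (b := z) (B := fun _ => 0)
        (B' := fun _ => 0) h.continuous_deriv.continuousOn
        (fun x _ => (h.deriv_deriv x).hasDerivWithinAt) hz₀.le (fun x => hasDerivAt_const x 0)
        (fun x _ hx => hcrit x hx) ⟨hz, le_rfl⟩
    have hanti : ∀ z, z₀ ≤ z → m z ≤ m z₀ := by
      intro z hz
      have := monotoneOn_Ici_of_hasDerivAt (f := fun z => -m z) (R := z₀)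
        (fun z _ => (h.deriv z).neg) (fun z hz => by have := hle z hz; linarith)
      have := this (le_refl z₀) hz hz
      simpa using this
    have := le_of_tendsto h.right (eventually_atTop.2 ⟨z₀, hanti⟩)
    exact absurd (hlt z₀) (not_lt.2 this)
  intro z
  refine ⟨hgt z, hlt z, ?_⟩
  by_contra! hneg
  have hall : ∀ y, m' y < 0 := by
    intro y
    by_contra! hy
    obtain ⟨w, hw⟩ := mem_range_of_exists_le_of_exists_ge h.continuous_deriv ⟨z, hneg⟩ ⟨y, hy⟩
    exact hm'ne w hw
  have hmo : Monotone fun z => -m z :=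
    monotone_of_hasDerivAt_nonneg (fun z => (h.deriv z).neg) fun z => by
      have := hall z; linarith
  have h5 := hmo.le_of_tendsto h.left.neg 0
  have h6 := hmo.ge_of_tendsto h.right.neg 0
  linarith

/-- Fronts of a bistable nonlinearity are strictly increasing. -/
theorem strict (h : IsFront g l r c m m') (hg : ContDiff ℝ 1 g) (hlb : l < b)
    (hbr : b < r) (gl : g l = 0) (gr : g r = 0)
    (h1 : ∀ u, l < u → u < b → g u < 0) (h2 : ∀ u, b < u → u < r → 0 < g u)
    (hI : ((∀ u, u < l → 0 < g u) ∧ 0 ≤ ∫ u in l..r, g u) ∨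
      ((∀ u, r < u → g u < 0) ∧ ∫ u in l..r, g u ≤ 0)) :
    ∀ z, l < m z ∧ m z < r ∧ 0 < m' z := by
  rcases hI with ⟨h0, hI⟩ | ⟨h0, hI⟩
  · exact h.strict_of_nonneg_integral hg hlb hbr gl gr h0 h1 h2 hI
  -- The reflection `u ↦ -u`, `z ↦ -z` exchanges the two ends and reverses the sign of the integral.
  · have hI' : 0 ≤ ∫ u in (-r)..(-l), (fun u => -g (-u)) u := by
      simp only [intervalIntegral.integral_neg]
      rw [intervalIntegral.integral_comp_neg (fun u => g u)]
      simpa using hI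
    have := h.reflect.strict_of_nonneg_integral (b := -b) (by fun_prop)
      (by linarith) (by linarith) (by simp [gr]) (by simp [gl])
      (fun u hu => by have := h0 (-u) (by linarith); linarith)
      (fun u hu hu' => by have := h2 (-u) (by linarith) (by linarith); linarith)
      (fun u hu hu' => by have := h1 (-u) (by linarith) (by linarith); linarith) hI'
    intro z
    have := this (-z)
    simp only [neg_neg] at this
    exact ⟨by linarith [this.2.1], by linarith [this.1], this.2.2⟩

end IsFront

/-! ### Uniqueness of monotone fronts and of their speed -/

namespace IsFront

variable {g : ℝ → ℝ} {l b r c₁ c₂ c : ℝ} {m m' m₁ m₁' m₂ m₂' : ℝ → ℝ}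

theorem strictMono (h : IsFront g l r c m m') (h' : ∀ z, 0 < m' z) : StrictMono m :=
  strictMono_of_deriv_pos fun z => by rw [(h.deriv z).deriv]; exact h' z

theorem exists_eq (h : IsFront g l r c m m') {u : ℝ} (hl : l < u) (hr : u < r) : ∃ z, m z = u := by
  obtain ⟨z₁, hz₁⟩ := (h.left.eventually_lt_const hl).exists
  obtain ⟨z₂, hz₂⟩ := (h.right.eventually_const_lt hr).exists
  exact mem_range_of_exists_le_of_exists_ge h.continuous ⟨z₁, hz₁.le⟩ ⟨z₂, hz₂.le⟩

/-- Change of variables between two increasing fronts. -/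
theorem exists_reparametrization (h₁ : IsFront g l r c₁ m₁ m₁') (h₂ : IsFront g l r c₂ m₂ m₂')
    (p₁ : ∀ z, l < m₁ z ∧ m₁ z < r ∧ 0 < m₁' z) (p₂ : ∀ z, l < m₂ z ∧ m₂ z < r ∧ 0 < m₂' z) :
    ∃ τ : ℝ → ℝ, (∀ z, m₂ (τ z) = m₁ z) ∧ (∀ z, HasDerivAt τ (m₁' z / m₂' (τ z)) z) ∧
      Tendsto τ atTop atTop ∧ Tendsto τ atBot atBot := by
  have s₁ := h₁.strictMono fun z => (p₁ z).2.2
  have s₂ := h₂.strictMono fun z => (p₂ z).2.2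
  choose τ hτ using fun z => h₂.exists_eq (p₁ z).1 (p₁ z).2.1
  have hτm : StrictMono τ := fun x y hxy => s₂.lt_iff_lt.1 (by rw [hτ, hτ]; exact s₁ hxy)
  have hτs : Function.Surjective τ := by
    intro w
    obtain ⟨z, hz⟩ := h₁.exists_eq (p₂ w).1 (p₂ w).2.1
    exact ⟨z, s₂.injective (by rw [hτ, hz])⟩
  have hτc : Continuous τ := hτm.monotone.continuous_of_surjective hτs
  refine ⟨τ, hτ, fun z => ?_, ?_, ?_⟩
  · have hst : HasStrictDerivAt m₂ (m₂' (τ z)) (τ z) :=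
      hasStrictDerivAt_of_hasDerivAt_of_continuousAt (Eventually.of_forall h₂.deriv)
        h₂.continuous_deriv.continuousAt
    have hne := (p₂ (τ z)).2.2.ne'
    have hinv := hst.to_localInverse hne
    have hev : ∀ᶠ y in 𝓝 (τ z), hst.localInverse m₂ _ _ hne (m₂ y) = y :=
      hst.hasStrictFDerivAt_equiv hne |>.eventually_left_inverse
    have hev' := hτc.continuousAt.eventually hev
    rw [hτ z] at hinv
    have := hinv.hasDerivAt.comp z (h₁.deriv z)
    rw [mul_comm, ← div_eq_mul_inv] at this
    refine this.congr_of_eventuallyEq (hev'.mono fun y hy => ?_)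
    simp only [Function.comp]
    rw [← hτ y]
    exact hy.symm
  · exact hτm.monotone.tendsto_atTop_atTop fun w => ⟨_, (hτs w).choose_spec.ge⟩
  · exact hτm.monotone.tendsto_atBot_atBot fun w => ⟨_, (hτs w).choose_spec.le⟩

/-- Compare the slopes of both fronts at equal heights: `D = m₁' - m₂' ∘ τ`, where `m₂ ∘ τ = m₁`.
The equations give `D' = (c₂ - c₁) m₁' + h D` with `h = g(m₁)/(m₂' ∘ τ)`. As `g(m₁)` changes sign
from negative to positive at `z = 0`, the primitive `H` of `h` is nonnegative, so the integrating
factor `e^{-H}` is bounded and `J = D e^{-H}` still tends to zero at both ends. It is monotone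
because `c₁ ≤ c₂`, so it vanishes; then the speeds agree, `τ' = 1`, and `τ 0 = 0`. -/
theorem unique_of_le (h₁ : IsFront g l r c₁ m₁ m₁') (h₂ : IsFront g l r c₂ m₂ m₂')
    (hg : Continuous g) (gl : g l = 0) (gr : g r = 0)
    (hs1 : ∀ u, l < u → u < b → g u < 0) (hs2 : ∀ u, b < u → u < r → 0 < g u)
    (p₁ : ∀ z, l < m₁ z ∧ m₁ z < r ∧ 0 < m₁' z) (p₂ : ∀ z, l < m₂ z ∧ m₂ z < r ∧ 0 < m₂' z)
    (e₁ : m₁ 0 = b) (e₂ : m₂ 0 = b) (hc : c₁ ≤ c₂) : c₁ = c₂ ∧ m₁ = m₂ := by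
  obtain ⟨τ, hτ, hτd, hτt, hτb⟩ := h₁.exists_reparametrization h₂ p₁ p₂
  have s₁ := h₁.strictMono fun z => (p₁ z).2.2
  have s₂ := h₂.strictMono fun z => (p₂ z).2.2
  have hτc : Continuous τ := continuous_iff_continuousAt.2 fun z => (hτd z).continuousAt
  set h : ℝ → ℝ := fun z => g (m₁ z) / m₂' (τ z) with hh
  have hhc : Continuous h := (hg.comp h₁.continuous).div (h₂.continuous_deriv.comp hτc)
    fun z => (p₂ _).2.2.ne'
  set H : ℝ → ℝ := fun z => ∫ s in (0 : ℝ)..z, h s with hH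
  have hHd : ∀ z, HasDerivAt H (h z) z := fun z =>
    intervalIntegral.integral_hasDerivAt_right (hhc.intervalIntegrable _ _)
      (hhc.stronglyMeasurableAtFilter _ _) hhc.continuousAt
  have gb : ∀ u, l < u → u ≤ b → g u ≤ 0 := by
    intro u hu hub
    have hlb : l < b := e₁ ▸ (p₁ 0).1
    have : Tendsto g (𝓝[<] b) (𝓝 (g b)) := hg.continuousAt.tendsto.mono_left nhdsWithin_le_nhds
    rcases hub.lt_or_eq with h1 | h1
    · exact (hs1 u hu h1).le
    · subst h1
      refine le_of_tendsto this ?_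
      filter_upwards [Ioo_mem_nhdsLT hlb] with v hv using (hs1 v hv.1 hv.2).le
  have gb' : ∀ u, b ≤ u → u < r → 0 ≤ g u := by
    intro u hub hu
    have hbr : b < r := e₁ ▸ (p₁ 0).2.1
    have : Tendsto g (𝓝[>] b) (𝓝 (g b)) := hg.continuousAt.tendsto.mono_left nhdsWithin_le_nhds
    rcases hub.lt_or_eq with h1 | h1
    · exact (hs2 u h1 hu).le
    · subst h1
      refine ge_of_tendsto this ?_
      filter_upwards [Ioo_mem_nhdsGT hbr] with v hv using (hs2 v hv.1 hv.2).le
  have hH0 : ∀ z, 0 ≤ H z := by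
    intro z
    rcases le_total 0 z with hz | hz
    · refine intervalIntegral.integral_nonneg hz fun s hs => ?_
      exact div_nonneg (gb' _ (e₁ ▸ s₁.monotone hs.1) (p₁ s).2.1) (p₂ _).2.2.le
    · simp only [hH]
      rw [intervalIntegral.integral_symm, ← intervalIntegral.integral_neg]
      refine intervalIntegral.integral_nonneg hz fun s hs => ?_
      have := div_nonpos_of_nonpos_of_nonneg
        (gb _ (p₁ s).1 (e₁ ▸ s₁.monotone hs.2)) (p₂ (τ s)).2.2.le
      simp only [hh]; linarith
  set D : ℝ → ℝ := fun z => m₁' z - m₂' (τ z) with hD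
  have hDd : ∀ z, HasDerivAt D ((c₂ - c₁) * m₁' z + h z * D z) z := by
    intro z
    have := (h₁.deriv_deriv z).sub ((h₂.deriv_deriv (τ z)).comp z (hτd z))
    convert! this using 1
    have hne := (p₂ (τ z)).2.2.ne'
    simp only [hh, hD, hτ]
    field_simp
    ring
  set J : ℝ → ℝ := fun z => D z * Real.exp (-H z) with hJ
  have hJd : ∀ z, HasDerivAt J ((c₂ - c₁) * m₁' z * Real.exp (-H z)) z := by
    intro z
    have := (hDd z).mul (hHd z).neg.exp
    convert! this using 1
    simp only [Pi.neg_apply]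
    ring
  have hJmono : Monotone J := monotone_of_hasDerivAt_nonneg hJd fun z =>
    mul_nonneg (mul_nonneg (by linarith) (p₁ z).2.2.le) (Real.exp_pos _).le
  have hJle : ∀ z, |J z| ≤ |D z| := by
    intro z
    simp only [hJ]
    rw [abs_mul, abs_of_pos (Real.exp_pos _)]
    have : Real.exp (-H z) ≤ 1 := Real.exp_le_one_iff.2 (by linarith [hH0 z])
    nlinarith [abs_nonneg (D z)]
  have hDtop : Tendsto D atTop (𝓝 0) := by
    have := (h₁.deriv_tendsto_atTop hg gr).sub ((h₂.deriv_tendsto_atTop hg gr).comp hτt)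
    simpa using this
  have hDbot : Tendsto D atBot (𝓝 0) := by
    have := (h₁.deriv_tendsto_atBot hg gl).sub ((h₂.deriv_tendsto_atBot hg gl).comp hτb)
    simpa using this
  have hJtop : Tendsto J atTop (𝓝 0) :=
    squeeze_zero_norm hJle (by simpa using hDtop.abs)
  have hJbot : Tendsto J atBot (𝓝 0) :=
    squeeze_zero_norm hJle (by simpa using hDbot.abs)
  have hJ0 : ∀ z, J z = 0 := fun z =>
    le_antisymm (hJmono.ge_of_tendsto hJtop z) (hJmono.le_of_tendsto hJbot z)
  have hD0 : ∀ z, m₁' z = m₂' (τ z) := fun z => by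
    have := hJ0 z
    simp only [hJ, mul_eq_zero, (Real.exp_pos _).ne', or_false, hD] at this
    linarith
  constructor
  · have e0 : J = fun _ => 0 := funext hJ0
    have e3 := (hJd 0).unique (e0 ▸ hasDerivAt_const (0 : ℝ) (0 : ℝ))
    have := (p₁ 0).2.2
    simp only [mul_eq_zero, (Real.exp_pos _).ne', or_false, this.ne'] at e3
    linarith
  · have hτ0 : τ 0 = 0 := s₂.injective (by rw [hτ, e₁, e₂])
    have hτid : ∀ z, τ z - z = τ 0 - 0 := by
      intro z
      have hd : ∀ z, HasDerivAt (fun z => τ z - z) 0 z := by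
        intro z
        have := (hτd z).sub (hasDerivAt_id z)
        rwa [hD0 z, div_self (p₂ _).2.2.ne', sub_self] at this
      exact is_const_of_deriv_eq_zero (fun z => (hd z).differentiableAt) (fun z => (hd z).deriv) z 0
    funext z
    have : τ z = z := by have := hτid z; rw [hτ0] at this; linarith
    rw [← hτ z, this]

/-- Increasing fronts of a bistable nonlinearity are unique up to translation. -/
theorem unique (h₁ : IsFront g l r c₁ m₁ m₁') (h₂ : IsFront g l r c₂ m₂ m₂')
    (hg : Continuous g) (gl : g l = 0) (gr : g r = 0)
    (hs1 : ∀ u, l < u → u < b → g u < 0) (hs2 : ∀ u, b < u → u < r → 0 < g u)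
    (p₁ : ∀ z, l < m₁ z ∧ m₁ z < r ∧ 0 < m₁' z) (p₂ : ∀ z, l < m₂ z ∧ m₂ z < r ∧ 0 < m₂' z)
    (e₁ : m₁ 0 = b) (e₂ : m₂ 0 = b) : c₁ = c₂ ∧ m₁ = m₂ := by
  rcases le_total c₁ c₂ with hc | hc
  · exact h₁.unique_of_le h₂ hg gl gr hs1 hs2 p₁ p₂ e₁ e₂ hc
  · have := h₂.unique_of_le h₁ hg gl gr hs1 hs2 p₂ p₁ e₂ e₁ hc
    exact ⟨this.1.symm, this.2.symm⟩

end IsFront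

/-! ### Zeros of the perturbed nonlinearity -/

/-- Sign pattern of a bistable function with zeros `l < b < r`. -/
structure IsBistableSigns (g : ℝ → ℝ) (l b r : ℝ) : Prop where
  lt_left : l < b
  lt_right : b < r
  left : g l = 0
  mid : g b = 0
  right : g r = 0
  neg : ∀ u, l < u → u < b → g u < 0
  pos : ∀ u, b < u → u < r → 0 < g u
  -- For `δ > 0` the function `f + δ` may vanish again far to the right, where `f` is merely
  -- negative (and symmetrically for `δ < 0`). Hence only one outer sign is recorded: the one that
  -- the energy argument needs for the given sign of the integral.
  outer : ((∀ u, u < l → 0 < g u) ∧ 0 ≤ ∫ u in l..r, g u) ∨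
      ((∀ u, r < u → g u < 0) ∧ ∫ u in l..r, g u ≤ 0)

theorem exists_strictMonoOn_of_deriv_pos {h : ℝ → ℝ} {z₀ : ℝ} (hh : ContDiff ℝ 1 h)
    (h0 : 0 < deriv h z₀) :
    ∃ r₀ > 0, StrictMonoOn h (Icc (z₀ - r₀) (z₀ + r₀)) := by
  have hc : Continuous (deriv h) := hh.continuous_deriv le_rfl
  obtain ⟨e, he, hball⟩ := Metric.eventually_nhds_iff.1 (hc.continuousAt.eventually_const_lt h0)
  refine ⟨e / 2, by positivity, strictMonoOn_of_deriv_pos (convex_Icc _ _)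
    hh.continuous.continuousOn fun x hx => hball ?_⟩
  rw [interior_Icc] at hx
  rw [Real.dist_eq, abs_lt]
  constructor <;> linarith [hx.1, hx.2]

theorem exists_zero_of_strictMonoOn {h : ℝ → ℝ} {z₀ r₀ : ℝ} (hh : Continuous h) (hz : h z₀ = 0)
    (hm : StrictMonoOn h (Icc (z₀ - r₀) (z₀ + r₀))) {ρ : ℝ} (hρ : 0 < ρ) (hρr : ρ ≤ r₀) :
    ∃ k > 0, ∀ δ, |δ| ≤ k → ∃ x, |x - z₀| ≤ ρ ∧ h x + δ = 0 := by
  have h1 : h z₀ < h (z₀ + ρ) := hm ⟨by linarith, by linarith⟩ ⟨by linarith, by linarith⟩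
    (by linarith)
  have h2 : h (z₀ - ρ) < h z₀ := hm ⟨by linarith, by linarith⟩ ⟨by linarith, by linarith⟩
    (by linarith)
  refine ⟨min (h (z₀ + ρ)) (-h (z₀ - ρ)), lt_min (by linarith) (by linarith), fun δ hδ => ?_⟩
  have h3 := le_min_iff.1 hδ
  have h4 := abs_le.1 h3.1
  have h5 := abs_le.1 h3.2
  have : (-δ) ∈ Icc (h (z₀ - ρ)) (h (z₀ + ρ)) := ⟨by linarith, by linarith⟩
  obtain ⟨x, hx, hx'⟩ := intermediate_value_Icc (by linarith) hh.continuousOn this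
  refine ⟨x, abs_le.2 ⟨by linarith [hx.1], by linarith [hx.2]⟩, by linarith⟩

theorem pos_of_ne_zero_of_pos {h : ℝ → ℝ} {s : Set ℝ} (hs : s.OrdConnected)
    (hh : Continuous h) (hne : ∀ u ∈ s, h u ≠ 0) {v : ℝ} (hv : v ∈ s) (hpos : 0 < h v) :
    ∀ u ∈ s, 0 < h u := by
  intro u hu
  by_contra! hcon
  have hpc : IsPreconnected s := hs.isPreconnected
  obtain ⟨w, hw, hw'⟩ := hpc.intermediate_value hu hv hh.continuousOn ⟨hcon, hpos.le⟩
  exact hne w hw hw'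

namespace IsBalancedBistable

variable {f : ℝ → ℝ} {am a ap : ℝ}

theorem zero_left (hf : IsBalancedBistable f am a ap) : f am = 0 := (hf.zeros am).2 (by simp)
theorem zero_mid (hf : IsBalancedBistable f am a ap) : f a = 0 := (hf.zeros a).2 (by simp)
theorem zero_right (hf : IsBalancedBistable f am a ap) : f ap = 0 := (hf.zeros ap).2 (by simp)

theorem contDiff_one (hf : IsBalancedBistable f am a ap) : ContDiff ℝ 1 f :=
  hf.contDiff.of_le (by norm_num)

theorem continuous (hf : IsBalancedBistable f am a ap) : Continuous f := hf.contDiff.continuous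

theorem exists_strictAntiOn {z₀ : ℝ} (hf : IsBalancedBistable f am a ap) (h : deriv f z₀ < 0) :
    ∃ r₀ > 0, StrictMonoOn (fun u => -f u) (Icc (z₀ - r₀) (z₀ + r₀)) :=
  exists_strictMonoOn_of_deriv_pos hf.contDiff_one.neg (by
    rw [deriv.fun_neg]; linarith)

theorem signs (hf : IsBalancedBistable f am a ap) :
    (∀ u, u < am → 0 < f u) ∧ (∀ u, am < u → u < a → f u < 0) ∧
    (∀ u, a < u → u < ap → 0 < f u) ∧ (∀ u, ap < u → f u < 0) := by
  have hne : ∀ u, u ≠ am → u ≠ a → u ≠ ap → f u ≠ 0 := fun u h1 h2 h3 h =>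
    ((hf.zeros u).1 h).elim h1 fun h => h.elim h2 h3
  have l1 := hf.lt_left
  have l2 := hf.lt_right
  obtain ⟨r1, hr1, m1⟩ := hf.exists_strictAntiOn hf.deriv_left
  obtain ⟨r2, hr2, m2⟩ := exists_strictMonoOn_of_deriv_pos hf.contDiff_one hf.deriv_mid
  obtain ⟨r3, hr3, m3⟩ := hf.exists_strictAntiOn hf.deriv_right
  have z1 := hf.zero_left
  have z2 := hf.zero_mid
  have z3 := hf.zero_right
  have hfc := hf.continuous
  refine ⟨fun u hu => ?_, fun u hu hu' => ?_, fun u hu hu' => ?_, fun u hu => ?_⟩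
  · refine pos_of_ne_zero_of_pos (s := Iio am) ordConnected_Iio hfc
      (fun v hv => hne v (ne_of_lt hv) (ne_of_lt (hv.trans l1)) (ne_of_lt (hv.trans (l1.trans l2))))
      (v := am - r1) (by simp [hr1]) ?_ u hu
    have := m1 (a := am - r1) (b := am) ⟨by linarith, by linarith⟩ ⟨by linarith, by linarith⟩
      (by linarith)
    simp only [z1] at this; linarith
  · have hmin : 0 < min r1 ((a - am) / 2) := lt_min hr1 (by linarith)
    have b1 := min_le_left r1 ((a - am) / 2)
    have b2 := min_le_right r1 ((a - am) / 2)
    have := pos_of_ne_zero_of_pos (h := fun u => -f u) (s := Ioo am a) ordConnected_Ioo hfc.neg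
      (fun v hv => neg_ne_zero.2 (hne v hv.1.ne' hv.2.ne (hv.2.trans l2).ne))
      (v := am + min r1 ((a - am) / 2)) ⟨by linarith, by linarith⟩ ?_ u ⟨hu, hu'⟩
    · linarith
    have := m1 (a := am) (b := am + min r1 ((a - am) / 2)) ⟨by linarith, by linarith⟩
      ⟨by linarith, by linarith⟩ (by linarith)
    simp only [z1] at this; linarith
  · have hmin : 0 < min r2 ((ap - a) / 2) := lt_min hr2 (by linarith)
    have b1 := min_le_left r2 ((ap - a) / 2)
    have b2 := min_le_right r2 ((ap - a) / 2)
    refine pos_of_ne_zero_of_pos (s := Ioo a ap) ordConnected_Ioo hfc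
      (fun v hv => hne v (l1.trans hv.1).ne' hv.1.ne' hv.2.ne)
      (v := a + min r2 ((ap - a) / 2)) ⟨by linarith, by linarith⟩ ?_ u ⟨hu, hu'⟩
    have := m2 (a := a) (b := a + min r2 ((ap - a) / 2)) ⟨by linarith, by linarith⟩
      ⟨by linarith, by linarith⟩ (by linarith)
    simp only [z2] at this; linarith
  · have := pos_of_ne_zero_of_pos (h := fun u => -f u) (s := Ioi ap) ordConnected_Ioi hfc.neg
      (fun v hv => neg_ne_zero.2 (hne v ((l1.trans l2).trans hv).ne' (l2.trans hv).ne' (ne_of_gt hv)))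
      (v := ap + r3) (by simp [hr3]) ?_ u hu
    · linarith
    have := m3 (a := ap) (b := ap + r3) ⟨by linarith, by linarith⟩
      ⟨by linarith, by linarith⟩ (by linarith)
    simp only [z3] at this; linarith

/-- Because `f` is balanced, the integral has the sign of `δ`. For `δ ≥ 0` the two stable zeros move
to the right; the main part of the integral is `δ (ap - am)`, the piece over `[ap, r]` is
nonnegative, and the piece over `[am, l]` that is lost is at most `δ (l - am)`. The case `δ ≤ 0` is
symmetric. -/
theorem outer_signs (hf : IsBalancedBistable f am a ap) {r₀ l r δ : ℝ}
    (m1 : StrictMonoOn (fun u => -f u) (Icc (am - r₀) (am + r₀)))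
    (m3 : StrictMonoOn (fun u => -f u) (Icc (ap - r₀) (ap + r₀)))
    (il : l ∈ Icc (am - r₀) (am + r₀)) (ir : r ∈ Icc (ap - r₀) (ap + r₀))
    (hl' : f l + δ = 0) (hr' : f r + δ = 0) (hla : l < a) (har : a < r) :
    ((∀ u, u < l → 0 < f u + δ) ∧ 0 ≤ ∫ u in l..r, (f u + δ)) ∨
      ((∀ u, r < u → f u + δ < 0) ∧ ∫ u in l..r, (f u + δ) ≤ 0) := by
  have l1 := hf.lt_left
  have l2 := hf.lt_right
  have z1 := hf.zero_left
  have z3 := hf.zero_right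
  have hfc := hf.continuous
  obtain ⟨s1, s2, s3, s4⟩ := hf.signs
  have il1 := il.1
  have il2 := il.2
  have ir1 := ir.1
  have ir2 := ir.2
  have hii : ∀ x y, IntervalIntegrable (fun u => f u + δ) volume x y := fun x y =>
    (hfc.add continuous_const).intervalIntegrable x y
  have hiic : ∀ x y, IntervalIntegrable (fun _ : ℝ => δ) volume x y := fun x y =>
    continuous_const.intervalIntegrable x y
  have hsplit : ∫ u in l..r, (f u + δ) = (δ * (ap - am) + ∫ u in ap..r, (f u + δ)) -
      ∫ u in am..l, (f u + δ) := by
    have e1 := intervalIntegral.integral_add_adjacent_intervals (hii am l) (hii l r)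
    have e2 := intervalIntegral.integral_add_adjacent_intervals (hii am ap) (hii ap r)
    have e3 : ∫ u in am..ap, (f u + δ) = δ * (ap - am) := by
      rw [intervalIntegral.integral_add (hfc.intervalIntegrable _ _) (hiic _ _), hf.balanced]
      simp [mul_comm]
    linarith
  rcases le_total 0 δ with h0 | h0
  · left
    have al : am ≤ l := by
      by_contra! hcon
      have := s1 l hcon; linarith
    have ar : ap ≤ r := by
      by_contra! hcon
      have := s3 r (by linarith) hcon; linarith
    constructor
    · intro u hu
      rcases lt_or_ge u am with h1 | h1
      · have := s1 u h1; linarith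
      · have := m1 ⟨by linarith, by linarith⟩ il hu
        simp only at this; linarith
    · rw [hsplit]
      have i1 : 0 ≤ ∫ u in ap..r, (f u + δ) := by
        refine intervalIntegral.integral_nonneg ar fun u hu => ?_
        have := m3.monotoneOn ⟨by linarith [hu.1], by linarith [hu.2]⟩ ir hu.2
        linarith
      have i2 : ∫ u in am..l, (f u + δ) ≤ ∫ u in am..l, δ := by
        refine intervalIntegral.integral_mono_on al (hii _ _) (hiic _ _) fun u hu => ?_
        have := m1.monotoneOn (a := am) ⟨by linarith, by linarith⟩
          ⟨by linarith [hu.1], by linarith [hu.2]⟩ hu.1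
        simp only [z1] at this; linarith
      simp only [intervalIntegral.integral_const, smul_eq_mul] at i2
      nlinarith
  · right
    have al : l ≤ am := by
      by_contra! hcon
      have := s2 l hcon (by linarith); linarith
    have ar : r ≤ ap := by
      by_contra! hcon
      have := s4 r hcon; linarith
    constructor
    · intro u hu
      rcases lt_or_ge ap u with h1 | h1
      · have := s4 u h1; linarith
      · have := m3 ir ⟨by linarith, by linarith⟩ hu
        simp only at this; linarith
    · rw [hsplit]
      have i1 : 0 ≤ ∫ u in l..am, -(f u + δ) := by
        refine intervalIntegral.integral_nonneg al fun u hu => ?_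
        have := m1.monotoneOn il ⟨by linarith [hu.1], by linarith [hu.2]⟩ hu.1
        linarith
      have i2 : ∫ u in r..ap, δ ≤ ∫ u in r..ap, (f u + δ) := by
        refine intervalIntegral.integral_mono_on ar (hiic _ _) (hii _ _) fun u hu => ?_
        have := m3.monotoneOn (b := ap)
          ⟨by linarith [hu.1], by linarith [hu.2]⟩ ⟨by linarith, by linarith⟩ hu.2
        simp only [z3] at this; linarith
      rw [intervalIntegral.integral_neg, ← intervalIntegral.integral_symm] at i1
      rw [intervalIntegral.integral_symm r ap]
      simp only [intervalIntegral.integral_const, smul_eq_mul] at i2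
      nlinarith

/-- Within `r₀` of each zero `f` is strictly monotone, which gives existence and uniqueness of the
perturbed zero there. On the two compact gaps between these windows `|f|` is bounded below, and `δ`
is taken smaller than that bound, so the signs in between persist. -/
theorem exists_perturbed_zeros (hf : IsBalancedBistable f am a ap) :
    ∃ r₀ > 0, ∀ ρ, 0 < ρ → ρ ≤ r₀ → ∃ δ₀ > 0, ∀ δ, |δ| ≤ δ₀ → ∃ l b r,
      IsBistableSigns (fun u => f u + δ) l b r ∧
      |l - am| ≤ ρ ∧ |b - a| ≤ ρ ∧ |r - ap| ≤ ρ ∧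
      (∀ x, f x + δ = 0 → |x - am| ≤ r₀ → x = l) ∧
      (∀ x, f x + δ = 0 → |x - a| ≤ r₀ → x = b) ∧
      (∀ x, f x + δ = 0 → |x - ap| ≤ r₀ → x = r) := by
  have l1 := hf.lt_left
  have l2 := hf.lt_right
  obtain ⟨r1, hr1, m1⟩ := hf.exists_strictAntiOn hf.deriv_left
  obtain ⟨r2, hr2, m2⟩ := exists_strictMonoOn_of_deriv_pos hf.contDiff_one hf.deriv_mid
  obtain ⟨r3, hr3, m3⟩ := hf.exists_strictAntiOn hf.deriv_right
  have z1 := hf.zero_left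
  have z2 := hf.zero_mid
  have z3 := hf.zero_right
  have hfc := hf.continuous
  obtain ⟨s1, s2, s3, s4⟩ := hf.signs
  set r₀ := min (min r1 (min r2 r3)) (min ((a - am) / 3) ((ap - a) / 3)) with hr₀
  have hr₀pos : 0 < r₀ := by
    refine lt_min (lt_min hr1 (lt_min hr2 hr3)) (lt_min ?_ ?_) <;> linarith
  have q1 : r₀ ≤ r1 := (min_le_left _ _).trans (min_le_left _ _)
  have q2 : r₀ ≤ r2 := (min_le_left _ _).trans ((min_le_right _ _).trans (min_le_left _ _))
  have q3 : r₀ ≤ r3 := (min_le_left _ _).trans ((min_le_right _ _).trans (min_le_right _ _))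
  have q4 : r₀ ≤ (a - am) / 3 := (min_le_right _ _).trans (min_le_left _ _)
  have q5 : r₀ ≤ (ap - a) / 3 := (min_le_right _ _).trans (min_le_right _ _)
  replace m1 : StrictMonoOn (fun u => -f u) (Icc (am - r₀) (am + r₀)) :=
    m1.mono (Icc_subset_Icc (by linarith) (by linarith))
  replace m2 : StrictMonoOn f (Icc (a - r₀) (a + r₀)) :=
    m2.mono (Icc_subset_Icc (by linarith) (by linarith))
  replace m3 : StrictMonoOn (fun u => -f u) (Icc (ap - r₀) (ap + r₀)) :=
    m3.mono (Icc_subset_Icc (by linarith) (by linarith))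
  refine ⟨r₀, hr₀pos, fun ρ hρ hρr => ?_⟩
  obtain ⟨k1, hk1, t1⟩ := exists_zero_of_strictMonoOn hfc.neg (by simp [z1]) m1 hρ hρr
  obtain ⟨k2, hk2, t2⟩ := exists_zero_of_strictMonoOn hfc z2 m2 hρ hρr
  obtain ⟨k3, hk3, t3⟩ := exists_zero_of_strictMonoOn hfc.neg (by simp [z3]) m3 hρ hρr
  obtain ⟨k4, hk4, t4⟩ : ∃ k > 0, ∀ u ∈ Icc (am + r₀) (a - r₀), f u ≤ -k := by
    obtain ⟨x, hx, hx'⟩ := (isCompact_Icc (a := am + r₀) (b := a - r₀)).exists_isMaxOn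
      (nonempty_Icc.2 (by linarith)) hfc.continuousOn
    exact ⟨-f x, by linarith [s2 x (by linarith [hx.1]) (by linarith [hx.2])],
      fun u hu => by rw [neg_neg]; exact hx' hu⟩
  obtain ⟨k5, hk5, t5⟩ : ∃ k > 0, ∀ u ∈ Icc (a + r₀) (ap - r₀), k ≤ f u := by
    obtain ⟨x, hx, hx'⟩ := (isCompact_Icc (a := a + r₀) (b := ap - r₀)).exists_isMinOn
      (nonempty_Icc.2 (by linarith)) hfc.continuousOn
    exact ⟨f x, s3 x (by linarith [hx.1]) (by linarith [hx.2]), fun u hu => hx' hu⟩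
  refine ⟨min (min k1 (min k2 k3)) (min k4 k5 / 2), lt_min (lt_min hk1 (lt_min hk2 hk3))
    (by have := lt_min hk4 hk5; positivity), fun δ hδ => ?_⟩
  have w1 : |δ| ≤ k1 := hδ.trans ((min_le_left _ _).trans (min_le_left _ _))
  have w2 : |δ| ≤ k2 :=
    hδ.trans ((min_le_left _ _).trans ((min_le_right _ _).trans (min_le_left _ _)))
  have w3 : |δ| ≤ k3 :=
    hδ.trans ((min_le_left _ _).trans ((min_le_right _ _).trans (min_le_right _ _)))
  have w45 : |δ| ≤ min k4 k5 / 2 := hδ.trans (min_le_right _ _)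
  have w4 : |δ| < k4 := by have := min_le_left k4 k5; linarith
  have w5 : |δ| < k5 := by have := min_le_right k4 k5; linarith
  obtain ⟨l, hl, hl'⟩ := t1 (-δ) (by rwa [abs_neg])
  obtain ⟨b, hb, hb'⟩ := t2 δ w2
  obtain ⟨r, hr, hr'⟩ := t3 (-δ) (by rwa [abs_neg])
  replace hl' : f l + δ = 0 := by simp only [Pi.neg_apply] at hl'; linarith
  replace hr' : f r + δ = 0 := by simp only [Pi.neg_apply] at hr'; linarith
  have hl2 := abs_le.1 hl
  have hb2 := abs_le.1 hb
  have hr2 := abs_le.1 hr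
  have δ4 := abs_lt.1 w4
  have δ5 := abs_lt.1 w5
  have il : l ∈ Icc (am - r₀) (am + r₀) := ⟨by linarith, by linarith⟩
  have ib : b ∈ Icc (a - r₀) (a + r₀) := ⟨by linarith, by linarith⟩
  have ir : r ∈ Icc (ap - r₀) (ap + r₀) := ⟨by linarith, by linarith⟩
  refine ⟨l, b, r, ⟨by linarith, by linarith, hl', hb', hr', ?_, ?_, ?_⟩, hl, hb, hr, ?_, ?_, ?_⟩
  · intro u hu hu'
    rcases le_total u (am + r₀) with h1 | h1
    · have := m1 il ⟨by linarith, h1⟩ hu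
      simp only at this; linarith
    rcases le_total u (a - r₀) with h2 | h2
    · have := t4 u ⟨h1, h2⟩; linarith
    · have := m2 ⟨h2, by linarith⟩ ib hu'
      linarith
  · intro u hu hu'
    rcases le_total u (a + r₀) with h1 | h1
    · have := m2 ib ⟨by linarith, h1⟩ hu
      linarith
    rcases le_total u (ap - r₀) with h2 | h2
    · have := t5 u ⟨h1, h2⟩; linarith
    · have := m3 ⟨h2, by linarith⟩ ir hu'
      simp only at this; linarith
  · exact hf.outer_signs m1 m3 il ir hl' hr' (by linarith) (by linarith)
  · intro x hx hx'
    have := abs_le.1 hx'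
    exact m1.injOn ⟨by linarith, by linarith⟩ il (by linarith)
  · intro x hx hx'
    have := abs_le.1 hx'
    exact m2.injOn ⟨by linarith, by linarith⟩ ib (by linarith)
  · intro x hx hx'
    have := abs_le.1 hx'
    exact m3.injOn ⟨by linarith, by linarith⟩ ir (by linarith)

end IsBalancedBistable

/-! ### Uniqueness of traveling waves -/

theorem isNearestZero_iff {f : ℝ → ℝ} {δ z₀ l ρ r₀ : ℝ} (hl : f l + δ = 0) (hlρ : |l - z₀| ≤ ρ)
    (hρ : ρ ≤ r₀) (hu : ∀ x, f x + δ = 0 → |x - z₀| ≤ r₀ → x = l) (x : ℝ) :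
    IsNearestZero f δ z₀ x ↔ x = l := by
  constructor
  · exact fun h => hu x h.1 (((h.2 l hl).trans hlρ).trans hρ)
  · rintro rfl
    refine ⟨hl, fun w hw => ?_⟩
    by_contra! hcon
    have := hu w hw ((hcon.le.trans hlρ).trans hρ)
    subst this
    exact lt_irrefl _ hcon

/-- The three zeros `l < b < r` of `f + δ` that continue `am < a < ap`. -/
structure IsZeroTriple (f : ℝ → ℝ) (am a ap δ l b r : ℝ) : Prop where
  signs : IsBistableSigns (fun u => f u + δ) l b r
  left_iff : ∀ x, IsNearestZero f δ am x ↔ x = l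
  mid_iff : ∀ x, IsNearestZero f δ a x ↔ x = b
  right_iff : ∀ x, IsNearestZero f δ ap x ↔ x = r

theorem IsBalancedBistable.exists_isZeroTriple {f : ℝ → ℝ} {am a ap : ℝ}
    (hf : IsBalancedBistable f am a ap) :
    ∃ r₀ > 0, ∀ ρ, 0 < ρ → ρ ≤ r₀ → ∃ δ₀ > 0, ∀ δ, |δ| ≤ δ₀ → ∃ l b r,
      IsZeroTriple f am a ap δ l b r ∧ |l - am| ≤ ρ ∧ |b - a| ≤ ρ ∧ |r - ap| ≤ ρ ∧
      (∀ x, f x + δ = 0 → |x - am| ≤ r₀ → x = l) ∧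
      (∀ x, f x + δ = 0 → |x - a| ≤ r₀ → x = b) ∧
      (∀ x, f x + δ = 0 → |x - ap| ≤ r₀ → x = r) := by
  obtain ⟨r₀, hr₀, h⟩ := hf.exists_perturbed_zeros
  refine ⟨r₀, hr₀, fun ρ hρ hρr => ?_⟩
  obtain ⟨δ₀, hδ₀, h⟩ := h ρ hρ hρr
  refine ⟨δ₀, hδ₀, fun δ hδ => ?_⟩
  obtain ⟨l, b, r, hs, h1, h2, h3, u1, u2, u3⟩ := h δ hδ
  exact ⟨l, b, r, ⟨hs, isNearestZero_iff hs.left h1 hρr u1, isNearestZero_iff hs.mid h2 hρr u2,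
    isNearestZero_iff hs.right h3 hρr u3⟩, h1, h2, h3, u1, u2, u3⟩

namespace IsZeroTriple

variable {f m m₁ m₂ : ℝ → ℝ} {am a ap δ l b r c c₁ c₂ : ℝ}

theorem isFront (h : IsZeroTriple f am a ap δ l b r) (hw : IsTravelingWave f am a ap δ c m) :
    IsFront (fun u => f u + δ) l r c m (deriv m) ∧ m 0 = b := by
  have h1 : ContDiff ℝ 1 (deriv m) := hw.contDiff.iterate_deriv' 1 1
  refine ⟨⟨fun z => ?_, fun z => ?_, ?_, ?_⟩, (h.mid_iff _).1 hw.mid⟩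
  · exact (hw.contDiff.differentiable two_ne_zero z).hasDerivAt
  · have := (h1.differentiable one_ne_zero z).hasDerivAt
    have e : deriv (deriv m) z = -(c * deriv m z) - (f (m z) + δ) := by linarith [hw.ode z]
    rwa [e] at this
  · obtain ⟨x, hx, hx'⟩ := hw.left
    rwa [(h.left_iff x).1 hx] at hx'
  · obtain ⟨x, hx, hx'⟩ := hw.right
    rwa [(h.right_iff x).1 hx] at hx'

theorem isTravelingWave {m' : ℝ → ℝ} (h : IsZeroTriple f am a ap δ l b r) (hfc : Continuous f)
    (hm : IsFront (fun u => f u + δ) l r c m m') (h0 : m 0 = b) :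
    IsTravelingWave f am a ap δ c m where
  contDiff := by
    have e1 : deriv m = m' := funext fun z => (hm.deriv z).deriv
    have e2 : deriv m' = fun z => -(c * m' z) - (f (m z) + δ) :=
      funext fun z => (hm.deriv_deriv z).deriv
    rw [show (2 : WithTop ℕ∞) = 1 + 1 by norm_num, contDiff_succ_iff_deriv]
    refine ⟨fun z => (hm.deriv z).differentiableAt, by simp, ?_⟩
    rw [e1, contDiff_one_iff_deriv]
    refine ⟨fun z => (hm.deriv_deriv z).differentiableAt, ?_⟩
    rw [e2]
    have := hm.continuous
    have := hm.continuous_deriv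
    fun_prop
  ode z := by
    have e1 : deriv m = m' := funext fun z => (hm.deriv z).deriv
    rw [e1, (hm.deriv_deriv z).deriv]; ring
  left := ⟨l, (h.left_iff l).2 rfl, hm.left⟩
  mid := (h.mid_iff _).2 h0
  right := ⟨r, (h.right_iff r).2 rfl, hm.right⟩

theorem strict {m' : ℝ → ℝ} (h : IsZeroTriple f am a ap δ l b r) (hfc : ContDiff ℝ 1 f)
    (hm : IsFront (fun u => f u + δ) l r c m m') : ∀ z, l < m z ∧ m z < r ∧ 0 < m' z :=
  hm.strict (b := b) (by fun_prop) h.signs.lt_left h.signs.lt_right h.signs.left h.signs.right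
    h.signs.neg h.signs.pos h.signs.outer

theorem wave_unique (h : IsZeroTriple f am a ap δ l b r) (hfc : ContDiff ℝ 1 f)
    (h₁ : IsTravelingWave f am a ap δ c₁ m₁) (h₂ : IsTravelingWave f am a ap δ c₂ m₂) :
    c₁ = c₂ ∧ m₁ = m₂ := by
  obtain ⟨f₁, e₁⟩ := h.isFront h₁
  obtain ⟨f₂, e₂⟩ := h.isFront h₂
  exact f₁.unique f₂ (hfc.continuous.add continuous_const) h.signs.left h.signs.right h.signs.neg
    h.signs.pos (h.strict hfc f₁) (h.strict hfc f₂) e₁ e₂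

/-- `travelingWave` is an arbitrary choice. Uniqueness makes every wave that is constructed by hand
the chosen one, so that properties of the branch become properties of `waveSpeed` and `waveProfile`.
-/
theorem travelingWave_eq (h : IsZeroTriple f am a ap δ l b r) (hfc : ContDiff ℝ 1 f)
    (h₁ : IsTravelingWave f am a ap δ c m) :
    waveSpeed f am a ap δ = c ∧ ∀ z, waveProfile f am a ap z δ = m z := by
  have hex : IsTravelingWave f am a ap δ (travelingWave f am a ap δ).1
      (travelingWave f am a ap δ).2 :=
    Classical.epsilon_spec (p := fun q : ℝ × (ℝ → ℝ) => IsTravelingWave f am a ap δ q.1 q.2)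
      ⟨(c, m), h₁⟩
  obtain ⟨e1, e2⟩ := h.wave_unique hfc hex h₁
  exact ⟨e1, fun z => congrFun e2 z⟩

end IsZeroTriple

/-! ### The standing wave -/

/-- The bound `w ≤ k (r - u)` makes `1/w` dominate `1/(k (r - u))`, whose integral diverges
logarithmically at `r`. The witness `u` is the point where that comparison integral equals `|z|`. -/
theorem exists_le_integral_inv {w : ℝ → ℝ} {b r k : ℝ} (hbr : b < r) (hk : 0 < k)
    (hw : ContinuousOn w (Ico b r)) (hpos : ∀ u ∈ Ico b r, 0 < w u)
    (hle : ∀ u ∈ Ico b r, w u ≤ k * (r - u)) (z : ℝ) :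
    ∃ u ∈ Ico b r, z ≤ ∫ s in b..u, (w s)⁻¹ := by
  set E := Real.exp (-(k * |z|)) with hE
  have hE0 : 0 < E := Real.exp_pos _
  have hE1 : E ≤ 1 := Real.exp_le_one_iff.2 (by have := abs_nonneg z; nlinarith)
  set u := r - (r - b) * E with hu
  have hub : b ≤ u := by nlinarith
  have hur : u < r := by nlinarith [mul_pos (sub_pos.2 hbr) hE0]
  have hsub : Icc b u ⊆ Ico b r := fun s hs => ⟨hs.1, hs.2.trans_lt hur⟩
  refine ⟨u, ⟨hub, hur⟩, ?_⟩
  have hcont : ContinuousOn (fun s => (k * (r - s))⁻¹) (uIcc b u) := by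
    rw [uIcc_of_le hub]
    refine ContinuousOn.inv₀ (by fun_prop) fun s hs => ?_
    have := (hsub hs).2
    exact (mul_pos hk (by linarith)).ne'
  have hcont' : ContinuousOn (fun s => (w s)⁻¹) (uIcc b u) := by
    rw [uIcc_of_le hub]
    exact (hw.mono hsub).inv₀ fun s hs => (hpos s (hsub hs)).ne'
  have h1 : ∫ s in b..u, (k * (r - s))⁻¹ = |z| := by
    rw [intervalIntegral.integral_eq_sub_of_hasDerivAt (f := fun s => -(1 / k) * Real.log (r - s))
      (fun s hs => ?_) hcont.intervalIntegrable]
    · have e1 : r - u = (r - b) * E := by rw [hu]; ring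
      rw [e1, Real.log_mul (by linarith) hE0.ne', hE, Real.log_exp]
      field_simp
      ring
    · rw [uIcc_of_le hub] at hs
      have hs' : 0 < r - s := by have := (hsub hs).2; linarith
      have := (((hasDerivAt_id s).const_sub r).log hs'.ne').const_mul (-(1 / k))
      convert! this using 1
      simp only [id]
      field_simp
  calc z ≤ |z| := le_abs_self z
    _ = _ := h1.symm
    _ ≤ _ := by
      refine intervalIntegral.integral_mono_on hub hcont.intervalIntegrable
        hcont'.intervalIntegrable fun s hs => ?_
      exact inv_anti₀ (hpos s (hsub hs)) (hle s (hsub hs))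

/-- The autonomous equation `m' = w(m)` has a solution that connects two zeros of `w`. -/
theorem exists_heteroclinic {w : ℝ → ℝ} {l b r k : ℝ} (hlb : l < b) (hbr : b < r) (hk : 0 < k)
    (hw : ContinuousOn w (Ioo l r)) (hpos : ∀ u ∈ Ioo l r, 0 < w u)
    (hle : ∀ u ∈ Ioo l r, w u ≤ k * (r - u)) (hle' : ∀ u ∈ Ioo l r, w u ≤ k * (u - l)) :
    ∃ m : ℝ → ℝ, (∀ z, HasDerivAt m (w (m z)) z) ∧ (∀ z, m z ∈ Ioo l r) ∧ m 0 = b ∧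
      Tendsto m atBot (𝓝 l) ∧ Tendsto m atTop (𝓝 r) := by
  have hb : b ∈ Ioo l r := ⟨hlb, hbr⟩
  have hwi : ContinuousOn (fun u => (w u)⁻¹) (Ioo l r) := hw.inv₀ fun u hu => (hpos u hu).ne'
  -- `G` is the travel time from `b`, and `m` will be its inverse. The linear bounds on `w` at both
  -- ends make the travel time to each end infinite, so `G` maps onto the whole line.
  set G : ℝ → ℝ := fun u => ∫ s in b..u, (w s)⁻¹ with hG
  have hGd : ∀ u ∈ Ioo l r, HasDerivAt G (w u)⁻¹ u := by
    intro u hu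
    have hsub : uIcc b u ⊆ Ioo l r := (ordConnected_Ioo.uIcc_subset hb hu)
    refine intervalIntegral.integral_hasDerivAt_right (hwi.mono hsub).intervalIntegrable ?_
      (hwi.continuousAt (isOpen_Ioo.mem_nhds hu))
    exact hwi.stronglyMeasurableAtFilter isOpen_Ioo u hu
  have hGm : StrictMonoOn G (Ioo l r) := by
    refine strictMonoOn_of_deriv_pos (convex_Ioo l r)
      (fun u hu => (hGd u hu).continuousAt.continuousWithinAt) fun u hu => ?_
    rw [interior_Ioo] at hu
    rw [(hGd u hu).deriv]
    exact inv_pos.2 (hpos u hu)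
  have hsurj : ∀ z, ∃ u ∈ Ioo l r, G u = z := by
    intro z
    obtain ⟨u₂, hu₂, h2⟩ := exists_le_integral_inv (w := w) hbr hk
      (hw.mono (Ico_subset_Ioo_left hlb)) (fun u hu => hpos u ⟨hlb.trans_le hu.1, hu.2⟩)
      (fun u hu => hle u ⟨hlb.trans_le hu.1, hu.2⟩) z
    obtain ⟨u₁, hu₁, h1⟩ := exists_le_integral_inv (w := fun u => w (-u)) (b := -b) (r := -l)
      (k := k) (by linarith) hk
      (hw.comp continuous_neg.continuousOn fun u hu => ⟨by linarith [hu.2], by linarith [hu.1]⟩)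
      (fun u hu => hpos (-u) ⟨by linarith [hu.2], by linarith [hu.1]⟩)
      (fun u hu => by
        have := hle' (-u) ⟨by linarith [hu.2], by linarith [hu.1]⟩
        linarith) (-z)
    rw [intervalIntegral.integral_comp_neg (fun s => (w s)⁻¹), neg_neg,
      intervalIntegral.integral_symm] at h1
    have hm₁ : -u₁ ∈ Ioo l r := ⟨by linarith [hu₁.2], by linarith [hu₁.1]⟩
    have hm₂ : u₂ ∈ Ioo l r := ⟨by linarith [hu₂.1], hu₂.2⟩
    obtain ⟨u, hu, hu'⟩ := isPreconnected_Ioo.intermediate_value hm₁ hm₂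
      (fun u hu => (hGd u hu).continuousAt.continuousWithinAt)
      (show z ∈ Icc (G (-u₁)) (G u₂) from ⟨by simp only [hG]; linarith, h2⟩)
    exact ⟨u, hu, hu'⟩
  choose m hm hGmz using hsurj
  have hmm : StrictMono m := fun x y hxy =>
    (hGm.lt_iff_lt (hm x) (hm y)).1 (by rw [hGmz, hGmz]; exact hxy)
  have hrange : range m = Ioo l r := by
    ext u
    constructor
    · rintro ⟨z, rfl⟩; exact hm z
    · intro hu
      exact ⟨G u, hGm.injOn (hm _) hu (hGmz _)⟩
  have hmc : Continuous m := (hmm.isEmbedding_of_ordConnected (by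
    rw [hrange]; exact ordConnected_Ioo)).continuous
  have htop : Tendsto m atTop (𝓝 r) := by
    refine tendsto_atTop_isLUB hmm.monotone ?_
    rw [hrange]; exact isLUB_Ioo (hlb.trans hbr)
  have hbot : Tendsto m atBot (𝓝 l) := by
    refine tendsto_atBot_isGLB hmm.monotone ?_
    rw [hrange]; exact isGLB_Ioo (hlb.trans hbr)
  refine ⟨m, fun z => ?_, hm, ?_, hbot, htop⟩
  · have := HasDerivAt.of_local_left_inverse hmc.continuousAt (hGd (m z) (hm z))
      (inv_ne_zero (hpos _ (hm z)).ne') (Eventually.of_forall hGmz)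
    simpa using this
  · exact hGm.injOn (hm 0) hb (by rw [hGmz]; simp [hG])

/-- At speed zero the energy is conserved, so `m'² = W(m)` with `W = -2 ∫ f`, a first order
equation. Balance makes `W` vanish at both ends and positive in between; the Lipschitz bound on `f`
makes `√W` at most linear near the ends, which are therefore reached only at infinity. -/
theorem IsBalancedBistable.exists_standing_wave {f : ℝ → ℝ} {am a ap : ℝ}
    (hf : IsBalancedBistable f am a ap) :
    ∃ m m' : ℝ → ℝ, IsFront f am ap 0 m m' ∧ (∀ z, am < m z ∧ m z < ap ∧ 0 < m' z) ∧ m 0 = a := by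
  have hfc := hf.continuous
  have l1 := hf.lt_left
  have l2 := hf.lt_right
  obtain ⟨s1, s2, s3, s4⟩ := hf.signs
  have hii : ∀ x y, IntervalIntegrable f volume x y := fun x y => hfc.intervalIntegrable x y
  set W : ℝ → ℝ := fun u => -2 * ∫ s in am..u, f s with hW
  have hWd : ∀ u, HasDerivAt W (-2 * f u) u := fun u =>
    (intervalIntegral.integral_hasDerivAt_right (hii _ _) (hfc.stronglyMeasurableAtFilter _ _)
      hfc.continuousAt).const_mul (-2)
  have hW2 : ∀ u, W u = 2 * ∫ s in u..ap, f s := by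
    intro u
    have := intervalIntegral.integral_add_adjacent_intervals (hii am u) (hii u ap)
    rw [hf.balanced] at this
    simp only [hW]; linarith
  have hWpos : ∀ u ∈ Ioo am ap, 0 < W u := by
    intro u hu
    rcases le_total u a with hua | hua
    · have := intervalIntegral.intervalIntegral_pos_of_pos_on (f := fun v => -f v)
        (hii am u).neg (fun v hv => by have := s2 v hv.1 (hv.2.trans_le hua); linarith) hu.1
      rw [intervalIntegral.integral_neg] at this
      simp only [hW]; linarith
    · have := intervalIntegral.intervalIntegral_pos_of_pos_on (f := f)
        (hii u ap) (fun v hv => s3 v (hua.trans_lt hv.1) hv.2) hu.2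
      rw [hW2]; linarith
  obtain ⟨K, hK0, hK⟩ := exists_lipschitz_of_contDiff hf.contDiff_one (max |am| |ap|)
  have habs : ∀ u ∈ Icc am ap, |u| ≤ max |am| |ap| := fun u hu => abs_le_max_abs_abs hu.1 hu.2
  have hmem1 : am ∈ Icc am ap := ⟨le_rfl, by linarith⟩
  have hmem2 : ap ∈ Icc am ap := ⟨by linarith, le_rfl⟩
  set k := Real.sqrt (2 * (K + 1)) with hk
  have hkpos : 0 < k := Real.sqrt_pos.2 (by linarith)
  have hk2 : k ^ 2 = 2 * (K + 1) := Real.sq_sqrt (by linarith)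
  have hle : ∀ u ∈ Ioo am ap, Real.sqrt (W u) ≤ k * (ap - u) := by
    intro u hu
    refine Real.sqrt_le_iff.2 ⟨mul_nonneg hkpos.le (by linarith [hu.2]), ?_⟩
    have : ∫ s in u..ap, f s ≤ ∫ s in u..ap, K * (ap - u) := by
      refine intervalIntegral.integral_mono_on hu.2.le (hii _ _)
        (continuous_const.intervalIntegrable _ _) fun s hs => ?_
      have h1 := hK s ap (habs s ⟨hu.1.le.trans hs.1, hs.2⟩) (habs ap hmem2)
      rw [hf.zero_right, sub_zero, abs_sub_comm s ap, abs_of_nonneg (a := ap - s) (by linarith [hs.2])] at h1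
      have := le_abs_self (f s)
      nlinarith [hs.1]
    rw [intervalIntegral.integral_const, smul_eq_mul] at this
    rw [hW2, mul_pow, hk2]
    nlinarith [sq_nonneg (ap - u)]
  have hle' : ∀ u ∈ Ioo am ap, Real.sqrt (W u) ≤ k * (u - am) := by
    intro u hu
    refine Real.sqrt_le_iff.2 ⟨mul_nonneg hkpos.le (by linarith [hu.1]), ?_⟩
    have : ∫ s in am..u, -f s ≤ ∫ s in am..u, K * (u - am) := by
      refine intervalIntegral.integral_mono_on hu.1.le (hii _ _).neg
        (continuous_const.intervalIntegrable _ _) fun s hs => ?_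
      have h1 := hK s am (habs s ⟨hs.1, hs.2.trans hu.2.le⟩) (habs am hmem1)
      rw [hf.zero_left, sub_zero, abs_of_nonneg (a := s - am) (by linarith [hs.1])] at h1
      have := neg_le_abs (f s)
      nlinarith [hs.2]
    rw [intervalIntegral.integral_const, smul_eq_mul, intervalIntegral.integral_neg] at this
    simp only [hW]
    rw [mul_pow, hk2]
    nlinarith [sq_nonneg (u - am)]
  have hWc : Continuous W := continuous_iff_continuousAt.2 fun u => (hWd u).continuousAt
  obtain ⟨m, hmd, hmm, hm0, hbot, htop⟩ := exists_heteroclinic (w := fun u => Real.sqrt (W u))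
    l1 l2 hkpos (hWc.sqrt.continuousOn) (fun u hu => Real.sqrt_pos.2 (hWpos u hu)) hle hle'
  refine ⟨m, fun z => Real.sqrt (W (m z)), ⟨hmd, fun z => ?_, hbot, htop⟩,
    fun z => ⟨(hmm z).1, (hmm z).2, Real.sqrt_pos.2 (hWpos _ (hmm z))⟩, hm0⟩
  have hp := hWpos _ (hmm z)
  have := ((hWd (m z)).comp z (hmd z)).sqrt hp.ne'
  convert! this using 1
  have := Real.sqrt_pos.2 hp
  simp only [Function.comp]
  field_simp
  ring

/-! ### Tails of a standing wave -/

theorem exists_forall_ge_le_of_tendsto {h : ℝ → ℝ} {c : ℝ} (hc : Continuous h)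
    (ht : Tendsto h atTop (𝓝 c)) (A : ℝ) : ∃ C, ∀ z, A ≤ z → |h z| ≤ C := by
  obtain ⟨B, hB⟩ := eventually_atTop.1 (ht.abs.eventually_lt_const (show |c| < |c| + 1 by linarith))
  obtain ⟨C, hC⟩ := (isCompact_Icc (a := A) (b := B)).exists_bound_of_continuousOn hc.continuousOn
  refine ⟨max C (|c| + 1), fun z hz => ?_⟩
  rcases le_total B z with h1 | h1
  · exact (hB z h1).le.trans (le_max_right _ _)
  · exact (hC z ⟨hz, h1⟩).trans (le_max_left _ _)

/-- Near a stable zero, `f` lies above a linear function to the left of it. -/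
theorem exists_stable_neighborhood {f : ℝ → ℝ} {r : ℝ} (hf : ContDiff ℝ 1 f) (hr : deriv f r < 0) :
    ∃ ν > 0, ∃ ρ > 0, (∀ u, |u - r| ≤ ρ → deriv f u ≤ -ν ^ 2) ∧
      ∀ u v, |u - r| ≤ ρ → |v - r| ≤ ρ → u ≤ v → ν ^ 2 * (v - u) ≤ f u - f v := by
  have hc : Continuous (deriv f) := hf.continuous_deriv le_rfl
  obtain ⟨e, he, hball⟩ := Metric.eventually_nhds_iff.1
    (hc.continuousAt.eventually_lt_const (show deriv f r < deriv f r / 2 by linarith))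
  refine ⟨Real.sqrt (-deriv f r / 2), Real.sqrt_pos.2 (by linarith), e / 2, by positivity, ?_, ?_⟩
  · intro u hu
    rw [Real.sq_sqrt (by linarith)]
    have := hball (y := u) (by rw [Real.dist_eq]; linarith)
    linarith
  · intro u v hu hv huv
    rw [Real.sq_sqrt (by linarith)]
    have hmono : AntitoneOn (fun x => f x - deriv f r / 2 * x) (Icc (r - e / 2) (r + e / 2)) := by
      refine antitoneOn_of_deriv_nonpos (convex_Icc _ _) (by
        have := hf.continuous; fun_prop) (by
        have := hf.differentiable one_ne_zero; fun_prop) fun x hx => ?_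
      rw [interior_Icc] at hx
      have h1 : HasDerivAt (fun x => f x - deriv f r / 2 * x) (deriv f x - deriv f r / 2 * 1) x :=
        (hf.differentiable one_ne_zero x).hasDerivAt.sub ((hasDerivAt_id x).const_mul _)
      rw [h1.deriv]
      have := hball (y := x) (by rw [Real.dist_eq, abs_lt]; constructor <;> linarith [hx.1, hx.2])
      linarith
    have hu' := abs_le.1 hu
    have hv' := abs_le.1 hv
    have := hmono (a := u) (b := v) ⟨by linarith, by linarith⟩ ⟨by linarith, by linarith⟩ huv
    simp only at this
    linarith

/-- These bounds make the variation-of-constants formula for the linearized equation bounded. Beyond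
some `R`, both `r - m` and `m'` satisfy `s'' ≥ ν² s`, hence `ν (r - m) ≤ m'` and `m'' ≤ -ν m'`. The
latter says that `1/(ν m')` grows at least as fast as the integral of `1/m'`. On `[0, R]`
compactness suffices. -/
theorem IsFront.exists_standing_tail {f m m' : ℝ → ℝ} {l r : ℝ} (h : IsFront f l r 0 m m')
    (hf : ContDiff ℝ 1 f) (hr : f r = 0) (hr' : _root_.deriv f r < 0) (hm : ∀ z, m z < r)
    (hm' : ∀ z, 0 < m' z) :
    ∃ C, ∀ z, 0 ≤ z → r - m z ≤ C * m' z ∧ m' z * ∫ s in (0 : ℝ)..z, (m' s)⁻¹ ≤ C := by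
  obtain ⟨ν, hν, ρ, hρ, h1, h2⟩ := exists_stable_neighborhood hf hr'
  have hmc := h.continuous
  have hmc' := h.continuous_deriv
  have hne : ∀ z, m' z ≠ 0 := fun z => (hm' z).ne'
  have hmt := h.deriv_tendsto_atTop hf.continuous hr
  have hdd : ∀ z, HasDerivAt m' (-f (m z)) z := fun z => by simpa using h.deriv_deriv z
  obtain ⟨R', hR'⟩ := eventually_atTop.1 (Metric.tendsto_nhds.1 h.right ρ hρ)
  obtain ⟨R, hR0, hR⟩ : ∃ R, 0 ≤ R ∧ ∀ z, R ≤ z → |m z - r| ≤ ρ :=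
    ⟨max R' 0, le_max_right _ _, fun z hz => (hR' z ((le_max_left _ _).trans hz)).le⟩
  have t1 : ∀ z, R ≤ z → -m' z + ν * (r - m z) ≤ 0 := by
    obtain ⟨C, hC⟩ := exists_forall_ge_le_of_tendsto (h := fun z => r - m z)
      (by fun_prop) (h.right.const_sub r) R
    refine deriv_add_mul_nonpos_of_bounded (s := fun z => r - m z) (s' := fun z => -m' z)
      (s'' := fun z => f (m z)) hν (fun z _ => (h.deriv z).const_sub r)
      (fun z _ => by simpa using! (hdd z).neg) (fun z hz => ?_)
      (fun z hz => (le_abs_self _).trans (hC z hz))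
    have := h2 (m z) r (hR z hz) (by simp [hρ.le]) (hm z).le
    rw [hr] at this; linarith
  obtain ⟨C₁, hC₁⟩ := exists_forall_ge_le_of_tendsto hmc' hmt 0
  have t2 : ∀ z, R ≤ z → -f (m z) + ν * m' z ≤ 0 := by
    refine deriv_add_mul_nonpos_of_bounded (s := m') (s' := fun z => -f (m z))
      (s'' := fun z => -(_root_.deriv f (m z) * m' z)) hν (fun z _ => hdd z)
      (fun z _ => ?_) (fun z hz => ?_) (fun z hz => (le_abs_self _).trans (hC₁ z (hR0.trans hz)))
    · exact ((hf.differentiable one_ne_zero (m z)).hasDerivAt.comp z (h.deriv z)).neg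
    · have := h1 (m z) (hR z hz)
      have := hm' z
      nlinarith
  have hic : Continuous fun z => (m' z)⁻¹ := hmc'.inv₀ hne
  set I : ℝ → ℝ := fun z => ∫ s in (0 : ℝ)..z, (m' s)⁻¹ with hI
  have hId : ∀ z, HasDerivAt I (m' z)⁻¹ z := fun z =>
    intervalIntegral.integral_hasDerivAt_right (hic.intervalIntegrable _ _)
      (hic.stronglyMeasurableAtFilter _ _) hic.continuousAt
  have hIc : Continuous I := continuous_iff_continuousAt.2 fun z => (hId z).continuousAt
  have t3 : MonotoneOn (fun z => (ν * m' z)⁻¹ - I z) (Ici R) := by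
    refine monotoneOn_Ici_of_hasDerivAt
      (fun z _ => (((hdd z).const_mul ν).inv (mul_ne_zero hν.ne' (hne z))).sub (hId z)) ?_
    intro z hz
    have e1 := t2 z hz
    have := hm' z
    have : -(ν * -f (m z)) / (ν * m' z) ^ 2 - (m' z)⁻¹ = (f (m z) - ν * m' z) / (ν * m' z ^ 2) := by
      field_simp
    rw [this]
    exact div_nonneg (by linarith) (by positivity)
  obtain ⟨C₂, hC₂⟩ := (isCompact_Icc (a := 0) (b := R)).exists_bound_of_continuousOn
    (f := fun z => (r - m z) * (m' z)⁻¹) (by fun_prop)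
  obtain ⟨C₃, hC₃⟩ := (isCompact_Icc (a := 0) (b := R)).exists_bound_of_continuousOn
    (f := fun z => m' z * I z) (by fun_prop)
  set q := |(ν * m' R)⁻¹ - I R| with hq
  have p1 : 0 < ν⁻¹ := inv_pos.2 hν
  have hC₁0 : 0 ≤ C₁ := (abs_nonneg _).trans (hC₁ 0 le_rfl)
  have p3 : 0 ≤ C₁ * q := mul_nonneg hC₁0 (abs_nonneg _)
  refine ⟨|C₂| + |C₃| + (ν⁻¹ + C₁ * q), fun z hz => ?_⟩
  have p2 := hm' z
  have a2 := abs_nonneg C₂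
  have a3 := abs_nonneg C₃
  rcases le_total z R with hzR | hzR
  · have b1 := (le_abs_self _).trans ((hC₂ z ⟨hz, hzR⟩).trans (le_abs_self _))
    have b2 := (le_abs_self _).trans ((hC₃ z ⟨hz, hzR⟩).trans (le_abs_self _))
    constructor
    · calc r - m z = (r - m z) * (m' z)⁻¹ * m' z := by field_simp
        _ ≤ |C₂| * m' z := mul_le_mul_of_nonneg_right b1 p2.le
        _ ≤ _ := mul_le_mul_of_nonneg_right (by linarith) p2.le
    · exact b2.trans (by linarith)
  · constructor
    · have b1 := t1 z hzR
      have b2 : r - m z ≤ ν⁻¹ * m' z := by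
        rw [inv_mul_eq_div, le_div_iff₀ hν]; linarith
      exact b2.trans (mul_le_mul_of_nonneg_right (by linarith) p2.le)
    · have b1 := t3 (le_refl R) hzR hzR
      simp only at b1
      have b2 : I z ≤ (ν * m' z)⁻¹ + q := by
        have := neg_abs_le ((ν * m' R)⁻¹ - I R)
        linarith
      have b3 : m' z ≤ C₁ := (le_abs_self _).trans (hC₁ z hz)
      calc m' z * I z ≤ m' z * ((ν * m' z)⁻¹ + q) := mul_le_mul_of_nonneg_left b2 p2.le
        _ = ν⁻¹ + m' z * q := by field_simp
        _ ≤ ν⁻¹ + C₁ * q := by gcongr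
        _ ≤ _ := by linarith

theorem IsBalancedBistable.exists_standing_wave_tails {f : ℝ → ℝ} {am a ap : ℝ}
    (hf : IsBalancedBistable f am a ap) :
    ∃ m m' : ℝ → ℝ, IsFront f am ap 0 m m' ∧ (∀ z, am < m z ∧ m z < ap ∧ 0 < m' z) ∧ m 0 = a ∧
      ∃ C, (∀ z, 0 ≤ z → ap - m z ≤ C * m' z) ∧ (∀ z, z ≤ 0 → m z - am ≤ C * m' z) ∧
        ∀ z, m' z * |∫ s in (0 : ℝ)..z, (m' s)⁻¹| ≤ C := by
  obtain ⟨m, m', h, hp, h0⟩ := hf.exists_standing_wave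
  obtain ⟨C₁, hC₁⟩ := h.exists_standing_tail hf.contDiff_one hf.zero_right hf.deriv_right
    (fun z => (hp z).2.1) (fun z => (hp z).2.2)
  have hrf : ContDiff ℝ 1 fun u => -f (-u) := by
    have := hf.contDiff_one; fun_prop
  have hrd : deriv (fun u => -f (-u)) (-am) < 0 := by
    rw [deriv.fun_neg, deriv_comp_neg]; simpa using hf.deriv_left
  have hr := h.reflect
  rw [neg_zero] at hr
  obtain ⟨C₂, hC₂⟩ := hr.exists_standing_tail hrf (by simp [hf.zero_left]) hrd
    (fun z => by linarith [(hp (-z)).1]) (fun z => (hp _).2.2)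
  refine ⟨m, m', h, hp, h0, max C₁ C₂, fun z hz => ?_, fun z hz => ?_, fun z => ?_⟩
  · exact (hC₁ z hz).1.trans (mul_le_mul_of_nonneg_right (le_max_left _ _) (hp z).2.2.le)
  · have := (hC₂ (-z) (by linarith)).1
    simp only [neg_neg] at this
    have h2 := mul_le_mul_of_nonneg_right (le_max_right C₁ C₂) (hp z).2.2.le
    linarith
  · rcases le_total 0 z with hz | hz
    · rw [abs_of_nonneg]
      · exact (hC₁ z hz).2.trans (le_max_left _ _)
      · exact intervalIntegral.integral_nonneg hz fun s _ => (inv_pos.2 (hp s).2.2).le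
    · have := (hC₂ (-z) (by linarith)).2
      rw [intervalIntegral.integral_comp_neg (fun s => (m' s)⁻¹)] at this
      simp only [neg_neg, neg_zero] at this
      rw [abs_of_nonpos, ← intervalIntegral.integral_symm]
      · exact this.trans (le_max_right _ _)
      · rw [intervalIntegral.integral_symm, neg_nonpos]
        exact intervalIntegral.integral_nonneg hz fun s _ => (inv_pos.2 (hp s).2.2).le

noncomputable section
open BoundedContinuousFunction

/-! ### Bounded solutions of `w'' - w = -g` -/

/-- Exponential average of `g` over `(-∞, z]`. -/
def expAvg (g : ℝ →ᵇ ℝ) (z : ℝ) : ℝ := Real.exp (-z) * ∫ s in Iic z, Real.exp s * g s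

theorem integrableOn_exp_mul (g : ℝ →ᵇ ℝ) (z : ℝ) :
    IntegrableOn (fun s => Real.exp s * g s) (Iic z) := by
  refine (integrableOn_exp_Iic z).mul_bdd (c := ‖g‖)
    g.continuous.aestronglyMeasurable (Eventually.of_forall fun x => g.norm_coe_le_norm x)

theorem expAvg_hasDerivAt (g : ℝ →ᵇ ℝ) (z : ℝ) : HasDerivAt (expAvg g) (g z - expAvg g z) z := by
  have hc : Continuous fun s => Real.exp s * g s := Real.continuous_exp.mul g.continuous
  have h1 : HasDerivAt (fun z => ∫ s in (0 : ℝ)..z, Real.exp s * g s) (Real.exp z * g z) z :=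
    intervalIntegral.integral_hasDerivAt_right (hc.intervalIntegrable _ _)
      (hc.stronglyMeasurableAtFilter _ _) hc.continuousAt
  have h2 : ∀ y, (∫ s in Iic y, Real.exp s * g s) =
      (∫ s in Iic 0, Real.exp s * g s) + ∫ s in (0 : ℝ)..y, Real.exp s * g s := fun y => by
    rw [← intervalIntegral.integral_Iic_sub_Iic (integrableOn_exp_mul g 0)
      (integrableOn_exp_mul g y)]
    ring
  have h3 : HasDerivAt (fun z => ∫ s in Iic z, Real.exp s * g s) (Real.exp z * g z) z := by
    rw [funext h2]
    exact h1.const_add _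
  have h4 : HasDerivAt (fun z : ℝ => Real.exp (-z)) (-Real.exp (-z)) z := by
    simpa using (hasDerivAt_neg z).exp
  have := h4.mul h3
  convert! this using 1
  have e : Real.exp (-z) * (Real.exp z * g z) = g z := by
    rw [← mul_assoc, ← Real.exp_add]; simp
  rw [e, expAvg]; ring

theorem abs_expAvg_le (g : ℝ →ᵇ ℝ) (z : ℝ) : |expAvg g z| ≤ ‖g‖ := by
  have h1 : ‖∫ s in Iic z, Real.exp s * g s‖ ≤ ∫ s in Iic z, Real.exp s * ‖g‖ := by
    refine norm_integral_le_of_norm_le ((integrableOn_exp_Iic z).mul_const _)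
      (Eventually.of_forall fun s => ?_)
    rw [norm_mul, Real.norm_of_nonneg (Real.exp_pos s).le]
    exact mul_le_mul_of_nonneg_left (g.norm_coe_le_norm s) (Real.exp_pos s).le
  rw [integral_mul_const, integral_exp_Iic] at h1
  rw [expAvg, abs_mul, abs_of_pos (Real.exp_pos _)]
  calc _ ≤ Real.exp (-z) * (Real.exp z * ‖g‖) :=
        mul_le_mul_of_nonneg_left h1 (Real.exp_pos _).le
    _ = ‖g‖ := by rw [← mul_assoc, ← Real.exp_add]; simp

theorem expAvg_add (g h : ℝ →ᵇ ℝ) (z : ℝ) : expAvg (g + h) z = expAvg g z + expAvg h z := by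
  simp only [expAvg, coe_add, Pi.add_apply, mul_add]
  rw [integral_add (integrableOn_exp_mul g z) (integrableOn_exp_mul h z), mul_add]

theorem expAvg_smul (c : ℝ) (g : ℝ →ᵇ ℝ) (z : ℝ) : expAvg (c • g) z = c * expAvg g z := by
  simp only [expAvg, coe_smul, smul_eq_mul]
  have : (fun s => Real.exp s * (c * g s)) = fun s => c * (Real.exp s * g s) := by
    ext s; ring
  rw [this, integral_const_mul]
  ring

/-- `expAvg` as an operator on bounded continuous functions. -/
def expAvgL : (ℝ →ᵇ ℝ) →L[ℝ] (ℝ →ᵇ ℝ) :=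
  LinearMap.mkContinuous
    { toFun := fun g => ofNormedAddCommGroup (expAvg g)
        (continuous_iff_continuousAt.2 fun z => (expAvg_hasDerivAt g z).continuousAt) ‖g‖
        (abs_expAvg_le g)
      map_add' := fun g h => by ext z; exact expAvg_add g h z
      map_smul' := fun c g => by ext z; exact expAvg_smul c g z } 1
    fun g => by
      rw [one_mul]
      exact norm_ofNormedAddCommGroup_le _ (norm_nonneg _) (abs_expAvg_le g)

theorem expAvgL_apply (g : ℝ →ᵇ ℝ) (z : ℝ) : expAvgL g z = expAvg g z := rfl

/-- The reflection `g ↦ g(-·)`. -/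
def reflectL : (ℝ →ᵇ ℝ) →L[ℝ] (ℝ →ᵇ ℝ) :=
  LinearMap.mkContinuous
    { toFun := fun g => g.compContinuous ⟨fun z => -z, continuous_neg⟩
      map_add' := fun g h => rfl
      map_smul' := fun c g => rfl } 1
    fun g => by
      rw [one_mul]
      exact (BoundedContinuousFunction.norm_le (norm_nonneg _)).2 fun z => g.norm_coe_le_norm _

theorem reflectL_apply (g : ℝ →ᵇ ℝ) (z : ℝ) : reflectL g z = g (-z) := rfl

/-- The bounded solution operator of `w'' - w = -g`. -/
def resolvL : (ℝ →ᵇ ℝ) →L[ℝ] (ℝ →ᵇ ℝ) :=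
  -- Convolution with the Green function `e^{-|z|}/2`, split into averages over the two half-lines.
  (1 / 2 : ℝ) • (reflectL ∘L expAvgL ∘L reflectL + expAvgL)

/-- The derivative of the bounded solution of `w'' - w = -g`. -/
def resolvDerivL : (ℝ →ᵇ ℝ) →L[ℝ] (ℝ →ᵇ ℝ) :=
  (1 / 2 : ℝ) • (reflectL ∘L expAvgL ∘L reflectL - expAvgL)

theorem reflected_hasDerivAt (g : ℝ →ᵇ ℝ) (z : ℝ) :
    HasDerivAt (fun z => expAvg (reflectL g) (-z)) (expAvg (reflectL g) (-z) - g z) z := by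
  have := (expAvg_hasDerivAt (reflectL g) (-z)).comp z (hasDerivAt_neg z)
  convert! this using 1
  rw [reflectL_apply, neg_neg]; ring

theorem resolvL_hasDerivAt (g : ℝ →ᵇ ℝ) (z : ℝ) :
    HasDerivAt (resolvL g) (resolvDerivL g z) z := by
  have := ((reflected_hasDerivAt g z).add (expAvg_hasDerivAt g z)).const_mul (1 / 2)
  convert! this using 1
  simp only [resolvDerivL, one_div, _root_.smul_apply, _root_.sub_apply,
    ContinuousLinearMap.comp_apply, coe_smul, coe_sub, Pi.sub_apply, reflectL_apply,
    expAvgL_apply, smul_eq_mul]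
  ring

theorem resolvDerivL_hasDerivAt (g : ℝ →ᵇ ℝ) (z : ℝ) :
    HasDerivAt (resolvDerivL g) (resolvL g z - g z) z := by
  have := ((reflected_hasDerivAt g z).sub (expAvg_hasDerivAt g z)).const_mul (1 / 2)
  convert! this using 1
  simp only [resolvL, one_div, _root_.smul_apply, _root_.add_apply,
    ContinuousLinearMap.comp_apply, coe_smul, coe_add, Pi.add_apply, reflectL_apply,
    expAvgL_apply, smul_eq_mul]
  ring

/-- A bounded solution of `e'' = e` vanishes. -/
theorem eq_zero_of_bounded {e e' : ℝ → ℝ} (h1 : ∀ z, HasDerivAt e (e' z) z)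
    (h2 : ∀ z, HasDerivAt e' (e z) z) {C : ℝ} (hb : ∀ z, |e z| ≤ C) (z : ℝ) : e z = 0 := by
  -- `(e²)'' = 2e'² + 2e² ≥ e²`, so `e²` decays exponentially from any starting point `R`, with a
  -- constant that does not depend on `R`. Then `R → -∞`.
  have key : ∀ R, R ≤ z → e z ^ 2 ≤ C ^ 2 * Real.exp (-(1 * (z - R))) := by
    intro R hR
    have := le_mul_exp_of_bounded (s := fun z => e z ^ 2) (s' := fun z => 2 * e z * e' z)
      (s'' := fun z => 2 * e' z * e' z + 2 * e z * e z) (ν := 1) (R := R) (C := C ^ 2) one_pos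
      (fun z _ => by simpa using! (h1 z).pow 2)
      (fun z _ => by simpa using! ((h1 z).const_mul 2).mul (h2 z))
      (fun z _ => by nlinarith [sq_nonneg (e z), sq_nonneg (e' z)])
      (fun z _ => sq_le_sq' (abs_le.1 (hb z)).1 (abs_le.1 (hb z)).2) z hR
    refine this.trans (mul_le_mul_of_nonneg_right ?_ (Real.exp_pos _).le)
    exact sq_le_sq' (abs_le.1 (hb R)).1 (abs_le.1 (hb R)).2
  have hlim : Tendsto (fun R => C ^ 2 * Real.exp (-(1 * (z - R)))) atBot (𝓝 0) := by
    rw [← mul_zero (C ^ 2)]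
    refine (Real.tendsto_exp_atBot.comp ?_).const_mul _
    have : (fun R : ℝ => -(1 * (z - R))) = fun R => R + -z := by ext; ring
    rw [this]
    exact tendsto_atBot_add_const_right _ _ tendsto_id
  have := ge_of_tendsto hlim (eventually_atBot.2 ⟨z, key⟩)
  exact pow_eq_zero_iff two_ne_zero |>.1 (le_antisymm this (sq_nonneg _))

/-- The difference of two bounded solutions solves `e'' = e` and vanishes. This recognizes a
solution found by an explicit formula as a value of `resolvL`. -/
theorem resolvL_eq {w w' : ℝ → ℝ} {g : ℝ →ᵇ ℝ} (h1 : ∀ z, HasDerivAt w (w' z) z)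
    (h2 : ∀ z, HasDerivAt w' (w z - g z) z) {C : ℝ} (hb : ∀ z, |w z| ≤ C) (z : ℝ) :
    resolvL g z = w z := by
  have := eq_zero_of_bounded (e := fun z => resolvL g z - w z)
    (e' := fun z => resolvDerivL g z - w' z) (C := ‖resolvL g‖ + C)
    (fun z => (resolvL_hasDerivAt g z).sub (h1 z))
    (fun z => by convert! (resolvDerivL_hasDerivAt g z).sub (h2 z) using 1; ring)
    (fun z => (abs_sub _ _).trans (add_le_add ((resolvL g).norm_coe_le_norm z) (hb z))) z
  linarith

theorem eq_zero_of_resolvL_eq_zero {g : ℝ →ᵇ ℝ} (h : resolvL g = 0) : g = 0 := by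
  have h1 : ∀ z, resolvDerivL g z = 0 := fun z => by
    have := resolvL_hasDerivAt g z
    rw [h] at this
    exact this.unique (hasDerivAt_const z (0 : ℝ))
  ext z
  have h2 := resolvDerivL_hasDerivAt g z
  have h3 : (resolvDerivL g : ℝ → ℝ) = fun _ => 0 := funext h1
  rw [h3] at h2
  have := h2.unique (hasDerivAt_const z (0 : ℝ))
  rw [h] at this
  simpa using this

/-! ### Superposition operators -/

theorem exists_bound_superpose {φ : ℝ → ℝ} (hφ : Continuous φ) (v : ℝ →ᵇ ℝ) :
    ∃ C, ∀ z, ‖φ (v z)‖ ≤ C := by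
  obtain ⟨C, hC⟩ := (isCompact_Icc (a := -‖v‖) (b := ‖v‖)).exists_bound_of_continuousOn
    hφ.continuousOn
  exact ⟨C, fun z => hC _ (abs_le.1 (v.norm_coe_le_norm z))⟩

/-- The superposition operator `v ↦ φ ∘ v`. -/
def superpose (φ : C(ℝ, ℝ)) (v : ℝ →ᵇ ℝ) : ℝ →ᵇ ℝ :=
  ofNormedAddCommGroup (fun z => φ (v z)) (φ.continuous.comp v.continuous)
    (exists_bound_superpose φ.continuous v).choose
    (exists_bound_superpose φ.continuous v).choose_spec

@[simp]
theorem superpose_apply (φ : C(ℝ, ℝ)) (v : ℝ →ᵇ ℝ) (z : ℝ) : superpose φ v z = φ (v z) := rfl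

theorem exists_modulus {φ : ℝ → ℝ} (hφ : Continuous φ) (R : ℝ) {ε : ℝ} (hε : 0 < ε) :
    ∃ η > 0, ∀ u v, |u| ≤ R → |v| ≤ R → |u - v| < η → |φ u - φ v| < ε := by
  have := (isCompact_Icc (a := -R) (b := R)).uniformContinuousOn_of_continuous hφ.continuousOn
  obtain ⟨η, hη, h⟩ := Metric.uniformContinuousOn_iff.1 this ε hε
  exact ⟨η, hη, fun u v hu hv huv => h u (abs_le.1 hu) v (abs_le.1 hv) huv⟩

theorem continuous_superpose (φ : C(ℝ, ℝ)) : Continuous (superpose φ) := by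
  rw [Metric.continuous_iff]
  intro v ε hε
  obtain ⟨η, hη, h⟩ := exists_modulus φ.continuous (‖v‖ + 1) (half_pos hε)
  refine ⟨min η 1, lt_min hη one_pos, fun w hw => ?_⟩
  have h1 : ‖w - v‖ < min η 1 := by rwa [← dist_eq_norm]
  refine lt_of_le_of_lt ((dist_le (half_pos hε).le).2 fun z => ?_) (half_lt_self hε)
  have h2 : |w z - v z| ≤ ‖w - v‖ := (w - v).norm_coe_le_norm z
  have h3 : |v z| ≤ ‖v‖ := v.norm_coe_le_norm z
  have h4 : |w z| ≤ |w z - v z| + |v z| := by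
    have := abs_add_le (w z - v z) (v z); simpa using this
  have h5 : ‖w - v‖ < 1 := h1.trans_le (min_le_right _ _)
  exact (h (w z) (v z) (by linarith) (by linarith)
    (h2.trans_lt (h1.trans_le (min_le_left _ _)))).le

/-- The remainder at `z` is controlled by the mean value inequality with the oscillation of `φ'` on
a compact interval containing all values involved. Uniform continuity there makes the estimate
uniform in `z`, which is what the supremum norm requires. -/
theorem hasFDerivAt_superpose (φ φ' : C(ℝ, ℝ)) (hφ : ∀ u, HasDerivAt φ (φ' u) u) (v : ℝ →ᵇ ℝ) :
    HasFDerivAt (superpose φ) (ContinuousLinearMap.mul ℝ (ℝ →ᵇ ℝ) (superpose φ' v)) v := by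
  rw [hasFDerivAt_iff_isLittleO_nhds_zero, Asymptotics.isLittleO_iff]
  intro ε hε
  obtain ⟨η, hη, h⟩ := exists_modulus φ'.continuous (‖v‖ + 1) hε
  filter_upwards [Metric.ball_mem_nhds (0 : ℝ →ᵇ ℝ) (lt_min hη one_pos)] with w hw
  rw [mem_ball_zero_iff, lt_min_iff] at hw
  refine (BoundedContinuousFunction.norm_le (by positivity)).2 fun z => ?_
  have h2 : |w z| ≤ ‖w‖ := w.norm_coe_le_norm z
  have h3 : |v z| ≤ ‖v‖ := v.norm_coe_le_norm z
  have key := (convex_uIcc (v z) (v z + w z)).norm_image_sub_le_of_norm_hasDerivWithin_le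
    (f := fun u => φ u - φ' (v z) * u) (f' := fun u => φ' u - φ' (v z) * 1) (C := ε)
    (fun u _ => ((hφ u).sub ((hasDerivAt_id u).const_mul _)).hasDerivWithinAt)
    (fun u hu => by
      have hd : |u - v z| ≤ |w z| := by
        have := abs_sub_left_of_mem_uIcc hu
        simpa using this
      have hu' : |u| ≤ |u - v z| + |v z| := by
        have := abs_add_le (u - v z) (v z); simpa using this
      rw [mul_one]
      exact (h u (v z) (by linarith) (by linarith) (by linarith)).le)
    left_mem_uIcc right_mem_uIcc
  have e : (superpose φ (v + w) - superpose φ v -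
      (ContinuousLinearMap.mul ℝ (ℝ →ᵇ ℝ) (superpose φ' v)) w) z =
      φ (v z + w z) - φ' (v z) * (v z + w z) - (φ (v z) - φ' (v z) * v z) := by
    simp; ring
  rw [e]
  refine key.trans ?_
  rw [add_sub_cancel_left]
  exact mul_le_mul_of_nonneg_left h2 hε.le

theorem contDiff_superpose (φ φ' : C(ℝ, ℝ)) (hφ : ∀ u, HasDerivAt φ (φ' u) u) :
    ContDiff ℝ 1 (superpose φ) := by
  rw [contDiff_one_iff_fderiv]
  refine ⟨fun v => (hasFDerivAt_superpose φ φ' hφ v).differentiableAt, ?_⟩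
  have : fderiv ℝ (superpose φ) = fun v => ContinuousLinearMap.mul ℝ (ℝ →ᵇ ℝ) (superpose φ' v) :=
    funext fun v => (hasFDerivAt_superpose φ φ' hφ v).fderiv
  rw [this]
  exact (ContinuousLinearMap.mul ℝ (ℝ →ᵇ ℝ)).continuous.comp (continuous_superpose φ')

/-! ### The linearization at the standing wave -/

theorem hasDerivAt_integral_Iic {g : ℝ → ℝ} (hc : Continuous g) (hi : Integrable g) (z : ℝ) :
    HasDerivAt (fun z => ∫ s in Iic z, g s) (g z) z := by
  have h1 : HasDerivAt (fun z => ∫ s in (0 : ℝ)..z, g s) (g z) z :=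
    intervalIntegral.integral_hasDerivAt_right (hc.intervalIntegrable _ _)
      (hc.stronglyMeasurableAtFilter _ _) hc.continuousAt
  have h2 : ∀ y, (∫ s in Iic y, g s) = (∫ s in Iic 0, g s) + ∫ s in (0 : ℝ)..y, g s := fun y => by
    rw [← intervalIntegral.integral_Iic_sub_Iic hi.integrableOn hi.integrableOn]
    ring
  rw [funext h2]
  exact h1.const_add _

theorem IsFront.integrable_deriv {g m m' : ℝ → ℝ} {l r c : ℝ} (h : IsFront g l r c m m')
    (hp : ∀ z, l < m z ∧ m z < r ∧ 0 < m' z) : Integrable m' := by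
  refine integrable_of_intervalIntegral_norm_bounded (ι := ℕ) (l := atTop) (r - l)
    (a := fun n => -(n : ℝ)) (b := fun n => (n : ℝ))
    (fun i => (h.continuous_deriv.integrableOn_Icc).mono_set Ioc_subset_Icc_self)
    (tendsto_neg_atTop_atBot.comp tendsto_natCast_atTop_atTop) tendsto_natCast_atTop_atTop
    (Eventually.of_forall fun n => ?_)
  have : (fun x => ‖m' x‖) = m' := funext fun x => Real.norm_of_nonneg (hp x).2.2.le
  rw [this, intervalIntegral.integral_eq_sub_of_hasDerivAt (fun x _ => h.deriv x)
    (h.continuous_deriv.intervalIntegrable _ _)]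
  linarith [(hp n).2.1, (hp (-n)).1]

variable {f m m' : ℝ → ℝ} {am a ap : ℝ}

/-- The Wronskian `J = w' m' - w m''` of `w` with the translation mode `m'` satisfies `J' = -γ m'²`.
It is monotone and tends to zero at both ends, so it vanishes. Then `γ = 0` and `w` is a multiple of
`m'`, which the normalization `w 0 = 0` excludes unless `w = 0`. -/
theorem linearization_injective (hf : IsBalancedBistable f am a ap)
    (hm : IsFront f am ap 0 m m') (hp : ∀ z, am < m z ∧ m z < ap ∧ 0 < m' z)
    {γ : ℝ} {w w' : ℝ → ℝ} {C : ℝ} (h1 : ∀ z, HasDerivAt w (w' z) z)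
    (h2 : ∀ z, HasDerivAt w' (-(deriv f (m z) * w z) - γ * m' z) z)
    (hb : ∀ z, |w z| ≤ C) (hb' : ∀ z, |w' z| ≤ C) (h0 : w 0 = 0) :
    γ = 0 ∧ ∀ z, w z = 0 := by
  have hfc := hf.continuous
  have hdd : ∀ z, HasDerivAt m' (-f (m z)) z := fun z => by simpa using hm.deriv_deriv z
  have hfm : ∀ z, HasDerivAt (fun z => f (m z)) (deriv f (m z) * m' z) z := fun z =>
    (hf.contDiff_one.differentiable one_ne_zero (m z)).hasDerivAt.comp z (hm.deriv z)
  set J : ℝ → ℝ := fun z => w' z * m' z + w z * f (m z) with hJ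
  have hJd : ∀ z, HasDerivAt J (-γ * m' z ^ 2) z := by
    intro z
    have := ((h2 z).mul (hdd z)).add ((h1 z).mul (hfm z))
    convert! this using 1
    ring
  have hlim : ∀ l : Filter ℝ, Tendsto m' l (𝓝 0) → Tendsto (fun z => f (m z)) l (𝓝 0) →
      Tendsto J l (𝓝 0) := by
    intro l t1 t2
    have hC : ∀ z, |J z| ≤ C * |m' z| + C * |f (m z)| := fun z => by
      refine (abs_add_le _ _).trans ?_
      rw [abs_mul, abs_mul]
      gcongr
      · exact hb' z
      · exact hb z
    refine squeeze_zero_norm hC ?_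
    simpa using (t1.abs.const_mul C).add (t2.abs.const_mul C)
  have hJtop : Tendsto J atTop (𝓝 0) :=
    hlim _ (hm.deriv_tendsto_atTop hfc hf.zero_right)
      (by rw [← hf.zero_right]; exact (hfc.tendsto ap).comp hm.right)
  have hJbot : Tendsto J atBot (𝓝 0) :=
    hlim _ (hm.deriv_tendsto_atBot hfc hf.zero_left)
      (by rw [← hf.zero_left]; exact (hfc.tendsto am).comp hm.left)
  have hJ0 : ∀ z, J z = 0 := by
    rcases le_total 0 γ with hγ | hγ
    · have hmo : Monotone fun z => -J z :=
        monotone_of_hasDerivAt_nonneg (fun z => (hJd z).neg) fun z => by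
          simp only [neg_mul, neg_neg]; positivity
      intro z
      have a1 := hmo.ge_of_tendsto hJtop.neg z
      have a2 := hmo.le_of_tendsto hJbot.neg z
      linarith
    · have hmo : Monotone J := monotone_of_hasDerivAt_nonneg hJd fun z => by
          have := sq_nonneg (m' z); nlinarith
      exact fun z => le_antisymm (hmo.ge_of_tendsto hJtop z) (hmo.le_of_tendsto hJbot z)
  constructor
  · have e0 : J = fun _ => 0 := funext hJ0
    have := (hJd 0).unique (e0 ▸ hasDerivAt_const (0 : ℝ) (0 : ℝ))
    have h3 := (hp 0).2.2
    simpa [h3.ne'] using this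
  · have hd : ∀ z, HasDerivAt (fun z => w z / m' z) 0 z := by
      intro z
      have := (h1 z).div (hdd z) (hp z).2.2.ne'
      convert! this using 1
      rw [show w' z * m' z - w z * -f (m z) = J z by simp only [hJ]; ring, hJ0, zero_div]
    intro z
    have := is_const_of_deriv_eq_zero (fun z => (hd z).differentiableAt)
      (fun z => (hd z).deriv) z 0
    rw [h0, zero_div, div_eq_zero_iff] at this
    exact this.resolve_right (hp z).2.2.ne'

theorem abs_integral_mul_le {s : Set ℝ} {k : ℝ → ℝ} {K : ℝ}
    (hi : Integrable m') (hpos : ∀ z, 0 < m' z) (hk : ∀ z, |k z| ≤ K) :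
    |∫ z in s, m' z * k z| ≤ K * ∫ z in s, m' z := by
  have : ‖∫ z in s, m' z * k z‖ ≤ ∫ z in s, m' z * K := by
    refine norm_integral_le_of_norm_le (hi.integrableOn.mul_const _)
      (Eventually.of_forall fun z => ?_)
    rw [norm_mul, Real.norm_of_nonneg (hpos z).le]
    exact mul_le_mul_of_nonneg_left (hk z) (hpos z).le
  rwa [integral_mul_const, mul_comm] at this

/-- Reduction of order: with `w = m' Y` the equation becomes `(m'² Y')' = m' k`, so `Y' = J/m'²`
with `J` the integral of `m' k` from `-∞`. The free parameter `γ` meets the solvability condition,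
the initial value of `Y` the normalization, and the tail bounds of the standing wave keep `m' Y`
bounded. -/
theorem linearization_surjective (hf : IsBalancedBistable f am a ap)
    (hm : IsFront f am ap 0 m m') (hp : ∀ z, am < m z ∧ m z < ap ∧ 0 < m' z) {C : ℝ}
    (hC₁ : ∀ z, 0 ≤ z → ap - m z ≤ C * m' z) (hC₂ : ∀ z, z ≤ 0 → m z - am ≤ C * m' z)
    (hC₃ : ∀ z, m' z * |∫ s in (0 : ℝ)..z, (m' s)⁻¹| ≤ C) (k₀ : ℝ →ᵇ ℝ) (y : ℝ) :
    ∃ γ : ℝ, ∃ w w' : ℝ → ℝ, (∀ z, HasDerivAt w (w' z) z) ∧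
      (∀ z, HasDerivAt w' (-(deriv f (m z) * w z) + (k₀ z - γ * m' z)) z) ∧
      (∃ D, ∀ z, |w z| ≤ D) ∧ w 0 = y := by
  have hfc := hf.continuous
  have hmc := hm.continuous
  have hmc' := hm.continuous_deriv
  have hpos : ∀ z, 0 < m' z := fun z => (hp z).2.2
  have hne : ∀ z, m' z ≠ 0 := fun z => (hpos z).ne'
  have hdd : ∀ z, HasDerivAt m' (-f (m z)) z := fun z => by simpa using hm.deriv_deriv z
  have hfm : ∀ z, HasDerivAt (fun z => f (m z)) (deriv f (m z) * m' z) z := fun z =>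
    (hf.contDiff_one.differentiable one_ne_zero (m z)).hasDerivAt.comp z (hm.deriv z)
  have hi := hm.integrable_deriv hp
  obtain ⟨B, hB⟩ : ∃ B, ∀ z, |m' z| ≤ B := by
    obtain ⟨B₁, hB₁⟩ := exists_forall_ge_le_of_tendsto hmc'
      (hm.deriv_tendsto_atTop hfc hf.zero_right) 0
    obtain ⟨B₂, hB₂⟩ := exists_forall_ge_le_of_tendsto (h := fun z => m' (-z)) (by fun_prop)
      ((hm.deriv_tendsto_atBot hfc hf.zero_left).comp tendsto_neg_atTop_atBot) 0
    refine ⟨max B₁ B₂, fun z => ?_⟩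
    rcases le_total 0 z with hz | hz
    · exact (hB₁ z hz).trans (le_max_left _ _)
    · have := hB₂ (-z) (by linarith)
      rw [neg_neg] at this
      exact this.trans (le_max_right _ _)
  have hint : ∀ {k : ℝ → ℝ} {K : ℝ}, Continuous k → (∀ z, |k z| ≤ K) →
      Integrable fun z => m' z * k z := fun hk hK =>
    hi.mul_bdd hk.aestronglyMeasurable (Eventually.of_forall hK)
  have hsqpos : 0 < ∫ z, m' z * m' z := by
    refine integral_pos_of_integrable_nonneg_nonzero (x := 0) (hmc'.mul hmc') (hint hmc' hB)
      (fun z => (mul_pos (hpos z) (hpos z)).le) (mul_pos (hpos 0) (hpos 0)).ne'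
  have hk₀ : ∀ z, |k₀ z| ≤ ‖k₀‖ := fun z => k₀.norm_coe_le_norm z
  -- Fredholm alternative: `γ` makes `k = k₀ - γ m'` orthogonal to the kernel element `m'`.
  set γ := (∫ z, m' z * k₀ z) / ∫ z, m' z * m' z with hγ
  set k : ℝ → ℝ := fun z => k₀ z - γ * m' z with hk
  have hkc : Continuous k := k₀.continuous.sub (hmc'.const_mul γ)
  set K := ‖k₀‖ + |γ| * B with hK
  have hkK : ∀ z, |k z| ≤ K := fun z => by
    refine (abs_sub _ _).trans (add_le_add (hk₀ z) ?_)
    rw [abs_mul]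
    exact mul_le_mul_of_nonneg_left (hB z) (abs_nonneg _)
  have hK0 : 0 ≤ K := (abs_nonneg _).trans (hkK 0)
  have hiK := hint hkc hkK
  have htot : ∫ z, m' z * k z = 0 := by
    have e : (fun z => m' z * k z) = fun z => m' z * k₀ z - γ * (m' z * m' z) := by
      ext z; simp only [hk]; ring
    rw [e, integral_sub (hint k₀.continuous hk₀) ((hint hmc' hB).const_mul γ), integral_const_mul,
      hγ, div_mul_cancel₀ _ hsqpos.ne', sub_self]
  set J : ℝ → ℝ := fun z => ∫ s in Iic z, m' s * k s with hJ
  have hJd : ∀ z, HasDerivAt J (m' z * k z) z := hasDerivAt_integral_Iic (hmc'.mul hkc) hiK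
  -- Orthogonality allows `J` to be computed from either end of the line. On each half-line the
  -- nearer end is used, where the integral of `m'` is at most `C m'`.
  have hJb : ∀ z, |J z| ≤ K * C * m' z := by
    intro z
    rcases le_total z 0 with hz | hz
    · have h1 := abs_integral_mul_le (s := Iic z) hi hpos hkK
      rw [integral_Iic_of_hasDerivAt_of_tendsto' (fun x _ => hm.deriv x) hi.integrableOn
        hm.left] at h1
      have := mul_le_mul_of_nonneg_left (hC₂ z hz) hK0
      simp only [hJ]; linarith
    · have h1 := abs_integral_mul_le (s := Ioi z) hi hpos hkK
      rw [integral_Ioi_of_hasDerivAt_of_tendsto' (fun x _ => hm.deriv x) hi.integrableOn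
        hm.right] at h1
      have h2 := intervalIntegral.integral_Iic_add_Ioi (b := z) hiK.integrableOn hiK.integrableOn
      rw [htot] at h2
      have h3 : J z = -∫ s in Ioi z, m' s * k s := by simp only [hJ]; linarith
      have := mul_le_mul_of_nonneg_left (hC₁ z hz) hK0
      rw [h3, abs_neg]; linarith
  have hJc : Continuous J := continuous_iff_continuousAt.2 fun z => (hJd z).continuousAt
  set q : ℝ → ℝ := fun z => J z / m' z ^ 2 with hq
  have hqc : Continuous q := hJc.div (hmc'.pow 2) fun z => pow_ne_zero 2 (hne z)
  set Y : ℝ → ℝ := fun z => y / m' 0 + ∫ s in (0 : ℝ)..z, q s with hY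
  have hYd : ∀ z, HasDerivAt Y (q z) z := fun z =>
    (intervalIntegral.integral_hasDerivAt_right (hqc.intervalIntegrable _ _)
      (hqc.stronglyMeasurableAtFilter _ _) hqc.continuousAt).const_add _
  refine ⟨γ, fun z => m' z * Y z, fun z => -f (m z) * Y z + J z / m' z, fun z => ?_, fun z => ?_,
    ⟨B * |y / m' 0| + K * C * C, fun z => ?_⟩, ?_⟩
  · have := (hdd z).mul (hYd z)
    convert! this using 1
    have := hne z
    simp only [hq]; field_simp
  · have := ((hfm z).neg.mul (hYd z)).add ((hJd z).div (hdd z) (hne z))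
    convert! this using 1
    have := hne z
    simp only [hq, hk, Pi.neg_apply]; field_simp; ring
  · have h1 : |∫ s in (0 : ℝ)..z, q s| ≤ K * C * |∫ s in (0 : ℝ)..z, (m' s)⁻¹| := by
      have hic : Continuous fun z => (m' z)⁻¹ := hmc'.inv₀ hne
      have : ‖∫ s in (0 : ℝ)..z, q s‖ ≤ |∫ s in (0 : ℝ)..z, K * C * (m' s)⁻¹| := by
        refine intervalIntegral.norm_integral_le_abs_of_norm_le (Eventually.of_forall fun s => ?_)
          ((hic.const_mul _).intervalIntegrable _ _)
        simp only [hq, norm_div, norm_pow, Real.norm_eq_abs, abs_of_pos (hpos s)]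
        rw [div_le_iff₀ (pow_pos (hpos s) 2)]
        calc |J s| ≤ K * C * m' s := hJb s
          _ = _ := by have := hne s; field_simp
      rw [intervalIntegral.integral_const_mul, abs_mul] at this
      refine this.trans (mul_le_mul_of_nonneg_right (le_of_eq (abs_of_nonneg ?_)) (abs_nonneg _))
      have := (abs_nonneg _).trans (hJb 0)
      exact nonneg_of_mul_nonneg_left this (hpos 0)
    have hKC : 0 ≤ K * C := by
      have := (abs_nonneg _).trans (hJb 0)
      exact nonneg_of_mul_nonneg_left this (hpos 0)
    rw [abs_mul]
    calc |m' z| * |Y z| ≤ |m' z| * (|y / m' 0| + |∫ s in (0 : ℝ)..z, q s|) :=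
          mul_le_mul_of_nonneg_left (abs_add_le _ _) (abs_nonneg _)
      _ = |m' z| * |y / m' 0| + m' z * |∫ s in (0 : ℝ)..z, q s| := by
          rw [mul_add, abs_of_pos (hpos z)]
      _ ≤ B * |y / m' 0| + m' z * (K * C * |∫ s in (0 : ℝ)..z, (m' s)⁻¹|) := by
          have := hB z
          have := (hpos z).le
          gcongr
      _ = B * |y / m' 0| + K * C * (m' z * |∫ s in (0 : ℝ)..z, (m' s)⁻¹|) := by ring
      _ ≤ _ := by gcongr; exact hC₃ z
  · simp only [hY, intervalIntegral.integral_same, add_zero]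
    rw [mul_div_cancel₀ _ (hne 0)]

/-! ### The branch of traveling waves -/

/-- The traveling wave equation for `m + (resolvL g)` with speed `c`, together with the
normalization at the origin. -/
def waveMap (F : C(ℝ, ℝ)) (a : ℝ) (M M' : ℝ →ᵇ ℝ) (p : ℝ × ℝ × (ℝ →ᵇ ℝ)) : (ℝ →ᵇ ℝ) × ℝ :=
  -- Since `(resolvL g)'' = resolvL g - g` and the standing wave satisfies `M'' = -F(M)`, the first
  -- component is the left side of the wave equation. With `g` as the unknown instead of the
  -- profile, everything stays in bounded continuous functions and no space of twice differentiable
  -- functions is needed.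
  (resolvL p.2.2 - p.2.2 + p.2.1 • (M' + resolvDerivL p.2.2) +
      (superpose F (M + resolvL p.2.2) - superpose F M) + p.1 • (1 : ℝ →ᵇ ℝ),
    F (a + evalCLM ℝ (0 : ℝ) (resolvL p.2.2)) + p.1)

theorem contDiff_waveMap {F F' : C(ℝ, ℝ)} (hF : ∀ u, HasDerivAt F (F' u) u)
    (hF1 : ContDiff ℝ 1 F) (a : ℝ) (M M' : ℝ →ᵇ ℝ) : ContDiff ℝ 1 (waveMap F a M M') := by
  have hs := contDiff_superpose F F' hF
  have h2 : ContDiff ℝ 1 fun p : ℝ × ℝ × (ℝ →ᵇ ℝ) => p.2.2 := by fun_prop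
  have hA : ContDiff ℝ 1 fun p : ℝ × ℝ × (ℝ →ᵇ ℝ) => resolvL p.2.2 := resolvL.contDiff.comp h2
  have hB : ContDiff ℝ 1 fun p : ℝ × ℝ × (ℝ →ᵇ ℝ) => resolvDerivL p.2.2 :=
    resolvDerivL.contDiff.comp h2
  have h3 : ContDiff ℝ 1 fun p : ℝ × ℝ × (ℝ →ᵇ ℝ) => superpose F (M + resolvL p.2.2) :=
    hs.comp (contDiff_const.add hA)
  have h4 : ContDiff ℝ 1 fun p : ℝ × ℝ × (ℝ →ᵇ ℝ) =>
      F (a + evalCLM ℝ (0 : ℝ) (resolvL p.2.2)) :=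
    hF1.comp (contDiff_const.add
      ((evalCLM (β := ℝ) ℝ (0 : ℝ)).contDiff.comp hA))
  refine ContDiff.prodMk ?_ (h4.add contDiff_fst)
  exact (((hA.sub h2).add ((contDiff_fst.comp contDiff_snd).smul (contDiff_const.add hB))).add
    (h3.sub contDiff_const)).add (contDiff_fst.smul contDiff_const)

theorem fderiv_waveMap_inr_apply {F F' : C(ℝ, ℝ)} (hF : ∀ u, HasDerivAt F (F' u) u)
    (hF1 : ContDiff ℝ 1 F) (a : ℝ) (M M' : ℝ →ᵇ ℝ) (γ : ℝ) (h : ℝ →ᵇ ℝ) :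
    (fderiv ℝ (waveMap F a M M') (0, 0, 0) ∘L .inr ℝ ℝ (ℝ × (ℝ →ᵇ ℝ))) (γ, h) =
      (resolvL h - h + γ • M' + superpose F' M * resolvL h, F' a * resolvL h 0) := by
  have hΦ := (contDiff_waveMap hF hF1 a M M').differentiable one_ne_zero (0, 0, 0)
  have hin : HasFDerivAt (fun q : ℝ × (ℝ →ᵇ ℝ) => ((0 : ℝ), q))
      (.inr ℝ ℝ (ℝ × (ℝ →ᵇ ℝ))) (0, 0) := (ContinuousLinearMap.inr ℝ ℝ (ℝ × (ℝ →ᵇ ℝ))).hasFDerivAt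
  have hcomp := HasFDerivAt.comp (0, 0) (show HasFDerivAt (waveMap F a M M') _ ((0 : ℝ), (0, 0))
    from hΦ.hasFDerivAt) hin
  have e2 : HasFDerivAt (fun q : ℝ × (ℝ →ᵇ ℝ) => q.2) (.snd ℝ ℝ (ℝ →ᵇ ℝ)) (0, 0) := hasFDerivAt_snd
  have eA := resolvL.hasFDerivAt.comp ((0 : ℝ), (0 : ℝ →ᵇ ℝ)) e2
  have eB := resolvDerivL.hasFDerivAt.comp ((0 : ℝ), (0 : ℝ →ᵇ ℝ)) e2
  have e3 := (hasFDerivAt_fst (𝕜 := ℝ) (p := ((0 : ℝ), (0 : ℝ →ᵇ ℝ)))).smul (eB.const_add M')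
  have e4 := ((hasFDerivAt_superpose F F' hF (M + resolvL 0)).comp ((0 : ℝ), (0 : ℝ →ᵇ ℝ))
    (eA.const_add M)).sub_const (superpose F M)
  have e5 := (hF (a + evalCLM ℝ (0 : ℝ) (resolvL (0 : ℝ →ᵇ ℝ)))).comp_hasFDerivAt
    ((0 : ℝ), (0 : ℝ →ᵇ ℝ)) (((evalCLM ℝ (0 : ℝ)).hasFDerivAt.comp ((0 : ℝ), (0 : ℝ →ᵇ ℝ))
      eA).const_add a)
  have e6 := ((((eA.sub e2).add e3).add e4).add_const ((0 : ℝ) • (1 : ℝ →ᵇ ℝ))).prodMk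
    (e5.add_const 0)
  have := hcomp.unique e6
  rw [this]
  simp

theorem bounded_of_deriv_tendsto {h : ℝ → ℝ} {c₁ c₂ : ℝ} (hc : Continuous h)
    (h1 : Tendsto h atBot (𝓝 c₁)) (h2 : Tendsto h atTop (𝓝 c₂)) : ∃ B, ∀ z, ‖h z‖ ≤ B := by
  obtain ⟨B₁, hB₁⟩ := exists_forall_ge_le_of_tendsto hc h2 0
  obtain ⟨B₂, hB₂⟩ := exists_forall_ge_le_of_tendsto (h := fun z => h (-z)) (by fun_prop)
    (h1.comp tendsto_neg_atTop_atBot) 0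
  refine ⟨max B₁ B₂, fun z => ?_⟩
  rcases le_total 0 z with hz | hz
  · exact (hB₁ z hz).trans (le_max_left _ _)
  · have := hB₂ (-z) (by linarith)
    rw [neg_neg] at this
    exact this.trans (le_max_right _ _)

/-- Implicit function theorem at the standing wave. The partial derivative in (speed, `g`) is
injective and surjective by the two linearization theorems, hence invertible by the open mapping
theorem. The unknown speed supplies the missing direction of the range and the normalization removes
the translation mode. -/
theorem IsBalancedBistable.exists_branch {f : ℝ → ℝ} {am a ap : ℝ}
    (hf : IsBalancedBistable f am a ap) :
    ∃ m m' : ℝ → ℝ, IsFront f am ap 0 m m' ∧ (∀ z, am < m z ∧ m z < ap ∧ 0 < m' z) ∧ m 0 = a ∧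
    ∃ (c : ℝ → ℝ) (G : ℝ → ℝ →ᵇ ℝ), ContDiffAt ℝ 1 c 0 ∧ ContDiffAt ℝ 1 G 0 ∧ c 0 = 0 ∧ G 0 = 0 ∧
      ∀ᶠ δ in 𝓝 0, (∀ z, resolvL (G δ) z - G δ z + c δ * (m' z + resolvDerivL (G δ) z) +
        (f (m z + resolvL (G δ) z) - f (m z)) + δ = 0) ∧ f (a + resolvL (G δ) 0) + δ = 0 := by
  obtain ⟨m, m', hm, hp, h0, C, hC₁, hC₂, hC₃⟩ := hf.exists_standing_wave_tails
  refine ⟨m, m', hm, hp, h0, ?_⟩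
  have hfc := hf.continuous
  have hF1 := hf.contDiff_one
  set F : C(ℝ, ℝ) := ⟨f, hfc⟩ with hFdef
  set F' : C(ℝ, ℝ) := ⟨deriv f, hF1.continuous_deriv le_rfl⟩ with hF'def
  have hF : ∀ u, HasDerivAt F (F' u) u := fun u => (hF1.differentiable one_ne_zero u).hasDerivAt
  obtain ⟨B₀, hB₀⟩ := bounded_of_deriv_tendsto hm.continuous hm.left hm.right
  obtain ⟨B₁, hB₁⟩ := bounded_of_deriv_tendsto hm.continuous_deriv
    (hm.deriv_tendsto_atBot hfc hf.zero_left) (hm.deriv_tendsto_atTop hfc hf.zero_right)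
  set M : ℝ →ᵇ ℝ := ofNormedAddCommGroup m hm.continuous B₀ hB₀ with hM
  set M' : ℝ →ᵇ ℝ := ofNormedAddCommGroup m' hm.continuous_deriv B₁ hB₁ with hM'
  set Φ := waveMap F a M M' with hΦ
  have hcd : ContDiff ℝ 1 Φ := contDiff_waveMap hF hF1 a M M'
  have hT := fderiv_waveMap_inr_apply hF hF1 a M M'
  set T := fderiv ℝ Φ (0, 0, 0) ∘L .inr ℝ ℝ (ℝ × (ℝ →ᵇ ℝ)) with hTdef
  have hma : deriv f a ≠ 0 := hf.deriv_mid.ne'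
  have hinj : T.ker = ⊥ := by
    rw [LinearMap.ker_eq_bot']
    rintro ⟨γ, h⟩ hTh
    have hTh' := (hT γ h).symm.trans hTh
    rw [Prod.mk_eq_zero] at hTh'
    obtain ⟨t1, t2⟩ := hTh'
    have t1' : ∀ z, resolvL h z - h z + γ * m' z + deriv f (m z) * resolvL h z = 0 := fun z =>
      congrArg (fun g : ℝ →ᵇ ℝ => g z) t1
    have t2' : resolvL h 0 = 0 := (mul_eq_zero.1 t2).resolve_left hma
    obtain ⟨r1, r2⟩ := linearization_injective hf hm hp (γ := γ) (w := resolvL h)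
      (w' := resolvDerivL h) (C := max ‖resolvL h‖ ‖resolvDerivL h‖) (resolvL_hasDerivAt h)
      (fun z => by
        have e : -(deriv f (m z) * resolvL h z) - γ * m' z = resolvL h z - h z := by
          linarith [t1' z]
        rw [e]
        exact resolvDerivL_hasDerivAt h z)
      (fun z => ((resolvL h).norm_coe_le_norm z).trans (le_max_left _ _))
      (fun z => ((resolvDerivL h).norm_coe_le_norm z).trans (le_max_right _ _)) t2'
    rw [r1, eq_zero_of_resolvL_eq_zero (BoundedContinuousFunction.ext r2)]
    rfl
  have hsurj : T.range = ⊤ := by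
    rw [LinearMap.range_eq_top]
    rintro ⟨k, y⟩
    obtain ⟨γ, w, w', hw, hw', ⟨D, hD⟩, hw0⟩ := linearization_surjective hf hm hp hC₁ hC₂ hC₃ k
      (y / deriv f a)
    have hwc : Continuous w := continuous_iff_continuousAt.2 fun z => (hw z).continuousAt
    set Wb : ℝ →ᵇ ℝ := ofNormedAddCommGroup w hwc D hD with hWb
    -- By the equation for `w` this is `w - w''`, so that `resolvL h = w`.
    set h : ℝ →ᵇ ℝ := Wb + superpose F' M * Wb - (k - γ • M') with hh
    have hh' : ∀ z, h z = w z + deriv f (m z) * w z - (k z - γ * m' z) := fun z => rfl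
    have hAh : ∀ z, resolvL h z = w z := resolvL_eq hw (fun z => by
      have e : w z - h z = -(deriv f (m z) * w z) + (k z - γ * m' z) := by rw [hh']; ring
      rw [e]
      exact hw' z) hD
    refine ⟨(γ, h), (hT γ h).trans (Prod.ext ?_ ?_)⟩
    · ext z
      change resolvL h z - h z + γ * m' z + deriv f (m z) * resolvL h z = k z
      rw [hAh, hh']; ring
    · change deriv f a * resolvL h 0 = y
      rw [hAh, hw0, mul_div_cancel₀ _ hma]
  have hinv : T.IsInvertible := ⟨ContinuousLinearEquiv.ofBijective T hinj hsurj, rfl⟩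
  have hcda : ContDiffAt ℝ 1 Φ (0, 0, 0) := hcd.contDiffAt
  set ψ := hcda.implicitFunction one_ne_zero hinv with hψ
  have hψ1 : ContDiffAt ℝ 1 ψ 0 := hcda.contDiffAt_implicitFunction one_ne_zero hinv
  have hψ0 : ψ 0 = (0, 0) := hcda.implicitFunction_apply_self one_ne_zero hinv
  have hψe : ∀ᶠ δ in 𝓝 0, Φ (δ, ψ δ) = Φ (0, 0, 0) :=
    hcda.eventually_apply_implicitFunction one_ne_zero hinv
  refine ⟨fun δ => (ψ δ).1, fun δ => (ψ δ).2, hψ1.fst, hψ1.snd, congrArg Prod.fst hψ0,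
    congrArg Prod.snd hψ0, ?_⟩
  have hΦ0 : Φ (0, 0, 0) = 0 := by
    simp only [hΦ, waveMap, map_zero, add_zero, sub_self, zero_smul, Prod.mk_eq_zero,
      true_and]
    exact hf.zero_mid
  filter_upwards [hψe] with δ hδ
  rw [hΦ0] at hδ
  obtain ⟨t1, t2⟩ := Prod.mk_eq_zero.1 hδ
  refine ⟨fun z => ?_, t2⟩
  have := congrArg (fun g : ℝ →ᵇ ℝ => g z) t1
  simpa [M, M', F, mul_add] using! this

/-! ### Uniform estimates for the traveling waves -/

/-- The squares of `n - r` and of `n'` both satisfy `s'' ≥ ν² s`. Passing to squares avoids any sign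
information and lets the drift be absorbed by completing a square, at the cost of half the decay
rate. -/
theorem tail_decay {f n n' : ℝ → ℝ} {p r c δ ν ρ R B : ℝ} (hf : ContDiff ℝ 1 f) (hν : 0 < ν)
    (h1 : ∀ u, |u - p| ≤ ρ → deriv f u ≤ -ν ^ 2)
    (h2 : ∀ u v, |u - p| ≤ ρ → |v - p| ≤ ρ → u ≤ v → ν ^ 2 * (v - u) ≤ f u - f v)
    (hn : ∀ z, HasDerivAt n (n' z) z) (hn' : ∀ z, HasDerivAt n' (-(c * n' z) - (f (n z) + δ)) z)
    (hc : c ^ 2 ≤ 2 * ν ^ 2) (hr : f r + δ = 0) (hrp : |r - p| ≤ ρ)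
    (hnp : ∀ z, R ≤ z → |n z - p| ≤ ρ) (hB : ∀ z, R ≤ z → |n' z| ≤ B) :
    ∀ z, R ≤ z → (n z - r) ^ 2 ≤ (2 * ρ) ^ 2 * Real.exp (-(ν * (z - R))) ∧
      n' z ^ 2 ≤ B ^ 2 * Real.exp (-(ν * (z - R))) := by
  have hyb : ∀ z, R ≤ z → |n z - r| ≤ 2 * ρ := fun z hz => by
    have := abs_sub_le (n z) p r
    rw [abs_sub_comm p r] at this
    linarith [hnp z hz]
  have hys : ∀ z, R ≤ z → (n z - r) ^ 2 ≤ (2 * ρ) ^ 2 := fun z hz =>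
    sq_le_sq' (abs_le.1 (hyb z hz)).1 (abs_le.1 (hyb z hz)).2
  have hws : ∀ z, R ≤ z → n' z ^ 2 ≤ B ^ 2 := fun z hz =>
    sq_le_sq' (abs_le.1 (hB z hz)).1 (abs_le.1 (hB z hz)).2
  -- the elementary inequality behind both estimates
  have quad : ∀ y w h : ℝ, h ≤ -(ν ^ 2 * y ^ 2) →
      ν ^ 2 * y ^ 2 ≤ 2 * w * w + 2 * y * (-(c * w)) - 2 * h := by
    intro y w h hh
    nlinarith [sq_nonneg (2 * w - c * y), mul_le_mul_of_nonneg_right hc (sq_nonneg y)]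
  have hfn : ∀ z, HasDerivAt (fun z => f (n z)) (deriv f (n z) * n' z) z := fun z =>
    (hf.differentiable one_ne_zero (n z)).hasDerivAt.comp z (hn z)
  intro z hz
  constructor
  · have := le_mul_exp_of_bounded (s := fun z => (n z - r) ^ 2)
      (s' := fun z => 2 * (n z - r) * n' z)
      (s'' := fun z => 2 * n' z * n' z + 2 * (n z - r) * (-(c * n' z) - (f (n z) + δ)))
      (ν := ν) (R := R) (C := (2 * ρ) ^ 2) hν
      (fun z _ => by simpa using! ((hn z).sub_const r).pow 2)
      (fun z _ => (((hn z).sub_const r).const_mul 2).mul (hn' z))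
      (fun z hz => ?_) hys z hz
    · exact this.trans (mul_le_mul_of_nonneg_right (hys R le_rfl) (Real.exp_pos _).le)
    · have key : (n z - r) * (f (n z) + δ) ≤ -(ν ^ 2 * (n z - r) ^ 2) := by
        rcases le_total (n z) r with hle | hle
        · have := h2 (n z) r (hnp z hz) hrp hle
          nlinarith
        · have := h2 r (n z) hrp (hnp z hz) hle
          nlinarith
      have := quad (n z - r) (n' z) ((n z - r) * (f (n z) + δ)) key
      linarith
  · have := le_mul_exp_of_bounded (s := fun z => n' z ^ 2)
      (s' := fun z => 2 * n' z * (-(c * n' z) - (f (n z) + δ)))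
      (s'' := fun z => 2 * (-(c * n' z) - (f (n z) + δ)) * (-(c * n' z) - (f (n z) + δ)) +
        2 * n' z * (-(c * (-(c * n' z) - (f (n z) + δ))) - deriv f (n z) * n' z))
      (ν := ν) (R := R) (C := B ^ 2) hν
      (fun z _ => by simpa using! (hn' z).pow 2)
      (fun z _ => ((hn' z).const_mul 2).mul (((hn' z).const_mul c).neg.sub
        ((hfn z).add_const δ)))
      (fun z hz => ?_) hws z hz
    · exact this.trans (mul_le_mul_of_nonneg_right (hws R le_rfl) (Real.exp_pos _).le)
    · have key : deriv f (n z) * n' z ^ 2 ≤ -(ν ^ 2 * n' z ^ 2) := by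
        have := h1 (n z) (hnp z hz)
        nlinarith [sq_nonneg (n' z)]
      have := quad (n' z) (-(c * n' z) - (f (n z) + δ)) (deriv f (n z) * n' z ^ 2) key
      linarith

/-- Differentiability of `V` in the supremum norm makes the `δ`-remainder uniform in `z`; continuity
of `V'` in `z` handles the moving evaluation point. The joint derivative is needed because both
arguments of the profile depend on time. -/
theorem hasFDerivAt_eval {V : ℝ → ℝ →ᵇ ℝ} {V' : ℝ →ᵇ ℝ} {δ z v : ℝ} (hV : HasDerivAt V V' δ)
    (hz : HasDerivAt (V δ) v z) :
    HasFDerivAt (fun p : ℝ × ℝ => V p.2 p.1)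
      (v • ContinuousLinearMap.fst ℝ ℝ ℝ + V' z • ContinuousLinearMap.snd ℝ ℝ ℝ) (z, δ) := by
  have h1 : HasFDerivAt (fun p : ℝ × ℝ => V δ p.1) (v • ContinuousLinearMap.fst ℝ ℝ ℝ) (z, δ) :=
    hz.comp_hasFDerivAt (z, δ) hasFDerivAt_fst
  have h2 : HasFDerivAt (fun p : ℝ × ℝ => (V p.2 - V δ) p.1)
      (V' z • ContinuousLinearMap.snd ℝ ℝ ℝ) (z, δ) := by
    rw [hasFDerivAt_iff_isLittleO, Asymptotics.isLittleO_iff]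
    intro ε hε
    have hV' := (hasDerivAt_iff_isLittleO.1 hV)
    have e1 : ∀ᶠ p : ℝ × ℝ in 𝓝 (z, δ), ‖V p.2 - V δ - (p.2 - δ) • V'‖ ≤ ε / 2 * ‖p.2 - δ‖ :=
      (continuous_snd.tendsto (z, δ)).eventually (Asymptotics.isLittleO_iff.1 hV' (half_pos hε))
    have e2 : ∀ᶠ p : ℝ × ℝ in 𝓝 (z, δ), |V' p.1 - V' z| < ε / 2 := by
      have : ContinuousAt (fun p : ℝ × ℝ => V' p.1) (z, δ) :=
        (V'.continuous.comp continuous_fst).continuousAt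
      simpa [Real.dist_eq] using Metric.tendsto_nhds.1 this (ε / 2) (half_pos hε)
    filter_upwards [e1, e2] with p hp1 hp2
    have a1 : |(V p.2 - V δ - (p.2 - δ) • V') p.1| ≤ ε / 2 * ‖p.2 - δ‖ :=
      ((V p.2 - V δ - (p.2 - δ) • V').norm_coe_le_norm p.1).trans hp1
    have a2 : |(p.2 - δ) * (V' p.1 - V' z)| ≤ ε / 2 * ‖p.2 - δ‖ := by
      rw [abs_mul, mul_comm, Real.norm_eq_abs]
      exact mul_le_mul_of_nonneg_right hp2.le (abs_nonneg _)
    have a3 : ‖p.2 - δ‖ ≤ ‖p - (z, δ)‖ := norm_snd_le (p - (z, δ))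
    have e : (V p.2 - V δ) p.1 - (V δ - V δ) z -
        (V' z • ContinuousLinearMap.snd ℝ ℝ ℝ) (p - (z, δ)) =
        (V p.2 - V δ - (p.2 - δ) • V') p.1 + (p.2 - δ) * (V' p.1 - V' z) := by
      simp; ring
    rw [e, Real.norm_eq_abs]
    refine (abs_add_le _ _).trans ?_
    nlinarith
  have := h1.add h2
  refine this.congr_of_eventuallyEq (Eventually.of_forall fun p => ?_)
  simp

theorem abs_le_mul_exp_half {x B ν t : ℝ} (hB : 0 ≤ B) (h : x ^ 2 ≤ B ^ 2 * Real.exp (-(ν * t))) :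
    |x| ≤ B * Real.exp (-(ν / 2 * t)) := by
  refine abs_le_of_sq_le_sq ?_ (mul_nonneg hB (Real.exp_pos _).le)
  have e : Real.exp (-(ν / 2 * t)) ^ 2 = Real.exp (-(ν * t)) := by
    rw [← Real.exp_nat_mul]; congr 1; push_cast; ring
  rwa [mul_pow, e]

theorem tendsto_of_abs_sub_le_exp {n : ℝ → ℝ} {r B a R : ℝ} (ha : 0 < a)
    (h : ∀ z, R ≤ z → |n z - r| ≤ B * Real.exp (-(a * (z - R)))) : Tendsto n atTop (𝓝 r) := by
  rw [tendsto_iff_norm_sub_tendsto_zero]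
  have hlim : Tendsto (fun z => B * Real.exp (-(a * (z - R)))) atTop (𝓝 0) := by
    rw [← mul_zero B]
    refine (Real.tendsto_exp_neg_atTop_nhds_zero.comp ?_).const_mul B
    exact Tendsto.const_mul_atTop ha (tendsto_atTop_add_const_right _ _ tendsto_id)
  exact squeeze_zero' (Eventually.of_forall fun _ => norm_nonneg _)
    (eventually_atTop.2 ⟨R, fun z hz => h z hz⟩) hlim

/-- A solution that is close to stable zeros outside of `[-R, R]` converges exponentially. -/
theorem two_sided_decay {f n n' : ℝ → ℝ} {am ap l r c δ ν ρ R B K N : ℝ} (hf : ContDiff ℝ 1 f)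
    (hν : 0 < ν) (hρ : 0 ≤ ρ)
    (h1 : ∀ u, |u - ap| ≤ ρ → deriv f u ≤ -ν ^ 2)
    (h2 : ∀ u v, |u - ap| ≤ ρ → |v - ap| ≤ ρ → u ≤ v → ν ^ 2 * (v - u) ≤ f u - f v)
    (h1' : ∀ u, |u - am| ≤ ρ → deriv f u ≤ -ν ^ 2)
    (h2' : ∀ u v, |u - am| ≤ ρ → |v - am| ≤ ρ → u ≤ v → ν ^ 2 * (v - u) ≤ f u - f v)
    (hn : ∀ z, HasDerivAt n (n' z) z) (hn' : ∀ z, HasDerivAt n' (-(c * n' z) - (f (n z) + δ)) z)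
    (hc : c ^ 2 ≤ 2 * ν ^ 2) (hr : f r + δ = 0) (hrp : |r - ap| ≤ ρ)
    (hl : f l + δ = 0) (hlm : |l - am| ≤ ρ)
    (hnp : ∀ z, R ≤ z → |n z - ap| ≤ ρ) (hnm : ∀ z, z ≤ -R → |n z - am| ≤ ρ)
    (hB : ∀ z, |n' z| ≤ B) (hN : ∀ z, |n z| ≤ N) (hrN : |r| ≤ N) (hlN : |l| ≤ N)
    (hK0 : 0 ≤ K) (hK : ∀ u v, |u| ≤ N → |v| ≤ N → |f u - f v| ≤ K * |u - v|) :
    Tendsto n atTop (𝓝 r) ∧ Tendsto n atBot (𝓝 l) ∧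
      ∀ z, R ≤ |z| → |n' z| ≤ B * Real.exp (-(ν / 2 * (|z| - R))) ∧
        |f (n z) + δ| ≤ K * (2 * ρ) * Real.exp (-(ν / 2 * (|z| - R))) := by
  have hB0 : 0 ≤ B := (abs_nonneg _).trans (hB 0)
  have A := tail_decay hf hν h1 h2 hn hn' hc hr hrp hnp fun z _ => hB z
  have hrd : ∀ u, deriv (fun u => -f (-u)) u = deriv f (-u) := fun u => by
    rw [deriv.fun_neg, deriv_comp_neg, neg_neg]
  have e1 : ∀ u v : ℝ, |-u - v| = |u - -v| := fun u v => by
    rw [← abs_neg]; congr 1; ring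
  have A' := tail_decay (f := fun u => -f (-u)) (n := fun z => -n (-z)) (n' := fun z => n' (-z))
    (p := -am) (r := -l) (c := -c) (δ := -δ) (ν := ν) (ρ := ρ) (R := R) (B := B) (by fun_prop) hν
    (fun u hu => by
      rw [hrd]
      refine h1' (-u) ?_
      rw [e1]; exact hu)
    (fun u v hu hv huv => by
      have := h2' (-v) (-u) (by rw [e1]; exact hv) (by rw [e1]; exact hu) (by linarith)
      linarith)
    (fun z => by simpa using! ((hn (-z)).comp z (hasDerivAt_neg z)).neg)
    (fun z => by
      have := (hn' (-z)).comp z (hasDerivAt_neg z)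
      convert! this using 1
      simp only [neg_neg]; ring)
    (by simpa using hc) (by simp only [neg_neg]; linarith) (by rw [e1, neg_neg]; exact hlm)
    (fun z hz => by rw [e1, neg_neg]; exact hnm (-z) (by linarith)) (fun z _ => hB (-z))
  have hfz : ∀ z x E, f x + δ = 0 → |x| ≤ N → |n z - x| ≤ 2 * ρ * E →
      |f (n z) + δ| ≤ K * (2 * ρ) * E := by
    intro z x E hx hxN hE
    have := hK (n z) x (hN z) hxN
    rw [show f (n z) + δ = f (n z) - f x by linarith, mul_assoc]
    exact this.trans (mul_le_mul_of_nonneg_left hE hK0)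
  refine ⟨tendsto_of_abs_sub_le_exp (half_pos hν) fun z hz =>
    abs_le_mul_exp_half (by positivity) (A z hz).1, ?_, fun z hz => ?_⟩
  · have := tendsto_of_abs_sub_le_exp (half_pos hν) fun z hz =>
      abs_le_mul_exp_half (by positivity) (A' z hz).1
    have h3 := (this.comp tendsto_neg_atBot_atTop).neg
    simpa [Function.comp_def] using h3
  · rcases le_total 0 z with h0 | h0
    · rw [abs_of_nonneg h0] at hz ⊢
      exact ⟨abs_le_mul_exp_half hB0 (A z hz).2,
        hfz z r _ hr hrN (abs_le_mul_exp_half (by positivity) (A z hz).1)⟩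
    · rw [abs_of_nonpos h0] at hz ⊢
      have a1 := abs_le_mul_exp_half hB0 (A' (-z) hz).2
      have a2 := abs_le_mul_exp_half (by positivity) (A' (-z) hz).1
      rw [neg_neg] at a1
      rw [e1, neg_neg, neg_neg] at a2
      exact ⟨a1, hfz z l _ hl hlN a2⟩

theorem exists_sq_mul_exp_le {a : ℝ} (ha : 0 < a) (R : ℝ) :
    ∃ C > 0, ∀ z, 0 ≤ z → (1 + z) ^ 2 * Real.exp (-(a * (z - R))) ≤ C := by
  set k := min 1 (a ^ 2 / 2) with hk
  have hk0 : 0 < k := lt_min one_pos (by positivity)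
  refine ⟨2 / k * Real.exp (a * R), by positivity, fun z hz => ?_⟩
  have h1 := Real.quadratic_le_exp_of_nonneg (mul_nonneg ha.le hz)
  have h2 : k * (1 + z) ^ 2 ≤ 2 * Real.exp (a * z) := by
    have b1 : k ≤ 1 := min_le_left _ _
    have b2 : k ≤ a ^ 2 / 2 := min_le_right _ _
    nlinarith [sq_nonneg (1 - z), mul_nonneg ha.le hz, mul_le_mul_of_nonneg_right b2 (sq_nonneg z)]
  have h3 : (1 + z) ^ 2 ≤ 2 / k * Real.exp (a * z) := by
    rw [div_mul_eq_mul_div, le_div_iff₀ hk0]; linarith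
  calc (1 + z) ^ 2 * Real.exp (-(a * (z - R)))
      ≤ 2 / k * Real.exp (a * z) * Real.exp (-(a * (z - R))) :=
        mul_le_mul_of_nonneg_right h3 (Real.exp_pos _).le
    _ = _ := by rw [mul_assoc, ← Real.exp_add]; ring_nf

/-- Regularity of the wave profile `m(·; δ)` with derivative `mz`, and bounds uniform in `δ`. -/
structure WaveBounds (f : ℝ → ℝ) (am a ap C δ : ℝ) (mz : ℝ → ℝ) : Prop where
  deriv : ∀ z, HasDerivAt (fun z => waveProfile f am a ap z δ) (mz z) z
  deriv_deriv : ∀ z, HasDerivAt mz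
    (-(waveSpeed f am a ap δ * mz z) - (f (waveProfile f am a ap z δ) + δ)) z
  pos : ∀ z, 0 < mz z
  bound : ∀ z, |waveProfile f am a ap z δ| ≤ C
  speed : |waveSpeed f am a ap δ| ≤ C
  speed_continuousAt : ContinuousAt (waveSpeed f am a ap) δ
  -- The power two is what the barriers need: one factor `|z|` pays for `|d| ≤ ε(|z| + p)` near the
  -- front, and two yield `ε²` where `|z|` is of order `1/ε`.
  decay : ∀ z, (1 + |z|) ^ 2 * mz z ≤ C
  decay_deriv : ∀ z, (1 + |z|) ^ 2 *
    |waveSpeed f am a ap δ * mz z + (f (waveProfile f am a ap z δ) + δ)| ≤ C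
  fderiv : ∀ z, ∃ D, |D| ≤ C ∧ HasFDerivAt (fun p : ℝ × ℝ => waveProfile f am a ap p.1 p.2)
    (mz z • ContinuousLinearMap.fst ℝ ℝ ℝ + D • ContinuousLinearMap.snd ℝ ℝ ℝ) (z, δ)

theorem ContDiffAt.eventually_hasDerivAt {E : Type*} [NormedAddCommGroup E] [NormedSpace ℝ E]
    {V : ℝ → E} {x : ℝ} (hV : ContDiffAt ℝ 1 V x) :
    ∃ C, ∀ᶠ δ in 𝓝 x, HasDerivAt V (deriv V δ) δ ∧ ‖deriv V δ‖ ≤ C := by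
  have h1 : ∀ᶠ δ in 𝓝 x, ContDiffAt ℝ 1 V δ := hV.eventually (by simp)
  have h2 : ContinuousAt (deriv V) x := by
    have : ContinuousAt (fderiv ℝ V) x := hV.continuousAt_fderiv one_ne_zero
    have e : deriv V = fun y => fderiv ℝ V y 1 := funext fun y => rfl
    rw [e]
    exact this.clm_apply continuousAt_const
  refine ⟨‖deriv V x‖ + 1, ?_⟩
  filter_upwards [h1, h2.norm.eventually_lt_const (show ‖deriv V x‖ < ‖deriv V x‖ + 1 by linarith)]
    with δ hδ hδ'
  exact ⟨(hδ.differentiableAt one_ne_zero).hasDerivAt, hδ'.le⟩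

namespace IsBalancedBistable

variable {f : ℝ → ℝ} {am a ap : ℝ}

theorem exists_common_stable_neighborhood (hf : IsBalancedBistable f am a ap) :
    ∃ ν > 0, ∃ ρ > 0,
      (∀ u, |u - ap| ≤ ρ → deriv f u ≤ -ν ^ 2) ∧
      (∀ u v, |u - ap| ≤ ρ → |v - ap| ≤ ρ → u ≤ v → ν ^ 2 * (v - u) ≤ f u - f v) ∧
      (∀ u, |u - am| ≤ ρ → deriv f u ≤ -ν ^ 2) ∧
      (∀ u v, |u - am| ≤ ρ → |v - am| ≤ ρ → u ≤ v → ν ^ 2 * (v - u) ≤ f u - f v) := by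
  obtain ⟨ν₁, hν₁, ρ₁, hρ₁, a1, a2⟩ := exists_stable_neighborhood hf.contDiff_one hf.deriv_right
  obtain ⟨ν₂, hν₂, ρ₂, hρ₂, b1, b2⟩ := exists_stable_neighborhood hf.contDiff_one hf.deriv_left
  have hsq : ∀ ν, 0 < ν → min ν₁ ν₂ ≤ ν → min ν₁ ν₂ ^ 2 ≤ ν ^ 2 := fun ν hν h =>
    pow_le_pow_left₀ (lt_min hν₁ hν₂).le h 2
  have s1 := hsq ν₁ hν₁ (min_le_left _ _)
  have s2 := hsq ν₂ hν₂ (min_le_right _ _)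
  refine ⟨min ν₁ ν₂, lt_min hν₁ hν₂, min ρ₁ ρ₂, lt_min hρ₁ hρ₂, ?_, ?_, ?_, ?_⟩
  · intro u hu
    have := a1 u (hu.trans (min_le_left _ _)); linarith
  · intro u v hu hv huv
    have := a2 u v (hu.trans (min_le_left _ _)) (hv.trans (min_le_left _ _)) huv
    nlinarith
  · intro u hu
    have := b1 u (hu.trans (min_le_right _ _)); linarith
  · intro u v hu hv huv
    have := b2 u v (hu.trans (min_le_right _ _)) (hv.trans (min_le_right _ _)) huv
    nlinarith

/-- The branch converges uniformly to the standing wave as `δ → 0`. So outside one interval `[-R,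
R]`, common to all small `δ`, it is close to the stable zeros, which yields the limits,
monotonicity, identification with `waveProfile` and decay. The second conclusion is the dichotomy
behind the reaction bound: away from the stable zeros the slope is bounded below. -/
theorem exists_waveBounds (hf : IsBalancedBistable f am a ap) :
    ∃ C > 0, ∃ mz : ℝ → ℝ → ℝ, (∀ᶠ δ in 𝓝 0, WaveBounds f am a ap C δ (mz δ)) ∧
      ∀ ρ > 0, ∃ κ > 0, ∀ᶠ δ in 𝓝 0, ∀ z, |waveProfile f am a ap z δ - am| ≤ ρ ∨
        |waveProfile f am a ap z δ - ap| ≤ ρ ∨ κ ≤ mz δ z := by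
  have hfc := hf.continuous
  have hf1 := hf.contDiff_one
  obtain ⟨m, m', hm, hp, h0, c, G, hc1, hG1, hc0, hG0, hev⟩ := hf.exists_branch
  obtain ⟨ν, hν, ρ', hρ', n1, n2, n3, n4⟩ := hf.exists_common_stable_neighborhood
  obtain ⟨r₀, hr₀, hzero⟩ := hf.exists_isZeroTriple
  -- The three bounds serve the linear stability of `f`, the common bound `N` on the values, and the
  -- uniqueness of the perturbed zeros.
  set ρ := min (min ρ' 1) r₀ with hρdef
  have hρ : 0 < ρ := lt_min (lt_min hρ' one_pos) hr₀
  have hρρ' : ρ ≤ ρ' := (min_le_left _ _).trans (min_le_left _ _)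
  have hρ1 : ρ ≤ 1 := (min_le_left _ _).trans (min_le_right _ _)
  have hρr : ρ ≤ r₀ := min_le_right _ _
  obtain ⟨δ₀, hδ₀, hzero⟩ := hzero ρ hρ hρr
  obtain ⟨B₁, hB₁⟩ := bounded_of_deriv_tendsto hm.continuous_deriv
    (hm.deriv_tendsto_atBot hfc hf.zero_left) (hm.deriv_tendsto_atTop hfc hf.zero_right)
  have hB₁0 : 0 ≤ B₁ := (norm_nonneg _).trans (hB₁ 0)
  set N := max |am| |ap| + 1 with hN
  obtain ⟨K, hK0, hK⟩ := exists_lipschitz_of_contDiff hf1 N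
  obtain ⟨F₁, hF₁⟩ := (isCompact_Icc (a := -N) (b := N)).exists_bound_of_continuousOn hfc.continuousOn
  obtain ⟨Rp, hRp⟩ := eventually_atTop.1 (Metric.tendsto_nhds.1 hm.right (ρ / 2) (half_pos hρ))
  obtain ⟨Rm, hRm⟩ := eventually_atBot.1 (Metric.tendsto_nhds.1 hm.left (ρ / 2) (half_pos hρ))
  set R := max 0 (max Rp (-Rm)) with hR
  have hR0 : 0 ≤ R := le_max_left _ _
  have hRRp : Rp ≤ R := (le_max_left _ _).trans (le_max_right _ _)
  have hRRm : -Rm ≤ R := (le_max_right _ _).trans (le_max_right _ _)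
  obtain ⟨E, hE0, hE⟩ := exists_sq_mul_exp_le (half_pos hν) R
  set B := B₁ + 1 with hB
  set V : ℝ → ℝ →ᵇ ℝ := fun δ => resolvL (G δ) with hV
  set V' : ℝ → ℝ →ᵇ ℝ := fun δ => resolvDerivL (G δ) with hV'
  have hV1 : ContDiffAt ℝ 1 V 0 := resolvL.contDiff.contDiffAt.comp 0 hG1
  obtain ⟨CV, hCV⟩ := ContDiffAt.eventually_hasDerivAt hV1
  have hVt : Tendsto V (𝓝 0) (𝓝 0) := by
    have := hV1.continuousAt.tendsto
    simpa [hV, hG0] using this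
  have hV't : Tendsto V' (𝓝 0) (𝓝 0) := by
    have := (resolvDerivL.continuous.tendsto _).comp hG1.continuousAt.tendsto
    simpa [hG0] using! this
  have hct : Tendsto c (𝓝 0) (𝓝 0) := by
    have := hc1.continuousAt.tendsto
    rwa [hc0] at this
  have hsmall : ∀ η > 0, ∀ᶠ δ in 𝓝 (0 : ℝ), (∀ z, |V δ z| ≤ η) ∧ ∀ z, |V' δ z| ≤ η := by
    intro η hη
    filter_upwards [(tendsto_zero_iff_norm_tendsto_zero.1 hVt).eventually_lt_const hη,
      (tendsto_zero_iff_norm_tendsto_zero.1 hV't).eventually_lt_const hη] with δ a1 a2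
    exact ⟨fun z => ((V δ).norm_coe_le_norm z).trans a1.le,
      fun z => ((V' δ).norm_coe_le_norm z).trans a2.le⟩
  set n : ℝ → ℝ → ℝ := fun δ z => m z + V δ z with hn
  set mz : ℝ → ℝ → ℝ := fun δ z => m' z + V' δ z with hmz
  have hspeed : ∀ η > 0, ∀ᶠ δ in 𝓝 (0 : ℝ), |c δ| ≤ η := fun η hη => by
    filter_upwards [(tendsto_zero_iff_norm_tendsto_zero.1 hct).eventually_lt_const hη] with δ h
    exact h.le
  have hδsmall : ∀ η > 0, ∀ᶠ δ in 𝓝 (0 : ℝ), |δ| ≤ η := fun η hη => by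
    filter_upwards [Metric.ball_mem_nhds (0 : ℝ) hη] with δ h
    rw [mem_ball_zero_iff] at h
    exact h.le
  have hmain : ∀ᶠ δ in 𝓝 (0 : ℝ), (waveSpeed f am a ap δ = c δ ∧
      ∀ z, waveProfile f am a ap z δ = n δ z) ∧ (∀ z, HasDerivAt (n δ) (mz δ z) z) ∧
      (∀ z, HasDerivAt (mz δ) (-(c δ * mz δ z) - (f (n δ z) + δ)) z) ∧ (∀ z, 0 < mz δ z) ∧
      (∀ z, |n δ z| ≤ N) ∧ (∀ z, |mz δ z| ≤ B) ∧
      ∀ z, R ≤ |z| → |mz δ z| ≤ B * Real.exp (-(ν / 2 * (|z| - R))) ∧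
        |f (n δ z) + δ| ≤ K * (2 * ρ) * Real.exp (-(ν / 2 * (|z| - R))) := by
    filter_upwards [hev, hsmall (ρ / 2) (half_pos hρ), hsmall 1 one_pos, hspeed ν hν,
      hδsmall δ₀ hδ₀] with δ ⟨he1, he2⟩ ⟨hs1, _⟩ ⟨_, hs3⟩ hcν hδ
    obtain ⟨l, b, r, htr, hl, hb, hr, ul, ub, ur⟩ := hzero δ hδ
    have d1 : ∀ z, HasDerivAt (n δ) (mz δ z) z := fun z =>
      (hm.deriv z).add (resolvL_hasDerivAt (G δ) z)
    have d2 : ∀ z, HasDerivAt (mz δ) (-(c δ * mz δ z) - (f (n δ z) + δ)) z := fun z => by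
      have := (hm.deriv_deriv z).add (resolvDerivL_hasDerivAt (G δ) z)
      convert! this using 1
      have := he1 z
      simp only [hmz, hn, hV, hV']
      linarith
    have hmN : ∀ z, |m z| ≤ max |am| |ap| := fun z => abs_le_max_abs_abs (hp z).1.le (hp z).2.1.le
    have hnN : ∀ z, |n δ z| ≤ N := fun z =>
      (abs_add_le _ _).trans (add_le_add (hmN z) ((hs1 z).trans (by linarith)))
    have hmzB : ∀ z, |mz δ z| ≤ B := fun z =>
      (abs_add_le _ _).trans (add_le_add (hB₁ z) (hs3 z))
    have hnear : ∀ x y z, |m z - x| ≤ ρ / 2 → y = n δ z → |y - x| ≤ ρ := by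
      rintro x y z hx rfl
      have := abs_add_le (m z - x) (V δ z)
      rw [show n δ z - x = m z - x + V δ z by simp only [hn]; ring]
      linarith [hs1 z]
    have habs : ∀ x y : ℝ, |x - y| ≤ ρ → |y| ≤ max |am| |ap| → |x| ≤ N := fun x y hxy hy => by
      have := abs_add_le (x - y) y
      rw [sub_add_cancel] at this
      linarith
    obtain ⟨t1, t2, t3⟩ := two_sided_decay (f := f) (n := n δ) (n' := mz δ) (am := am) (ap := ap)
      (l := l) (r := r) (c := c δ) (δ := δ) (ν := ν) (ρ := ρ) (R := R) (B := B) (K := K) (N := N)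
      hf1 hν hρ.le (fun u hu => n1 u (hu.trans hρρ'))
      (fun u v hu hv => n2 u v (hu.trans hρρ') (hv.trans hρρ'))
      (fun u hu => n3 u (hu.trans hρρ')) (fun u v hu hv => n4 u v (hu.trans hρρ') (hv.trans hρρ'))
      d1 d2
      (by have := abs_le.1 hcν; nlinarith) htr.signs.right hr htr.signs.left hl
      (fun z hz => hnear ap _ z (hRp z (hRRp.trans hz)).le rfl)
      (fun z hz => hnear am _ z (hRm z (by linarith)).le rfl) hmzB hnN
      (habs r ap hr (le_max_right _ _)) (habs l am hl (le_max_left _ _)) hK0 hK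
    have hfront : IsFront (fun u => f u + δ) l r (c δ) (n δ) (mz δ) := ⟨d1, d2, t2, t1⟩
    -- The branch only knows that its value at `0` is some zero of `f + δ`; closeness to `a` singles
    -- out the middle one.
    have hnb : n δ 0 = b := by
      refine ub _ ?_ ?_
      · simp only [hn, hV, h0]; exact he2
      · simp only [hn, h0, add_sub_cancel_left]
        exact (hs1 0).trans (by linarith)
    exact ⟨htr.travelingWave_eq hf1 (htr.isTravelingWave hfc hfront hnb), d1, d2,
      fun z => (htr.strict hf1 hfront z).2.2, hnN, hmzB, t3⟩
  set C := N + 1 + |CV| + (B * E + (1 + R) ^ 2 * B) + (B * E + K * (2 * ρ) * E +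
    (1 + R) ^ 2 * (B + (|F₁| + 1))) with hC
  have hN0 : 0 ≤ N := by positivity
  have hB0 : 0 ≤ B := by positivity
  have p1 : 0 ≤ B * E + (1 + R) ^ 2 * B := by positivity
  have p2 : 0 ≤ B * E + K * (2 * ρ) * E + (1 + R) ^ 2 * (B + (|F₁| + 1)) := by positivity
  have p3 : 0 ≤ |CV| := abs_nonneg _
  refine ⟨C, by linarith, mz, ?_, ?_⟩
  · filter_upwards [hmain, hmain.eventually_nhds, hspeed 1 one_pos, hCV, hδsmall 1 one_pos,
      (hc1.eventually (by simp))] with δ ⟨⟨w1, w2⟩, d1, d2, hpos, hnN, hmzB, hdec⟩ hnh hc1' hCV' hδ1 hcd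
    have w2' : (fun z => waveProfile f am a ap z δ) = n δ := funext w2
    have hexp : ∀ z, R ≤ |z| → (1 + |z|) ^ 2 * Real.exp (-(ν / 2 * (|z| - R))) ≤ E := fun z _ =>
      hE |z| (abs_nonneg z)
    have hsq : ∀ z : ℝ, |z| ≤ R → (1 + |z|) ^ 2 ≤ (1 + R) ^ 2 := fun z hz =>
      pow_le_pow_left₀ (by positivity) (by linarith) 2
    refine ⟨fun z => w2' ▸ d1 z, fun z => ?_, hpos, fun z => ?_, ?_, ?_, fun z => ?_, fun z => ?_,
      fun z => ?_⟩
    · rw [w1, w2]; exact d2 z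
    · rw [w2]; exact (hnN z).trans (by linarith)
    · rw [w1]; exact hc1'.trans (by linarith)
    -- The chosen speed agrees with the branch on a whole neighbourhood of `δ`, so it inherits
    -- continuity.
    · refine hcd.continuousAt.congr ?_
      filter_upwards [hnh] with y hy using hy.1.1.symm
    · rcases le_total R |z| with hz | hz
      · have h3 := (le_abs_self _).trans (hdec z hz).1
        calc (1 + |z|) ^ 2 * mz δ z
            ≤ (1 + |z|) ^ 2 * (B * Real.exp (-(ν / 2 * (|z| - R)))) := by gcongr
          _ = B * ((1 + |z|) ^ 2 * Real.exp (-(ν / 2 * (|z| - R)))) := by ring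
          _ ≤ B * E := by gcongr; exact hexp z hz
          _ ≤ C := by
            have : 0 ≤ (1 + R) ^ 2 * B := by positivity
            linarith
      · have h3 := (le_abs_self _).trans (hmzB z)
        calc (1 + |z|) ^ 2 * mz δ z ≤ (1 + R) ^ 2 * B :=
              mul_le_mul (hsq z hz) h3 (hpos z).le (by positivity)
          _ ≤ C := by
            have : 0 ≤ B * E := by positivity
            linarith
    · rw [w1, w2]
      have h4 : |c δ * mz δ z + (f (n δ z) + δ)| ≤ |mz δ z| + |f (n δ z) + δ| := by
        refine (abs_add_le _ _).trans ?_
        rw [abs_mul]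
        have := mul_le_mul_of_nonneg_right hc1' (abs_nonneg (mz δ z))
        linarith
      have h5 : |f (n δ z) + δ| ≤ |F₁| + 1 :=
        (abs_add_le _ _).trans (add_le_add
          ((hF₁ _ (abs_le.1 (hnN z))).trans (le_abs_self _)) hδ1)
      rcases le_total R |z| with hz | hz
      · obtain ⟨h3, h3'⟩ := hdec z hz
        calc (1 + |z|) ^ 2 * |c δ * mz δ z + (f (n δ z) + δ)|
            ≤ (1 + |z|) ^ 2 * (B * Real.exp (-(ν / 2 * (|z| - R))) +
              K * (2 * ρ) * Real.exp (-(ν / 2 * (|z| - R)))) := by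
              gcongr; linarith
          _ = (B + K * (2 * ρ)) * ((1 + |z|) ^ 2 * Real.exp (-(ν / 2 * (|z| - R)))) := by ring
          _ ≤ (B + K * (2 * ρ)) * E := by gcongr; exact hexp z hz
          _ ≤ C := by
            have : 0 ≤ (1 + R) ^ 2 * (B + (|F₁| + 1)) := by positivity
            linarith
      · calc (1 + |z|) ^ 2 * |c δ * mz δ z + (f (n δ z) + δ)|
            ≤ (1 + R) ^ 2 * (B + (|F₁| + 1)) := by
              refine mul_le_mul (hsq z hz) ?_ (abs_nonneg _) (by positivity)
              linarith [hmzB z]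
          _ ≤ C := by
            have : 0 ≤ B * E + K * (2 * ρ) * E := by positivity
            linarith
    · refine ⟨deriv V δ z, ?_, ?_⟩
      · have := ((deriv V δ).norm_coe_le_norm z).trans hCV'.2
        exact this.trans ((le_abs_self _).trans (by linarith))
      · have e1 := hasFDerivAt_eval hCV'.1 (resolvL_hasDerivAt (G δ) z)
        have e2 : HasFDerivAt (fun p : ℝ × ℝ => m p.1) (m' z • ContinuousLinearMap.fst ℝ ℝ ℝ)
            (z, δ) := (hm.deriv z).comp_hasFDerivAt (z, δ) hasFDerivAt_fst
        have e3 := e2.add e1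
        rw [← add_assoc, ← add_smul] at e3
        refine e3.congr_of_eventuallyEq ?_
        filter_upwards [(continuous_snd.tendsto (z, δ)).eventually hnh] with p hp
        exact hp.1.2 p.1
  · intro σ hσ
    obtain ⟨Sp, hSp⟩ := eventually_atTop.1 (Metric.tendsto_nhds.1 hm.right (σ / 2) (half_pos hσ))
    obtain ⟨Sm, hSm⟩ := eventually_atBot.1 (Metric.tendsto_nhds.1 hm.left (σ / 2) (half_pos hσ))
    obtain ⟨κ, hκ, hκ'⟩ : ∃ κ > 0, ∀ z ∈ Icc Sm Sp, κ ≤ m' z := by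
      rcases (Icc Sm Sp).eq_empty_or_nonempty with he | he
      · exact ⟨1, one_pos, fun z hz => by rw [he] at hz; exact hz.elim⟩
      · obtain ⟨x, _, hx'⟩ := isCompact_Icc.exists_isMinOn he hm.continuous_deriv.continuousOn
        exact ⟨m' x, (hp x).2.2, fun z hz => hx' hz⟩
    refine ⟨κ / 2, half_pos hκ, ?_⟩
    filter_upwards [hmain, hsmall (σ / 2) (half_pos hσ), hsmall (κ / 2) (half_pos hκ)]
      with δ ⟨⟨_, w2⟩, _⟩ ⟨s1, _⟩ ⟨_, s2⟩ z
    rw [w2]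
    have hnear : ∀ x, |m z - x| ≤ σ / 2 → |n δ z - x| ≤ σ := by
      intro x hx
      have := abs_add_le (m z - x) (V δ z)
      rw [show n δ z - x = m z - x + V δ z by simp only [hn]; ring]
      linarith [s1 z]
    rcases le_total z Sm with h1 | h1
    · exact Or.inl (hnear am (hSm z h1).le)
    rcases le_total Sp z with h2 | h2
    · exact Or.inr (Or.inl (hnear ap (hSp z h2).le))
    · right; right
      have := hκ' z ⟨h1, h2⟩
      have := (abs_le.1 (s2 z)).1
      simp only [hmz]; linarith

end IsBalancedBistable

/-! ### Laplacians of compositions, and cut-off signed distances -/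

section Laplacian

variable {E : Type*} [NormedAddCommGroup E] [InnerProductSpace ℝ E]

theorem ContDiffAt.eventually_hasFDerivAt {g : E → ℝ} {x : E} (hg : ContDiffAt ℝ 2 g x) :
    (∀ᶠ y in 𝓝 x, HasFDerivAt g (fderiv ℝ g y) y) ∧
      HasFDerivAt (fderiv ℝ g) (fderiv ℝ (fderiv ℝ g) x) x := by
  constructor
  · have : ∀ᶠ y in 𝓝 x, ContDiffAt ℝ 2 g y := hg.eventually (by simp)
    filter_upwards [this] with y hy using (hy.differentiableAt two_ne_zero).hasFDerivAt
  · exact ((hg.fderiv_right (m := 1) (by norm_num [one_add_one_eq_two])).differentiableAt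
      one_ne_zero).hasFDerivAt

variable [FiniteDimensional ℝ E]

theorem laplacian_eq_sum_of_hasFDerivAt {ι : Type*} [Fintype ι] (b : OrthonormalBasis ι ℝ E)
    {g : E → ℝ} {g' : E → E →L[ℝ] ℝ} {g'' : E →L[ℝ] E →L[ℝ] ℝ} {x : E}
    (h1 : ∀ᶠ y in 𝓝 x, HasFDerivAt g (g' y) y) (h2 : HasFDerivAt g' g'' x) :
    (Δ g) x = ∑ i, g'' (b i) (b i) := by
  have h3 : fderiv ℝ (fderiv ℝ g) x = g'' := by
    refine (h2.congr_of_eventuallyEq ?_).fderiv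
    filter_upwards [h1] with y hy using hy.fderiv
  rw [InnerProductSpace.laplacian_eq_iteratedFDeriv_orthonormalBasis g b]
  simp [iteratedFDeriv_two_apply, h3]

theorem laplacian_eq_sum_fderiv_fderiv {ι : Type*} [Fintype ι] (b : OrthonormalBasis ι ℝ E)
    (g : E → ℝ) (x : E) : (Δ g) x = ∑ i, fderiv ℝ (fderiv ℝ g) x (b i) (b i) := by
  rw [InnerProductSpace.laplacian_eq_iteratedFDeriv_orthonormalBasis g b]
  simp [iteratedFDeriv_two_apply]

theorem sum_sq_apply_orthonormalBasis {ι : Type*} [Fintype ι] (b : OrthonormalBasis ι ℝ E)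
    (l : E →L[ℝ] ℝ) : ∑ i, l (b i) ^ 2 = ‖l‖ ^ 2 := by
  have h := b.sum_sq_norm_inner_right ((InnerProductSpace.toDual ℝ E).symm l)
  rw [LinearIsometryEquiv.norm_map] at h
  rw [← h]
  refine Finset.sum_congr rfl fun i _ => ?_
  rw [real_inner_comm, InnerProductSpace.toDual_symm_apply, Real.norm_eq_abs, sq_abs]

theorem laplacian_comp {h h' : ℝ → ℝ} {h'' : ℝ} {g : E → ℝ} {x : E} (hg : ContDiffAt ℝ 2 g x)
    (h1 : ∀ y, HasDerivAt h (h' y) y) (h2 : HasDerivAt h' h'' (g x)) :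
    (Δ fun y => h (g y)) x = h'' * ‖fderiv ℝ g x‖ ^ 2 + h' (g x) * (Δ g) x := by
  obtain ⟨g1, g2⟩ := ContDiffAt.eventually_hasFDerivAt hg
  have e1 : ∀ᶠ y in 𝓝 x, HasFDerivAt (fun y => h (g y)) (h' (g y) • fderiv ℝ g y) y := by
    filter_upwards [g1] with y hy using (h1 (g y)).comp_hasFDerivAt y hy
  have e2 : HasFDerivAt (fun y => h' (g y)) (h'' • fderiv ℝ g x) x :=
    h2.comp_hasFDerivAt x g1.self_of_nhds
  have e3 := e2.smul g2
  set b := stdOrthonormalBasis ℝ E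
  rw [laplacian_eq_sum_of_hasFDerivAt b e1 e3, ← sum_sq_apply_orthonormalBasis b,
    laplacian_eq_sum_fderiv_fderiv b g, Finset.mul_sum, Finset.mul_sum, ← Finset.sum_add_distrib]
  refine Finset.sum_congr rfl fun i _ => ?_
  simp
  ring

end Laplacian

/-! ### Cut-off distance functions -/

variable {n : ℕ}

/-- Regularity of a function `d` near `(x, t)` that behaves like the signed distance to a front
moving with inward normal velocity `H - F`: within distance `b` of the front it is `C²` in space
with unit gradient, its time derivative is `H - F`, where `H` agrees with its Laplacian up to
`C |d|`; elsewhere it is merely continuous. -/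
structure IsFrontDistanceAt (d : EuclideanSpace ℝ (Fin n) → ℝ → ℝ) (F C b : ℝ)
    (x : EuclideanSpace ℝ (Fin n)) (t : ℝ) : Prop where
  near : |d x t| < b → ContDiffAt ℝ 2 (fun y => d y t) x ∧ ‖fderiv ℝ (fun y => d y t) x‖ = 1 ∧
    ∃ H, |(Δ fun y => d y t) x - H| ≤ C * |d x t| ∧ HasDerivAt (d x) (H - F) t
  continuous_space : ContinuousAt (fun y => d y t) x
  continuous_time : ContinuousAt (d x) t

/-- What the barriers need to know about a cut-off signed distance `D` near `(x, t)`. -/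
def IsCutoffDistanceAt (D : EuclideanSpace ℝ (Fin n) → ℝ → ℝ) (F C d₀ : ℝ)
    (x : EuclideanSpace ℝ (Fin n)) (t : ℝ) : Prop :=
  ContDiffAt ℝ 2 (fun y => D y t) x ∧ ∃ v, HasDerivAt (D x) v t ∧
    ((‖fderiv ℝ (fun y => D y t) x‖ = 1 ∧ |v - (Δ fun y => D y t) x + F| ≤ C * |D x t|) ∨
      (d₀ ≤ |D x t| ∧ |v - (Δ fun y => D y t) x| ≤ C * (1 + |F|) ∧
        ‖fderiv ℝ (fun y => D y t) x‖ ^ 2 ≤ C))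

theorem isCutoffDistanceAt_of_eventuallyEq_const {D : EuclideanSpace ℝ (Fin n) → ℝ → ℝ}
    {F C d₀ w : ℝ} {x : EuclideanSpace ℝ (Fin n)} {t : ℝ} (hC : 0 ≤ C) (hw : d₀ ≤ |w|)
    (h1 : ∀ᶠ y in 𝓝 x, D y t = w) (h2 : ∀ᶠ s in 𝓝 t, D x s = w) :
    IsCutoffDistanceAt D F C d₀ x t := by
  have e1 : (fun y => D y t) =ᶠ[𝓝 x] fun _ => w := h1
  have e2 : D x =ᶠ[𝓝 t] fun _ => w := h2
  refine ⟨contDiffAt_const.congr_of_eventuallyEq e1, 0,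
    (hasDerivAt_const t w).congr_of_eventuallyEq e2, Or.inr ⟨?_, ?_, ?_⟩⟩
  · rw [h1.self_of_nhds]; exact hw
  · rw [(InnerProductSpace.laplacian_congr_nhds e1).eq_of_nhds, InnerProductSpace.laplacian_const]
    simp; positivity
  · rw [e1.fderiv_eq]; simpa

theorem IsCutoff.le_abs_apply {φ : ℝ → ℝ} {d₀ : ℝ} (hφ : IsCutoff φ d₀) (h0 : 0 < d₀) {s : ℝ}
    (hs : d₀ ≤ |s|) : d₀ ≤ |φ s| := by
  rcases _root_.le_abs.1 hs with h | h
  · have := hφ.mono h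
    rw [hφ.mid d₀ (by rw [abs_of_pos h0])] at this
    exact this.trans (le_abs_self _)
  · have := hφ.mono (show s ≤ -d₀ by linarith)
    rw [hφ.mid (-d₀) (by rw [abs_neg, abs_of_pos h0])] at this
    exact le_trans (by linarith) (neg_le_abs _)

/-- Three zones. For `|d| < d₀` the cut-off is the identity; for `d₀ ≤ |d| < 3d₀` the chain rule
applies, with `φ'` and `φ''` bounded; for `|d| ≥ 3d₀` the cut-off is constant near the point. The
threshold `3d₀` rather than `2d₀` leaves room for a neighbourhood, so no regularity of `d` is needed
in the last zone. -/
theorem IsCutoff.exists_isCutoffDistanceAt {φ : ℝ → ℝ} {d₀ : ℝ} (hφ : IsCutoff φ d₀)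
    (h0 : 0 < d₀) (C : ℝ) (hC : 0 ≤ C) :
    ∃ C', 0 ≤ C' ∧ ∀ (n : ℕ) (d : EuclideanSpace ℝ (Fin n) → ℝ → ℝ) (F : ℝ) (x) (t),
      IsFrontDistanceAt d F C (3 * d₀) x t →
        IsCutoffDistanceAt (fun y s => φ (d y s)) F C' d₀ x t := by
  have hφ2 : ContDiff ℝ 2 φ := mod_cast contDiff_infty.1 hφ.contDiff 2
  have d1 : ∀ s, HasDerivAt φ (deriv φ s) s := fun s =>
    (hφ2.differentiable two_ne_zero s).hasDerivAt
  have hφ' : ContDiff ℝ 1 (deriv φ) :=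
    ((contDiff_succ_iff_deriv (n := 1)).1 (by rw [one_add_one_eq_two]; exact hφ2)).2.2
  have d2 : ∀ s, HasDerivAt (deriv φ) (deriv (deriv φ) s) s := fun s =>
    (hφ'.differentiable one_ne_zero s).hasDerivAt
  obtain ⟨A, hA⟩ := (isCompact_Icc (a := -(3 * d₀)) (b := 3 * d₀)).exists_bound_of_continuousOn
    hφ'.continuous.continuousOn
  obtain ⟨B, hB⟩ := (isCompact_Icc (a := -(3 * d₀)) (b := 3 * d₀)).exists_bound_of_continuousOn
    (hφ'.continuous_deriv_one).continuousOn
  have hA0 : 0 ≤ A := (norm_nonneg _).trans (hA 0 ⟨by linarith, by linarith⟩)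
  have hB0 : 0 ≤ B := (norm_nonneg _).trans (hB 0 ⟨by linarith, by linarith⟩)
  refine ⟨C + A ^ 2 + A + A * (C * (3 * d₀)) + B, by positivity, fun n d F x t hd => ?_⟩
  set C' := C + A ^ 2 + A + A * (C * (3 * d₀)) + B with hC'
  have hCC' : C ≤ C' := by
    have : 0 ≤ A ^ 2 + A + A * (C * (3 * d₀)) + B := by positivity
    linarith
  have hC'0 : 0 ≤ C' := hC.trans hCC'
  rcases lt_or_ge |d x t| d₀ with h | h
  · obtain ⟨n1, n2, H, n4, n5⟩ := hd.near (by linarith)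
    have e1 : (fun y => φ (d y t)) =ᶠ[𝓝 x] fun y => d y t := by
      filter_upwards [hd.continuous_space.abs.eventually_lt_const h] with y hy
        using hφ.mid _ hy.le
    have e2 : (fun s => φ (d x s)) =ᶠ[𝓝 t] d x := by
      filter_upwards [hd.continuous_time.abs.eventually_lt_const h] with y hy
        using hφ.mid _ hy.le
    refine ⟨n1.congr_of_eventuallyEq e1, H - F, n5.congr_of_eventuallyEq e2, Or.inl ⟨?_, ?_⟩⟩
    · rw [e1.fderiv_eq, n2]
    · have e3 : φ (d x t) = d x t := e1.self_of_nhds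
      simp only [e3, (InnerProductSpace.laplacian_congr_nhds e1).eq_of_nhds]
      refine (le_of_eq ?_).trans (n4.trans (by gcongr))
      rw [← abs_neg]; congr 1; ring
  rcases lt_or_ge |d x t| (3 * d₀) with h3 | h3
  · obtain ⟨n1, n2, H, n4, n5⟩ := hd.near h3
    have hmem : d x t ∈ Icc (-(3 * d₀)) (3 * d₀) := abs_le.1 h3.le
    have a1 := hA _ hmem
    have a2 := hB _ hmem
    rw [Real.norm_eq_abs] at a1 a2
    have hΔ := laplacian_comp n1 d1 (d2 (d x t))
    have hD : HasFDerivAt (fun y => φ (d y t)) (deriv φ (d x t) • fderiv ℝ (fun y => d y t) x) x :=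
      (d1 (d x t)).comp_hasFDerivAt x (n1.differentiableAt two_ne_zero).hasFDerivAt
    refine ⟨hφ2.contDiffAt.comp x n1, deriv φ (d x t) * (H - F), (d1 (d x t)).comp t n5,
      Or.inr ⟨hφ.le_abs_apply h0 h, ?_, ?_⟩⟩
    · rw [hΔ, n2]
      have e : deriv φ (d x t) * (H - F) - (deriv (deriv φ) (d x t) * 1 ^ 2 +
          deriv φ (d x t) * (Δ fun y => d y t) x) = deriv φ (d x t) *
          (-((Δ fun y => d y t) x - H)) - (deriv φ (d x t) * F + deriv (deriv φ) (d x t)) := by ring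
      rw [e]
      refine (abs_sub _ _).trans ?_
      have b1 : |deriv φ (d x t) * (-((Δ fun y => d y t) x - H))| ≤ A * (C * (3 * d₀)) := by
        rw [abs_mul, abs_neg]
        exact mul_le_mul a1 (n4.trans (by gcongr)) (abs_nonneg _) hA0
      have b2 : |deriv φ (d x t) * F + deriv (deriv φ) (d x t)| ≤ A * |F| + B := by
        refine (abs_add_le _ _).trans (add_le_add ?_ a2)
        rw [abs_mul]; gcongr
      have hF := abs_nonneg F
      have : A * |F| ≤ C' * |F| := by
        gcongr
        have : 0 ≤ C + A ^ 2 + A * (C * (3 * d₀)) + B := by positivity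
        linarith
      have : 0 ≤ C + A ^ 2 + A := by positivity
      rw [mul_add, mul_one]
      linarith
    · rw [hD.fderiv, norm_smul, n2, mul_one, Real.norm_eq_abs]
      have : |deriv φ (d x t)| ^ 2 ≤ A ^ 2 := by gcongr
      have : 0 ≤ C + A + A * (C * (3 * d₀)) + B := by positivity
      linarith
  · rcases le_abs.1 h3 with h4 | h4
    · refine isCutoffDistanceAt_of_eventuallyEq_const (w := 2 * d₀) hC'0
        (by rw [abs_of_pos] <;> linarith) ?_ ?_
      · filter_upwards [hd.continuous_space.eventually_const_lt (show 2 * d₀ < d x t by linarith)]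
          with y hy using hφ.right _ hy.le
      · filter_upwards [hd.continuous_time.eventually_const_lt (show 2 * d₀ < d x t by linarith)]
          with y hy using hφ.right _ hy.le
    · refine isCutoffDistanceAt_of_eventuallyEq_const (w := -(2 * d₀)) hC'0
        (by rw [abs_neg, abs_of_pos] <;> linarith) ?_ ?_
      · filter_upwards [hd.continuous_space.eventually_lt_const
          (show d x t < -(2 * d₀) by linarith)] with y hy using hφ.left _ hy.le
      · filter_upwards [hd.continuous_time.eventually_lt_const
          (show d x t < -(2 * d₀) by linarith)] with y hy using hφ.left _ hy.le

/-! ### Barriers built from the traveling waves -/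

theorem WaveBounds.contDiff {f : ℝ → ℝ} {am a ap C δ : ℝ} {mz : ℝ → ℝ}
    (h : WaveBounds f am a ap C δ mz) (hf : Continuous f) :
    ContDiff ℝ 2 fun z => waveProfile f am a ap z δ := by
  have e1 : _root_.deriv (fun z => waveProfile f am a ap z δ) = mz :=
    funext fun z => (h.deriv z).deriv
  have e2 : _root_.deriv mz = fun z => -(waveSpeed f am a ap δ * mz z) -
      (f (waveProfile f am a ap z δ) + δ) := funext fun z => (h.deriv_deriv z).deriv
  have d1 : Differentiable ℝ fun z => waveProfile f am a ap z δ :=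
    fun z => (h.deriv z).differentiableAt
  have d2 : Differentiable ℝ mz := fun z => (h.deriv_deriv z).differentiableAt
  rw [← one_add_one_eq_two, contDiff_succ_iff_deriv, e1]
  refine ⟨d1, by simp, contDiff_one_iff_deriv.2 ⟨d2, ?_⟩⟩
  rw [e2]
  exact (continuous_const.mul d2.continuous).neg.sub ((hf.comp d1.continuous).add continuous_const)

/-- Near a stable zero `f' ≤ -ν²` alone yields `ν² q = 2βq`, and the term with `m_z` is nonnegative.
In the transition layer the Lipschitz bound loses at most `Λ q`, which `m_z/σ ≥ κ/σ` outweighs. -/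
theorem IsBalancedBistable.exists_reaction_bound {f : ℝ → ℝ} {am a ap : ℝ}
    (hf : IsBalancedBistable f am a ap) :
    ∃ β > 0, ∃ σ₀ > 0, ∃ δ₀ > 0, ∃ C > 0, ∃ mz : ℝ → ℝ → ℝ,
      (∀ δ, |δ| ≤ δ₀ → WaveBounds f am a ap C δ (mz δ)) ∧
      ∀ σ, 0 < σ → σ ≤ σ₀ → ∀ δ, |δ| ≤ δ₀ → ∀ z q s, 0 ≤ q → q ≤ σ * (β + 1) →
        (s = 1 ∨ s = -1) → 2 * β * q ≤ mz δ z / σ * q -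
          s * (f (waveProfile f am a ap z δ + s * q) - f (waveProfile f am a ap z δ)) := by
  obtain ⟨ν, hν, ρ, hρ, -, hp, -, hm⟩ := hf.exists_common_stable_neighborhood
  obtain ⟨C, hC, mz, hw, htri⟩ := hf.exists_waveBounds
  obtain ⟨κ, hκ, htri⟩ := htri (ρ / 2) (half_pos hρ)
  obtain ⟨δ₀, hδ₀, hδ⟩ := Metric.nhds_basis_closedBall.eventually_iff.1 (hw.and htri)
  have hball : ∀ δ, |δ| ≤ δ₀ → δ ∈ Metric.closedBall (0 : ℝ) δ₀ := fun δ h => by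
    rwa [mem_closedBall_zero_iff]
  obtain ⟨Λ, hΛ0, hΛ⟩ := exists_lipschitz_of_contDiff hf.contDiff_one (C + 1)
  set β := ν ^ 2 / 2 with hβdef
  have hβ : 0 < β := by positivity
  -- The first bound on `σ` keeps the shift `q` inside the stable neighbourhoods and below `1`; the
  -- second ensures `κ/σ ≥ Λ + 2β`.
  refine ⟨β, hβ, min (min (ρ / 2) 1 / (β + 1)) (κ / (Λ + 2 * β)), by positivity, δ₀, hδ₀, C, hC,
    mz, fun δ h => (hδ (hball δ h)).1, ?_⟩
  intro σ hσ hσ₀ δ hδδ z q s hq hqσ hs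
  obtain ⟨w, htri⟩ := hδ (hball δ hδδ)
  have hσ1 : σ * (β + 1) ≤ min (ρ / 2) 1 :=
    (le_div_iff₀ (by positivity)).1 (hσ₀.trans (min_le_left _ _))
  have hσ2 : σ * (Λ + 2 * β) ≤ κ :=
    (le_div_iff₀ (by positivity)).1 (hσ₀.trans (min_le_right _ _))
  have hq1 : q ≤ ρ / 2 := hqσ.trans (hσ1.trans (min_le_left _ _))
  have hq2 : q ≤ 1 := hqσ.trans (hσ1.trans (min_le_right _ _))
  set M := waveProfile f am a ap z δ
  have hsq : |s * q| = q := by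
    rcases hs with rfl | rfl <;> simp [abs_of_nonneg hq]
  have hM : |M| ≤ C := w.bound z
  have hpos : 0 ≤ mz δ z / σ * q := by have := w.pos z; positivity
  have hstable : ∀ x, |M - x| ≤ ρ / 2 →
      (∀ u v, |u - x| ≤ ρ → |v - x| ≤ ρ → u ≤ v → ν ^ 2 * (v - u) ≤ f u - f v) →
      2 * β * q ≤ -(s * (f (M + s * q) - f M)) := by
    intro x hx h
    have hx' : |M - x| ≤ ρ := hx.trans (by linarith)
    have hy : |M + s * q - x| ≤ ρ := by
      rw [show M + s * q - x = (M - x) + s * q by ring]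
      refine (abs_add_le _ _).trans ?_
      rw [hsq]; linarith
    rcases hs with rfl | rfl
    · have := h _ _ hx' hy (by linarith)
      rw [hβdef]; linarith
    · have := h _ _ hy hx' (by linarith)
      rw [hβdef]; linarith
  rcases htri z with h | h | h
  · linarith [hstable am h hm]
  · linarith [hstable ap h hp]
  · have h1 : κ / σ ≤ mz δ z / σ := by gcongr
    have h2 : Λ + 2 * β ≤ κ / σ := (le_div_iff₀ hσ).2 (by linarith)
    have h3 : |s * (f (M + s * q) - f M)| ≤ Λ * q := by
      have h4 := hΛ (M + s * q) M ((abs_add_le _ _).trans (by rw [hsq]; linarith)) (by linarith)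
      rw [add_sub_cancel_left, hsq] at h4
      rcases hs with rfl | rfl
      · rwa [one_mul]
      · rwa [neg_one_mul, abs_neg]
    have h5 : (Λ + 2 * β) * q ≤ mz δ z / σ * q := by gcongr; exact h2.trans h1
    have := (abs_le.1 h3).2
    linarith

theorem hasDerivAt_pFun (β K L ε t : ℝ) :
    HasDerivAt (pFun β K L ε)
      (β / ε ^ 2 * Real.exp (-(β * t / ε ^ 2)) + L * Real.exp (L * t)) t := by
  have h1 : HasDerivAt (fun t => -(β * t / ε ^ 2)) (-(β * 1 / ε ^ 2)) t :=
    (((hasDerivAt_id t).const_mul β).div_const _).neg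
  have h2 : HasDerivAt (fun t => L * t) (L * 1) t := (hasDerivAt_id t).const_mul L
  convert! (h1.exp.neg.add h2.exp).add_const K using 1
  ring

theorem hasDerivAt_qFun (σ β L ε t : ℝ) :
    HasDerivAt (qFun σ β L ε) (σ * (β * (-(β / ε ^ 2) * Real.exp (-(β * t / ε ^ 2))) +
      ε ^ 2 * L * (L * Real.exp (L * t)))) t := by
  have h1 : HasDerivAt (fun t => -(β * t / ε ^ 2)) (-(β * 1 / ε ^ 2)) t :=
    (((hasDerivAt_id t).const_mul β).div_const _).neg
  have h2 : HasDerivAt (fun t => L * t) (L * 1) t := (hasDerivAt_id t).const_mul L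
  convert! ((h1.exp.const_mul β).add (h2.exp.const_mul (ε ^ 2 * L))).const_mul σ using 1
  ring

/-- The barriers `u_ε^±` in one formula, with `s = ±1`. -/
def uSign {n : ℕ} (f : ℝ → ℝ) (am a ap σ β K L ε s : ℝ) (ξ : ℝ → ℝ)
    (d : EuclideanSpace ℝ (Fin n) → ℝ → ℝ) (x : EuclideanSpace ℝ (Fin n)) (t : ℝ) : ℝ :=
  waveProfile f am a ap ((d x t + s * (ε * pFun β K L ε t)) / ε) (ε * ξ t) + s * qFun σ β L ε t

theorem uSign_one {n : ℕ} (f : ℝ → ℝ) (am a ap σ β K L ε : ℝ) (ξ : ℝ → ℝ)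
    (d : EuclideanSpace ℝ (Fin n) → ℝ → ℝ) :
    uSign f am a ap σ β K L ε 1 ξ d = uPlus f am a ap σ β K L ε ξ d := by
  ext x t; simp [uSign, uPlus]

theorem uSign_neg_one {n : ℕ} (f : ℝ → ℝ) (am a ap σ β K L ε : ℝ) (ξ : ℝ → ℝ)
    (d : EuclideanSpace ℝ (Fin n) → ℝ → ℝ) :
    uSign f am a ap σ β K L ε (-1) ξ d = uMinus f am a ap σ β K L ε ξ d := by
  ext x t; simp [uSign, uMinus, sub_eq_add_neg]

/-- The error terms in the barrier inequality. -/
theorem abs_barrier_error_le {C C₁ d₀ K ε e p s D G lap v c z m₁ m₂ : ℝ}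
    (hC : 0 < C) (hC₁ : 0 ≤ C₁) (hd₀ : 0 < d₀) (hK : 0 < K) (hε : 0 < ε) (hε1 : ε ≤ 1) (he : 1 ≤ e)
    (hp0 : 0 ≤ p) (hp : p ≤ e + K) (hpd : ε * p ≤ d₀ / 2) (hs : s = 1 ∨ s = -1)
    (hz : ε * z = D + s * (ε * p)) (hc : |c| ≤ C) (hm₁ : 0 < m₁) (h1 : (1 + |z|) ^ 2 * m₁ ≤ C)
    (h2 : (1 + |z|) ^ 2 * |m₂| ≤ C) (hG : 0 ≤ G)
    (h : (G = 1 ∧ |v - lap + c / ε| ≤ C₁ * |D|) ∨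
      (d₀ ≤ |D| ∧ |v - lap| ≤ C₁ * (1 + |c / ε|) ∧ G ≤ C₁)) :
    |m₁ / ε * (v - lap + c / ε)| + |(1 - G) * m₂ / ε ^ 2| ≤
      (C₁ * C * (2 + K) + 4 * C / d₀ ^ 2 * (C₁ * (1 + C) + C + 1 + C₁)) * e := by
  have hsp : |s * (ε * p)| = ε * p := by
    rcases hs with rfl | rfl <;> simp [abs_of_nonneg hp0, abs_of_pos hε]
  have hz0 := abs_nonneg z
  -- Near the front the gradient error vanishes and `|D| ≤ ε(|z| + p)` cancels the factor `1/ε`. In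
  -- the other case `εp ≤ d₀/2` leaves `|z| ≥ d₀/(2ε)`, so the quadratic weight makes `m₁` and `m₂`
  -- of order `ε²`.
  rcases h with ⟨rfl, h⟩ | ⟨hD, h, hG1⟩
  · have hDle : |D| ≤ ε * (|z| + p) := by
      rw [show D = ε * z - s * (ε * p) by linarith]
      refine (abs_sub _ _).trans ?_
      rw [hsp, abs_mul, abs_of_pos hε, mul_add]
    have a1 : m₁ * |z| ≤ C := le_trans (by nlinarith [mul_nonneg hz0 hz0]) h1
    have a2 : m₁ ≤ C := le_trans (by nlinarith [mul_nonneg hz0 hz0, mul_nonneg hm₁.le hz0]) h1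
    have a3 : |m₁ / ε * (v - lap + c / ε)| ≤ C₁ * C * (2 + K) * e := by
      rw [abs_mul, abs_of_pos (div_pos hm₁ hε)]
      calc m₁ / ε * |v - lap + c / ε| ≤ m₁ / ε * (C₁ * (ε * (|z| + p))) := by
            gcongr; exact h.trans (by gcongr)
        _ = C₁ * (m₁ * |z| + m₁ * p) := by field_simp
        _ ≤ C₁ * (C + C * p) := by gcongr
        _ ≤ C₁ * (C * ((2 + K) * e)) := by
            have : 1 + p ≤ (2 + K) * e := by nlinarith
            have := mul_le_mul_of_nonneg_left this hC.le
            gcongr; linarith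
        _ = _ := by ring
    have a4 : 0 ≤ 4 * C / d₀ ^ 2 * (C₁ * (1 + C) + C + 1 + C₁) * e := by positivity
    rw [sub_self, zero_mul, zero_div, abs_zero]
    linarith
  · have hzd : d₀ / (2 * ε) ≤ |z| := by
      rw [div_le_iff₀ (by positivity)]
      have : |D| ≤ ε * |z| + ε * p := by
        rw [show D = ε * z - s * (ε * p) by linarith]
        refine (abs_sub _ _).trans ?_
        rw [hsp, abs_mul, abs_of_pos hε]
      linarith
    have key : ∀ w, (1 + |z|) ^ 2 * w ≤ C → 0 ≤ w → w ≤ 4 * C / d₀ ^ 2 * ε ^ 2 := by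
      intro w hw hw0
      have b1 : (d₀ / (2 * ε)) ^ 2 * w ≤ C := le_trans (by gcongr; linarith) hw
      have b2 : (d₀ / (2 * ε)) ^ 2 * w = w * d₀ ^ 2 / (4 * ε ^ 2) := by field_simp; ring
      rw [b2, div_le_iff₀ (by positivity)] at b1
      rw [div_mul_eq_mul_div, le_div_iff₀ (by positivity)]
      linarith
    have b1 := key m₁ h1 hm₁.le
    have b2 := key |m₂| h2 (abs_nonneg _)
    have b3 : ε * |c / ε| ≤ C := by
      rw [abs_div, abs_of_pos hε, mul_div_cancel₀ _ hε.ne']; exact hc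
    have b4 : |m₁ / ε * (v - lap + c / ε)| ≤ 4 * C / d₀ ^ 2 * (C₁ * (1 + C) + C) := by
      rw [abs_mul, abs_of_pos (div_pos hm₁ hε)]
      have b5 : |v - lap + c / ε| ≤ C₁ * (1 + |c / ε|) + |c / ε| :=
        (abs_add_le _ _).trans (by linarith)
      have b6 : ε * (C₁ * (1 + |c / ε|) + |c / ε|) ≤ C₁ * (1 + C) + C := by
        have : C₁ * (ε + ε * |c / ε|) ≤ C₁ * (1 + C) := by gcongr
        linarith
      calc m₁ / ε * |v - lap + c / ε|
          ≤ 4 * C / d₀ ^ 2 * ε ^ 2 / ε * (C₁ * (1 + |c / ε|) + |c / ε|) := by gcongr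
        _ = 4 * C / d₀ ^ 2 * (ε * (C₁ * (1 + |c / ε|) + |c / ε|)) := by field_simp
        _ ≤ _ := by gcongr
    have b5 : |(1 - G) * m₂ / ε ^ 2| ≤ 4 * C / d₀ ^ 2 * (1 + C₁) := by
      rw [abs_div, abs_mul, abs_of_pos (pow_pos hε 2), div_le_iff₀ (by positivity)]
      have : |1 - G| ≤ 1 + C₁ := abs_le.2 ⟨by linarith, by linarith⟩
      calc |1 - G| * |m₂| ≤ (1 + C₁) * (4 * C / d₀ ^ 2 * ε ^ 2) := by gcongr
        _ = _ := by ring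
    have b6 : 0 ≤ C₁ * C * (2 + K) := by positivity
    have b7 : 0 ≤ 4 * C / d₀ ^ 2 * (C₁ * (1 + C) + C + 1 + C₁) := by positivity
    have b8 : 4 * C / d₀ ^ 2 * (C₁ * (1 + C) + C) + 4 * C / d₀ ^ 2 * (1 + C₁) =
      4 * C / d₀ ^ 2 * (C₁ * (1 + C) + C + 1 + C₁) := by ring
    nlinarith

/-- The Allen–Cahn operator applied to the barriers, with the traveling wave equation inserted. -/
theorem WaveBounds.acOperator_uSign {f : ℝ → ℝ} {am a ap C σ β K L ε s ξ' v t : ℝ} {mz : ℝ → ℝ}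
    {n : ℕ} {D : EuclideanSpace ℝ (Fin n) → ℝ → ℝ} {ξ : ℝ → ℝ} {x : EuclideanSpace ℝ (Fin n)}
    (w : WaveBounds f am a ap C (ε * ξ t) mz) (hf : Continuous f) (hε : 0 < ε)
    (hs : s = 1 ∨ s = -1) (hξ' : HasDerivAt ξ ξ' t) (hv : HasDerivAt (D x) v t)
    (hD2 : ContDiffAt ℝ 2 (fun y => D y t) x) {z m : ℝ}
    (hz : z = (D x t + s * (ε * pFun β K L ε t)) / ε)
    (hm : m = waveProfile f am a ap z (ε * ξ t)) :
    (DifferentiableAt ℝ (fun r => uSign f am a ap σ β K L ε s ξ D x r) t ∧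
      ContDiffAt ℝ 2 (fun y => uSign f am a ap σ β K L ε s ξ D y t) x) ∧
    ∃ Dδ, |Dδ| ≤ C ∧ s * acOperator f ε ξ (uSign f am a ap σ β K L ε s ξ D) x t =
      s * (mz z / ε * (v - (Δ fun y => D y t) x + waveSpeed f am a ap (ε * ξ t) / ε) +
        (1 - ‖_root_.fderiv ℝ (fun y => D y t) x‖ ^ 2) *
          -(waveSpeed f am a ap (ε * ξ t) * mz z + (f m + ε * ξ t)) / ε ^ 2 + Dδ * (ε * ξ')) +
      (mz z * _root_.deriv (pFun β K L ε) t + _root_.deriv (qFun σ β L ε) t -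
        s * (f (m + s * qFun σ β L ε t) - f m) / ε ^ 2) := by
  subst hz hm
  set δ := ε * ξ t with hδ
  have hp' := (hasDerivAt_pFun β K L ε t).differentiableAt.hasDerivAt
  have hq' := (hasDerivAt_qFun σ β L ε t).differentiableAt.hasDerivAt
  set p := pFun β K L ε t with hpdef
  set q := qFun σ β L ε t with hqdef
  set z := (D x t + s * (ε * p)) / ε with hz
  obtain ⟨Dδ, hDδ, hfd⟩ := w.fderiv z
  set c := waveSpeed f am a ap δ
  set m := waveProfile f am a ap z δ with hm
  have hss : s * s = 1 := by rcases hs with rfl | rfl <;> norm_num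
  set pt := _root_.deriv (pFun β K L ε) t
  set qt := _root_.deriv (qFun σ β L ε) t
  have hz' : HasDerivAt (fun r => (D x r + s * (ε * pFun β K L ε r)) / ε)
      ((v + s * (ε * pt)) / ε) t := (hv.add ((hp'.const_mul ε).const_mul s)).div_const ε
  have ht' : HasDerivAt (fun r => uSign f am a ap σ β K L ε s ξ D x r)
      ((mz z * ((v + s * (ε * pt)) / ε) + Dδ * (ε * ξ')) + s * qt) t := by
    have := hfd.comp_hasDerivAt t (hz'.prodMk (hξ'.const_mul ε))
    refine HasDerivAt.add ?_ (hq'.const_mul s)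
    convert! this using 1
  have hh1 : ∀ y, HasDerivAt (fun y => waveProfile f am a ap ((y + s * (ε * p)) / ε) δ + s * q)
      (mz ((y + s * (ε * p)) / ε) / ε) y := fun y => by
    have h1 : HasDerivAt (fun y => (y + s * (ε * p)) / ε) (1 / ε) y :=
      ((hasDerivAt_id y).add_const _).div_const ε
    convert! ((w.deriv _).comp y h1).add_const (s * q) using 1
    ring
  set mzz := -(c * mz z) - (f m + δ) with hmzz
  have hh2 : HasDerivAt (fun y => mz ((y + s * (ε * p)) / ε) / ε) (mzz / ε ^ 2) (D x t) := by
    have h1 : HasDerivAt (fun y => (y + s * (ε * p)) / ε) (1 / ε) (D x t) :=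
      ((hasDerivAt_id _).add_const _).div_const ε
    convert! ((w.deriv_deriv _).comp (D x t) h1).div_const ε using 1
    change mzz / ε ^ 2 = mzz * (1 / ε) / ε
    field_simp
  have hlap := laplacian_comp hD2 hh1 hh2
  have hspace : (fun y => uSign f am a ap σ β K L ε s ξ D y t) =
    fun y => (fun y => waveProfile f am a ap ((y + s * (ε * p)) / ε) δ + s * q) (D y t) := rfl
  refine ⟨⟨ht'.differentiableAt, ?_⟩, Dδ, hDδ, ?_⟩
  · rw [hspace]
    have h1 : ContDiff ℝ 2 fun y : ℝ => (y + s * (ε * p)) / ε := by fun_prop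
    have h2 : ContDiff ℝ 2 (fun y => waveProfile f am a ap ((y + s * (ε * p)) / ε) δ + s * q) :=
      ((w.contDiff hf).comp h1).add contDiff_const
    exact h2.contDiffAt.comp x hD2
  have hz1 : (D x t + s * (ε * p)) / ε = z := rfl
  have hu : uSign f am a ap σ β K L ε s ξ D x t = m + s * q := rfl
  rw [hz1] at hlap
  rw [acOperator, ht'.deriv, hspace, hlap, hu]
  -- The forcing is exactly the constant `δ` of the wave equation at scale `ε²`, so the two cancel
  -- and only the increment of `f` caused by `q` survives.
  have e1 : 1 / ε * ξ t = δ / ε ^ 2 := by rw [hδ]; field_simp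
  have e2 : f m = -mzz - c * mz z - δ := by rw [hmzz]; ring
  have e3 : mz z * ((v + s * (ε * pt)) / ε) = mz z / ε * v + s * (mz z * pt) := by
    field_simp
  have e4 : s * (s * (mz z * pt)) = mz z * pt := by rw [← mul_assoc, hss, one_mul]
  have e5 : s * (s * qt) = qt := by rw [← mul_assoc, hss, one_mul]
  have e6 : -(c * mz z + (f m + δ)) = mzz := by rw [hmzz]; ring
  rw [e6, e1, e2, e3]
  simp only [mul_add, mul_sub, e4, e5]
  field_simp
  ring

set_option maxHeartbeats 1000000 in
-- The order of the constants is the point: `A` bounds the errors and does not involve `L`; `L` is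
-- then so large that `βσL` exceeds `A`; finally `ε₀` may depend on `L` through `e^{LT}`. Everything
-- is pointwise in `(x, t)`, so the two noise situations can share it.
theorem IsBalancedBistable.exists_barriers {f : ℝ → ℝ} {am a ap : ℝ}
    (hf : IsBalancedBistable f am a ap) :
    ∃ β > 0, ∃ σ₀ > 0, ∃ δ₀ > 0,
      (∀ δ, |δ| ≤ δ₀ → ContinuousAt (waveSpeed f am a ap) δ) ∧
      ∀ σ, 0 < σ → σ ≤ σ₀ → ∀ C₁ C₂ T d₀ K : ℝ, 0 ≤ C₁ → 0 ≤ C₂ → 0 < d₀ → 1 < K →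
      ∃ ε₀ > 0, ∃ L > 0, ∀ ε, 0 < ε → ε < ε₀ → ∀ (n : ℕ) (D : EuclideanSpace ℝ (Fin n) → ℝ → ℝ)
        (ξ : ℝ → ℝ) (ξ' : ℝ) (x : EuclideanSpace ℝ (Fin n)) (t s : ℝ), 0 < t → t < T →
        |ε * ξ t| ≤ δ₀ → HasDerivAt ξ ξ' t → |ε * ξ'| ≤ C₂ →
        IsCutoffDistanceAt D (waveSpeed f am a ap (ε * ξ t) / ε) C₁ d₀ x t → (s = 1 ∨ s = -1) →
        (DifferentiableAt ℝ (fun r => uSign f am a ap σ β K L ε s ξ D x r) t ∧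
          ContDiffAt ℝ 2 (fun y => uSign f am a ap σ β K L ε s ξ D y t) x) ∧
        0 ≤ s * acOperator f ε ξ (uSign f am a ap σ β K L ε s ξ D) x t := by
  obtain ⟨β, hβ, σ₀, hσ₀, δ₀, hδ₀, C, hC, mz, hw, hreact⟩ := hf.exists_reaction_bound
  refine ⟨β, hβ, σ₀, hσ₀, δ₀, hδ₀, fun δ h => (hw δ h).speed_continuousAt, ?_⟩
  intro σ hσ hσσ₀ C₁ C₂ T d₀ K hC₁ hC₂ hd₀ hK
  set A := C₁ * C * (2 + K) + 4 * C / d₀ ^ 2 * (C₁ * (1 + C) + C + 1 + C₁) + C * C₂ with hA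
  have hA0 : 0 ≤ A := by positivity
  set L := A / (β * σ) + 1 with hL
  have hL0 : 0 < L := by positivity
  set E := Real.exp (L * T) with hE
  have hE0 : 0 < E := Real.exp_pos _
  -- The second bound on `ε` ensures `ε² L e^{Lt} ≤ 1`, hence `q ≤ σ(β + 1)`; the third ensures `εp
  -- ≤ d₀/2`.
  refine ⟨min 1 (min (1 / (L * E + 1)) (d₀ / (2 * (E + K)))), by positivity, L, hL0, ?_⟩
  intro ε hε hεε₀ n D ξ ξ' x t s ht htT hξ hξ' hCξ hD hs
  have hε1 : ε ≤ 1 := hεε₀.le.trans (min_le_left _ _)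
  have hε2 : ε * (L * E + 1) ≤ 1 := (le_div_iff₀ (by positivity)).1
    (hεε₀.le.trans ((min_le_right _ _).trans (min_le_left _ _)))
  have hε3 : ε * (2 * (E + K)) ≤ d₀ := (le_div_iff₀ (by positivity)).1
    (hεε₀.le.trans ((min_le_right _ _).trans (min_le_right _ _)))
  obtain ⟨hD2, v, hv, hcases⟩ := hD
  set δ := ε * ξ t with hδ
  have w := hw δ hξ
  set e := Real.exp (L * t) with he
  set k := Real.exp (-(β * t / ε ^ 2)) with hk
  have hk0 : 0 < k := Real.exp_pos _
  have hk1 : k ≤ 1 := Real.exp_le_one_iff.2 (by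
    have : 0 ≤ β * t / ε ^ 2 := by positivity
    linarith)
  have he1 : 1 ≤ e := Real.one_le_exp (by positivity)
  have heE : e ≤ E := Real.exp_le_exp.2 (by gcongr)
  set p := pFun β K L ε t with hpdef
  set q := qFun σ β L ε t with hqdef
  have hpe : p = -k + e + K := rfl
  have hqe : q = σ * (β * k + ε ^ 2 * L * e) := rfl
  set z := (D x t + s * (ε * p)) / ε with hz
  set c := waveSpeed f am a ap δ
  set m := waveProfile f am a ap z δ with hm
  have hp' := (hasDerivAt_pFun β K L ε t).deriv
  have hq' := (hasDerivAt_qFun σ β L ε t).deriv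
  rw [← hk, ← he] at hp' hq'
  obtain ⟨hreg, Dδ, hDδ, hop⟩ := w.acOperator_uSign (σ := σ) hf.continuous hε hs hξ' hv hD2 hz hm
  refine ⟨hreg, ?_⟩
  rw [hop, hp', hq']
  set pt := β / ε ^ 2 * k + L * e with hpt
  set qt := σ * (β * (-(β / ε ^ 2) * k) + ε ^ 2 * L * (L * e)) with hqt
  set mzz := -(c * mz δ z + (f m + δ)) with hmzz
  set lap := (Δ fun y => D y t) x
  set G := ‖fderiv ℝ (fun y => D y t) x‖ ^ 2 with hG
  have hq0 : 0 ≤ q := by rw [hqe]; positivity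
  have hqσ : q ≤ σ * (β + 1) := by
    have : ε ^ 2 * L * e ≤ 1 := by
      calc ε ^ 2 * L * e ≤ ε * L * E := by gcongr; exact pow_le_of_le_one hε.le hε1 two_ne_zero
        _ ≤ 1 := by linarith
    rw [hqe]
    gcongr
    nlinarith
  have hR := hreact σ hσ hσσ₀ δ hξ z q s hq0 hqσ hs
  rw [← hm] at hR
  have hp0 : 0 ≤ p := by rw [hpe]; linarith
  have hpd : ε * p ≤ d₀ / 2 := by
    have : ε * p ≤ ε * (E + K) := by gcongr; rw [hpe]; linarith
    linarith
  have hcases' : (G = 1 ∧ |v - lap + c / ε| ≤ C₁ * |D x t|) ∨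
      (d₀ ≤ |D x t| ∧ |v - lap| ≤ C₁ * (1 + |c / ε|) ∧ G ≤ C₁) := by
    rcases hcases with ⟨h, h'⟩ | h
    · exact Or.inl ⟨by rw [hG, h, one_pow], h'⟩
    · exact Or.inr h
  have hm2 : (1 + |z|) ^ 2 * |mzz| ≤ C := by
    rw [hmzz, abs_neg]; exact w.decay_deriv z
  have herr := abs_barrier_error_le (z := z) (K := K) (G := G) (D := D x t) (c := c) hC hC₁ hd₀ (by linarith) hε hε1 he1 hp0
    (by rw [hpe]; linarith) hpd hs (by rw [hz]; field_simp) w.speed (w.pos z) (w.decay z) hm2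
    (sq_nonneg _) hcases'
  have herr2 : |Dδ * (ε * ξ')| ≤ C * C₂ * e := by
    rw [abs_mul]
    calc |Dδ| * |ε * ξ'| ≤ C * C₂ := by gcongr
      _ ≤ C * C₂ * e := le_mul_of_one_le_right (by positivity) he1
  have hgood : β * q / ε ^ 2 ≤ mz δ z * pt + qt - s * (f (m + s * q) - f m) / ε ^ 2 := by
    -- The identity that `p` and `q` were designed for.
    have e1 : pt = q / σ / ε ^ 2 := by rw [hpt, hqe]; field_simp
    -- The initial layer `e^{-βt/ε²}` of `q` decays at exactly the rate `β/ε²`, and the other part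
    -- of `q` increases. So `q'` costs at most half of the gain `2βq/ε²`.
    have e2 : -(β * q) / ε ^ 2 ≤ qt := by
      have : qt - -(β * q) / ε ^ 2 = σ * (ε ^ 2 * L * (L * e)) + β * σ * L * e := by
        rw [hqt, hqe]; field_simp; ring
      have : 0 ≤ σ * (ε ^ 2 * L * (L * e)) + β * σ * L * e := by positivity
      linarith
    have e3 : 2 * β * q / ε ^ 2 ≤ (mz δ z / σ * q - s * (f (m + s * q) - f m)) / ε ^ 2 := by
      gcongr
    have e4 : (mz δ z / σ * q - s * (f (m + s * q) - f m)) / ε ^ 2 =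
        mz δ z * pt - s * (f (m + s * q) - f m) / ε ^ 2 := by rw [e1]; field_simp
    have e5 : 2 * β * q / ε ^ 2 + -(β * q) / ε ^ 2 = β * q / ε ^ 2 := by ring
    linarith
  have hbig : A * e ≤ β * q / ε ^ 2 := by
    have e1 : β * q / ε ^ 2 = β * σ * L * e + β * σ * β * k / ε ^ 2 := by
      rw [hqe]; field_simp; ring
    have e2 : β * σ * L = A + β * σ := by rw [hL]; field_simp
    have e3 : 0 ≤ β * σ * β * k / ε ^ 2 := by positivity
    have e4 : 0 ≤ β * σ * e := by positivity
    rw [e1, e2]; linarith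
  set R := mz δ z / ε * (v - lap + c / ε) + (1 - G) * mzz / ε ^ 2 + Dδ * (ε * ξ') with hRdef
  have hRle : |s * R| ≤ A * e := by
    have : |s * R| = |R| := by rcases hs with rfl | rfl <;> simp
    rw [this, hRdef]
    refine (abs_add_le _ _).trans ?_
    have := abs_add_le (mz δ z / ε * (v - lap + c / ε)) ((1 - G) * mzz / ε ^ 2)
    rw [hA, add_mul _ (C * C₂)]
    linarith
  have := (abs_le.1 hRle).1
  linarith

/-! ### Signed distances to strictly convex planar curves -/

abbrev Plane := EuclideanSpace ℝ (Fin 2)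

theorem gaussNormal_eq (θ : ℝ) :
    gaussNormal θ = Real.cos θ • gaussNormal 0 + Real.sin θ • gaussTangent 0 := by
  ext i; fin_cases i <;> simp [gaussNormal, gaussTangent]

theorem gaussTangent_eq (θ : ℝ) :
    gaussTangent θ = -Real.sin θ • gaussNormal 0 + Real.cos θ • gaussTangent 0 := by
  ext i; fin_cases i <;> simp [gaussNormal, gaussTangent]

theorem hasDerivAt_gaussNormal (θ : ℝ) : HasDerivAt gaussNormal (gaussTangent θ) θ := by
  rw [gaussTangent_eq]
  exact (((Real.hasDerivAt_cos θ).smul_const (gaussNormal 0)).add ((Real.hasDerivAt_sin θ).smul_const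
    (gaussTangent 0))).congr_of_eventuallyEq (Eventually.of_forall gaussNormal_eq)

theorem hasDerivAt_gaussTangent (θ : ℝ) : HasDerivAt gaussTangent (-gaussNormal θ) θ := by
  rw [gaussNormal_eq, neg_add, ← neg_smul, ← neg_smul]
  exact (((Real.hasDerivAt_sin θ).neg.smul_const (gaussNormal 0)).add
    ((Real.hasDerivAt_cos θ).smul_const (gaussTangent 0))).congr_of_eventuallyEq
      (Eventually.of_forall gaussTangent_eq)

theorem contDiff_gaussNormal : ContDiff ℝ (⊤ : ℕ∞) gaussNormal := by
  rw [funext gaussNormal_eq]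
  exact (Real.contDiff_cos.smul contDiff_const).add (Real.contDiff_sin.smul contDiff_const)

theorem contDiff_gaussTangent : ContDiff ℝ (⊤ : ℕ∞) gaussTangent := by
  rw [funext gaussTangent_eq]
  exact (Real.contDiff_sin.neg.smul contDiff_const).add (Real.contDiff_cos.smul contDiff_const)

theorem inner_plane (u v : Plane) : inner ℝ u v = u 0 * v 0 + u 1 * v 1 := by
  simp [PiLp.inner_apply, Fin.sum_univ_two, mul_comm]

theorem inner_gaussNormal_self (θ : ℝ) : inner ℝ (gaussNormal θ) (gaussNormal θ) = 1 := by
  rw [inner_plane]; simp [gaussNormal, ← sq]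

theorem inner_gaussTangent_self (θ : ℝ) : inner ℝ (gaussTangent θ) (gaussTangent θ) = 1 := by
  rw [inner_plane]; simp [gaussTangent, ← sq]

theorem inner_gaussTangent_gaussNormal (θ : ℝ) :
    inner ℝ (gaussTangent θ) (gaussNormal θ) = 0 := by
  rw [inner_plane]; simp [gaussTangent, gaussNormal]; ring

theorem norm_gaussNormal (θ : ℝ) : ‖gaussNormal θ‖ = 1 := by
  rw [norm_eq_sqrt_real_inner, inner_gaussNormal_self, Real.sqrt_one]

theorem norm_gaussTangent (θ : ℝ) : ‖gaussTangent θ‖ = 1 := by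
  rw [norm_eq_sqrt_real_inner, inner_gaussTangent_self, Real.sqrt_one]

theorem gauss_frame_decomp (v : Plane) (θ : ℝ) :
    v = inner ℝ v (gaussNormal θ) • gaussNormal θ + inner ℝ v (gaussTangent θ) • gaussTangent θ := by
  have h := Real.sin_sq_add_cos_sq θ
  ext i
  fin_cases i
  · simp [inner_plane, gaussNormal, gaussTangent]
    linear_combination -(v 0) * h
  · simp [inner_plane, gaussNormal, gaussTangent]
    linear_combination -(v 1) * h

theorem gaussNormal_periodic : Function.Periodic gaussNormal (2 * Real.pi) := fun θ => by
  simp [gaussNormal]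

theorem exists_gaussNormal_eq (v : Plane) : ∃ θ, v = ‖v‖ • gaussNormal θ := by
  refine ⟨Complex.arg ⟨v 0, v 1⟩, ?_⟩
  have h : ‖v‖ = ‖(⟨v 0, v 1⟩ : ℂ)‖ := by
    rw [EuclideanSpace.norm_eq, Complex.norm_def, Complex.normSq_apply]
    simp [Fin.sum_univ_two, sq]
  rw [h]
  ext i
  fin_cases i
  · simp [gaussNormal, Complex.norm_mul_cos_arg]
  · simp [gaussNormal, Complex.norm_mul_sin_arg]

/-- A convex set and its closure have the same interior once the set has interior points. It does
here: its affine span is closed, so it contains the closure and thus an open set. -/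
theorem mem_interior_of_mem_nhds_closure {E : Type*} [NormedAddCommGroup E] [NormedSpace ℝ E]
    [FiniteDimensional ℝ E] {s : Set E} (hs : Convex ℝ s) {x : E} (hx : closure s ∈ 𝓝 x) :
    x ∈ interior s := by
  have h1 : x ∈ interior (closure s) := mem_interior_iff_mem_nhds.2 hx
  have h2 : affineSpan ℝ s = ⊤ := by
    have h3 : closure s ⊆ affineSpan ℝ s := closure_minimal (subset_affineSpan ℝ s)
      (AffineSubspace.closed_of_finiteDimensional _)
    have h4 := isOpen_interior.affineSpan_eq_top ⟨x, h1⟩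
    refine top_unique (h4.symm.le.trans ?_)
    exact affineSpan_le.2 (interior_subset.trans h3)
  rwa [hs.interior_closure_eq_interior_of_nonempty_interior
    (hs.interior_nonempty_iff_affineSpan_eq_top.2 h2)] at h1

/-- If `g'' + g = -κ ≤ -r` and `g'(θ₀) = 0`, then `g` lies below the solution of `h'' + h = -r`
with the same initial data. -/
theorem le_of_deriv_deriv_add_eq {g g' κ : ℝ → ℝ} {r θ₀ θ : ℝ}
    (hg : ∀ s, HasDerivAt g (g' s) s) (hg' : ∀ s, HasDerivAt g' (-(κ s + g s)) s)
    (hκ : ∀ s, r ≤ κ s) (h0 : g' θ₀ = 0) (hθ : |θ - θ₀| ≤ Real.pi) :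
    g θ ≤ g θ₀ - (g θ₀ + r) * (1 - Real.cos (θ - θ₀)) := by
  -- Variation of constants: propagate by the flow of `y'' + y = 0` from angle `s` to `θ` the
  -- difference between `g` and the comparison solution. Then `A θ` is the difference at `θ`, and
  -- `A' = (r - κ) sin(θ - s)` has one sign on the way because `|θ - θ₀| ≤ π`.
  set A : ℝ → ℝ := fun s => (g s + r - (g θ₀ + r) * Real.cos (s - θ₀)) * Real.cos (θ - s) +
    (g' s + (g θ₀ + r) * Real.sin (s - θ₀)) * Real.sin (θ - s) with hA
  have d : ∀ s, HasDerivAt A ((r - κ s) * Real.sin (θ - s)) s := by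
    intro s
    have a1 : HasDerivAt (fun s => Real.cos (s - θ₀)) (-Real.sin (s - θ₀) * 1) s :=
      ((hasDerivAt_id s).sub_const θ₀).cos
    have a2 : HasDerivAt (fun s => Real.sin (s - θ₀)) (Real.cos (s - θ₀) * 1) s :=
      ((hasDerivAt_id s).sub_const θ₀).sin
    have a3 : HasDerivAt (fun s => Real.cos (θ - s)) (-Real.sin (θ - s) * -1) s :=
      ((hasDerivAt_id s).const_sub θ).cos
    have a4 : HasDerivAt (fun s => Real.sin (θ - s)) (Real.cos (θ - s) * -1) s :=
      ((hasDerivAt_id s).const_sub θ).sin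
    convert! ((((hg s).add_const r).sub (a1.const_mul (g θ₀ + r))).mul a3).add
      (((hg' s).add (a2.const_mul (g θ₀ + r))).mul a4) using 1
    simp only [Pi.sub_apply, Pi.add_apply]
    ring
  have e0 : A θ₀ = 0 := by simp [hA, h0]
  have e1 : A θ = g θ + r - (g θ₀ + r) * Real.cos (θ - θ₀) := by simp [hA]
  have key : A θ ≤ A θ₀ := by
    have hc : ContinuousOn A univ := fun s _ => (d s).continuousAt.continuousWithinAt
    obtain ⟨l1, l2⟩ := abs_le.1 hθ
    rcases le_total θ₀ θ with h | h
    · refine antitoneOn_of_deriv_nonpos (convex_Icc θ₀ θ) (hc.mono (subset_univ _))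
        (fun s _ => (d s).differentiableAt.differentiableWithinAt) (fun s hs => ?_)
        (left_mem_Icc.2 h) (right_mem_Icc.2 h) h
      rw [interior_Icc] at hs
      rw [(d s).deriv]
      exact mul_nonpos_of_nonpos_of_nonneg (by linarith [hκ s])
        (Real.sin_nonneg_of_nonneg_of_le_pi (by linarith [hs.2]) (by linarith [hs.1]))
    · refine monotoneOn_of_deriv_nonneg (convex_Icc θ θ₀) (hc.mono (subset_univ _))
        (fun s _ => (d s).differentiableAt.differentiableWithinAt) (fun s hs => ?_)
        (left_mem_Icc.2 h) (right_mem_Icc.2 h) h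
      rw [interior_Icc] at hs
      rw [(d s).deriv]
      exact mul_nonneg_of_nonpos_of_nonpos (by linarith [hκ s])
        (Real.sin_nonpos_of_nonpos_of_neg_pi_le (by linarith [hs.1]) (by linarith [hs.2]))
  rw [e0, e1] at key
  linarith

/-- A closed curve parametrized by its Gauss angle, with curvature `k`. -/
structure IsGaussCurve (X : ℝ → Plane) (k : ℝ → ℝ) : Prop where
  periodic : Function.Periodic X (2 * Real.pi)
  pos : ∀ θ, 0 < k θ
  deriv : ∀ θ, HasDerivAt X ((k θ)⁻¹ • gaussTangent θ) θ
  continuous_curvature : Continuous k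

/-- The signed distance of `y` to the tangent line of the curve at `X θ`. -/
def tangentGap (X : ℝ → Plane) (y : Plane) (θ : ℝ) : ℝ := inner ℝ (y - X θ) (gaussNormal θ)

/-- The tangential coordinate of `y` with respect to the frame at `X θ`. -/
def tangentShift (X : ℝ → Plane) (y : Plane) (θ : ℝ) : ℝ := inner ℝ (y - X θ) (gaussTangent θ)

/-- The curve is as far as possible below `y` in the direction with angle `θ`. -/
def IsFootAngle (X : ℝ → Plane) (y : Plane) (θ : ℝ) : Prop :=
  ∀ η, tangentGap X y η ≤ tangentGap X y θ

theorem abs_tangentGap_sub_le (X : ℝ → Plane) (y y' : Plane) (θ : ℝ) :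
    |tangentGap X y θ - tangentGap X y' θ| ≤ ‖y - y'‖ := by
  rw [tangentGap, tangentGap, ← inner_sub_left, sub_sub_sub_cancel_right]
  refine (abs_real_inner_le_norm _ _).trans ?_
  rw [norm_gaussNormal, mul_one]

theorem abs_tangentGap_sub_le' (X X' : ℝ → Plane) (y : Plane) (θ : ℝ) :
    |tangentGap X y θ - tangentGap X' y θ| ≤ ‖X θ - X' θ‖ := by
  rw [tangentGap, tangentGap, ← inner_sub_left, sub_sub_sub_cancel_left, norm_sub_rev]
  refine (abs_real_inner_le_norm _ _).trans ?_
  rw [norm_gaussNormal, mul_one]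

namespace IsGaussCurve

variable {X : ℝ → Plane} {k : ℝ → ℝ}

theorem continuous (h : IsGaussCurve X k) : Continuous X :=
  continuous_iff_continuousAt.2 fun θ => (h.deriv θ).continuousAt

theorem contDiff (h : IsGaussCurve X k) : ContDiff ℝ 1 X := by
  rw [contDiff_one_iff_deriv]
  refine ⟨fun θ => (h.deriv θ).differentiableAt, ?_⟩
  rw [show _root_.deriv X = fun θ => (k θ)⁻¹ • gaussTangent θ from funext fun θ => (h.deriv θ).deriv]
  exact (h.continuous_curvature.inv₀ fun θ => (h.pos θ).ne').smul contDiff_gaussTangent.continuous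

theorem hasDerivAt_tangentGap (h : IsGaussCurve X k) (y : Plane) (θ : ℝ) :
    HasDerivAt (tangentGap X y) (tangentShift X y θ) θ := by
  have h1 := ((h.deriv θ).const_sub y).inner ℝ (hasDerivAt_gaussNormal θ)
  convert! h1 using 1
  rw [inner_neg_left, real_inner_smul_left, inner_gaussTangent_gaussNormal, mul_zero, neg_zero,
    add_zero, tangentShift]

theorem hasDerivAt_tangentShift (h : IsGaussCurve X k) (y : Plane) (θ : ℝ) :
    HasDerivAt (tangentShift X y) (-((k θ)⁻¹ + tangentGap X y θ)) θ := by
  have h1 := ((h.deriv θ).const_sub y).inner ℝ (hasDerivAt_gaussTangent θ)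
  convert! h1 using 1
  rw [inner_neg_left, inner_neg_right, real_inner_smul_left, inner_gaussTangent_self, mul_one,
    tangentGap]
  ring

theorem tangentGap_periodic (h : IsGaussCurve X k) (y : Plane) :
    Function.Periodic (tangentGap X y) (2 * Real.pi) := fun θ => by
  rw [tangentGap, tangentGap, h.periodic, gaussNormal_periodic]

theorem exists_isFootAngle (h : IsGaussCurve X k) (y : Plane) : ∃ θ, IsFootAngle X y θ := by
  have hc : Continuous (tangentGap X y) :=
    continuous_iff_continuousAt.2 fun θ => (h.hasDerivAt_tangentGap y θ).continuousAt
  obtain ⟨θ, _, hθ⟩ := (isCompact_Icc (a := 0) (b := 2 * Real.pi)).exists_isMaxOn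
    (nonempty_Icc.2 Real.two_pi_pos.le) hc.continuousOn
  refine ⟨θ, fun η => ?_⟩
  obtain ⟨η', hη', e⟩ := (h.tangentGap_periodic y).exists_mem_Ico₀ Real.two_pi_pos η
  rw [e]
  exact hθ (Ico_subset_Icc_self hη')

theorem tangentShift_eq_zero (h : IsGaussCurve X k) {y : Plane} {θ : ℝ} (hθ : IsFootAngle X y θ) :
    tangentShift X y θ = 0 := by
  have : IsLocalMax (tangentGap X y) θ := Eventually.of_forall hθ
  exact this.hasDerivAt_eq_zero (h.hasDerivAt_tangentGap y θ)

theorem exists_near_angle {η θ : ℝ} : ∃ m : ℤ, |η - m • (2 * Real.pi) - θ| ≤ Real.pi := by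
  obtain ⟨m, hm, -⟩ := existsUnique_sub_zsmul_mem_Ico Real.two_pi_pos η (θ - Real.pi)
  exact ⟨m, abs_le.2 ⟨by linarith [hm.1], by linarith [hm.2]⟩⟩

theorem tangentGap_le (h : IsGaussCurve X k) {y : Plane} {θ η r : ℝ} (hr : ∀ s, r ≤ (k s)⁻¹)
    (hθ : tangentShift X y θ = 0) (hη : |η - θ| ≤ Real.pi) :
    tangentGap X y η ≤ tangentGap X y θ - (tangentGap X y θ + r) * (1 - Real.cos (η - θ)) :=
  le_of_deriv_deriv_add_eq (h.hasDerivAt_tangentGap y) (h.hasDerivAt_tangentShift y) hr hθ hη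

/-- By the cosine comparison, a critical angle whose gap is at least minus the smallest radius of
curvature is already a global maximum. So foot angles can be followed locally as critical points. -/
theorem isFootAngle (h : IsGaussCurve X k) {y : Plane} {θ r : ℝ} (hr : ∀ s, r ≤ (k s)⁻¹)
    (hθ : tangentShift X y θ = 0) (hpos : 0 ≤ tangentGap X y θ + r) : IsFootAngle X y θ := by
  intro η
  obtain ⟨m, hm⟩ := exists_near_angle (η := η) (θ := θ)
  rw [← (h.tangentGap_periodic y).sub_zsmul_eq m]
  refine (h.tangentGap_le hr hθ hm).trans ?_
  have : 0 ≤ 1 - Real.cos (η - m • (2 * Real.pi) - θ) := by linarith [Real.cos_le_one (η - m • (2 * Real.pi) - θ)]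
  nlinarith [mul_nonneg hpos this]

theorem tangentGap_curve_nonpos (h : IsGaussCurve X k) (η θ : ℝ) : tangentGap X (X η) θ ≤ 0 := by
  have e : tangentGap X (X η) η = 0 := by simp [tangentGap]
  have := h.isFootAngle (y := X η) (θ := η) (r := 0) (fun s => (inv_pos.2 (h.pos s)).le)
    (by simp [tangentShift]) (by rw [e, add_zero])
  exact (this θ).trans e.le

/-- The half-plane behind the tangent at `θ` contains the hull, so interior points have a strictly
negative gap. Conversely, if a small ball around `y` left the closed hull, a separating direction
would produce an angle with a positive gap at a point of the ball, contradicting that the largest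
gap at `y` is below minus the radius. -/
theorem mem_interior_iff (h : IsGaussCurve X k) {y : Plane} {θ : ℝ} (hθ : IsFootAngle X y θ) :
    y ∈ interior (convexHull ℝ (range X)) ↔ tangentGap X y θ < 0 := by
  constructor
  · intro hy
    have hle : ∀ z ∈ convexHull ℝ (range X), tangentGap X z θ ≤ 0 := by
      intro z hz
      have hconv : Convex ℝ {z | tangentGap X z θ ≤ 0} := by
        have : {z | tangentGap X z θ ≤ 0} =
            {z : Plane | innerSL ℝ (gaussNormal θ) z ≤ inner ℝ (X θ) (gaussNormal θ)} := by
          ext z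
          simp only [tangentGap, inner_sub_left, mem_ofPred_eq, innerSL_apply_apply, sub_nonpos]
          rw [real_inner_comm]
        rw [this]
        exact convex_halfSpace_le (innerSL ℝ (gaussNormal θ)).toLinearMap.isLinear _
      refine convexHull_min ?_ hconv hz
      rintro _ ⟨η, rfl⟩
      exact h.tangentGap_curve_nonpos η θ
    obtain ⟨ρ, hρ, hball⟩ := Metric.isOpen_iff.1 isOpen_interior y hy
    have hmem : y + (ρ / 2) • gaussNormal θ ∈ Metric.ball y ρ := by
      rw [mem_ball_iff_norm, add_sub_cancel_left, norm_smul, norm_gaussNormal, mul_one,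
        Real.norm_eq_abs, abs_of_pos (half_pos hρ)]
      exact half_lt_self hρ
    have := hle _ (interior_subset (hball hmem))
    have e : tangentGap X (y + (ρ / 2) • gaussNormal θ) θ = tangentGap X y θ + ρ / 2 := by
      rw [tangentGap, tangentGap, add_sub_right_comm, inner_add_left, real_inner_smul_left,
        inner_gaussNormal_self, mul_one]
    linarith
  · intro hneg
    refine mem_interior_of_mem_nhds_closure (convex_convexHull ℝ _)
      (mem_of_superset (Metric.ball_mem_nhds y (show 0 < -tangentGap X y θ by linarith)) ?_)
    intro z hz
    by_contra hz'
    obtain ⟨l, u, hl, hu⟩ := geometric_hahn_banach_closed_point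
      (convex_convexHull ℝ (range X)).closure isClosed_closure hz'
    obtain ⟨η, hη⟩ := exists_gaussNormal_eq ((InnerProductSpace.toDual ℝ Plane).symm l)
    set v := (InnerProductSpace.toDual ℝ Plane).symm l with hv
    have hlv : ∀ w, l w = inner ℝ w (‖v‖ • gaussNormal η) := fun w => by
      rw [← hη, real_inner_comm, hv, InnerProductSpace.toDual_symm_apply]
    have h1 := hl (X η) (subset_closure (subset_convexHull ℝ _ (mem_range_self η)))
    have h2 : 0 < ‖v‖ * tangentGap X z η := by
      have : l (X η) < l z := h1.trans hu
      rw [hlv, hlv, real_inner_smul_right, real_inner_smul_right] at this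
      rw [tangentGap, inner_sub_left]
      linarith
    have h3 := (abs_le.1 (abs_tangentGap_sub_le X z y η)).2
    rw [mem_ball_iff_norm] at hz
    have h4 := hθ η
    have h5 : tangentGap X z η < 0 := by linarith
    nlinarith [norm_nonneg v]

/-- The signed distance to a convex curve is the maximum over all tangent lines of the signed
distance to the line. At a maximizing angle the tangential coordinate vanishes, so the distance is
at most `|gap|`. Conversely, the gap is 1-Lipschitz in the point: inside, compare with the tangent
at the competitor, outside with the tangent at the foot. -/
theorem signedDist_eq (h : IsGaussCurve X k) {y : Plane} {θ : ℝ} (hθ : IsFootAngle X y θ) :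
    signedDist (range X) (interior (convexHull ℝ (range X))) y = tangentGap X y θ := by
  have hne : (range X).Nonempty := range_nonempty X
  have hd : ‖y - X θ‖ = |tangentGap X y θ| := by
    have := gauss_frame_decomp (y - X θ) θ
    rw [← tangentGap, ← tangentShift, h.tangentShift_eq_zero hθ, zero_smul, add_zero] at this
    rw [this, norm_smul, norm_gaussNormal, mul_one, Real.norm_eq_abs]
  have hle : Metric.infDist y (range X) ≤ |tangentGap X y θ| := by
    rw [← hd, ← dist_eq_norm]
    exact Metric.infDist_le_dist_of_mem (mem_range_self θ)
  rw [signedDist]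
  split_ifs with hy
  · have hneg := (h.mem_interior_iff hθ).1 hy
    rw [abs_of_neg hneg] at hle
    have : -tangentGap X y θ ≤ Metric.infDist y (range X) := by
      refine (Metric.le_infDist hne).2 ?_
      rintro _ ⟨η, rfl⟩
      rw [dist_eq_norm]
      have h1 := (abs_le.1 (abs_tangentGap_sub_le X y (X η) η)).1
      have h2 : tangentGap X (X η) η = 0 := by simp [tangentGap]
      linarith [hθ η]
    linarith
  · have hpos := not_lt.1 fun hlt => hy ((h.mem_interior_iff hθ).2 hlt)
    rw [abs_of_nonneg hpos] at hle
    refine le_antisymm hle ((Metric.le_infDist hne).2 ?_)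
    rintro _ ⟨η, rfl⟩
    rw [dist_eq_norm]
    have h1 := (abs_le.1 (abs_tangentGap_sub_le X y (X η) θ)).2
    linarith [h.tangentGap_curve_nonpos η θ]

end IsGaussCurve

/-- The signed distance to a closed convex curve whose enclosed region is the interior of its
convex hull. -/
abbrev curveDist (X : ℝ → Plane) (y : Plane) : ℝ :=
  signedDist (range X) (interior (convexHull ℝ (range X))) y

/-! ### Regularity of the signed distance to a convex curve -/

namespace IsGaussCurve

variable {X : ℝ → Plane} {k : ℝ → ℝ}

/-- The tangential coordinate has angular derivative `-(1/k + gap)`, which is nonzero before the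
centre of curvature, so the implicit function theorem solves for the foot angle. -/
theorem exists_implicit_footAngle (h : IsGaussCurve X k) {y : Plane} {θ : ℝ}
    (hθ : tangentShift X y θ = 0) (hpos : 0 < (k θ)⁻¹ + tangentGap X y θ) :
    ∃ φ : Plane → ℝ, ContDiffAt ℝ 1 φ y ∧ φ y = θ ∧
      ∀ᶠ z in 𝓝 y, tangentShift X z (φ z) = 0 := by
  set f : Plane × ℝ → ℝ := fun p => tangentShift X p.1 p.2 with hf
  have hcd : ContDiff ℝ 1 f :=
    (contDiff_fst.sub (h.contDiff.comp contDiff_snd)).inner ℝ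
      ((contDiff_gaussTangent.of_le (mod_cast le_top)).comp contDiff_snd)
  have hcda : ContDiffAt ℝ 1 f (y, θ) := hcd.contDiffAt
  have hT : ∀ w, (fderiv ℝ f (y, θ) ∘L .inr ℝ Plane ℝ) w = -((k θ)⁻¹ + tangentGap X y θ) * w := by
    have h1 : HasFDerivAt (fun η => f (y, η)) (fderiv ℝ f (y, θ) ∘L .inr ℝ Plane ℝ) θ := by
      have := (hcd.differentiable one_ne_zero (y, θ)).hasFDerivAt.comp θ
        (hasFDerivAt_prodMk_right (𝕜 := ℝ) y θ)
      exact this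
    have h2 := h1.hasDerivAt.unique (h.hasDerivAt_tangentShift y θ)
    intro w
    have h3 := (fderiv ℝ f (y, θ) ∘L .inr ℝ Plane ℝ).map_smul w 1
    rw [smul_eq_mul, mul_one, h2] at h3
    rw [h3, smul_eq_mul, mul_comm]
  have hinv : (fderiv ℝ f (y, θ) ∘L .inr ℝ Plane ℝ).IsInvertible := by
    refine ⟨ContinuousLinearEquiv.unitsEquivAut ℝ
      (Units.mk0 (-((k θ)⁻¹ + tangentGap X y θ)) (neg_neg_of_pos hpos).ne), ?_⟩
    ext
    rw [hT]
    simp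
  refine ⟨hcda.implicitFunction one_ne_zero hinv, hcda.contDiffAt_implicitFunction one_ne_zero hinv,
    hcda.implicitFunction_apply_self one_ne_zero hinv, ?_⟩
  filter_upwards [hcda.eventually_apply_implicitFunction one_ne_zero hinv] with z hz
  exact hz.trans hθ

/-- Envelope argument: the gap is stationary in the angle, so the derivative of `φ` drops out and
the gradient is the normal. -/
theorem hasFDerivAt_gap_comp (h : IsGaussCurve X k) {φ : Plane → ℝ} {φ' : Plane →L[ℝ] ℝ} {z : Plane}
    (hφ : HasFDerivAt φ φ' z) (hz : tangentShift X z (φ z) = 0) :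
    HasFDerivAt (fun z => tangentGap X z (φ z)) (innerSL ℝ (gaussNormal (φ z))) z := by
  have h1 : HasFDerivAt (fun z => X (φ z)) (φ'.smulRight ((k (φ z))⁻¹ • gaussTangent (φ z))) z :=
    (h.deriv (φ z)).hasFDerivAt.comp z hφ
  have h2 : HasFDerivAt (fun z => gaussNormal (φ z)) (φ'.smulRight (gaussTangent (φ z))) z :=
    (hasDerivAt_gaussNormal (φ z)).hasFDerivAt.comp z hφ
  have h3 := ((hasFDerivAt_id z).sub h1).inner ℝ h2
  refine h3.congr_fderiv ?_
  ext v
  rw [tangentShift] at hz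
  rw [inner_sub_left] at hz
  simp [real_inner_smul_right, real_inner_smul_left, inner_sub_left,
    inner_gaussTangent_gaussNormal]
  linear_combination (φ' v) * hz + real_inner_comm (gaussNormal (φ z)) v

theorem footAngle_derivative (h : IsGaussCurve X k) {φ : Plane → ℝ} {φ' : Plane →L[ℝ] ℝ} {z : Plane}
    (hφ : HasFDerivAt φ φ' z) (hz : ∀ᶠ w in 𝓝 z, tangentShift X w (φ w) = 0) (v : Plane) :
    φ' v * ((k (φ z))⁻¹ + tangentGap X z (φ z)) = inner ℝ v (gaussTangent (φ z)) := by
  have h1 : HasFDerivAt (fun z => X (φ z)) (φ'.smulRight ((k (φ z))⁻¹ • gaussTangent (φ z))) z :=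
    (h.deriv (φ z)).hasFDerivAt.comp z hφ
  have h2 : HasFDerivAt (fun z => gaussTangent (φ z)) (φ'.smulRight (-gaussNormal (φ z))) z :=
    (hasDerivAt_gaussTangent (φ z)).hasFDerivAt.comp z hφ
  have h3 := ((hasFDerivAt_id z).sub h1).inner ℝ h2
  have h4 : HasFDerivAt (fun z => tangentShift X z (φ z)) (0 : Plane →L[ℝ] ℝ) z :=
    (hasFDerivAt_const (0 : ℝ) z).congr_of_eventuallyEq hz
  have h5 := congrArg (fun l : Plane →L[ℝ] ℝ => l v) (h3.unique h4)
  simp [real_inner_smul_right, real_inner_smul_left, inner_sub_left,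
    norm_gaussTangent] at h5
  rw [tangentGap, inner_sub_left]
  linarith

/-- The gradient is the normal at a foot angle that is only `C¹` in the point; this already makes
the distance `C²`. Differentiating once more yields the curvature of the parallel curve through `y`,
that is `1/(1/k + gap)`. -/
theorem curveDist_regular (h : IsGaussCurve X k) {y : Plane} {θ r : ℝ} (hr : ∀ s, r ≤ (k s)⁻¹)
    (hθ : IsFootAngle X y θ) (hpos : 0 < r + tangentGap X y θ) :
    ContDiffAt ℝ 2 (curveDist X) y ∧ ‖fderiv ℝ (curveDist X) y‖ = 1 ∧
      (Δ (curveDist X)) y = ((k θ)⁻¹ + tangentGap X y θ)⁻¹ := by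
  have hpos' : 0 < (k θ)⁻¹ + tangentGap X y θ := by linarith [hr θ]
  obtain ⟨φ, hφ, hφy, hφ0⟩ := h.exists_implicit_footAngle (h.tangentShift_eq_zero hθ) hpos'
  have hgap : ContinuousAt (fun z => tangentGap X z (φ z)) y := by
    have h1 : HasFDerivAt φ (fderiv ℝ φ y) y := (hφ.differentiableAt one_ne_zero).hasFDerivAt
    exact (h.hasFDerivAt_gap_comp h1 hφ0.self_of_nhds).continuousAt
  have hev : ∀ᶠ z in 𝓝 y, ContDiffAt ℝ 1 φ z ∧ tangentShift X z (φ z) = 0 ∧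
      curveDist X z = tangentGap X z (φ z) := by
    have h2 : ∀ᶠ z in 𝓝 y, ContDiffAt ℝ 1 φ z := hφ.eventually (by simp)
    have h3 : ∀ᶠ z in 𝓝 y, 0 < r + tangentGap X z (φ z) := by
      refine (continuousAt_const.add hgap).eventually_const_lt ?_
      simpa [hφy] using hpos
    filter_upwards [h2, hφ0, h3] with z z1 z2 z3
    exact ⟨z1, z2, h.signedDist_eq (h.isFootAngle hr z2 (by linarith))⟩
  have hd : ∀ᶠ z in 𝓝 y, HasFDerivAt (curveDist X) (innerSL ℝ (gaussNormal (φ z))) z := by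
    filter_upwards [hev.eventually_nhds] with z hz
    obtain ⟨z1, z2, -⟩ := hz.self_of_nhds
    refine (h.hasFDerivAt_gap_comp (z1.differentiableAt one_ne_zero).hasFDerivAt
      z2).congr_of_eventuallyEq ?_
    filter_upwards [hz] with w hw using hw.2.2
  have hνφ : ContDiffAt ℝ 1 (fun z => innerSL ℝ (gaussNormal (φ z))) y :=
    (innerSL ℝ (E := Plane)).contDiff.contDiffAt.comp y
      ((contDiff_gaussNormal.of_le (mod_cast le_top)).contDiffAt.comp y hφ)
  refine ⟨?_, ?_, ?_⟩
  · have h1 : ContDiffAt ℝ (1 + 1) (curveDist X) y :=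
      contDiffAt_succ_iff_hasFDerivAt.2 ⟨_, ⟨_, hd, fun z hz => hz⟩, hνφ⟩
    exact h1.of_le one_add_one_eq_two.ge
  · rw [hd.self_of_nhds.fderiv, innerSL_apply_norm, norm_gaussNormal]
  · have h1 : HasFDerivAt φ (fderiv ℝ φ y) y := (hφ.differentiableAt one_ne_zero).hasFDerivAt
    have h2 : HasFDerivAt (fun z => gaussNormal (φ z))
        ((fderiv ℝ φ y).smulRight (gaussTangent (φ y))) y :=
      (hasDerivAt_gaussNormal (φ y)).hasFDerivAt.comp y h1
    have h3 : HasFDerivAt (fun z => innerSL ℝ (gaussNormal (φ z)))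
        ((innerSL ℝ (E := Plane)).comp ((fderiv ℝ φ y).smulRight (gaussTangent (φ y)))) y :=
      (innerSL ℝ (E := Plane)).hasFDerivAt.comp y h2
    set b := EuclideanSpace.basisFun (Fin 2) ℝ
    rw [laplacian_eq_sum_of_hasFDerivAt b hd h3]
    have h4 := sum_sq_apply_orthonormalBasis b (innerSL ℝ (gaussTangent θ))
    rw [innerSL_apply_norm, norm_gaussTangent, one_pow] at h4
    rw [← one_div, eq_div_iff hpos'.ne', ← h4, Finset.sum_mul]
    refine Finset.sum_congr rfl fun i _ => ?_
    have h5 := h.footAngle_derivative h1 hφ0 (b i)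
    rw [hφy] at h5
    simp only [ContinuousLinearMap.comp_apply, ContinuousLinearMap.smulRight_apply, map_smul, hφy,
      _root_.smul_apply, innerSL_apply_apply, smul_eq_mul]
    rw [real_inner_comm] at h5
    rw [mul_right_comm, h5, sq]

end IsGaussCurve

namespace IsGaussCurve

variable {X X' : ℝ → Plane} {k k' : ℝ → ℝ}

theorem abs_curveDist_sub_le (h : IsGaussCurve X k) (y z : Plane) :
    |curveDist X y - curveDist X z| ≤ ‖y - z‖ := by
  obtain ⟨θ, hθ⟩ := h.exists_isFootAngle y
  obtain ⟨η, hη⟩ := h.exists_isFootAngle z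
  rw [curveDist, curveDist, h.signedDist_eq hθ, h.signedDist_eq hη]
  have h1 := abs_le.1 (abs_tangentGap_sub_le X y z θ)
  have h2 := abs_le.1 (abs_tangentGap_sub_le X y z η)
  exact abs_le.2 ⟨by linarith [hθ η], by linarith [hη θ]⟩

theorem abs_curveDist_sub_le' (h : IsGaussCurve X k) (h' : IsGaussCurve X' k') {η : ℝ}
    (hη : ∀ θ, ‖X θ - X' θ‖ ≤ η) (y : Plane) : |curveDist X y - curveDist X' y| ≤ η := by
  obtain ⟨θ, hθ⟩ := h.exists_isFootAngle y
  obtain ⟨ζ, hζ⟩ := h'.exists_isFootAngle y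
  rw [curveDist, curveDist, h.signedDist_eq hθ, h'.signedDist_eq hζ]
  have h1 := abs_le.1 ((abs_tangentGap_sub_le' X X' y θ).trans (hη θ))
  have h2 := abs_le.1 ((abs_tangentGap_sub_le' X X' y ζ).trans (hη ζ))
  exact abs_le.2 ⟨by linarith [hθ ζ], by linarith [hζ θ]⟩

/-- Quantitative uniqueness of the foot angle: an almost maximal gap forces the angle to be close to
the maximizer. -/
theorem abs_sub_lt_of_gap (h : IsGaussCurve X k) {y : Plane} {θ η r ρ : ℝ}
    (hr : ∀ s, r ≤ (k s)⁻¹) (hθ : IsFootAngle X y θ) (hpos : 0 < tangentGap X y θ + r)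
    (hρ0 : 0 ≤ ρ) (hη : |η - θ| ≤ Real.pi)
    (hgap : tangentGap X y θ - (tangentGap X y θ + r) * (1 - Real.cos ρ) < tangentGap X y η) :
    |η - θ| < ρ := by
  by_contra hlt
  have h1 := h.tangentGap_le hr (h.tangentShift_eq_zero hθ) hη
  have h2 : Real.cos (η - θ) ≤ Real.cos ρ := by
    rw [← Real.cos_abs (η - θ)]
    exact Real.cos_le_cos_of_nonneg_of_le_pi hρ0 hη (not_lt.1 hlt)
  nlinarith [mul_le_mul_of_nonneg_left h2 hpos.le]

end IsGaussCurve

/-! ### Time dependence of the signed distance to the convex flow -/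

namespace IsConvexFlow

variable {Ω : Set Plane} {F : ℝ → ℝ} {S : ℝ≥0∞} {x : ℝ → ℝ → Plane} {κ : ℝ → ℝ → ℝ}

theorem isGaussCurve (h : IsConvexFlow Ω F S x κ) {t : ℝ} (ht : 0 ≤ t)
    (htS : ENNReal.ofReal t < S) : IsGaussCurve (fun θ => x θ t) fun θ => κ θ t where
  periodic θ := h.periodic θ t ht htS
  pos θ := h.curvature_pos θ t ht htS
  deriv θ := h.gauss θ t ht htS
  continuous_curvature := by
    have h1 : Continuous fun θ : ℝ => (θ, t) := by fun_prop
    exact h.continuous_curvature.comp_continuous h1 fun θ => ⟨ht, htS⟩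

theorem eventually_lifetime {t : ℝ} (ht : 0 < t) (htS : ENNReal.ofReal t < S) :
    ∀ᶠ s in 𝓝 t, 0 < s ∧ ENNReal.ofReal s < S :=
  (lt_mem_nhds ht).and (ENNReal.continuous_ofReal.continuousAt.eventually_lt_const htS)

theorem mem_nhds_lifetime (θ : ℝ) {t : ℝ} (ht : 0 < t) (htS : ENNReal.ofReal t < S) :
    {q : ℝ × ℝ | 0 ≤ q.2 ∧ ENNReal.ofReal q.2 < S} ∈ 𝓝 (θ, t) := by
  filter_upwards [(continuous_snd.tendsto (θ, t)).eventually (eventually_lifetime ht htS)] with q hq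
  exact ⟨hq.1.le, hq.2⟩

theorem eventually_norm_sub_lt (h : IsConvexFlow Ω F S x κ) {t : ℝ} (ht : 0 < t)
    (htS : ENNReal.ofReal t < S) {η : ℝ} (hη : 0 < η) :
    ∀ᶠ s in 𝓝 t, ∀ θ, ‖x θ s - x θ t‖ < η := by
  have h1 : ∀ᶠ s in 𝓝 t, ∀ θ ∈ Icc 0 (2 * Real.pi), ‖x θ s - x θ t‖ < η := by
    refine isCompact_Icc.eventually_forall_of_forall_eventually fun θ _ => ?_
    have c1 : ContinuousAt (fun q : ℝ × ℝ => x q.1 q.2) (θ, t) :=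
      h.continuous_pos.continuousAt (mem_nhds_lifetime θ ht htS)
    have c3 : ContinuousAt (fun q : ℝ × ℝ => x q.1 t) (θ, t) :=
      (h.isGaussCurve ht.le htS).continuous.continuousAt.comp continuousAt_fst
    have c4 : ContinuousAt (fun q : ℝ × ℝ => ‖x q.1 q.2 - x q.1 t‖) (θ, t) := (c1.sub c3).norm
    have c5 := c4.eventually_lt_const (u := η) (by simpa using hη)
    have c6 : Tendsto (fun z : ℝ × ℝ => (z.2, z.1)) (𝓝 (t, θ)) (𝓝 (θ, t)) :=
      continuous_swap.tendsto (t, θ)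
    exact c6.eventually c5
  filter_upwards [h1, eventually_lifetime ht htS] with s hs hsS θ
  have p1 := (h.isGaussCurve ht.le htS).periodic
  have p2 := (h.isGaussCurve hsS.1.le hsS.2).periodic
  have p3 : Function.Periodic (fun θ => ‖x θ s - x θ t‖) (2 * Real.pi) := fun θ => by
    have q1 : x (θ + 2 * Real.pi) t = x θ t := p1 θ
    have q2 : x (θ + 2 * Real.pi) s = x θ s := p2 θ
    simp only [q1, q2]
  obtain ⟨θ', hθ', e⟩ := p3.exists_mem_Ico₀ Real.two_pi_pos θ
  exact e.trans_lt (hs θ' (Ico_subset_Icc_self hθ'))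

theorem hasDerivAt_gap (h : IsConvexFlow Ω F S x κ) {t : ℝ} (ht : 0 < t)
    (htS : ENNReal.ofReal t < S) (y : Plane) (θ : ℝ) :
    HasDerivAt (fun s => tangentGap (fun θ => x θ s) y θ) (κ θ t - F t) t := by
  have h1 := ((h.differentiable_time θ t ht htS).hasDerivAt.const_sub y).inner ℝ
    (hasDerivAt_const t (gaussNormal θ))
  convert! h1 using 1
  rw [inner_zero_right, zero_add, inner_neg_left, h.law θ t ht htS]

/-- The distance is a maximum of gaps over the angle, and the maximizer at time `t` is unique modulo
`2π`. Hence the maximum has the time derivative of the gap at the maximizing angle. The maximizers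
at times `s` and `t` are compared in both directions; they are close because the curves converge
uniformly, and the speed `κ - F` is continuous. -/
theorem hasDerivAt_convexDist (h : IsConvexFlow Ω F S x κ) {t : ℝ} (ht : 0 < t)
    (htS : ENNReal.ofReal t < S) (hF : ContinuousAt F t) {y : Plane} {θ r : ℝ}
    (hr : ∀ η, r ≤ (κ η t)⁻¹) (hθ : IsFootAngle (fun θ => x θ t) y θ)
    (hpos : 0 < tangentGap (fun θ => x θ t) y θ + r) :
    HasDerivAt (convexDist x y) (κ θ t - F t) t := by
  have hX := h.isGaussCurve ht.le htS
  rw [hasDerivAt_iff_isLittleO, Asymptotics.isLittleO_iff]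
  intro η hη
  have hcont : ContinuousAt (fun q : ℝ × ℝ => κ q.1 q.2 - F q.2) (θ, t) :=
    (h.continuous_curvature.continuousAt (mem_nhds_lifetime θ ht htS)).sub
      (hF.comp (f := Prod.snd) (x := (θ, t)) continuousAt_snd)
  have hnear := Metric.tendsto_nhds.1 hcont η hη
  obtain ⟨ρ₁, hρ₁, hρ⟩ := Metric.eventually_nhds_iff.1 hnear
  obtain ⟨ρ₂, hρ₂, hlife⟩ := Metric.eventually_nhds_iff.1 (eventually_lifetime ht htS)
  set ρ := min (min ρ₁ ρ₂) Real.pi with hρdef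
  have hρ0 : 0 < ρ := lt_min (lt_min hρ₁ hρ₂) Real.pi_pos
  have hρ1 : ρ ≤ ρ₁ := (min_le_left _ _).trans (min_le_left _ _)
  have hρ2 : ρ ≤ ρ₂ := (min_le_left _ _).trans (min_le_right _ _)
  have hcos : Real.cos ρ < 1 := by
    rw [← Real.cos_zero]
    exact Real.cos_lt_cos_of_nonneg_of_le_pi le_rfl (min_le_right _ _) hρ0
  have hstep : ∀ ζ s, |ζ - θ| < ρ → |s - t| < ρ →
      |tangentGap (fun θ => x θ s) y ζ - tangentGap (fun θ => x θ t) y ζ -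
        (s - t) * (κ θ t - F t)| ≤ η * |s - t| := by
    intro ζ s hζ hs
    have hd : ∀ u ∈ Metric.ball t ρ, HasDerivWithinAt (fun s => tangentGap (fun θ => x θ s) y ζ -
        s * (κ θ t - F t)) (κ ζ u - F u - 1 * (κ θ t - F t)) (Metric.ball t ρ) u := fun u hu => by
      obtain ⟨u1, u2⟩ := hlife ((Metric.mem_ball.1 hu).trans_le hρ2)
      exact ((h.hasDerivAt_gap u1 u2 y ζ).sub
        ((hasDerivAt_id u).mul_const (κ θ t - F t))).hasDerivWithinAt
    have hb : ∀ u ∈ Metric.ball t ρ, ‖κ ζ u - F u - 1 * (κ θ t - F t)‖ ≤ η := fun u hu => by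
      have := @hρ (ζ, u) (by
        rw [Prod.dist_eq, max_lt_iff, Real.dist_eq]
        exact ⟨hζ.trans_le hρ1, (Metric.mem_ball.1 hu).trans_le hρ1⟩)
      rw [one_mul, ← dist_eq_norm]
      exact this.le
    have := (convex_ball t ρ).norm_image_sub_le_of_norm_hasDerivWithin_le hd hb
      (Metric.mem_ball_self hρ0) (by rwa [Metric.mem_ball, Real.dist_eq])
    rw [Real.norm_eq_abs, Real.norm_eq_abs] at this
    convert! this using 2
    ring
  set A := (tangentGap (fun θ => x θ t) y θ + r) * (1 - Real.cos ρ) with hA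
  have hA0 : 0 < A := mul_pos hpos (by linarith)
  have e0 : convexDist x y t = tangentGap (fun θ => x θ t) y θ := hX.signedDist_eq hθ
  filter_upwards [h.eventually_norm_sub_lt ht htS (show 0 < A / 3 by positivity),
    Metric.ball_mem_nhds t hρ0] with s hs hsρ
  obtain ⟨s1, s2⟩ := hlife ((Metric.mem_ball.1 hsρ).trans_le hρ2)
  have hXs := h.isGaussCurve s1.le s2
  obtain ⟨ζ₀, hζ₀⟩ := hXs.exists_isFootAngle y
  obtain ⟨m, hm⟩ := IsGaussCurve.exists_near_angle (η := ζ₀) (θ := θ)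
  -- Foot angles are determined only modulo `2π`; the cosine comparison needs the representative
  -- within `π` of `θ`.
  set ζ := ζ₀ - m • (2 * Real.pi) with hζdef
  have hζ : IsFootAngle (fun θ => x θ s) y ζ := by
    intro ζ'
    rw [hζdef, (hXs.tangentGap_periodic y).sub_zsmul_eq m]
    exact hζ₀ ζ'
  have es : convexDist x y s = tangentGap (fun θ => x θ s) y ζ := hXs.signedDist_eq hζ
  have b1 := abs_le.1 ((abs_tangentGap_sub_le' (fun θ => x θ s) (fun θ => x θ t) y ζ).trans
    (hs ζ).le)
  have b2 := abs_le.1 ((abs_tangentGap_sub_le' (fun θ => x θ s) (fun θ => x θ t) y θ).trans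
    (hs θ).le)
  have b3 : |ζ - θ| < ρ := by
    refine hX.abs_sub_lt_of_gap hr hθ hpos hρ0.le hm ?_
    rw [← hA]
    linarith [hζ θ]
  have hsρ' : |s - t| < ρ := by rwa [Metric.mem_ball, Real.dist_eq] at hsρ
  have c1 := abs_le.1 (hstep ζ s b3 hsρ')
  have c2 := abs_le.1 (hstep θ s (by simpa using hρ0) hsρ')
  rw [Real.norm_eq_abs, Real.norm_eq_abs, e0, es, smul_eq_mul]
  exact abs_le.2 ⟨by linarith [hζ θ], by linarith [hθ ζ]⟩

/-- Radii of curvature are at least `1/N`, so within `1/(2N)` of the curve the distance is regular.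
Its Laplacian `1/(1/κ + g)` differs from `κ` by `κ|g|/(1/κ + g) ≤ N · 2N |g|`. -/
theorem isFrontDistanceAt (h : IsConvexFlow Ω F S x κ) {t : ℝ} (ht : 0 < t)
    (htS : ENNReal.ofReal t < S) (hF : ContinuousAt F t) {N b : ℝ} (hN : 0 < N)
    (h1 : ∀ θ, κ θ t ≤ N) (hb : b ≤ 1 / (2 * N)) (y : Plane) :
    IsFrontDistanceAt (convexDist x) (F t) (2 * N ^ 2) b y t := by
  have hX := h.isGaussCurve ht.le htS
  have hr : ∀ s, N⁻¹ ≤ (κ s t)⁻¹ := fun s => inv_anti₀ (hX.pos s) (h1 s)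
  refine ⟨fun hlt => ?_, ?_, ?_⟩
  · obtain ⟨θ, hθ⟩ := hX.exists_isFootAngle y
    have e0 : convexDist x y t = tangentGap (fun θ => x θ t) y θ := hX.signedDist_eq hθ
    rw [e0] at hlt ⊢
    set g := tangentGap (fun θ => x θ t) y θ
    have hg := (abs_lt.1 (hlt.trans_le hb)).1
    have e1 : N⁻¹ = 2 * (1 / (2 * N)) := by field_simp
    have hN2 : 0 < 1 / (2 * N) := by positivity
    have hpos : 0 < N⁻¹ + g := by linarith
    obtain ⟨r1, r2, r3⟩ := hX.curveDist_regular hr hθ hpos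
    refine ⟨r1, r2, κ θ t, ?_, h.hasDerivAt_convexDist ht htS hF hr hθ (by linarith)⟩
    have r3' : (Δ fun z => convexDist x z t) y = ((κ θ t)⁻¹ + g)⁻¹ := r3
    rw [r3']
    have hk := hX.pos θ
    have hk' : 0 < (κ θ t)⁻¹ + g := by linarith [hr θ]
    have e2 : ((κ θ t)⁻¹ + g)⁻¹ - κ θ t = -(κ θ t * g * ((κ θ t)⁻¹ + g)⁻¹) := by
      have i1 := inv_mul_cancel₀ hk'.ne'
      have i2 := mul_inv_cancel₀ hk.ne'
      linear_combination κ θ t * i1 - ((κ θ t)⁻¹ + g)⁻¹ * i2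
    have hle : ((κ θ t)⁻¹ + g)⁻¹ ≤ 2 * N := by
      rw [inv_le_comm₀ hk' (by positivity), ← one_div]
      linarith [hr θ]
    rw [e2, abs_neg, abs_mul, abs_mul, abs_of_pos hk, abs_of_pos (inv_pos.2 hk')]
    calc κ θ t * |g| * ((κ θ t)⁻¹ + g)⁻¹ ≤ N * |g| * (2 * N) := by
          gcongr; exact h1 θ
      _ = 2 * N ^ 2 * |g| := by ring
  · refine (LipschitzWith.of_dist_le_mul (K := 1) fun y z => ?_).continuous.continuousAt
    rw [NNReal.coe_one, one_mul, Real.dist_eq, dist_eq_norm]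
    exact hX.abs_curveDist_sub_le y z
  · refine Metric.tendsto_nhds.2 fun η hη => ?_
    filter_upwards [h.eventually_norm_sub_lt ht htS (half_pos hη), eventually_lifetime ht htS]
      with s hs hsS
    refine lt_of_le_of_lt ?_ (half_lt_self hη)
    exact (h.isGaussCurve hsS.1.le hsS.2).abs_curveDist_sub_le' hX (fun θ => (hs θ).le) y

theorem lt_of_lt_stoppingTime {N t : ℝ} (ht : 0 < t)
    (h : ENNReal.ofReal t < stoppingTime Ω N S x κ) :
    ENNReal.ofReal t < S ∧ ∀ θ, κ θ t ≤ N := by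
  have hS : ENNReal.ofReal t < S := h.trans_le (sInf_le (Or.inl rfl))
  refine ⟨hS, fun θ => ?_⟩
  by_contra hN
  refine h.not_ge (sInf_le (Or.inr ⟨t, ht, rfl, hS, Or.inl ⟨θ, ?_⟩⟩))
  rw [lt_max_iff, lt_max_iff]
  by_contra hcon
  simp only [not_or, not_lt] at hcon
  exact hN hcon.1

end IsConvexFlow

/-! ### Distance functions with nearest points -/

section Eikonal

variable {E : Type*} [NormedAddCommGroup E] [InnerProductSpace ℝ E]

/-- A 1-Lipschitz function whose increment equals the distance between two points must grow at full
speed along the whole segment. -/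
theorem apply_segment_of_eq_dist {D : E → ℝ} (hD : ∀ u v, |D u - D v| ≤ ‖u - v‖) {x y : E}
    (hy : D y = 0) (hx : D x = ‖x - y‖) {s : ℝ} (hs : s ∈ Icc (0 : ℝ) 1) :
    D (y + s • (x - y)) = s * ‖x - y‖ := by
  have h1 := (abs_le.1 (hD (y + s • (x - y)) y)).2
  have h2 := (abs_le.1 (hD x (y + s • (x - y)))).2
  rw [add_sub_cancel_left, norm_smul, Real.norm_eq_abs, abs_of_nonneg hs.1, hy, sub_zero] at h1
  have e : x - (y + s • (x - y)) = (1 - s) • (x - y) := by rw [sub_smul, one_smul]; abel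
  rw [e, norm_smul, Real.norm_eq_abs, abs_of_nonneg (by linarith [hs.2]), hx] at h2
  linarith

variable [FiniteDimensional ℝ E]

/-- The gradient vector associated with a linear form. -/
def rieszVec (E : Type*) [NormedAddCommGroup E] [InnerProductSpace ℝ E]
    [FiniteDimensional ℝ E] : (E →L[ℝ] ℝ) →L[ℝ] E :=
  LinearMap.mkContinuous
    { toFun := fun l => (InnerProductSpace.toDual ℝ E).symm l
      map_add' := fun l l' => map_add _ l l'
      map_smul' := fun c l => by simp } 1
    fun l => by rw [one_mul]; exact ((InnerProductSpace.toDual ℝ E).symm.norm_map l).le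

theorem inner_rieszVec (l : E →L[ℝ] ℝ) (v : E) : inner ℝ (rieszVec E l) v = l v :=
  InnerProductSpace.toDual_symm_apply

theorem norm_rieszVec (l : E →L[ℝ] ℝ) : ‖rieszVec E l‖ = ‖l‖ :=
  (InnerProductSpace.toDual ℝ E).symm.norm_map l

theorem rieszVec_injective : Function.Injective (rieszVec E) :=
  (InnerProductSpace.toDual ℝ E).symm.injective

/-- The derivative along the segment is `|x - y|` while the gradient has norm at most one. Equality
in Cauchy–Schwarz makes the gradient parallel to `x - y`. -/
theorem gradient_of_eq_dist {D : E → ℝ} (hD : ∀ u v, |D u - D v| ≤ ‖u - v‖) {x y : E}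
    (hy : D y = 0) (hx : D x = ‖x - y‖) {s : ℝ} (hs : s ∈ Icc (0 : ℝ) 1)
    (hd : DifferentiableAt ℝ D (y + s • (x - y))) :
    x - y = D x • rieszVec E (fderiv ℝ D (y + s • (x - y))) ∧
      (0 < D x → ‖fderiv ℝ D (y + s • (x - y))‖ = 1) := by
  set l := fderiv ℝ D (y + s • (x - y)) with hl
  have h1 : HasDerivWithinAt (fun s : ℝ => D (y + s • (x - y))) (l (x - y)) (Icc 0 1) s := by
    have h2 : HasDerivAt (fun s : ℝ => y + s • (x - y)) ((1 : ℝ) • (x - y)) s :=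
      ((hasDerivAt_id s).smul_const (x - y)).const_add y
    rw [one_smul] at h2
    exact (hd.hasFDerivAt.comp_hasDerivAt s h2).hasDerivWithinAt
  have h2 : HasDerivWithinAt (fun s : ℝ => D (y + s • (x - y))) ‖x - y‖ (Icc 0 1) s := by
    have h3 : HasDerivWithinAt (fun s : ℝ => s * ‖x - y‖) (1 * ‖x - y‖) (Icc 0 1) s :=
      ((hasDerivAt_id s).mul_const _).hasDerivWithinAt
    rw [one_mul] at h3
    exact h3.congr (fun r hr => apply_segment_of_eq_dist hD hy hx hr)
      (apply_segment_of_eq_dist hD hy hx hs)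
  have h3 : l (x - y) = ‖x - y‖ := (uniqueDiffOn_Icc one_pos s hs).eq_deriv _ h1 h2
  have h4 : ‖l‖ ≤ 1 := by
    have : LipschitzWith 1 D := LipschitzWith.of_dist_le_mul fun u v => by
      rw [NNReal.coe_one, one_mul, Real.dist_eq, dist_eq_norm]; exact hD u v
    simpa using norm_fderiv_le_of_lipschitz ℝ this
  constructor
  · rw [← sub_eq_zero, ← norm_le_zero_iff, hx]
    have h5 : ‖x - y - ‖x - y‖ • rieszVec E l‖ ^ 2 ≤ 0 := by
      rw [norm_sub_sq_real, real_inner_smul_right, real_inner_comm, inner_rieszVec, h3, norm_smul,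
        norm_norm, norm_rieszVec]
      have h6 : ‖l‖ ^ 2 ≤ 1 := pow_le_one₀ (norm_nonneg _) h4
      nlinarith [mul_le_mul_of_nonneg_left h6 (sq_nonneg ‖x - y‖)]
    nlinarith [norm_nonneg (x - y - ‖x - y‖ • rieszVec E l)]
  · intro hpos
    refine le_antisymm h4 ?_
    have h5 := l.le_opNorm (x - y)
    rw [h3, norm_norm, ← hx] at h5
    nlinarith

theorem abs_laplacian_le_of_hasFDerivAt {L₁ L₂ : E →L[ℝ] E →L[ℝ] ℝ} {C : ℝ} (hC : 0 ≤ C)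
    (h₁ : ∀ u v, |L₁ u v| ≤ C * ‖u‖ * ‖v‖) (h₂ : ∀ u v, |L₂ u v| ≤ C * ‖u‖ * ‖v‖) {e : E}
    (he : ‖e‖ = 1) : |L₁ (rieszVec E (L₂ e)) e| ≤ C ^ 2 := by
  have h3 : ‖L₂ e‖ ≤ C := (L₂ e).opNorm_le_bound hC fun v => by
    have := h₂ e v
    rwa [he, mul_one] at this
  have := h₁ (rieszVec E (L₂ e)) e
  rw [he, mul_one, norm_rieszVec] at this
  exact this.trans (by rw [sq]; gcongr)

/-- A distance function is as regular at `x` as at the nearest point `y` of its zero set, and the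
two Laplacians differ by at most a multiple of the distance. -/
theorem regularity_of_nearest_points {D : E → ℝ} {Ω : Set E} {b C : ℝ} {x : E}
    (hD : ∀ u v, |D u - D v| ≤ ‖u - v‖) (hΩ : IsOpen Ω)
    (hreg : ∀ z ∈ Ω, |D z| < b → ContDiffAt ℝ 2 D z ∧
      ∀ u v, |fderiv ℝ (fderiv ℝ D) z u v| ≤ C * ‖u‖ * ‖v‖) (hC : 0 ≤ C)
    (hx : x ∈ Ω) (hx0 : 0 < D x) (hxb : D x < b)
    (hfoot : ∀ z, 0 < D z → ∃ y ∈ Ω, D y = 0 ∧ D z = ‖z - y‖) :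
    ‖fderiv ℝ D x‖ = 1 ∧ ∃ y ∈ Ω, D y = 0 ∧ D x = ‖x - y‖ ∧
      (∀ w, D w = 0 → D x = ‖x - w‖ → w = y) ∧
      |(Δ D) x - (Δ D) y| ≤ Module.finrank ℝ E * C ^ 2 * |D x| := by
  have hcont : Continuous D := (LipschitzWith.of_dist_le_mul (K := 1) fun u v => by
    rw [NNReal.coe_one, one_mul, Real.dist_eq, dist_eq_norm]; exact hD u v).continuous
  have hb : 0 < b := hx0.trans hxb
  set L := fderiv ℝ D with hL
  have hdiff : ∀ z ∈ Ω, |D z| < b → DifferentiableAt ℝ D z := fun z hz hzb =>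
    (hreg z hz hzb).1.differentiableAt two_ne_zero
  have hnear : ∀ z ∈ Ω, 0 < D z → D z < b → ∀ w, D w = 0 → D z = ‖z - w‖ →
      z - w = D z • rieszVec E (L z) ∧ ‖L z‖ = 1 := by
    intro z hz hz0 hzb w hw hzw
    have e : w + (1 : ℝ) • (z - w) = z := by rw [one_smul]; abel
    have := gradient_of_eq_dist hD hw hzw (right_mem_Icc.2 zero_le_one)
      (by rw [e]; exact hdiff z hz (by rwa [abs_of_pos hz0]))
    rw [e] at this
    exact ⟨this.1, this.2 hz0⟩
  -- The segment from the nearest point to `z` determines the gradient at both ends, so `∇D` is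
  -- invariant under the projection `z ↦ z - D(z) ∇D(z)`.
  have hsame : ∀ z ∈ Ω, 0 < D z → D z < b → z - D z • rieszVec E (L z) ∈ Ω ∧
      D (z - D z • rieszVec E (L z)) = 0 ∧ L (z - D z • rieszVec E (L z)) = L z := by
    intro z hz hz0 hzb
    obtain ⟨w, hw, hw0, hzw⟩ := hfoot z hz0
    obtain ⟨h1, -⟩ := hnear z hz hz0 hzb w hw0 hzw
    have e : z - D z • rieszVec E (L z) = w := by rw [← h1]; abel
    have e' : w + (0 : ℝ) • (z - w) = w := by rw [zero_smul, add_zero]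
    have h2 := gradient_of_eq_dist hD hw0 hzw (left_mem_Icc.2 zero_le_one)
      (by rw [e']; exact hdiff w hw (by rwa [hw0, abs_zero]))
    rw [e'] at h2
    rw [e]
    refine ⟨hw, hw0, ?_⟩
    have h3 := smul_right_injective E hz0.ne' (h2.1.symm.trans h1)
    exact rieszVec_injective h3
  obtain ⟨y, hyΩ, hy0, hxy⟩ := hfoot x hx0
  obtain ⟨hxy', hnorm⟩ := hnear x hx hx0 hxb y hy0 hxy
  refine ⟨hnorm, y, hyΩ, hy0, hxy, ?_, ?_⟩
  · intro w hw hxw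
    have := (hnear x hx hx0 hxb w hw hxw).1
    rw [← hxy'] at this
    exact sub_right_injective this
  have hπx : x - D x • rieszVec E (L x) = y := by rw [← hxy']; abel
  have hxabs : |D x| < b := by rwa [abs_of_pos hx0]
  have hyabs : |D y| < b := by rwa [hy0, abs_zero]
  obtain ⟨x1, x2⟩ := ContDiffAt.eventually_hasFDerivAt (hreg x hx hxabs).1
  obtain ⟨y1, y2⟩ := ContDiffAt.eventually_hasFDerivAt (hreg y hyΩ hyabs).1
  rw [← hL] at x1 x2 y1 y2
  have hLy : L y = L x := by
    have := (hsame x hx hx0 hxb).2.2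
    rwa [hπx] at this
  -- the gradient is constant along the normal segment
  have hzero : fderiv ℝ L y (rieszVec E (L x)) = 0 := by
    have h1 : HasDerivWithinAt (fun s : ℝ => L (y + s • (x - y))) (fderiv ℝ L y (x - y))
        (Ici 0) 0 := by
      have h2 : HasDerivAt (fun s : ℝ => y + s • (x - y)) ((1 : ℝ) • (x - y)) 0 :=
        ((hasDerivAt_id (0 : ℝ)).smul_const (x - y)).const_add y
      rw [one_smul] at h2
      have h3 : HasFDerivAt L (fderiv ℝ L y) (y + (0 : ℝ) • (x - y)) := by
        rwa [zero_smul, add_zero]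
      exact (h3.comp_hasDerivAt (0 : ℝ) h2).hasDerivWithinAt
    have h2 : HasDerivWithinAt (fun s : ℝ => L (y + s • (x - y))) 0 (Ici 0) 0 := by
      have hev : ∀ᶠ s : ℝ in 𝓝 0, DifferentiableAt ℝ D (y + s • (x - y)) ∧ s < 1 := by
        have hc : ContinuousAt (fun s : ℝ => y + s • (x - y)) 0 := by fun_prop
        have hd : ∀ᶠ z in 𝓝 (y + (0 : ℝ) • (x - y)), DifferentiableAt ℝ D z := by
          rw [zero_smul, add_zero]
          filter_upwards [y1] with z hz using hz.differentiableAt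
        exact (hc.eventually hd).and (gt_mem_nhds one_pos)
      refine (hasDerivWithinAt_const (0 : ℝ) (Ici 0) (L y)).congr_of_eventuallyEq ?_ (by simp)
      filter_upwards [self_mem_nhdsWithin, mem_nhdsWithin_of_mem_nhds hev] with s hs hs'
      have := (gradient_of_eq_dist hD hy0 hxy (s := s) ⟨hs, hs'.2.le⟩ hs'.1).1
      have h3 := smul_right_injective E hx0.ne' (hxy'.symm.trans this)
      rw [hLy]
      exact (rieszVec_injective h3).symm
    have h3 := (uniqueDiffOn_Ici (0 : ℝ) 0 self_mem_Ici).eq_deriv _ h1 h2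
    rw [hxy', map_smul] at h3
    exact (smul_eq_zero.1 h3).resolve_left hx0.ne'
  have hπ : HasFDerivAt (fun z => z - D z • rieszVec E (L z))
      (ContinuousLinearMap.id ℝ E - (D x • (rieszVec E).comp (fderiv ℝ L x) +
        (L x).smulRight (rieszVec E (L x)))) x :=
    (hasFDerivAt_id x).sub (x1.self_of_nhds.smul ((rieszVec E).hasFDerivAt.comp x x2))
  -- Differentiating this invariance at `x` yields `D²D(x) = D²D(y) (1 - D(x) D²D(x))`; the part of
  -- the projection along the normal is annihilated by `hzero`. So the Hessians differ by `O(D(x))`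
  -- without any third derivative.
  have hLL : HasFDerivAt L ((fderiv ℝ L y).comp (ContinuousLinearMap.id ℝ E -
      (D x • (rieszVec E).comp (fderiv ℝ L x) + (L x).smulRight (rieszVec E (L x))))) x := by
    have h1 : HasFDerivAt L (fderiv ℝ L y) (x - D x • rieszVec E (L x)) := by rwa [hπx]
    refine (h1.comp x hπ).congr_of_eventuallyEq ?_
    filter_upwards [hΩ.mem_nhds hx, hcont.continuousAt.eventually_const_lt hx0,
      hcont.continuousAt.eventually_lt_const hxb] with z z1 z2 z3
    exact (hsame z z1 z2 z3).2.2.symm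
  have key : ∀ v, fderiv ℝ L x v v - fderiv ℝ L y v v =
      -(D x * fderiv ℝ L y (rieszVec E (fderiv ℝ L x v)) v) := by
    intro v
    have h1 := congrArg (fun l : E →L[ℝ] E →L[ℝ] ℝ => l v v) (x2.unique hLL)
    simp only [ContinuousLinearMap.comp_apply, _root_.sub_apply, _root_.add_apply,
      ContinuousLinearMap.id_apply, _root_.smul_apply, ContinuousLinearMap.smulRight_apply,
      map_sub, map_add, map_smul, hzero, smul_zero, add_zero, smul_eq_mul] at h1
    rw [h1]
    ring
  set B := stdOrthonormalBasis ℝ E with hB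
  rw [laplacian_eq_sum_fderiv_fderiv B, laplacian_eq_sum_fderiv_fderiv B, ← Finset.sum_sub_distrib]
  refine (Finset.abs_sum_le_sum_abs _ _).trans ?_
  have hterm : ∀ i ∈ Finset.univ, |fderiv ℝ (fderiv ℝ D) x (B i) (B i) -
      fderiv ℝ (fderiv ℝ D) y (B i) (B i)| ≤ C ^ 2 * |D x| := by
    intro i _
    have h1 := abs_laplacian_le_of_hasFDerivAt hC (hreg y hyΩ hyabs).2 (hreg x hx hxabs).2
      (B.norm_eq_one i)
    rw [key, abs_neg, abs_mul, mul_comm]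
    gcongr
  refine (Finset.sum_le_card_nsmul _ _ _ hterm).trans ?_
  rw [Finset.card_univ, Fintype.card_fin, nsmul_eq_mul, mul_assoc]

end Eikonal

/-! ### Time derivative of a distance away from its zero set -/

section TimeDerivative

variable {E : Type*} [NormedAddCommGroup E] [ProperSpace E] {D : E → ℝ → ℝ} {x y : E} {t : ℝ}

/-- All candidates at nearby times stay in a fixed ball around `x`. On the compact part of it away
from `y` one of the two defining equations fails at time `t`, hence also, by continuity and
compactness, at nearby times. -/
theorem eventually_nearest_point_mem_ball (hlip : ∀ᶠ s in 𝓝 t, ∀ u v, |D u s - D v s| ≤ ‖u - v‖)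
    (hcont : ∀ u, ContinuousAt (D u) t)
    (huniq : ∀ w, D w t = 0 → D x t = ‖x - w‖ → w = y) {ρ : ℝ} (hρ : 0 < ρ) :
    ∀ᶠ s in 𝓝 t, ∀ w, D w s = 0 → D x s = ‖x - w‖ → ‖w - y‖ < ρ := by
  set K := Metric.closedBall x (|D x t| + 1) \ Metric.ball y ρ with hK
  have hKc : IsCompact K := (isCompact_closedBall _ _).diff Metric.isOpen_ball
  have hjoint : ∀ w, Tendsto (fun q : ℝ × E => D q.2 q.1) (𝓝 (t, w)) (𝓝 (D w t)) := by
    intro w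
    have h1 : Tendsto (fun q : ℝ × E => ‖q.2 - w‖ + |D w q.1 - D w t|) (𝓝 (t, w)) (𝓝 0) := by
      have a1 : Tendsto (fun q : ℝ × E => ‖q.2 - w‖) (𝓝 (t, w)) (𝓝 0) := by
        have : Continuous fun q : ℝ × E => ‖q.2 - w‖ := by fun_prop
        simpa using this.tendsto (t, w)
      have a2 : Tendsto (fun q : ℝ × E => |D w q.1 - D w t|) (𝓝 (t, w)) (𝓝 0) := by
        have : ContinuousAt (fun q : ℝ × E => |D w q.1 - D w t|) (t, w) :=
          (((hcont w).comp (f := Prod.fst) (x := (t, w)) continuousAt_fst).sub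
            continuousAt_const).abs
        simpa [ContinuousAt] using this
      simpa using a1.add a2
    rw [tendsto_iff_dist_tendsto_zero]
    refine squeeze_zero' (Eventually.of_forall fun _ => dist_nonneg) ?_ h1
    filter_upwards [(continuous_fst.tendsto (t, w)).eventually hlip] with q hq
    rw [Real.dist_eq, show D q.2 q.1 - D w t = (D q.2 q.1 - D w q.1) + (D w q.1 - D w t) by ring]
    exact (abs_add_le _ _).trans (add_le_add_left (hq _ _) _)
  have h1 : ∀ᶠ s in 𝓝 t, ∀ w ∈ K, ¬(D w s = 0 ∧ D x s = ‖x - w‖) := by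
    refine hKc.eventually_forall_of_forall_eventually fun w hw => ?_
    by_cases h0 : D w t = 0
    · have hne : D x t - ‖x - w‖ ≠ 0 := by
        intro h
        have := huniq w h0 (sub_eq_zero.1 h)
        exact hw.2 (by rw [this]; exact Metric.mem_ball_self hρ)
      have h2 : ContinuousAt (fun q : ℝ × E => D x q.1 - ‖x - q.2‖) (t, w) := by
        refine ((hcont x).comp (f := Prod.fst) (x := (t, w)) continuousAt_fst).sub ?_
        fun_prop
      filter_upwards [h2.eventually_ne hne] with q hq hq'
      exact hq (sub_eq_zero.2 hq'.2)
    · filter_upwards [(hjoint w).eventually_ne h0] with q hq hq'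
      exact hq hq'.1
  filter_upwards [h1, (hcont x).abs.eventually_lt_const (show |D x t| < |D x t| + 1 by linarith)]
    with s hs hs' w hw hxw
  by_contra hlt
  refine hs w ⟨?_, ?_⟩ ⟨hw, hxw⟩
  · rw [mem_closedBall_iff_norm, norm_sub_rev, ← hxw]
    exact (le_abs_self _).trans hs'.le
  · rwa [mem_ball_iff_norm]

/-- A time dependent distance function has the same time derivative at `x` as at the nearest point
`y` of its zero set. -/
theorem hasDerivAt_of_nearest_points (hlip : ∀ᶠ s in 𝓝 t, ∀ u v, |D u s - D v s| ≤ ‖u - v‖)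
    (hcont : ∀ u, ContinuousAt (D u) t)
    (hfoot : ∀ᶠ s in 𝓝 t, ∃ w, D w s = 0 ∧ D x s = ‖x - w‖)
    (hy : D y t = 0) (hxy : D x t = ‖x - y‖)
    (huniq : ∀ w, D w t = 0 → D x t = ‖x - w‖ → w = y)
    (hd : ∀ᶠ q in 𝓝 (y, t), DifferentiableAt ℝ (D q.1) q.2)
    (hdc : ContinuousAt (fun q : E × ℝ => deriv (D q.1) q.2) (y, t)) :
    HasDerivAt (D x) (deriv (D y) t) t := by
  rw [hasDerivAt_iff_isLittleO, Asymptotics.isLittleO_iff]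
  intro η hη
  obtain ⟨ρ, hρ, hnear⟩ := Metric.eventually_nhds_iff.1 (hd.and (Metric.tendsto_nhds.1 hdc η hη))
  set v := deriv (D y) t with hv
  have hstep : ∀ w s, ‖w - y‖ < ρ → |s - t| < ρ →
      |D w s - D w t - (s - t) * v| ≤ η * |s - t| := by
    intro w s hw hs
    have hmem : ∀ u ∈ Metric.ball t ρ, dist (w, u) (y, t) < ρ := fun u hu => by
      rw [Prod.dist_eq, max_lt_iff, dist_eq_norm]
      exact ⟨hw, hu⟩
    have h1 : ∀ u ∈ Metric.ball t ρ, HasDerivWithinAt (fun s => D w s - s * v)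
        (deriv (D w) u - 1 * v) (Metric.ball t ρ) u := fun u hu =>
      ((hnear (hmem u hu)).1.hasDerivAt.sub ((hasDerivAt_id u).mul_const v)).hasDerivWithinAt
    have h2 : ∀ u ∈ Metric.ball t ρ, ‖deriv (D w) u - 1 * v‖ ≤ η := fun u hu => by
      rw [one_mul, ← dist_eq_norm]
      exact (hnear (hmem u hu)).2.le
    have := (convex_ball t ρ).norm_image_sub_le_of_norm_hasDerivWithin_le h1 h2
      (Metric.mem_ball_self hρ) (by rwa [Metric.mem_ball, Real.dist_eq])
    rw [Real.norm_eq_abs, Real.norm_eq_abs] at this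
    convert! this using 2
    ring
  filter_upwards [hlip, hlip.self_of_nhds |> fun h => Eventually.of_forall fun _ => h, hfoot,
    eventually_nearest_point_mem_ball hlip hcont huniq hρ, Metric.ball_mem_nhds t hρ]
    with s hs ht ⟨w, hw, hxw⟩ hball hsρ
  have hsρ' : |s - t| < ρ := by rwa [Metric.mem_ball, Real.dist_eq] at hsρ
  -- The old nearest point `y` bounds `D x s - D x t` above by the increment of `D y`; the new one
  -- `w` bounds it below by the increment of `D w`. Both increments are `(s - t) v` up to `η |s -
  -- t|`.
  have c1 := abs_le.1 (hstep w s (hball w hw hxw) hsρ')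
  have c2 := abs_le.1 (hstep y s (by simpa using hρ) hsρ')
  have d1 := (abs_le.1 (hs x y)).2
  have d2 := (abs_le.1 (ht x w)).2
  rw [Real.norm_eq_abs, Real.norm_eq_abs, smul_eq_mul]
  exact abs_le.2 ⟨by linarith, by linarith⟩

end TimeDerivative

/-! ### Signed distance to the boundary of an open set -/

section SignedDist

variable {n : ℕ} {V : Set (EuclideanSpace ℝ (Fin n))}

theorem abs_signedDist (γ V : Set (EuclideanSpace ℝ (Fin n))) (x : EuclideanSpace ℝ (Fin n)) :
    |signedDist γ V x| = Metric.infDist x γ := by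
  rw [signedDist]
  split_ifs
  · rw [abs_neg, abs_of_nonneg Metric.infDist_nonneg]
  · rw [abs_of_nonneg Metric.infDist_nonneg]

theorem frontier_nonempty_of_isBounded (hn : 0 < n) (hV : V.Nonempty)
    (hb : Bornology.IsBounded V) : (frontier V).Nonempty := by
  rw [nonempty_frontier_iff]
  refine ⟨hV, ?_⟩
  rintro rfl
  have : Nonempty (Fin n) := ⟨⟨0, hn⟩⟩
  exact NormedSpace.unbounded_univ ℝ (EuclideanSpace ℝ (Fin n)) hb

theorem signedDist_eq_zero_iff (hne : (frontier V).Nonempty)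
    (y : EuclideanSpace ℝ (Fin n)) : signedDist (frontier V) V y = 0 ↔ y ∈ frontier V := by
  rw [← abs_eq_zero, abs_signedDist, ← isClosed_frontier.mem_iff_infDist_zero hne]

theorem exists_nearest_frontier_point (hne : (frontier V).Nonempty)
    (x : EuclideanSpace ℝ (Fin n)) :
    ∃ y ∈ frontier V, signedDist (frontier V) V y = 0 ∧ |signedDist (frontier V) V x| = ‖x - y‖ := by
  obtain ⟨y, hy, h⟩ := isClosed_frontier.exists_infDist_eq_dist hne x
  refine ⟨y, hy, (signedDist_eq_zero_iff hne y).2 hy, ?_⟩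
  rw [abs_signedDist, h, dist_eq_norm]

/-- The segment is connected and must meet the frontier; this makes the signed distance 1-Lipschitz
across it. -/
theorem infDist_add_infDist_le (hV : IsOpen V) {x z : EuclideanSpace ℝ (Fin n)} (hx : x ∈ V)
    (hz : z ∉ V) : Metric.infDist x (frontier V) + Metric.infDist z (frontier V) ≤ ‖x - z‖ := by
  obtain ⟨w, hw, hwf⟩ : (segment ℝ x z ∩ frontier V).Nonempty := by
    by_contra hemp
    have hsub : segment ℝ x z ⊆ V ∪ (closure V)ᶜ := fun w hw => by
      by_cases h : w ∈ V
      · exact Or.inl h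
      · refine Or.inr fun hc => hemp ⟨w, hw, ?_⟩
        rw [hV.frontier_eq]; exact ⟨hc, h⟩
    have hz' : z ∈ (closure V)ᶜ := (hsub (right_mem_segment ℝ x z)).resolve_left hz
    obtain ⟨w, -, h1, h2⟩ := (convex_segment (𝕜 := ℝ) x z).isPreconnected V (closure V)ᶜ hV
      isClosed_closure.isOpen_compl hsub ⟨x, left_mem_segment ℝ x z, hx⟩
      ⟨z, right_mem_segment ℝ x z, hz'⟩
    exact h2 (subset_closure h1)
  have h1 := Metric.infDist_le_dist_of_mem (x := x) hwf
  have h2 := Metric.infDist_le_dist_of_mem (x := z) hwf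
  have h3 := dist_add_dist_of_mem_segment hw
  rw [← dist_eq_norm, ← h3, dist_comm w z]
  exact add_le_add h1 h2

theorem abs_signedDist_sub_le (hV : IsOpen V) (x z : EuclideanSpace ℝ (Fin n)) :
    |signedDist (frontier V) V x - signedDist (frontier V) V z| ≤ ‖x - z‖ := by
  have h1 := Metric.infDist_le_infDist_add_dist (s := frontier V) (x := x) (y := z)
  have h2 := Metric.infDist_le_infDist_add_dist (s := frontier V) (x := z) (y := x)
  rw [dist_comm, dist_eq_norm] at h2
  rw [dist_eq_norm] at h1
  have h3 : 0 ≤ Metric.infDist x (frontier V) := Metric.infDist_nonneg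
  have h4 : 0 ≤ Metric.infDist z (frontier V) := Metric.infDist_nonneg
  rw [signedDist, signedDist]
  split_ifs with hx hz hz
  · exact abs_le.2 ⟨by linarith, by linarith⟩
  · have := infDist_add_infDist_le hV hx hz
    exact abs_le.2 ⟨by linarith, by linarith⟩
  · have := infDist_add_infDist_le hV hz hx
    rw [norm_sub_rev] at this
    exact abs_le.2 ⟨by linarith, by linarith⟩
  · exact abs_le.2 ⟨by linarith, by linarith⟩

end SignedDist

/-! ### Distance functions of the forced flow -/

namespace IsForcedFlow

variable {n : ℕ} {Ω : Set (EuclideanSpace ℝ (Fin n))} {F : ℝ → ℝ} {T : ℝ}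
  {U : ℝ → Set (EuclideanSpace ℝ (Fin n))}

theorem frontier_nonempty (h : IsForcedFlow Ω F T U) (hn : 2 ≤ n) {t : ℝ} (ht : t ∈ Icc 0 T) :
    (frontier (U t)).Nonempty :=
  frontier_nonempty_of_isBounded (by omega) (h.nonempty t ht) (h.isBounded t ht)

theorem deriv_eq (h : IsForcedFlow Ω F T U) (hn : 2 ≤ n) {t : ℝ} (ht : t ∈ Ioo 0 T)
    {y : EuclideanSpace ℝ (Fin n)} (hy : y ∈ frontier (U t)) :
    deriv (regionDist U y) t = (Δ fun x => regionDist U x t) y - F t := by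
  have hn' : (n : ℝ) - 1 ≠ 0 := by
    have : (2 : ℝ) ≤ n := by exact_mod_cast hn
    linarith
  have := h.law t ht y hy
  rw [inwardVelocity, meanCurvature, mul_div_cancel₀ _ hn'] at this
  exact this

/-- Off the front the nearest-point theorems apply, to the signed distance outside and to its
negative inside. They reduce the time derivative and the Laplacian to the front, where the law of
motion holds. -/
theorem isFrontDistanceAt (h : IsForcedFlow Ω F T U) (hn : 2 ≤ n) (hΩ : IsOpen Ω) {t b C : ℝ}
    (ht : t ∈ Ioo 0 T) (hC : 0 ≤ C)
    (hreg : ∀ z ∈ Ω, |regionDist U z t| < b → ContDiffAt ℝ 2 (fun x => regionDist U x t) z ∧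
      ∀ u v, |fderiv ℝ (fderiv ℝ fun x => regionDist U x t) z u v| ≤ C * ‖u‖ * ‖v‖)
    {x : EuclideanSpace ℝ (Fin n)} (hx : x ∈ Ω) :
    IsFrontDistanceAt (regionDist U) (F t) (n * C ^ 2) b x t := by
  have ht' : t ∈ Icc 0 T := Ioo_subset_Icc_self ht
  have hIcc : Icc 0 T ∈ 𝓝 t := Icc_mem_nhds ht.1 ht.2
  have hlip : ∀ᶠ s in 𝓝 t, ∀ u v, |regionDist U u s - regionDist U v s| ≤ ‖u - v‖ := by
    filter_upwards [hIcc] with s hs u v using abs_signedDist_sub_le (h.isOpen s hs) u v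
  have hcont : ∀ u, ContinuousAt (regionDist U u) t := fun u =>
    (h.continuous_time u).continuousAt hIcc
  have hzero : ∀ s ∈ Icc 0 T, ∀ w, regionDist U w s = 0 ↔ w ∈ frontier (U s) := fun s hs w =>
    signedDist_eq_zero_iff (h.frontier_nonempty hn hs) w
  have hfoot : ∀ s ∈ Icc 0 T, ∀ z, ∃ w ∈ Ω, regionDist U w s = 0 ∧
      |regionDist U z s| = ‖z - w‖ := fun s hs z => by
    obtain ⟨w, w1, w2, w3⟩ := exists_nearest_frontier_point
      (h.frontier_nonempty hn hs) z
    exact ⟨w, h.frontier_subset s hs w1, w2, w3⟩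
  have hspace : Continuous fun u => regionDist U u t :=
    (LipschitzWith.of_dist_le_mul (K := 1) fun u v => by
      rw [NNReal.coe_one, one_mul, Real.dist_eq, dist_eq_norm]
      exact hlip.self_of_nhds u v).continuous
  have hdiff : ∀ y ∈ frontier (U t), (∀ᶠ q in 𝓝 (y, t), DifferentiableAt ℝ (regionDist U q.1) q.2) ∧
      ContinuousAt (fun q : EuclideanSpace ℝ (Fin n) × ℝ => deriv (regionDist U q.1) q.2)
        (y, t) := fun y hy => by
    obtain ⟨V, hV, h1, h2⟩ := h.regular t ht y hy
    refine ⟨?_, h2.continuousAt hV⟩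
    filter_upwards [hV] with q hq using (h1 q hq).2
  -- points outside the region
  have hplus : ∀ z ∈ Ω, 0 < regionDist U z t → regionDist U z t < b →
      ‖fderiv ℝ (fun y => regionDist U y t) z‖ = 1 ∧ ∃ H,
        |(Δ fun y => regionDist U y t) z - H| ≤ n * C ^ 2 * |regionDist U z t| ∧
        HasDerivAt (regionDist U z) (H - F t) t := by
    intro z hz h0 hb
    obtain ⟨r1, y, -, r2, r3, r4, r5⟩ := regularity_of_nearest_points
      (D := fun y => regionDist U y t) hlip.self_of_nhds hΩ hreg hC hz h0 hb
      (fun w hw => by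
        obtain ⟨y, y1, y2, y3⟩ := hfoot t ht' w
        exact ⟨y, y1, y2, by rw [← y3, abs_of_pos hw]⟩)
    have hy := (hzero t ht' y).1 r2
    refine ⟨r1, (Δ fun y => regionDist U y t) y, ?_, ?_⟩
    · rwa [finrank_euclideanSpace_fin] at r5
    · rw [← h.deriv_eq hn ht hy]
      refine hasDerivAt_of_nearest_points hlip hcont ?_ r2 r3 r4 (hdiff y hy).1 (hdiff y hy).2
      filter_upwards [hIcc, (hcont z).eventually_const_lt h0] with s hs hs0
      obtain ⟨w, -, w1, w2⟩ := hfoot s hs z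
      exact ⟨w, w1, by rw [← w2, abs_of_pos hs0]⟩
  -- points inside the region
  have hminus : ∀ z ∈ Ω, regionDist U z t < 0 → -b < regionDist U z t →
      ‖fderiv ℝ (fun y => regionDist U y t) z‖ = 1 ∧ ∃ H,
        |(Δ fun y => regionDist U y t) z - H| ≤ n * C ^ 2 * |regionDist U z t| ∧
        HasDerivAt (regionDist U z) (H - F t) t := by
    intro z hz h0 hb
    have hf : ∀ z, fderiv ℝ (fun y => -regionDist U y t) z =
        -fderiv ℝ (fun y => regionDist U y t) z := fun z => fderiv_fun_neg
    have hΔ : ∀ z, (Δ fun y => -regionDist U y t) z = -(Δ fun y => regionDist U y t) z := fun z =>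
      congrFun (InnerProductSpace.laplacian_neg (f := fun y => regionDist U y t)) z
    obtain ⟨r1, y, -, r2, r3, r4, r5⟩ := regularity_of_nearest_points
      (D := fun y => -regionDist U y t) (b := b) (C := C)
      (fun u v => by
        rw [neg_sub_neg, norm_sub_rev]; exact hlip.self_of_nhds v u) hΩ
      (fun w hw hwb => by
        rw [abs_neg] at hwb
        obtain ⟨a1, a2⟩ := hreg w hw hwb
        refine ⟨a1.neg, fun u v => ?_⟩
        rw [funext hf, fderiv_fun_neg]
        simpa using a2 u v) hC hz (by linarith) (by linarith)
      (fun w hw => by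
        obtain ⟨y, y1, y2, y3⟩ := hfoot t ht' w
        exact ⟨y, y1, by rw [y2, neg_zero], by rw [← y3, abs_of_neg (by linarith)]⟩)
    have r2' := neg_eq_zero.1 r2
    have hy := (hzero t ht' y).1 r2'
    rw [hf, norm_neg] at r1
    refine ⟨r1, (Δ fun y => regionDist U y t) y, ?_, ?_⟩
    · rw [finrank_euclideanSpace_fin, hΔ, hΔ, abs_neg, neg_sub_neg, abs_sub_comm] at r5
      exact r5
    · rw [← h.deriv_eq hn ht hy]
      have hneg : ∀ q : EuclideanSpace ℝ (Fin n) × ℝ, deriv (fun s => -regionDist U q.1 s) q.2 =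
          -deriv (regionDist U q.1) q.2 := fun q => deriv.fun_neg
      have := hasDerivAt_of_nearest_points (D := fun u s => -regionDist U u s) (x := z) (y := y)
        (t := t) (hlip.mono fun s hs u v => by rw [neg_sub_neg, norm_sub_rev]; exact hs v u)
        (fun u => (hcont u).neg) ?_ r2 r3 r4 ((hdiff y hy).1.mono fun q hq => hq.neg)
        (by simp only [hneg]; exact (hdiff y hy).2.neg)
      · have e := this.neg
        rw [hneg (y, t), neg_neg] at e
        refine e.congr_of_eventuallyEq (Eventually.of_forall fun s => ?_)
        simp
      · filter_upwards [hIcc, (hcont z).eventually_lt_const h0] with s hs hs0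
        obtain ⟨w, -, w1, w2⟩ := hfoot s hs z
        exact ⟨w, by rw [w1, neg_zero], by rw [← w2, abs_of_neg hs0]⟩
  refine ⟨fun hlt => ⟨(hreg x hx hlt).1, ?_⟩, hspace.continuousAt, hcont x⟩
  rcases lt_trichotomy (regionDist U x t) 0 with h0 | h0 | h0
  · exact hminus x hx h0 (abs_lt.1 hlt).1
  · have hxf := (hzero t ht' x).1 h0
    refine ⟨?_, (Δ fun y => regionDist U y t) x, by simp [h0], ?_⟩
    -- On the front itself the gradient has norm one by continuity, since every front point is a
    -- limit of points of the region.
    · by_contra hne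
      have hc : ContinuousAt (fderiv ℝ fun y => regionDist U y t) x :=
        ((hreg x hx hlt).1.fderiv_right (m := 0) (by norm_num)).continuousAt
      have hev := hc.norm.eventually_ne hne
      obtain ⟨z, ⟨⟨z1, z2⟩, z3⟩, z4⟩ := mem_closure_iff_nhds.1 (frontier_subset_closure hxf) _
        (inter_mem (inter_mem hev (hΩ.mem_nhds hx))
          (hspace.abs.continuousAt.eventually_lt_const hlt))
      have hz0 : regionDist U z t < 0 := by
        have a1 : regionDist U z t ≤ 0 := by
          rw [regionDist, signedDist, if_pos z4]
          exact neg_nonpos.2 Metric.infDist_nonneg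
        refine lt_of_le_of_ne a1 fun a2 => ?_
        have a3 := (hzero t ht' z).1 a2
        rw [(h.isOpen t ht').frontier_eq] at a3
        exact a3.2 z4
      exact z1 (hminus z z2 hz0 (abs_lt.1 z3).1).1
    · rw [← h.deriv_eq hn ht hxf]
      exact (hdiff x hxf).1.self_of_nhds.hasDerivAt
  · exact hplus x hx h0 (abs_lt.1 hlt).2

end IsForcedFlow

/-- Once the distances differ by at most `r/2`, the tube of width `r/2` around the moving front lies
in the fixed tube of width `r`, where the limit's Hessian bound plus one serves all small `ε`. -/
theorem SignedDistConverge.exists_regular {n : ℕ} {Ω : Set (EuclideanSpace ℝ (Fin n))} {T : ℝ}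
    {G : ℝ → Set (EuclideanSpace ℝ (Fin n))} {U : ℝ → ℝ → Set (EuclideanSpace ℝ (Fin n))}
    (h : SignedDistConverge Ω T G U) :
    ∃ b > 0, ∃ C, 0 ≤ C ∧ ∃ ε₂ > 0, ∀ ε, 0 < ε → ε < ε₂ → ∀ t ∈ Icc 0 T, ∀ z ∈ Ω,
      |regionDist (U ε) z t| < b → ContDiffAt ℝ 2 (fun x => regionDist (U ε) x t) z ∧
        ∀ u v, |fderiv ℝ (fderiv ℝ fun x => regionDist (U ε) x t) z u v| ≤ C * ‖u‖ * ‖v‖ := by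
  obtain ⟨α, r, C, -, -, hr, hG, hconv⟩ := h.converge
  obtain ⟨ε₂, hε₂, hconv⟩ := hconv (min 1 (r / 2)) (lt_min one_pos (half_pos hr))
  refine ⟨r / 2, half_pos hr, |C| + 1, by positivity, ε₂, hε₂, ?_⟩
  intro ε hε hεε₂ t ht z hz hzb
  obtain ⟨hdiff, hcd, hbd, -⟩ := hconv ε hε hεε₂ t ht
  obtain ⟨gcd, gbd, -⟩ := hG t ht
  set D := {x | |regionDist G x t| < r} with hD
  have hcont : Continuous fun u => regionDist G u t :=
    (LipschitzWith.of_dist_le_mul (K := 1) fun u v => by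
      rw [NNReal.coe_one, one_mul, Real.dist_eq, dist_eq_norm]
      exact abs_signedDist_sub_le (h.isOpen t ht) u v).continuous
  have hDo : IsOpen D := isOpen_lt hcont.abs continuous_const
  have hzD : z ∈ D := by
    have h1 := (hdiff z hz).trans (min_le_right _ _)
    have h2 := abs_sub_abs_le_abs_sub (regionDist G z t) (regionDist (U ε) z t)
    rw [abs_sub_comm] at h2
    change |regionDist G z t| < r
    linarith
  have a1 : ContDiffAt ℝ 2 (fun x => regionDist G x t) z := gcd.contDiffAt (hDo.mem_nhds hzD)
  have a2 : ContDiffAt ℝ 2 (fun x => regionDist (U ε) x t - regionDist G x t) z :=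
    hcd.contDiffAt (hDo.mem_nhds hzD)
  have e : (fun x => regionDist (U ε) x t) = (fun x => regionDist G x t) +
      fun x => regionDist (U ε) x t - regionDist G x t := by
    ext x; simp
  refine ⟨e ▸ a1.add a2, fun u v => ?_⟩
  have h3 : ‖iteratedFDeriv ℝ 2 (fun x => regionDist (U ε) x t) z‖ ≤ |C| + 1 := by
    rw [e, iteratedFDeriv_add_apply a1 a2]
    refine (norm_add_le _ _).trans (add_le_add ?_ ?_)
    · exact (gbd 2 le_rfl z hzD).trans (le_abs_self _)
    · exact (hbd 2 le_rfl z hzD).trans (min_le_left _ _)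
  have h4 := (iteratedFDeriv ℝ 2 (fun x => regionDist (U ε) x t) z).le_opNorm ![u, v]
  rw [iteratedFDeriv_two_apply, Fin.prod_univ_two] at h4
  simp only [Matrix.cons_val_zero, Matrix.cons_val_one, Real.norm_eq_abs] at h4
  refine h4.trans ?_
  rw [mul_assoc]
  gcongr

/-! ### Bounds for the noise -/

/-- Scaling: `εξ^ε` is of size `ε^{1-γ₁}`, and one time derivative costs a further `ε^{-2γ₁}`,
leaving `ε^{1-3γ₁} ≤ 1`. The bound `M` is deterministic, hence so is the threshold for `ε`. -/
theorem IsMixingProcess.noiseOne_bounds {Ωp : Type*} [MeasurableSpace Ωp] {P : Measure Ωp}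
    {ξ : ℝ → Ωp → ℝ} {M γ₁ : ℝ} (h : IsMixingProcess P ξ M) (h0 : 0 < γ₁) (h1 : γ₁ < 1 / 3)
    {δ₀ : ℝ} (hδ₀ : 0 < δ₀) :
    ∃ ε₀ > 0, ∀ᵐ ω ∂P, ∀ ε, 0 < ε → ε < ε₀ → ∀ t, 0 < t → |ε * noiseOne ξ γ₁ ε ω t| ≤ δ₀ ∧
      ∃ ξ', HasDerivAt (noiseOne ξ γ₁ ε ω) ξ' t ∧ |ε * ξ'| ≤ |M| := by
  have hlim : Tendsto (fun ε : ℝ => ε ^ (1 - γ₁) * |M|) (𝓝 0) (𝓝 0) := by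
    have : ContinuousAt (fun ε : ℝ => ε ^ (1 - γ₁) * |M|) 0 :=
      (Real.continuousAt_rpow_const _ _ (Or.inr (by linarith))).mul continuousAt_const
    have h2 := this.tendsto
    rwa [Real.zero_rpow (by linarith), zero_mul] at h2
  obtain ⟨ε₁, hε₁, hsmall⟩ := Metric.eventually_nhds_iff.1 (hlim.eventually_le_const hδ₀)
  refine ⟨min ε₁ 1, by positivity, ?_⟩
  filter_upwards [h.contDiff, h.bound, h.bound_deriv] with ω w1 w2 w3 ε hε hεε t ht
  have hε1 : ε ≤ 1 := hεε.le.trans (min_le_right _ _)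
  have hs : 0 < ε ^ (-(2 * γ₁)) * t := by positivity
  constructor
  · refine le_trans ?_ (hsmall (y := ε) (by
      rw [dist_zero_right, Real.norm_eq_abs, abs_of_pos hε]
      exact hεε.trans_le (min_le_left _ _)))
    rw [noiseOne, ← mul_assoc, abs_mul, abs_of_pos (by positivity : 0 < ε * ε ^ (-γ₁)),
      sub_eq_add_neg, Real.rpow_add hε, Real.rpow_one]
    exact mul_le_mul_of_nonneg_left ((w2 _ hs.le).trans (le_abs_self M)) (by positivity)
  · have hd : HasDerivAt (fun s => ξ s ω) (deriv (fun s => ξ s ω) (ε ^ (-(2 * γ₁)) * t))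
        (ε ^ (-(2 * γ₁)) * t) :=
      ((w1.contDiffAt (Ici_mem_nhds hs)).differentiableAt one_ne_zero).hasDerivAt
    have hl : HasDerivAt (fun s => ε ^ (-(2 * γ₁)) * s) (ε ^ (-(2 * γ₁)) * 1) t :=
      (hasDerivAt_id t).const_mul _
    refine ⟨_, (hd.comp t hl).const_mul (ε ^ (-γ₁)), ?_⟩
    have e : ε * (ε ^ (-γ₁) * (deriv (fun s => ξ s ω) (ε ^ (-(2 * γ₁)) * t) *
        (ε ^ (-(2 * γ₁)) * 1))) = ε ^ (1 - 3 * γ₁) * deriv (fun s => ξ s ω)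
          (ε ^ (-(2 * γ₁)) * t) := by
      rw [show 1 - 3 * γ₁ = 1 + -γ₁ + -(2 * γ₁) by ring, Real.rpow_add hε, Real.rpow_add hε,
        Real.rpow_one]
      ring
    rw [e, abs_mul, abs_of_pos (Real.rpow_pos_of_pos hε _)]
    have h3 : ε ^ (1 - 3 * γ₁) ≤ 1 := Real.rpow_le_one hε.le hε1 (by linarith)
    calc ε ^ (1 - 3 * γ₁) * |deriv (fun s => ξ s ω) (ε ^ (-(2 * γ₁)) * t)| ≤ 1 * |M| :=
          mul_le_mul h3 ((w3 _ hs).trans (le_abs_self M)) (abs_nonneg _) zero_le_one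
      _ = |M| := one_mul _

/-! ### Hölder continuity of Brownian paths -/

theorem natFloor_mul_two (x : ℝ) (hx : 0 ≤ x) :
    ⌊x * 2⌋₊ = 2 * ⌊x⌋₊ ∨ ⌊x * 2⌋₊ = 2 * ⌊x⌋₊ + 1 := by
  have h1 := Nat.floor_le hx
  have h2 := Nat.lt_floor_add_one x
  have h3 : 2 * ⌊x⌋₊ ≤ ⌊x * 2⌋₊ := Nat.le_floor (by push_cast; linarith)
  have h4 : ⌊x * 2⌋₊ < 2 * ⌊x⌋₊ + 2 := (Nat.floor_lt (by positivity)).2 (by push_cast; linarith)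
  omega

/-- Chaining: refining the grid once moves the rounded-down point by at most one step of the finer
grid, so the increments form a geometric series. -/
theorem abs_sub_dyadic_le {w : ℝ → ℝ} {q C : ℝ} {N : ℕ} (hq0 : 0 < q) (hq1 : q < 1)
    (hw : Continuous w)
    (h : ∀ n j : ℕ, j < N * 2 ^ n → |w ((j + 1) / 2 ^ n) - w (j / 2 ^ n)| ≤ C * q ^ n)
    (hC : 0 ≤ C) {s : ℝ} (hs : s ∈ Icc (0 : ℝ) N) (n : ℕ) :
    |w s - w (⌊s * 2 ^ n⌋₊ / 2 ^ n)| ≤ C * q ^ n / (1 - q) := by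
  have hq : 0 < 1 - q := by linarith
  have hstep : ∀ n, |w (⌊s * 2 ^ (n + 1)⌋₊ / 2 ^ (n + 1)) - w (⌊s * 2 ^ n⌋₊ / 2 ^ n)| ≤
      C * q ^ (n + 1) := by
    intro n
    have e : s * 2 ^ (n + 1) = s * 2 ^ n * 2 := by rw [pow_succ, mul_assoc]
    have e2 : (⌊s * 2 ^ n⌋₊ : ℝ) / 2 ^ n = (2 * ⌊s * 2 ^ n⌋₊ : ℕ) / 2 ^ (n + 1) := by
      push_cast; rw [pow_succ]; field_simp
    rcases natFloor_mul_two (s * 2 ^ n) (by have := hs.1; positivity) with h1 | h1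
    · rw [e, h1, e2, sub_self, abs_zero]; positivity
    · have hlt : 2 * ⌊s * 2 ^ n⌋₊ < N * 2 ^ (n + 1) := by
        have : ⌊s * 2 ^ (n + 1)⌋₊ ≤ N * 2 ^ (n + 1) := by
          refine Nat.floor_le_of_le ?_
          push_cast
          gcongr
          exact hs.2
        rw [e, h1] at this
        omega
      have := h (n + 1) _ hlt
      rw [e, h1, e2]
      push_cast at this ⊢
      exact this
  have hsum : ∀ k, |w (⌊s * 2 ^ (n + k)⌋₊ / 2 ^ (n + k)) - w (⌊s * 2 ^ n⌋₊ / 2 ^ n)| ≤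
      C * (q ^ n - q ^ (n + k)) / (1 - q) := by
    intro k
    induction k with
    | zero => simp
    | succ k ih =>
      have h1 := hstep (n + k)
      have h2 := abs_sub_le (w (⌊s * 2 ^ (n + (k + 1))⌋₊ / 2 ^ (n + (k + 1))))
        (w (⌊s * 2 ^ (n + k)⌋₊ / 2 ^ (n + k))) (w (⌊s * 2 ^ n⌋₊ / 2 ^ n))
      rw [← add_assoc] at h2 ⊢
      have h3 : C * q ^ (n + k + 1) ≤ C * (q ^ (n + k) - q ^ (n + k + 1)) / (1 - q) := by
        rw [le_div_iff₀ hq, pow_succ, mul_assoc]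
        have : q ^ (n + k) * q * (1 - q) ≤ q ^ (n + k) - q ^ (n + k) * q := by
          have := pow_pos hq0 (n + k)
          nlinarith [mul_pos this hq]
        gcongr
      have h4 : C * (q ^ n - q ^ (n + k)) / (1 - q) + C * (q ^ (n + k) - q ^ (n + k + 1)) / (1 - q)
          = C * (q ^ n - q ^ (n + k + 1)) / (1 - q) := by ring
      linarith
  have hlim : Tendsto (fun k : ℕ => (⌊s * 2 ^ (n + k)⌋₊ : ℝ) / 2 ^ (n + k)) atTop (𝓝 s) := by
    have h1 : Tendsto (fun k : ℕ => (2 : ℝ) ^ (n + k)) atTop atTop :=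
      (tendsto_pow_atTop_atTop_of_one_lt one_lt_two).comp (tendsto_add_atTop_nat n |>.congr
        fun k => add_comm _ _)
    exact (tendsto_nat_floor_mul_div_atTop hs.1).comp h1
  have h5 : Tendsto (fun k : ℕ => |w (⌊s * 2 ^ (n + k)⌋₊ / 2 ^ (n + k)) -
      w (⌊s * 2 ^ n⌋₊ / 2 ^ n)|) atTop (𝓝 |w s - w (⌊s * 2 ^ n⌋₊ / 2 ^ n)|) :=
    (((hw.tendsto s).comp hlim).sub_const _).abs
  refine le_of_tendsto' h5 fun k => (hsum k).trans ?_
  gcongr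
  linarith [pow_pos hq0 (n + k)]

/-- A path with Hölder increments along the dyadic grids is Hölder continuous. -/
theorem exists_holder_of_dyadic {w : ℝ → ℝ} {a C : ℝ} {N : ℕ} (ha : 0 < a) (hw : Continuous w)
    (h : ∀ n j : ℕ, j < N * 2 ^ n →
      |w ((j + 1) / 2 ^ n) - w (j / 2 ^ n)| ≤ C * ((1 / 2 : ℝ) ^ a) ^ n) (hC : 0 ≤ C) :
    ∃ C', 0 ≤ C' ∧ ∀ s ∈ Icc (0 : ℝ) N, ∀ t ∈ Icc (0 : ℝ) N, |s - t| ≤ 1 →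
      |w s - w t| ≤ C' * |s - t| ^ a := by
  set q := (1 / 2 : ℝ) ^ a with hq
  have hq0 : 0 < q := by positivity
  have hq1 : q < 1 := Real.rpow_lt_one (by norm_num) (by norm_num) ha
  have hq2 : 0 < 1 - q := by linarith
  refine ⟨C * (2 / (1 - q) + 1) * 2 ^ a, by positivity, ?_⟩
  have main : ∀ s ∈ Icc (0 : ℝ) N, ∀ t ∈ Icc (0 : ℝ) N, s < t → t - s ≤ 1 →
      |w s - w t| ≤ C * (2 / (1 - q) + 1) * 2 ^ a * (t - s) ^ a := by
    intro s hs t ht hst hst1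
    -- The grid size is matched to the distance, `2^{-n-1} < t - s ≤ 2^{-n}`, so the rounded-down
    -- points are equal or adjacent.
    obtain ⟨n, hn1, hn2⟩ := exists_nat_pow_near_of_lt_one (sub_pos.2 hst) hst1
      (show (0 : ℝ) < 1 / 2 by norm_num) (by norm_num)
    have hp : (0 : ℝ) < 2 ^ n := by positivity
    have h1 := abs_sub_dyadic_le hq0 hq1 hw h hC hs n
    have h2 := abs_sub_dyadic_le hq0 hq1 hw h hC ht n
    have hle : t * 2 ^ n ≤ s * 2 ^ n + 1 := by
      rw [one_div, inv_pow, ← one_div, le_div_iff₀ hp] at hn2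
      linarith
    have h3 : |w (⌊s * 2 ^ n⌋₊ / 2 ^ n) - w (⌊t * 2 ^ n⌋₊ / 2 ^ n)| ≤ C * q ^ n := by
      have hs0 : 0 ≤ s * 2 ^ n := by have := hs.1; positivity
      have f1 : ⌊s * 2 ^ n⌋₊ ≤ ⌊t * 2 ^ n⌋₊ := Nat.floor_le_floor (by gcongr)
      have f2 : ⌊t * 2 ^ n⌋₊ ≤ ⌊s * 2 ^ n⌋₊ + 1 := by
        rw [← Nat.floor_add_one hs0]
        exact Nat.floor_le_floor hle
      rcases eq_or_lt_of_le f1 with h4 | h4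
      · rw [h4, sub_self, abs_zero]; positivity
      · have h5 : ⌊t * 2 ^ n⌋₊ = ⌊s * 2 ^ n⌋₊ + 1 := by omega
        have h6 : ⌊t * 2 ^ n⌋₊ ≤ N * 2 ^ n := by
          refine Nat.floor_le_of_le ?_
          push_cast
          gcongr
          exact ht.2
        have := h n ⌊s * 2 ^ n⌋₊ (by omega)
        rw [abs_sub_comm, h5]
        push_cast
        exact this
    have h4 : |w s - w t| ≤ C * q ^ n / (1 - q) + C * q ^ n + C * q ^ n / (1 - q) := by
      have e : w s - w t = (w s - w (⌊s * 2 ^ n⌋₊ / 2 ^ n)) +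
        (w (⌊s * 2 ^ n⌋₊ / 2 ^ n) - w (⌊t * 2 ^ n⌋₊ / 2 ^ n)) -
        (w t - w (⌊t * 2 ^ n⌋₊ / 2 ^ n)) := by ring
      rw [e]
      refine (abs_sub _ _).trans (add_le_add ((abs_add_le _ _).trans (add_le_add h1 h3)) h2)
    have h5 : q ^ n ≤ 2 ^ a * (t - s) ^ a := by
      rw [hq, ← Real.mul_rpow (by norm_num) (by linarith), ← Real.rpow_natCast, ← Real.rpow_mul
        (by norm_num), mul_comm a, Real.rpow_mul (by norm_num), Real.rpow_natCast]
      refine Real.rpow_le_rpow (by positivity) ?_ ha.le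
      rw [pow_succ] at hn1
      linarith
    calc |w s - w t| ≤ C * (2 / (1 - q) + 1) * q ^ n := by
          refine h4.trans (le_of_eq ?_); ring
      _ ≤ C * (2 / (1 - q) + 1) * (2 ^ a * (t - s) ^ a) := by gcongr
      _ = _ := by ring
  intro s hs t ht hst
  rcases lt_trichotomy s t with h1 | h1 | h1
  · rw [abs_sub_comm s t, abs_of_pos (sub_pos.2 h1)] at hst ⊢
    exact main s hs t ht h1 hst
  · rw [h1]; simp [Real.zero_rpow ha.ne']
  · rw [abs_of_pos (sub_pos.2 h1)] at hst ⊢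
    rw [abs_sub_comm]
    exact main t ht s hs h1 hst

theorem lintegral_enorm_pow_gaussianReal (c : ℝ) (p : ℕ) (v : ℝ≥0) (hv : (v : ℝ) = c ^ 2) :
    ∫⁻ z, ‖z‖ₑ ^ p ∂(gaussianReal 0 v) = ‖c‖ₑ ^ p * ∫⁻ z, ‖z‖ₑ ^ p ∂(gaussianReal 0 1) := by
  have h := gaussianReal_map_const_mul (μ := 0) (v := 1) c
  rw [mul_zero, mul_one] at h
  have e : v = ⟨c ^ 2, sq_nonneg c⟩ := NNReal.eq hv
  have h' : gaussianReal 0 v = Measure.map (fun x => c * x) (gaussianReal 0 1) := by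
    rw [e]; exact h.symm
  rw [h', lintegral_map (by fun_prop) (by fun_prop), ← lintegral_const_mul _ (by fun_prop)]
  simp only [enorm_mul, mul_pow]

theorem lintegral_enorm_pow_gaussianReal_lt_top (p : ℕ) :
    ∫⁻ z, ‖z‖ₑ ^ p ∂(gaussianReal 0 1) < ⊤ := by
  rcases Nat.eq_zero_or_pos p with rfl | hp
  · simp
  have h := (memLp_id_gaussianReal (μ := 0) (v := 1) p).eLpNorm_lt_top
  have := lintegral_rpow_enorm_lt_top_of_eLpNorm_lt_top (by simpa using hp.ne') (by simp) h
  simpa using this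

/-- Kolmogorov's argument. After division by `q^n` a level-`n` increment has `p`-th moment
proportional to `(θ/q)^{pn}`, with `θ = 2^{-1/2}` from Gaussian scaling. The sum of all these powers
over all levels has finite expectation, and an almost surely finite sum bounds each term. -/
theorem exists_dyadic_bound {Ωp : Type*} [MeasurableSpace Ωp] {P : Measure Ωp}
    {B : ℝ≥0 → Ωp → ℝ} (hB : IsBrownianReal B P) {a : ℝ} (ha : a < 1 / 2) (N : ℕ) :
    ∀ᵐ ω ∂P, ∃ C, 0 ≤ C ∧ ∀ n j : ℕ, j < N * 2 ^ n →
      |B (((j + 1 : ℝ) / 2 ^ n).toNNReal) ω - B ((j / 2 ^ n : ℝ).toNNReal) ω| ≤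
        C * ((1 / 2 : ℝ) ^ a) ^ n := by
  set q := (1 / 2 : ℝ) ^ a with hq
  have hq0 : 0 < q := by positivity
  set θ := (1 / 2 : ℝ) ^ (1 / 2 : ℝ) with hθ
  have hθ0 : 0 < θ := by positivity
  have hθ2 : θ ^ 2 = 1 / 2 := by
    rw [hθ, ← Real.rpow_natCast, ← Real.rpow_mul (by norm_num)]; norm_num
  have hr1 : q⁻¹ * θ < 1 := by
    rw [inv_mul_lt_one₀ hq0]
    exact Real.rpow_lt_rpow_of_exponent_gt (by norm_num) (by norm_num) ha
  -- The moment order must beat the `2^n` growth of the number of increments per level; this is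
  -- possible because `a < 1/2` makes `θ/q < 1`.
  obtain ⟨p, hp⟩ := exists_pow_lt_of_lt_one (show (0 : ℝ) < 1 / 2 by norm_num) hr1
  have hp0 : p ≠ 0 := by rintro rfl; norm_num at hp
  set m := ∫⁻ z, ‖z‖ₑ ^ p ∂(gaussianReal 0 1) with hm
  have hmtop : m < ⊤ := lintegral_enorm_pow_gaussianReal_lt_top p
  set inc : ℕ → ℕ → Ωp → ℝ := fun n j ω =>
    B (((j + 1 : ℝ) / 2 ^ n).toNNReal) ω - B ((j / 2 ^ n : ℝ).toNNReal) ω with hinc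
  have hlaw : ∀ n j, HasLaw (inc n j) (gaussianReal 0 (1 / 2 ^ n)) P := by
    intro n j
    have := hB.hasLaw_sub (((j + 1 : ℝ) / 2 ^ n).toNNReal) ((j / 2 ^ n : ℝ).toNNReal)
    have e : nndist (((j + 1 : ℝ) / 2 ^ n).toNNReal).1 ((j / 2 ^ n : ℝ).toNNReal).1 =
        1 / 2 ^ n := by
      apply NNReal.eq
      change dist ((((j + 1 : ℝ) / 2 ^ n).toNNReal : ℝ≥0) : ℝ) ((j / 2 ^ n : ℝ).toNNReal : ℝ≥0) = _
      rw [Real.dist_eq, Real.coe_toNNReal _ (by positivity),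
        Real.coe_toNNReal _ (by positivity), ← sub_div, add_sub_cancel_left, abs_of_pos (by positivity)]
      simp
    rw [e] at this
    exact this
  set X : ℕ → Ωp → ℝ≥0∞ := fun n ω =>
    ∑ j ∈ Finset.range (N * 2 ^ n), ‖q⁻¹ ^ n * inc n j ω‖ₑ ^ p with hX
  have hmeas : ∀ n, AEMeasurable (X n) P := fun n =>
    Finset.aemeasurable_fun_sum _ fun j _ =>
      (((hlaw n j).aemeasurable.const_mul _).enorm).pow_const p
  have hterm : ∀ n j, ∫⁻ ω, ‖q⁻¹ ^ n * inc n j ω‖ₑ ^ p ∂P =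
      ENNReal.ofReal ((q⁻¹ * θ) ^ p) ^ n * m := by
    intro n j
    have h1 : ∫⁻ ω, ‖inc n j ω‖ₑ ^ p ∂P = ‖θ ^ n‖ₑ ^ p * m := by
      rw [hm, ← lintegral_enorm_pow_gaussianReal (θ ^ n) p (1 / 2 ^ n) (by
        rw [← pow_mul, mul_comm, pow_mul, hθ2]; simp), ← (hlaw n j).map_eq,
        lintegral_map' (by fun_prop) (hlaw n j).aemeasurable]
    have h2 : ∀ ω, ‖q⁻¹ ^ n * inc n j ω‖ₑ ^ p = ‖q⁻¹ ^ n‖ₑ ^ p * ‖inc n j ω‖ₑ ^ p := fun ω => by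
      rw [enorm_mul, mul_pow]
    simp only [h2]
    rw [lintegral_const_mul'' _ ((hlaw n j).aemeasurable.enorm.pow_const p), h1, ← mul_assoc,
      ← mul_pow, ← enorm_mul, ← mul_pow, Real.enorm_eq_ofReal (by positivity),
      ENNReal.ofReal_pow (by positivity), ENNReal.ofReal_pow (by positivity), ← pow_mul, ← pow_mul,
      mul_comm n p]
  set r := 2 * ENNReal.ofReal ((q⁻¹ * θ) ^ p) with hr
  have hr' : r < 1 := by
    have h1 : ENNReal.ofReal ((q⁻¹ * θ) ^ p) < ENNReal.ofReal (1 / 2) :=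
      (ENNReal.ofReal_lt_ofReal_iff (by norm_num)).2 hp
    have h2 : r = ENNReal.ofReal (2 * (q⁻¹ * θ) ^ p) := by
      rw [ENNReal.ofReal_mul (by norm_num)]; simp [hr]
    rw [h2, ← ENNReal.ofReal_one]
    exact (ENNReal.ofReal_lt_ofReal_iff one_pos).2 (by linarith)
  have hint : ∫⁻ ω, ∑' n, X n ω ∂P < ⊤ := by
    rw [lintegral_tsum hmeas]
    have h1 : ∀ n, ∫⁻ ω, X n ω ∂P = (N * m) * r ^ n := by
      intro n
      rw [hX, lintegral_finsetSum' _ fun j _ =>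
        (((hlaw n j).aemeasurable.const_mul _).enorm).pow_const p]
      simp only [hterm, Finset.sum_const, Finset.card_range, nsmul_eq_mul]
      push_cast
      rw [hr, mul_pow]
      ring
    simp only [h1]
    rw [ENNReal.tsum_mul_left, ENNReal.tsum_geometric]
    refine ENNReal.mul_lt_top (ENNReal.mul_lt_top (by simp) hmtop) ?_
    exact ENNReal.inv_lt_top.2 (tsub_pos_of_lt hr')
  filter_upwards [ae_lt_top' (AEMeasurable.tsum hmeas) hint.ne] with ω hω
  set Y := ∑' n, X n ω with hY
  refine ⟨max 1 Y.toReal, by positivity, fun n j hj => ?_⟩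
  have h1 : ‖q⁻¹ ^ n * inc n j ω‖ₑ ^ p ≤ Y :=
    (Finset.single_le_sum (f := fun j => ‖q⁻¹ ^ n * inc n j ω‖ₑ ^ p) (fun _ _ => zero_le)
      (Finset.mem_range.2 hj)).trans (ENNReal.le_tsum n)
  have h2 : |q⁻¹ ^ n * inc n j ω| ^ p ≤ Y.toReal := by
    rw [Real.enorm_eq_ofReal_abs, ← ENNReal.ofReal_pow (abs_nonneg _)] at h1
    exact (ENNReal.ofReal_le_iff_le_toReal hω.ne).1 h1
  have h3 : |q⁻¹ ^ n * inc n j ω| ≤ max 1 Y.toReal := by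
    refine le_of_pow_le_pow_left₀ hp0 (by positivity) (h2.trans ((le_max_right 1 _).trans ?_))
    exact le_self_pow₀ (le_max_left _ _) hp0
  rw [abs_mul, abs_of_pos (by positivity), inv_pow, inv_mul_le_iff₀ (by positivity)] at h3
  rw [mul_comm]
  exact h3

theorem ae_exists_holder {Ωp : Type*} [MeasurableSpace Ωp] {P : Measure Ωp}
    {B : ℝ≥0 → Ωp → ℝ} (hB : IsBrownianReal B P) {a : ℝ} (ha0 : 0 < a) (ha : a < 1 / 2) :
    ∀ᵐ ω ∂P, ∀ N : ℕ, ∃ C, 0 ≤ C ∧ ∀ s ∈ Icc (0 : ℝ) N, ∀ t ∈ Icc (0 : ℝ) N, |s - t| ≤ 1 →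
      |B s.toNNReal ω - B t.toNNReal ω| ≤ C * |s - t| ^ a := by
  have h := ae_all_iff.2 fun N : ℕ => exists_dyadic_bound hB ha N
  filter_upwards [h, hB.cont] with ω hω hc N
  obtain ⟨C, hC, h1⟩ := hω N
  exact exists_holder_of_dyadic (w := fun s => B s.toNNReal ω) ha0
    (hc.comp continuous_real_toNNReal) h1 hC

/-- Two-sided Brownian paths are continuous, and Hölder continuous on bounded intervals. -/
theorem ae_twoSided_holder {Ωp : Type*} [MeasurableSpace Ωp] {P : Measure Ωp}
    {B B' : ℝ≥0 → Ωp → ℝ} (hB : IsBrownianReal B P) (hB' : IsBrownianReal B' P) {a : ℝ}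
    (ha0 : 0 < a) (ha : a < 1 / 2) :
    ∀ᵐ ω ∂P, Continuous (twoSided B B' ω) ∧ ∀ N : ℕ, ∃ C, 0 ≤ C ∧
      ∀ s ∈ Icc (-N : ℝ) N, ∀ t ∈ Icc (-N : ℝ) N, |s - t| ≤ 1 →
        |twoSided B B' ω s - twoSided B B' ω t| ≤ C * |s - t| ^ a := by
  filter_upwards [ae_exists_holder hB ha0 ha, ae_exists_holder hB' ha0 ha, hB.cont, hB'.cont,
    hB.eval_zero_ae_eq_zero, hB'.eval_zero_ae_eq_zero] with ω h1 h2 c1 c2 z1 z2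
  constructor
  · refine Continuous.if_le (c1.comp continuous_real_toNNReal)
      (c2.comp (continuous_real_toNNReal.comp continuous_neg)) continuous_const continuous_id ?_
    rintro x rfl
    simp [z1, z2]
  intro N
  obtain ⟨C₁, hC₁, k1⟩ := h1 N
  obtain ⟨C₂, hC₂, k2⟩ := h2 N
  refine ⟨C₁ + C₂, by positivity, ?_⟩
  have main : ∀ s ∈ Icc (-N : ℝ) N, ∀ t ∈ Icc (-N : ℝ) N, s ≤ t → |s - t| ≤ 1 →
      |twoSided B B' ω s - twoSided B B' ω t| ≤ (C₁ + C₂) * |s - t| ^ a := by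
    intro s hs t ht hst hst1
    have hpow : 0 ≤ |s - t| ^ a := by positivity
    rcases le_or_gt 0 s with s0 | s0
    · have := k1 s ⟨s0, hs.2⟩ t ⟨s0.trans hst, ht.2⟩ hst1
      simp only [twoSided, if_pos s0, if_pos (s0.trans hst)]
      nlinarith
    rcases lt_or_ge t 0 with t0 | t0
    · have := k2 (-s) ⟨by linarith, by linarith [hs.1]⟩ (-t) ⟨by linarith, by linarith [ht.1]⟩
        (by rwa [neg_sub_neg, abs_sub_comm])
      rw [neg_sub_neg, abs_sub_comm t s] at this
      simp only [twoSided, if_neg s0.not_ge, if_neg t0.not_ge]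
      nlinarith
    -- An interval that straddles `0` is split there; both one-sided paths vanish at `0` almost
    -- surely.
    · have e0 : |s - t| = t - s := by rw [abs_sub_comm, abs_of_nonneg (by linarith)]
      rw [e0] at hst1 ⊢
      have N0 : (0 : ℝ) ≤ N := Nat.cast_nonneg N
      have e1 := k1 t ⟨t0, ht.2⟩ 0 ⟨le_rfl, N0⟩ (by
        rw [sub_zero, abs_of_nonneg t0]; linarith)
      have e2 := k2 (-s) ⟨by linarith, by linarith [hs.1]⟩ 0 ⟨le_rfl, N0⟩ (by
        rw [sub_zero, abs_of_nonneg (show (0 : ℝ) ≤ -s by linarith)]; linarith)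
      rw [sub_zero, abs_of_nonneg t0, Real.toNNReal_zero, z1, sub_zero] at e1
      rw [sub_zero, abs_of_nonneg (show (0 : ℝ) ≤ -s by linarith), Real.toNNReal_zero, z2, sub_zero] at e2
      have p1 : t ^ a ≤ (t - s) ^ a := Real.rpow_le_rpow t0 (by linarith) ha0.le
      have p2 : (-s) ^ a ≤ (t - s) ^ a := Real.rpow_le_rpow (by linarith) (by linarith) ha0.le
      simp only [twoSided, if_neg s0.not_ge, if_pos t0]
      have e3 := abs_sub (B t.toNNReal ω) (B' (-s).toNNReal ω)
      have q1 := mul_le_mul_of_nonneg_left p1 hC₁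
      have q2 := mul_le_mul_of_nonneg_left p2 hC₂
      rw [abs_sub_comm] at e3
      rw [add_mul]
      linarith
  intro s hs t ht hst
  rcases le_total s t with h | h
  · exact main s hs t ht h hst
  · rw [abs_sub_comm s t] at hst ⊢
    rw [abs_sub_comm]
    exact main t ht s hs h hst

/-! ### Mollified noise and its derivative -/

theorem hasCompactSupport_comp_mul {g : ℝ → ℝ} (hs : ∀ u, 1 < |u| → g u = 0) {l : ℝ}
    (hl : 0 < l) : HasCompactSupport fun u => g (l * u) := by
  refine HasCompactSupport.intro (K := Icc (-(1 / l)) (1 / l)) isCompact_Icc fun u hu => hs _ ?_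
  by_contra! h
  refine hu (abs_le.1 ?_)
  rw [abs_mul, abs_of_pos hl] at h
  rw [le_div_iff₀ hl]; linarith

/-- Differentiation of a rescaled convolution with a compactly supported kernel. -/
theorem hasDerivAt_integral_kernel {W g : ℝ → ℝ} (hW : Continuous W) (hg : ContDiff ℝ 1 g)
    (hs : ∀ u, 1 < |u| → g u = 0) {l : ℝ} (hl : 0 < l) (t : ℝ) :
    HasDerivAt (fun r => ∫ s, g (l * (r - s)) * W s)
      (l * ∫ s, deriv g (l * (t - s)) * W s) t := by
  have hk : ContDiff ℝ 1 fun u => g (l * u) := hg.comp (contDiff_const.mul contDiff_id)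
  have h := (hasCompactSupport_comp_mul hs hl).hasDerivAt_convolution_right
    (ContinuousLinearMap.mul ℝ ℝ) (μ := volume) (hW.locallyIntegrable) hk t
  have hd : ∀ u, deriv (fun u => g (l * u)) u = l * deriv g (l * u) := fun u => by
    rw [deriv_comp_mul_left, smul_eq_mul]
  simp only [convolution_def] at h
  have e1 : (fun r => ∫ s, (ContinuousLinearMap.mul ℝ ℝ) (W s) (g (l * (r - s)))) =
      fun r => ∫ s, g (l * (r - s)) * W s := by
    funext r
    simp only [ContinuousLinearMap.mul_apply', mul_comm]
  have e2 : ∫ s, (ContinuousLinearMap.mul ℝ ℝ) (W s) (deriv (fun u => g (l * u)) (t - s)) =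
      l * ∫ s, deriv g (l * (t - s)) * W s := by
    rw [← integral_const_mul]
    refine integral_congr_ae (.of_forall fun s => ?_)
    simp only [hd, ContinuousLinearMap.mul_apply']
    ring
  have e3 := h.congr_deriv e2
  convert! e3 using 1
  exact e1.symm

/-- A kernel with integral zero only sees the oscillation of the path on its support. -/
theorem abs_integral_kernel_le {W g : ℝ → ℝ} (hW : Continuous W) (hg : Continuous g)
    (hs : ∀ u, 1 < |u| → g u = 0) (h0 : ∫ u, g u = 0) {A D l t : ℝ} (hA : ∀ u, |g u| ≤ A)
    (hl : 0 < l) (hD : ∀ s, |s - t| ≤ 1 / l → |W s - W t| ≤ D) :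
    |∫ s, g (l * (t - s)) * W s| ≤ 2 * A * D / l := by
  have hA0 : 0 ≤ A := (abs_nonneg _).trans (hA 0)
  have hsupp : ∀ s, s ∉ Icc (t - 1 / l) (t + 1 / l) → g (l * (t - s)) = 0 := fun s h => by
    refine hs _ ?_
    by_contra! h'
    rw [abs_mul, abs_of_pos hl, mul_comm, ← le_div_iff₀ hl] at h'
    have := abs_le.1 h'
    exact h ⟨by linarith, by linarith⟩
  have hz : ∫ s, g (l * (t - s)) * W t = 0 := by
    rw [integral_mul_const, integral_sub_left_eq_self (fun u => g (l * u)) volume t,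
      Measure.integral_comp_mul_left, h0]
    simp
  have hcs : ∀ V : ℝ → ℝ, Continuous V → Integrable fun s => g (l * (t - s)) * V s := by
    intro V hV
    refine Continuous.integrable_of_hasCompactSupport (by fun_prop) ?_
    exact HasCompactSupport.intro (K := Icc (t - 1 / l) (t + 1 / l)) isCompact_Icc fun s h => by
      rw [hsupp s h, zero_mul]
  have hsub : ∫ s, g (l * (t - s)) * W s = ∫ s, g (l * (t - s)) * (W s - W t) := by
    have h1 := integral_sub (hcs W hW) (hcs (fun _ => W t) continuous_const)
    rw [hz, sub_zero] at h1
    rw [← h1]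
    exact integral_congr_ae (.of_forall fun s => (mul_sub _ _ _).symm)
  rw [hsub, ← setIntegral_eq_integral_of_forall_compl_eq_zero (s := Icc (t - 1 / l) (t + 1 / l))
    fun s h => by rw [hsupp s h, zero_mul]]
  have hb := norm_setIntegral_le_of_norm_le_const (μ := volume) (C := A * D)
    (f := fun s => g (l * (t - s)) * (W s - W t)) (s := Icc (t - 1 / l) (t + 1 / l))
    (by simp) (fun s h => by
      rw [Real.norm_eq_abs, abs_mul]
      refine mul_le_mul (hA _) (hD s ?_) (abs_nonneg _) hA0
      rw [abs_le]; constructor <;> linarith [h.1, h.2])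
  rw [Real.norm_eq_abs] at hb
  refine hb.trans (le_of_eq ?_)
  have : volume.real (Icc (t - 1 / l) (t + 1 / l)) = 2 / l := by
    rw [Real.volume_real_Icc_of_le (by have : 0 < 1 / l := by positivity
                                       linarith)]
    ring
  rw [this]; ring

theorem deriv_eq_zero_of_supp {ρ : ℝ → ℝ} (hs : ∀ u, 1 < |u| → ρ u = 0) (u : ℝ)
    (hu : 1 < |u|) : deriv ρ u = 0 := by
  have h : ρ =ᶠ[𝓝 u] fun _ => 0 := by
    filter_upwards [(isOpen_lt continuous_const continuous_abs).mem_nhds hu] with v hv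
    exact hs v hv
  rw [h.deriv_eq, deriv_const]

theorem integral_deriv_eq_zero_of_supp {g : ℝ → ℝ} (hg : ContDiff ℝ 1 g)
    (hs : ∀ u, 1 < |u| → g u = 0) : ∫ u, deriv g u = 0 := by
  have hc : HasCompactSupport g := by simpa using hasCompactSupport_comp_mul hs one_pos
  refine integral_eq_zero_of_hasDerivAt_of_integrable (f := g)
    (fun u => (hg.differentiable one_ne_zero u).hasDerivAt) ?_ ?_
  · exact (hg.continuous_deriv le_rfl).integrable_of_hasCompactSupport hc.deriv
  · exact hg.continuous.integrable_of_hasCompactSupport hc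

/-- The mollified noise and its derivative, for a path that is `a`-Hölder continuous near `t`. -/
theorem IsMollifier.exists_noise_bound {ρ : ℝ → ℝ} (h : IsMollifier ρ) :
    ∃ A, 0 ≤ A ∧ ∀ (W : ℝ → ℝ) (γ ε C a t : ℝ), Continuous W → 0 < γ → 0 < ε → ε ≤ 1 → 0 ≤ C →
      0 < a → (∀ s, |s - t| ≤ 1 → |W s - W t| ≤ C * |s - t| ^ a) →
      |deriv (fun r => mollified ρ W γ ε r) t| ≤ A * C * ε ^ (-(γ * (1 - a))) ∧
      ∃ ξ', HasDerivAt (fun s => deriv (fun r => mollified ρ W γ ε r) s) ξ' t ∧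
        |ξ'| ≤ A * C * ε ^ (-(γ * (2 - a))) := by
  have hρ1 : ContDiff ℝ 1 ρ := h.contDiff.of_le (by exact_mod_cast le_top)
  have hρ2 : ContDiff ℝ 2 ρ := mod_cast contDiff_infty.1 h.contDiff 2
  have hρ' : ContDiff ℝ 1 (deriv ρ) :=
    ((contDiff_succ_iff_deriv (n := 1)).1 (by simpa [one_add_one_eq_two] using hρ2)).2.2
  have hρ'' : Continuous (deriv (deriv ρ)) := hρ'.continuous_deriv le_rfl
  have s1 := deriv_eq_zero_of_supp h.supp
  have s2 := deriv_eq_zero_of_supp s1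
  have c1 : HasCompactSupport (deriv ρ) := by simpa using hasCompactSupport_comp_mul s1 one_pos
  have c2 : HasCompactSupport (deriv (deriv ρ)) := c1.deriv
  obtain ⟨A₁, hA₁⟩ := hρ'.continuous.bounded_above_of_compact_support c1
  obtain ⟨A₂, hA₂⟩ := hρ''.bounded_above_of_compact_support c2
  have hA0 : 0 ≤ max A₁ A₂ := ((norm_nonneg _).trans (hA₁ 0)).trans (le_max_left _ _)
  refine ⟨2 * max A₁ A₂, by positivity, fun W γ ε C a t hW hγ hε hε1 hC ha hH => ?_⟩
  set l := ε ^ (-γ) with hl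
  have hl0 : 0 < l := by positivity
  have hl1 : 1 / l ≤ 1 := by
    rw [div_le_one hl0, hl]
    exact Real.one_le_rpow_of_pos_of_le_one_of_nonpos hε hε1 (by linarith)
  -- The kernels `ρ'` and `ρ''` have integral zero, so only the oscillation of `W` over the window
  -- `1/l` matters. It gains the factor `l^{-a}` against the powers `l` and `l²` from
  -- differentiation.
  have hosc : ∀ s, |s - t| ≤ 1 / l → |W s - W t| ≤ C * l ^ (-a) := fun s hs => by
    refine (hH s (hs.trans hl1)).trans (mul_le_mul_of_nonneg_left ?_ hC)
    rw [Real.rpow_neg hl0.le, ← Real.inv_rpow hl0.le, ← one_div]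
    exact Real.rpow_le_rpow (abs_nonneg _) hs ha.le
  have hd1 : ∀ r, HasDerivAt (fun r => mollified ρ W γ ε r)
      (l ^ 2 * ∫ s, deriv ρ (l * (r - s)) * W s) r := fun r => by
    have h1 := (hasDerivAt_integral_kernel hW hρ1 h.supp hl0 r).const_mul l
    have e : (fun r => mollified ρ W γ ε r) = fun r => l * ∫ s, ρ (l * (r - s)) * W s := by
      funext r
      rw [mollified, ← integral_const_mul]
      simp only [mul_assoc, hl]
    rw [e]
    exact h1.congr_deriv (by ring)
  have hd : (fun s => deriv (fun r => mollified ρ W γ ε r) s) =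
      fun r => l ^ 2 * ∫ s, deriv ρ (l * (r - s)) * W s := funext fun r => (hd1 r).deriv
  have hd2 := (hasDerivAt_integral_kernel hW hρ' s1 hl0 t).const_mul (l ^ 2)
  have b1 := abs_integral_kernel_le hW hρ'.continuous s1 (integral_deriv_eq_zero_of_supp hρ1 h.supp)
    (A := max A₁ A₂) (fun u => (hA₁ u).trans (le_max_left _ _)) hl0 hosc
  have b2 := abs_integral_kernel_le hW hρ'' s2 (integral_deriv_eq_zero_of_supp hρ' s1)
    (A := max A₁ A₂) (fun u => (hA₂ u).trans (le_max_right _ _)) hl0 hosc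
  have p1 : l * l ^ (-a) = ε ^ (-(γ * (1 - a))) := by
    rw [hl, ← Real.rpow_mul hε.le, ← Real.rpow_add hε]; ring_nf
  have p2 : l ^ 2 * l ^ (-a) = ε ^ (-(γ * (2 - a))) := by
    rw [pow_two, mul_assoc, p1, hl, ← Real.rpow_add hε]; ring_nf
  refine ⟨?_, l ^ 2 * (l * ∫ s, deriv (deriv ρ) (l * (t - s)) * W s), ?_, ?_⟩
  · rw [(hd1 t).deriv, abs_mul, abs_of_pos (by positivity), ← p1]
    refine (mul_le_mul_of_nonneg_left b1 (by positivity)).trans (le_of_eq ?_)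
    field_simp
  · rw [hd]; exact hd2
  · rw [← mul_assoc, abs_mul, abs_of_pos (by positivity), ← p2]
    refine (mul_le_mul_of_nonneg_left b2 (by positivity)).trans (le_of_eq ?_)
    field_simp

/-- For a path of Hölder exponent `a`, the noise is of size `ε^{-γ(1-a)}` and its derivative of size
`ε^{-γ(2-a)}`. Multiplication by `ε` tames both if `γ(2 - a) < 1`, and some `a < 1/2` achieves this
because `γ < 2/3`. -/
theorem IsMollifier.noiseTwo_bounds {Ωp : Type*} [MeasurableSpace Ωp] {P : Measure Ωp}
    {B B' : ℝ≥0 → Ωp → ℝ} {ρ : ℝ → ℝ} {γ : ℝ} (hB : IsBrownianReal B P)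
    (hB' : IsBrownianReal B' P) (hρ : IsMollifier ρ) (hγ0 : 0 < γ) (hγ : γ < 2 / 3) :
    ∀ᵐ ω ∂P, ∀ T > 0, ∃ C₂, 0 ≤ C₂ ∧ ∀ δ₀ > 0, ∃ ε₀ > 0, ∀ ε, 0 < ε → ε < ε₀ → ∀ t, 0 < t →
      t < T → |ε * noiseTwo ρ B B' γ ε ω t| ≤ δ₀ ∧
        ∃ ξ', HasDerivAt (noiseTwo ρ B B' γ ε ω) ξ' t ∧ |ε * ξ'| ≤ C₂ := by
  obtain ⟨a, ha, ha'⟩ : ∃ a, max (2 - 1 / γ) 0 < a ∧ a < 1 / 2 := by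
    refine exists_between (max_lt ?_ (by norm_num))
    have : 3 / 2 < 1 / γ := by rw [lt_div_iff₀ hγ0]; linarith
    linarith
  have ha0 : 0 < a := (le_max_right _ _).trans_lt ha
  have haγ : γ * (2 - a) < 1 := by
    have : 2 - a < 1 / γ := by linarith [(le_max_left _ _).trans_lt ha]
    rw [lt_div_iff₀ hγ0] at this; linarith
  obtain ⟨A, hA, hA'⟩ := hρ.exists_noise_bound
  filter_upwards [ae_twoSided_holder hB hB' ha0 ha'] with ω hω T hT
  obtain ⟨N, hN⟩ := exists_nat_ge (T + 1)
  obtain ⟨C, hC, hC'⟩ := hω.2 N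
  refine ⟨A * C, by positivity, fun δ₀ hδ₀ => ?_⟩
  have e1 : 0 < 1 - γ * (1 - a) := by nlinarith
  obtain ⟨ε₀, hε₀, hb⟩ : ∃ ε₀ > 0, ∀ ε, 0 < ε → ε < ε₀ → A * C * ε ^ (1 - γ * (1 - a)) ≤ δ₀ := by
    have h1 : Tendsto (fun ε : ℝ => A * C * ε ^ (1 - γ * (1 - a))) (𝓝 0) (𝓝 0) := by
      have := ((Real.continuous_rpow_const e1.le).tendsto 0).const_mul (A * C)
      rwa [Real.zero_rpow e1.ne', mul_zero] at this
    obtain ⟨r, hr, hr'⟩ := Metric.eventually_nhds_iff.1 (h1.eventually (gt_mem_nhds hδ₀))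
    refine ⟨r, hr, fun ε h0 h => (hr' ?_).le⟩
    rw [Real.dist_eq, sub_zero, abs_of_pos h0]; exact h
  refine ⟨min 1 ε₀, lt_min one_pos hε₀, fun ε h0 hε t ht htT => ?_⟩
  have hε1 : ε ≤ 1 := (hε.trans_le (min_le_left _ _)).le
  obtain ⟨h1, ξ', h2, h3⟩ := hA' (twoSided B B' ω) γ ε C a t hω.1 hγ0 h0 hε1 hC ha0 fun s hs =>
    hC' s ⟨by linarith [(abs_le.1 hs).1], by linarith [(abs_le.1 hs).2]⟩ t
      ⟨by linarith, by linarith⟩ hs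
  have hm : ∀ e : ℝ, ε * ε ^ (-e) = ε ^ (1 - e) := fun e => by
    rw [sub_eq_add_neg, Real.rpow_add h0, Real.rpow_one]
  refine ⟨?_, ξ', h2, ?_⟩
  · rw [abs_mul, abs_of_pos h0]
    refine (mul_le_mul_of_nonneg_left h1 h0.le).trans ?_
    rw [mul_left_comm, hm]
    exact hb ε h0 (hε.trans_le (min_le_right _ _))
  · rw [abs_mul, abs_of_pos h0]
    refine (mul_le_mul_of_nonneg_left h3 h0.le).trans ?_
    rw [mul_left_comm, hm]
    exact mul_le_of_le_one_right (by positivity) (Real.rpow_le_one h0.le hε1 (by linarith))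

/-- The two barriers from a pointwise statement for both signs. -/
theorem isSubsolution_and_isSupersolution {n : ℕ} {f : ℝ → ℝ} {am a ap σ β K L ε : ℝ} {ξ : ℝ → ℝ}
    {D : EuclideanSpace ℝ (Fin n) → ℝ → ℝ} {Ω : Set (EuclideanSpace ℝ (Fin n))} {S : ℝ≥0∞}
    (h : ∀ x ∈ Ω, ∀ t : ℝ, 0 < t → ENNReal.ofReal t < S → ∀ s : ℝ, (s = 1 ∨ s = -1) →
      (DifferentiableAt ℝ (fun r => uSign f am a ap σ β K L ε s ξ D x r) t ∧
        ContDiffAt ℝ 2 (fun y => uSign f am a ap σ β K L ε s ξ D y t) x) ∧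
      0 ≤ s * acOperator f ε ξ (uSign f am a ap σ β K L ε s ξ D) x t) :
    IsSubsolution f ε ξ Ω S (uMinus f am a ap σ β K L ε ξ D) ∧
      IsSupersolution f ε ξ Ω S (uPlus f am a ap σ β K L ε ξ D) := by
  rw [← uSign_one, ← uSign_neg_one]
  refine ⟨⟨fun x hx t ht hS => (h x hx t ht hS _ (.inr rfl)).1, fun x hx t ht hS => ?_⟩,
    fun x hx t ht hS => (h x hx t ht hS _ (.inl rfl)).1, fun x hx t ht hS => ?_⟩
  · have := (h x hx t ht hS _ (.inr rfl)).2
    linarith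
  · have := (h x hx t ht hS _ (.inl rfl)).2
    rwa [one_mul] at this

end
end AllenCahn

/-! ### Assembly of waves, geometry and noise -/

theorem proposition5p2 (f : ℝ → ℝ) (am a ap : ℝ) (hf : IsBalancedBistable f am a ap) :
    ∃ β > 0, ∃ σ₀ > 0, ∀ σ : ℝ, 0 < σ → σ ≤ σ₀ →
      -- first type of noise
      (∀ (Ωp : Type u) [MeasurableSpace Ωp] (P : Measure Ωp) [IsProbabilityMeasure P]
        (ξ : ℝ → Ωp → ℝ) (M γ₁ : ℝ), IsMixingProcess P ξ M → 0 < γ₁ → γ₁ < 1 / 3 →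
        ∀ Ω : Set (EuclideanSpace ℝ (Fin 2)), IsSmoothBoundedDomain Ω →
        ∀ N > 0, ∀ T > 0, ∃ dbar > 0, ∀ d₀, 0 < d₀ → d₀ < dbar → ∀ φ, IsCutoff φ d₀ →
        ∀ K > 1, ∃ ε₀ > 0, ∃ L > 0, ∀ᵐ ω ∂P, ∀ ε, 0 < ε → ε < ε₀ →
        ∀ (S : ℝ≥0∞) (x : ℝ → ℝ → EuclideanSpace ℝ (Fin 2)) (κ : ℝ → ℝ → ℝ),
        IsConvexFlow Ω (fun t => waveSpeed f am a ap (ε * noiseOne ξ γ₁ ε ω t) / ε) S x κ →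
          IsSubsolution f ε (noiseOne ξ γ₁ ε ω) Ω
            (min (stoppingTime Ω N S x κ) (ENNReal.ofReal T))
            (uMinus f am a ap σ β K L ε (noiseOne ξ γ₁ ε ω) fun y t => φ (convexDist x y t)) ∧
          IsSupersolution f ε (noiseOne ξ γ₁ ε ω) Ω
            (min (stoppingTime Ω N S x κ) (ENNReal.ofReal T))
            (uPlus f am a ap σ β K L ε (noiseOne ξ γ₁ ε ω) fun y t => φ (convexDist x y t))) ∧
      -- second type of noise
      (∀ (Ωp : Type u) [MeasurableSpace Ωp] (P : Measure Ωp) [IsProbabilityMeasure P]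
        (B B' : ℝ≥0 → Ωp → ℝ) (ρ : ℝ → ℝ) (γ₂ : ℝ),
        IsBrownianReal B P → IsBrownianReal B' P →
        IndepFun (fun ω t => B t ω) (fun ω t => B' t ω) P →
        IsMollifier ρ → 0 < γ₂ → γ₂ < 2 / 3 →
        ∀ n : ℕ, 2 ≤ n → ∀ Ω : Set (EuclideanSpace ℝ (Fin n)), IsSmoothBoundedDomain Ω →
        ∀ᵐ ω ∂P, ∀ T > 0, ∀ (G : ℝ → Set (EuclideanSpace ℝ (Fin n)))
          (U : ℝ → ℝ → Set (EuclideanSpace ℝ (Fin n))) (ε₁ : ℝ), 0 < ε₁ →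
        (∀ ε, 0 < ε → ε < ε₁ → IsForcedFlow Ω
          (fun t => waveSpeed f am a ap (ε * noiseTwo ρ B B' γ₂ ε ω t) / ε) T (U ε)) →
        SignedDistConverge Ω T G U →
        ∃ dbar > 0, ∀ d₀, 0 < d₀ → d₀ < dbar → ∀ φ, IsCutoff φ d₀ →
        ∀ K > 1, ∃ ε₀ > 0, ∃ L > 0, ∀ ε, 0 < ε → ε < ε₀ →
          IsSubsolution f ε (noiseTwo ρ B B' γ₂ ε ω) Ω (ENNReal.ofReal T)
            (uMinus f am a ap σ β K L ε (noiseTwo ρ B B' γ₂ ε ω)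
              fun y t => φ (regionDist (U ε) y t)) ∧
          IsSupersolution f ε (noiseTwo ρ B B' γ₂ ε ω) Ω (ENNReal.ofReal T)
            (uPlus f am a ap σ β K L ε (noiseTwo ρ B B' γ₂ ε ω)
              fun y t => φ (regionDist (U ε) y t))) := by
  obtain ⟨β, hβ, σ₀, hσ₀, δ₀, hδ₀, hcont, hbar⟩ := hf.exists_barriers
  refine ⟨β, hβ, σ₀, hσ₀, fun σ hσ hσσ₀ => ⟨?_, ?_⟩⟩
  · intro Ωp _ P _ ξ M γ₁ hξ hγ0 hγ Ω hΩ N hN T hT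
    -- The cut-off uses the distance up to `3d₀`, which must stay below half the smallest radius of
    -- curvature, `1/(2N)`.
    refine ⟨1 / (6 * N), by positivity, fun d₀ hd₀ hd φ hφ K hK => ?_⟩
    obtain ⟨C₁, hC₁, hcut⟩ := hφ.exists_isCutoffDistanceAt hd₀ (2 * N ^ 2) (by positivity)
    obtain ⟨ε₁, hε₁, L, hL, hB⟩ :=
      hbar σ hσ hσσ₀ C₁ |M| T d₀ K hC₁ (abs_nonneg _) hd₀ hK
    obtain ⟨ε₂, hε₂, hnoise⟩ := hξ.noiseOne_bounds hγ0 hγ hδ₀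
    refine ⟨min ε₁ ε₂, lt_min hε₁ hε₂, L, hL, ?_⟩
    filter_upwards [hnoise] with ω hω ε hε hεε S x κ hflow
    refine isSubsolution_and_isSupersolution fun y hy t ht htS s hs => ?_
    obtain ⟨htstop, htT⟩ := lt_min_iff.1 htS
    replace htT : t < T := (ENNReal.ofReal_lt_ofReal_iff hT).1 htT
    obtain ⟨hb, ξ', hξ', hξb⟩ := hω ε hε (hεε.trans_le (min_le_right _ _)) t ht
    obtain ⟨hlife, hκ⟩ := IsConvexFlow.lt_of_lt_stoppingTime ht htstop
    have hF : ContinuousAt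
        (fun t => waveSpeed f am a ap (ε * noiseOne ξ γ₁ ε ω t) / ε) t :=
      (ContinuousAt.comp (f := fun t => ε * noiseOne ξ γ₁ ε ω t) (hcont _ hb)
        (hξ'.continuousAt.const_mul ε)).div_const ε
    have h3 : 3 * d₀ ≤ 1 / (2 * N) := by
      have : (1 : ℝ) / (2 * N) = 3 * (1 / (6 * N)) := by field_simp; norm_num
      linarith
    exact hB ε hε (hεε.trans_le (min_le_left _ _)) 2 _ _ ξ' y t s ht htT hb hξ' hξb
      (hcut 2 _ _ _ _ (hflow.isFrontDistanceAt ht hlife hF hN hκ h3 y)) hs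
  · intro Ωp _ P _ B B' ρ γ₂ hB hB' _ hρ hγ0 hγ n hn Ω hΩ
    filter_upwards [hρ.noiseTwo_bounds hB hB' hγ0 hγ] with ω hω T hT G U ε₁ hε₁ hflow hconv
    obtain ⟨C₂, hC₂, hω⟩ := hω T hT
    obtain ⟨ε₂, hε₂, hω⟩ := hω δ₀ hδ₀
    obtain ⟨b, hb, C, hC, ε₃, hε₃, hreg⟩ := hconv.exists_regular
    -- Again the zone `|d| < 3d₀` must lie in the tube where the distances are regular.
    refine ⟨b / 3, by positivity, fun d₀ hd₀ hd φ hφ K hK => ?_⟩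
    obtain ⟨C₁, hC₁, hcut⟩ := hφ.exists_isCutoffDistanceAt hd₀ (n * C ^ 2) (by positivity)
    obtain ⟨ε₄, hε₄, L, hL, hBar⟩ := hbar σ hσ hσσ₀ C₁ C₂ T d₀ K hC₁ hC₂ hd₀ hK
    refine ⟨min (min ε₁ ε₂) (min ε₃ ε₄), by positivity, L, hL, fun ε hε hεε => ?_⟩
    obtain ⟨h12, h34⟩ := lt_min_iff.1 hεε
    obtain ⟨h1, h2⟩ := lt_min_iff.1 h12
    obtain ⟨h3, h4⟩ := lt_min_iff.1 h34
    refine isSubsolution_and_isSupersolution fun y hy t ht htT s hs => ?_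
    replace htT : t < T := (ENNReal.ofReal_lt_ofReal_iff hT).1 htT
    obtain ⟨hnb, ξ', hξ', hξb⟩ := hω ε hε h2 t ht htT
    exact hBar ε hε h4 n _ _ ξ' y t s ht htT hnb hξ' hξb
      (hcut n _ _ _ _ ((hflow ε hε h1).isFrontDistanceAt hn hΩ.isOpen ⟨ht, htT⟩ hC
        (fun z hz hzb => hreg ε hε h3 t ⟨ht.le, htT.le⟩ z hz (hzb.trans (by linarith))) hy)) hs
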